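/- Let $F$ be a totally real number field with ring of integers $\mathcal O_F$, set of embeddings $\mathbf a=\{\tau:F\hookrightarrow\mathbb R\}$ and different $\mathfrak d$, and let $F^+$ be the set of totally positive elements. Let $B$ be a totally definite quaternion algebra over $F$, $R\subset B$ an order, and $\mathbf k=(k_\tau)\in\mathbb Z_{\ge0}^{\mathbf a}$. On $B$ and on quadratic extensions of $F$ put $\operatorname{disc}(y)=\operatorname{tr}(y)^2-4\,\mathrm n(y)$. Let $W_\tau=B_\tau/F_\tau$ with the positive definite form $-\operatorname{disc}$, and let $V_{\mathbf k}=\bigotimes_\tau V_{k_\tau}$, where $V_{k_\tau}$ is the space of complex homogeneous harmonic polynomials of degree $k_\tau$ on $W_\tau$. Here $(P\cdot\gamma)(y)=P(\gamma y\gamma^{-1})$ for $\gamma\in B^\times$, and $\langle\,,\rangle$ is the invariant hermitian inner product for which the monomials $X^m$ in orthonormal coordinates are orthogonal of square norm $\prod_i m_i!$. Let $\mathcal M_{\mathbf k}(R)$ be the space of functions $\varphi:\widehat B^\times\to V_{\mathbf k}$ with $\varphi(ux\gamma)=\varphi(x)\cdot\gamma$ for $u\in\widehat R^\times$, $\gamma\in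 B^\times$. For $x,y\in\widehat B^\times$ and $v\in V_{\mathbf k}$ let $R_x=B\cap x^{-1}\widehat Rx$, $w_x=|R_x^\times/\mathcal O_F^\times|$, $\Gamma_{x,y}=(B^\times\cap x^{-1}\widehat R^\times y)/\mathcal O_F^\times$, $\varphi_{x,v}(y)=\sum_{\gamma\in\Gamma_{x,y}}v\cdot\gamma$, $L_x=R_x/\mathcal O_F\subset B/F$, and with $\mathrm{cl}(R)=\widehat R^\times\backslash\widehat B^\times/B^\times$ let $$\langle\varphi,\psi\rangle=\sum_{x\in\mathrm{cl}(R)}\frac1{w_x}\langle\varphi(x),\psi(x)\rangle,\qquad \vartheta(\varphi)(z)=\sum_{x\in\mathrm{cl}(R)}\frac1{w_x}\sum_{y\in L_x}\varphi(x)(y)\,e_F(-\operatorname{disc}(y),z/2),$$ where $z\in\mathbb H^{\mathbf a}$ ($\mathbb H$ is the upper half-plane) and $e_F(\xi,z)=\exp\bigl(2\pi i\sum_\tau\tau(\xi)z_\tau\bigr)$. Fourier coefficients at a cusp. For a fractional ideal $\mathfrak a$ let $\theta_{\mathfrak a}(z)=N(\mathfrak a)^{-1/2}\sum_{\xi\in\mathfrak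 a^{-1}}e_F(\xi^2,z/2)$ and $\theta=\theta_{\mathcal O_F}$. For a nonzero integral ideal $\mathfrak c$ let $G_{\mathfrak c,\mathfrak a}$ be the set of $\beta=\begin{pmatrix}a&b\\c&d\end{pmatrix}\in SL_2(F)$ with $a\in\mathfrak a$, $b\in2\mathfrak d^{-1}\mathfrak a$, $c\in2^{-1}(4\mathfrak c)\mathfrak d\mathfrak a^{-1}$, $d\in\mathfrak a^{-1}$. For such $\beta$ let $h(\beta,\cdot)$ be the continuous function on $\mathbb H^{\mathbf a}$ with $\theta_{\mathfrak a}(\beta w)=h(\beta,w)\theta(w)$, and let $j(\beta,w)^{\mathbf k}=\prod_\tau(\tau(c)w_\tau+\tau(d))^{k_\tau}$. The coefficients $\lambda(\xi,\mathfrak a;f)$, $\xi\in F$, of a form $f$ of weight $\mathbf{3/2+k}$ at the cusp $\mathfrak a$ are determined by $$h(\beta,w)^3\,j(\beta,w)^{\mathbf k}f(w)=N(\mathfrak a)^{-1/2}\sum_{\xi\in F}\lambda(\xi,\mathfrak a;f)\,e_F(\xi,\beta w/2)\qquad\text{for all }\beta\in G_{\mathfrak c,\mathfrak a},\ w\in\mathbb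 H^{\mathbf a},$$ for some nonzero $\mathfrak c$ (on which they do not depend). Special points. Let $D\in F^+$, $K=F(\sqrt{-D})$, and let $\mathfrak a$ be a fractional ideal. Call $(-D,\mathfrak a)$ a discriminant if some $\omega'\in K$ with $\operatorname{disc}(\omega')=-D$ makes $\mathcal O_{D,\mathfrak a}=\mathcal O_F\oplus\mathfrak a\omega'$ an order in $K$; this order does not depend on $\omega'$. Fix an embedding $K\hookrightarrow B$, if there is one, and $\omega\in K$ with $\operatorname{disc}(\omega)=-D$. Let $P_D\in V_{\mathbf k}$ be the polynomial with $P(\omega)=\langle P,P_D\rangle$ for all $P\in V_{\mathbf k}$. Let $X_{D,\mathfrak a}=\widehat R^\times\backslash\{x\in\widehat B^\times:\mathcal O_{D,\mathfrak a}\subseteq R_x\}/K^\times$ if $(-D,\mathfrak a)$ is a discriminant, $X_{D,\mathfrak a}=\varnothing$ otherwise, and $$\eta_{D,\mathfrak a}=\sum_{x\in X_{D,\mathfrak a}}\frac1{[\mathcal O_x^\times:\mathcal O_F^\times]}\,\varphi_{x,P_D},\qquad\mathcal O_x=R_x\cap K.$$ If $K$ does not embed in $B$, let $\eta_{D,\mathfrak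 a}=0$. **Proposition.** For every $\varphi\in\mathcal M_{\mathbf k}(R)$, every $D\in F^+$ and every fractional ideal $\mathfrak a$ of $F$, the function $\vartheta(\varphi)$ has a Fourier expansion at the cusp $\mathfrak a$ in the above sense, and its $D$-th coefficient is $$\lambda(D,\mathfrak a;\vartheta(\varphi))=\frac1{N(\mathfrak a)}\,\langle\varphi,\eta_{D,\mathfrak a}\rangle .$$ This holds for every choice of the embedding $K\hookrightarrow B$ and of $\omega$. -/

import Mathlib

open scoped NumberField TensorProduct nonZeroDivisors

noncomputable section

/-! ## Quadratic data in the quaternion algebra -/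

section Algebra

variable (F : Type*) [Field F] [NumberField F]

/-- `R` is an `𝓞 F`-order of the `F`-algebra `A`: a subring containing `𝓞 F`, finitely generated
as an `𝓞 F`-module, which spans `A` over `F`. -/
def IsOrder {A : Type*} [Ring A] [Algebra F A] (R : Subalgebra (𝓞 F) A) : Prop :=
  (Subalgebra.toSubmodule R).FG ∧ Submodule.span F (R : Set A) = ⊤

/-- The image of `(𝓞 F)ˣ` in the units of an `F`-algebra. -/
def intUnits (A : Type*) [Ring A] [Algebra F A] : Subgroup Aˣ :=
  (Units.map ((algebraMap (𝓞 F) A : 𝓞 F →+* A) : 𝓞 F →* A)).range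

end Algebra

section Adeles

variable {F : Type*} [Field F] [NumberField F] {B : Type*} [Ring B] [Algebra F B]

variable (F) in
/-- The reduced trace of a quaternion algebra, which is half of the trace of the regular
representation. -/
def redTrace (b : B) : F := LinearMap.trace F B (LinearMap.mulLeft F b) / 2

variable (F) in
/-- The reduced norm of a quaternion algebra: taking traces in `b² - tr(b) b + n(b) = 0` gives
`2 n(b) = tr(b)² - tr(b²)`. -/
def redNorm (b : B) : F := (redTrace F b ^ 2 - redTrace F (b ^ 2)) / 2

variable (F) in
/-- `disc(b) = tr(b)² - 4 n(b)`. -/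
def quatDisc (b : B) : F := redTrace F b ^ 2 - 4 * redNorm F b

/-! ## Finite adeles -/

variable (F) in
/-- The finite adeles of `F`. -/
abbrev FinAdele : Type _ := IsDedekindDomain.FiniteAdeleRing (𝓞 F) F

variable (F B) in
/-- `B̂ = 𝔸_{F,f} ⊗_F B`, the restricted product of the completions `B_𝔭`. -/
abbrev BHat : Type _ := FinAdele F ⊗[F] B

/-- `R̂`: the subring of `B̂` generated by the elements `a ⊗ r` with `a` an everywhere integral
finite adele and `r ∈ R`. -/
def orderHat (R : Subalgebra (𝓞 F) B) : Subring (BHat F B) :=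
  Subring.closure {t | ∃ a : FinAdele F, (∀ v, a v ∈ v.adicCompletionIntegers F) ∧
    ∃ r ∈ R, t = a ⊗ₜ[F] r}

/-- `R̂ˣ`, as a subgroup of `B̂ˣ`. -/
def orderHatUnits (R : Subalgebra (𝓞 F) B) : Subgroup (BHat F B)ˣ :=
  (orderHat R).toSubmonoid.units

variable (F B) in
/-- The embedding `Bˣ → B̂ˣ`. -/
def globalUnits : Bˣ →* (BHat F B)ˣ :=
  Units.map ((Algebra.TensorProduct.includeRight : B →ₐ[F] BHat F B) : B →* BHat F B)

/-- `R_x = B ∩ x⁻¹ R̂ x`. -/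
def orderAt (R : Subalgebra (𝓞 F) B) (x : (BHat F B)ˣ) : Subring B where
  carrier := {b | (x : BHat F B) * (1 ⊗ₜ[F] b) * ((x⁻¹ : (BHat F B)ˣ) : BHat F B) ∈ orderHat R}
  mul_mem' {a b} ha hb := by
    have h := (orderHat R).mul_mem ha hb
    have e : (1 : FinAdele F) ⊗ₜ[F] (a * b) = ((1 : FinAdele F) ⊗ₜ[F] a) * (1 ⊗ₜ[F] b) := by
      simp
    simp only [Set.mem_ofPred_eq]
    rw [e]
    simpa only [mul_assoc, Units.inv_mul_cancel_left] using h
  one_mem' := by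
    have e : (1 : FinAdele F) ⊗ₜ[F] (1 : B) = 1 := rfl
    simp only [Set.mem_ofPred_eq]
    rw [e]
    simp [(orderHat R).one_mem]
  add_mem' {a b} ha hb := by
    have h := (orderHat R).add_mem ha hb
    simpa only [Set.mem_ofPred_eq, TensorProduct.tmul_add, mul_add, add_mul] using h
  zero_mem' := by simp [(orderHat R).zero_mem]
  neg_mem' {a} ha := by
    have h := (orderHat R).neg_mem ha
    simpa only [Set.mem_ofPred_eq, TensorProduct.tmul_neg, mul_neg, neg_mul] using h

/-- `R_xˣ`, as a subgroup of `Bˣ`. -/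
def orderAtUnits (R : Subalgebra (𝓞 F) B) (x : (BHat F B)ˣ) : Subgroup Bˣ :=
  (orderAt R x).toSubmonoid.units

/-- `w_x = #(R_xˣ / (𝓞 F)ˣ)`. -/
def stabCard (R : Subalgebra (𝓞 F) B) (x : (BHat F B)ˣ) : ℕ :=
  (intUnits F B).relIndex (orderAtUnits R x)

/-- `cl(R) = R̂ˣ \ B̂ˣ / Bˣ`. -/
abbrev ClassSet (R : Subalgebra (𝓞 F) B) : Type _ :=
  DoubleCoset.Quotient (orderHatUnits R : Set (BHat F B)ˣ)
    ((globalUnits F B).range : Set (BHat F B)ˣ)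

end Adeles

/-! ## The weight representation

For each `τ : F →+* ℝ` a ring homomorphism `ι τ : B →+* ℍ` extending `τ` identifies `B_τ` with the
Hamilton quaternions. Then `i/2, j/2, ij/2` is an orthonormal basis of `W_τ = B_τ / ℝ` for `-disc`;
the variable `X (τ, l)` is the corresponding `l`-th coordinate on `W_τ`. -/

section Weight

variable {F : Type*} [Field F] {B : Type*} [Ring B]

/-- The `l`-th imaginary coordinate of a Hamilton quaternion. -/
def imCoord (q : Quaternion ℝ) : Fin 3 → ℝ := ![q.imI, q.imJ, q.imK]

/-- The imaginary units `i, j, ij`. -/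
def imUnit : Fin 3 → Quaternion ℝ := ![⟨0, 1, 0, 0⟩, ⟨0, 0, 1, 0⟩, ⟨0, 0, 0, 1⟩]

variable (F) in
/-- Polynomial functions on `∏_τ W_τ` with complex coefficients. -/
abbrev WeightPoly : Type _ := MvPolynomial ((F →+* ℝ) × Fin 3) ℂ

/-- The value `P(b)`; it only depends on the class of `b` in `B/F`. -/
def evalAt (ι : (F →+* ℝ) → B →+* Quaternion ℝ) (P : WeightPoly F) (b : B) : ℂ :=
  MvPolynomial.eval (fun p => ((2 * imCoord (ι p.1 b) p.2 : ℝ) : ℂ)) P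

/-- The right action `(P · γ)(w) = P(γ w γ⁻¹)`. -/
def polyAct (ι : (F →+* ℝ) → B →+* Quaternion ℝ) (γ : Bˣ) : WeightPoly F →ₐ[ℂ] WeightPoly F :=
  MvPolynomial.aeval fun p => ∑ l : Fin 3,
    MvPolynomial.C ((imCoord (ι p.1 γ * imUnit l * ι p.1 (γ⁻¹ : Bˣ)) p.2 : ℝ) : ℂ) *
      MvPolynomial.X (p.1, l)

variable (F) in
/-- `V_𝐤 = ⨂_τ V_{k_τ}`: the polynomials which for each `τ` are homogeneous of degree `k_τ` and
harmonic in the coordinates of `W_τ`. -/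
def weightSpace (k : (F →+* ℝ) → ℕ) : Submodule ℂ (WeightPoly F) where
  carrier := {P | (∀ m ∈ P.support, ∀ τ, ∑ l : Fin 3, m (τ, l) = k τ) ∧
    ∀ τ, ∑ l : Fin 3, MvPolynomial.pderiv (τ, l) (MvPolynomial.pderiv (τ, l) P) = 0}
  add_mem' {P Q} hP hQ := by
    classical
    refine ⟨fun m hm τ => ?_, fun τ => ?_⟩
    · rcases Finset.mem_union.1 (MvPolynomial.support_add hm) with h | h
      · exact hP.1 m h τ
      · exact hQ.1 m h τ
    · have h1 := hP.2 τ
      have h2 := hQ.2 τ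
      simp only [map_add, Finset.sum_add_distrib]
      rw [h1, h2, add_zero]
  zero_mem' := by simp
  smul_mem' c P hP := by
    refine ⟨fun m hm τ => hP.1 m (MvPolynomial.support_smul hm) τ, fun τ => ?_⟩
    have h1 := hP.2 τ
    calc ∑ l : Fin 3, MvPolynomial.pderiv (τ, l) (MvPolynomial.pderiv (τ, l) (c • P))
        = c • ∑ l : Fin 3, MvPolynomial.pderiv (τ, l) (MvPolynomial.pderiv (τ, l) P) := by
          rw [Finset.smul_sum]
          exact Finset.sum_congr rfl fun l _ => by rw [Derivation.map_smul, Derivation.map_smul]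
      _ = 0 := by rw [h1, smul_zero]

/-- The hermitian inner product on polynomials (linear in the first variable) for which the
monomials are orthogonal and `X^m` has square norm `∏ m_p!`. -/
def polyInner (P Q : WeightPoly F) : ℂ :=
  ∑ m ∈ P.support, (m.prod fun _ n => (n.factorial : ℂ)) * P.coeff m *
    (starRingEnd ℂ) (Q.coeff m)

lemma polyInner_eq (S : Finset (((F →+* ℝ) × Fin 3) →₀ ℕ)) (P Q : WeightPoly F)
    (h : P.support ⊆ S) :
    polyInner P Q = ∑ m ∈ S, (m.prod fun _ n => (n.factorial : ℂ)) * P.coeff m *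
      (starRingEnd ℂ) (Q.coeff m) := by
  refine Finset.sum_subset h fun m _ hm => ?_
  rw [MvPolynomial.notMem_support_iff.1 hm]
  simp

lemma polyInner_add (P P' Q : WeightPoly F) :
    polyInner (P + P') Q = polyInner P Q + polyInner P' Q := by
  classical
  rw [polyInner_eq (P.support ∪ P'.support) _ _ MvPolynomial.support_add,
    polyInner_eq (P.support ∪ P'.support) P _ Finset.subset_union_left,
    polyInner_eq (P.support ∪ P'.support) P' _ Finset.subset_union_right,
    ← Finset.sum_add_distrib]
  refine Finset.sum_congr rfl fun m _ => ?_
  rw [MvPolynomial.coeff_add]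
  ring

lemma polyInner_smul (c : ℂ) (P Q : WeightPoly F) :
    polyInner (c • P) Q = c * polyInner P Q := by
  rw [polyInner_eq P.support _ _ MvPolynomial.support_smul, polyInner, Finset.mul_sum]
  refine Finset.sum_congr rfl fun m _ => ?_
  rw [MvPolynomial.coeff_smul, smul_eq_mul]
  ring

lemma polyInner_conj (P Q : WeightPoly F) :
    (starRingEnd ℂ) (polyInner P Q) = polyInner Q P := by
  classical
  rw [polyInner_eq (P.support ∪ Q.support) P Q Finset.subset_union_left,
    polyInner_eq (P.support ∪ Q.support) Q P Finset.subset_union_right, map_sum]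
  refine Finset.sum_congr rfl fun m _ => ?_
  have : (starRingEnd ℂ) (m.prod fun _ n => (n.factorial : ℂ)) =
      m.prod fun _ n => (n.factorial : ℂ) := by
    simp [Finsupp.prod, map_prod]
  rw [map_mul, map_mul, this, Complex.conj_conj]
  ring

lemma polyInner_self (P : WeightPoly F) :
    polyInner P P = ((∑ m ∈ P.support, (m.prod fun _ n => (n.factorial : ℝ)) *
      Complex.normSq (P.coeff m) : ℝ) : ℂ) := by
  rw [polyInner, Complex.ofReal_sum]
  refine Finset.sum_congr rfl fun m _ => ?_
  rw [mul_assoc, Complex.mul_conj]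
  simp [Finsupp.prod]

lemma factProd_pos (m : ((F →+* ℝ) × Fin 3) →₀ ℕ) :
    0 < m.prod fun _ n => (n.factorial : ℝ) :=
  Finset.prod_pos fun p _ => Nat.cast_pos.2 (Nat.factorial_pos (m p))

lemma eq_zero_of_polyInner_self {P : WeightPoly F} (h : polyInner P P = 0) : P = 0 := by
  rw [polyInner_self, Complex.ofReal_eq_zero] at h
  ext m
  by_cases hm : m ∈ P.support
  · have := (Finset.sum_eq_zero_iff_of_nonneg fun m _ =>
      mul_nonneg (factProd_pos m).le (Complex.normSq_nonneg _)).1 h m hm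
    rcases mul_eq_zero.1 this with h' | h'
    · exact absurd h' (factProd_pos m).ne'
    · simpa using h'
  · simpa using hm

variable [NumberField F]

instance weightSpace_finite (k : (F →+* ℝ) → ℕ) : Module.Finite ℂ (weightSpace F k) := by
  have hle : weightSpace F k ≤ MvPolynomial.restrictTotalDegree _ ℂ (∑ τ, k τ) := by
    intro P hP
    rw [MvPolynomial.mem_restrictTotalDegree]
    refine Finset.sup_le fun m hm => le_of_eq ?_
    rw [Finsupp.sum_fintype _ _ (fun _ => rfl), Fintype.sum_prod_type]
    exact Finset.sum_congr rfl fun τ _ => hP.1 m hm τ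
  exact Module.Finite.of_injective (Submodule.inclusion hle) (Submodule.inclusion_injective hle)

/-- Evaluation at a point is represented by a unique polynomial, by positivity of the inner
product. -/
theorem exists_polyAt (ι : (F →+* ℝ) → B →+* Quaternion ℝ) (k : (F →+* ℝ) → ℕ) (b : B) :
    ∃! Q : WeightPoly F, Q ∈ weightSpace F k ∧
      ∀ P ∈ weightSpace F k, evalAt ι P b = polyInner P Q := by
  let V := weightSpace F k
  let ev : Module.Dual ℂ V :=
    { toFun := fun P => evalAt ι (P : WeightPoly F) b
      map_add' := fun P Q => by simp [evalAt]
      map_smul' := fun c P => by simp [evalAt, MvPolynomial.smul_eval] }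
  let T : V →ₛₗ[starRingEnd ℂ] Module.Dual ℂ V :=
    { toFun := fun Q =>
        { toFun := fun P => polyInner (P : WeightPoly F) (Q : WeightPoly F)
          map_add' := fun P P' => polyInner_add _ _ _
          map_smul' := fun c P => polyInner_smul _ _ _ }
      map_add' := fun Q Q' => LinearMap.ext fun P => by
        change polyInner (P : WeightPoly F) (Q + Q' : WeightPoly F) =
          polyInner (P : WeightPoly F) Q + polyInner (P : WeightPoly F) Q'
        rw [← polyInner_conj, polyInner_add, map_add, polyInner_conj, polyInner_conj]
      map_smul' := fun c Q => LinearMap.ext fun P => by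
        change polyInner (P : WeightPoly F) (c • Q : WeightPoly F) =
          (starRingEnd ℂ) c * polyInner (P : WeightPoly F) Q
        rw [← polyInner_conj, polyInner_smul, map_mul, polyInner_conj] }
  have hT : LinearMap.range T = ⊤ := by
    have h0 : (LinearMap.range T).dualCoannihilator = ⊥ := by
      rw [eq_bot_iff]
      intro P hP
      rw [Submodule.mem_dualCoannihilator] at hP
      have h1 : polyInner (P : WeightPoly F) (P : WeightPoly F) = 0 :=
        hP (T P) (LinearMap.mem_range_self T P)
      exact (Submodule.mem_bot ℂ).2 (Subtype.ext (eq_zero_of_polyInner_self h1))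
    rw [← Subspace.dualCoannihilator_dualAnnihilator_eq (W := LinearMap.range T), h0,
      Submodule.dualAnnihilator_bot]
  obtain ⟨Q₀, hTQ⟩ : ev ∈ LinearMap.range T := hT ▸ Submodule.mem_top
  obtain ⟨Q, hQV⟩ := Q₀
  have hQ : ∀ P ∈ V, polyInner P Q = evalAt ι P b := fun P hP => LinearMap.congr_fun hTQ ⟨P, hP⟩
  refine ⟨Q, ⟨hQV, fun P hP => (hQ P hP).symm⟩, ?_⟩
  rintro Q' ⟨hQ'm, hQ'⟩
  have hm : Q' + (-1 : ℂ) • Q ∈ V := Submodule.add_mem _ hQ'm (Submodule.smul_mem _ _ hQV)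
  have e : polyInner (Q' + (-1 : ℂ) • Q) Q' = polyInner (Q' + (-1 : ℂ) • Q) Q := by
    rw [← hQ' _ hm, hQ _ hm]
  have e2 : polyInner (Q' + (-1 : ℂ) • Q) (Q' + (-1 : ℂ) • Q) = 0 := by
    conv_lhs => rw [← polyInner_conj]
    conv_lhs => arg 2; rw [polyInner_add, polyInner_smul]
    rw [map_add, map_mul, polyInner_conj, polyInner_conj, e]
    simp
  have e3 := eq_zero_of_polyInner_self e2
  rwa [neg_one_smul, ← sub_eq_add_neg, sub_eq_zero] at e3

/-- The polynomial `P_b ∈ V_𝐤` characterized by `P(b) = ⟨P, P_b⟩` for all `P ∈ V_𝐤`. -/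
def polyAt (ι : (F →+* ℝ) → B →+* Quaternion ℝ) (k : (F →+* ℝ) → ℕ) (b : B) : WeightPoly F :=
  (exists_polyAt ι k b).choose

end Weight

/-! ## Quaternionic modular forms -/

section Forms

variable {F : Type*} [Field F] [NumberField F] {B : Type*} [Ring B] [Algebra F B]

/-- `M_𝐤(R)`: functions `φ : B̂ˣ → V_𝐤` with `φ(u x γ) = φ(x) · γ` for `u ∈ R̂ˣ`, `γ ∈ Bˣ`. -/
def quatForms (ι : (F →+* ℝ) → B →+* Quaternion ℝ) (R : Subalgebra (𝓞 F) B)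
    (k : (F →+* ℝ) → ℕ) : Submodule ℂ ((BHat F B)ˣ → WeightPoly F) where
  carrier := {φ | (∀ x, φ x ∈ weightSpace F k) ∧
    ∀ x, ∀ u ∈ orderHatUnits R, ∀ γ : Bˣ, φ (u * x * globalUnits F B γ) = polyAct ι γ (φ x)}
  add_mem' {φ ψ} hφ hψ := ⟨fun x => Submodule.add_mem _ (hφ.1 x) (hψ.1 x), fun x u hu γ => by
    simp [hφ.2 x u hu γ, hψ.2 x u hu γ]⟩
  zero_mem' := ⟨fun _ => Submodule.zero_mem _, fun x u hu γ => by simp⟩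
  smul_mem' c φ hφ := ⟨fun x => Submodule.smul_mem _ c (hφ.1 x), fun x u hu γ => by
    simp [hφ.2 x u hu γ]⟩

/-- The height pairing `⟨φ, ψ⟩ = ∑_{x ∈ cl(R)} (1 / w_x) ⟨φ(x), ψ(x)⟩`. -/
def heightPairing (R : Subalgebra (𝓞 F) B) (φ ψ : (BHat F B)ˣ → WeightPoly F) : ℂ :=
  ∑ᶠ c : ClassSet R, (stabCard R c.out : ℂ)⁻¹ * polyInner (φ c.out) (ψ c.out)

/-- The form with minimal support `φ_{x,v}(y) = ∑_{γ ∈ Γ_{x,y}} v · γ`, where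
`Γ_{x,y} = (Bˣ ∩ x⁻¹ R̂ˣ y) / (𝓞 F)ˣ`. -/
def minSupp (ι : (F →+* ℝ) → B →+* Quaternion ℝ) (R : Subalgebra (𝓞 F) B) (x : (BHat F B)ˣ)
    (v : WeightPoly F) : (BHat F B)ˣ → WeightPoly F := fun y =>
  ∑ᶠ g ∈ {g : Bˣ ⧸ intUnits F B | ∃ γ : Bˣ, (γ : Bˣ ⧸ intUnits F B) = g ∧
    ∃ u ∈ orderHatUnits R, globalUnits F B γ = x⁻¹ * u * y}, polyAct ι g.out v

/-! ## Special points -/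

open Polynomial in
/-- `K = F(√-D)`. -/
abbrev QuadExt (D : F) : Type _ := AdjoinRoot (X ^ 2 + C D : F[X])

/-- `disc(ω) = tr(ω)² - 4 n(ω)` on `K`. -/
def fieldDisc {D : F} (ω : QuadExt D) : F :=
  Algebra.trace F (QuadExt D) ω ^ 2 - 4 * Algebra.norm F ω

/-- `S` is the order `𝓞_{D,𝔞}`: an order of `K` of the form `𝓞_F ⊕ 𝔞 ω` with `disc(ω) = -D`. There
is at most one; the pair `(-D, 𝔞)` is a discriminant if there is one. -/
def IsQuadOrder (D : F) (𝔞 : (FractionalIdeal (𝓞 F)⁰ F)ˣ) (S : Subalgebra (𝓞 F) (QuadExt D)) :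
    Prop :=
  IsOrder F S ∧ ∃ ω : QuadExt D, fieldDisc ω = -D ∧
    (S : Set (QuadExt D)) = {z | ∃ a : 𝓞 F, ∃ b ∈ (𝔞 : FractionalIdeal (𝓞 F)⁰ F),
      z = algebraMap (𝓞 F) (QuadExt D) a + algebraMap F (QuadExt D) b * ω}

/-- `X̃_{D,𝔞} = {x ∈ B̂ˣ : 𝓞_{D,𝔞} ⊆ R_x}`, empty if `(-D, 𝔞)` is not a discriminant. -/
def specialPoints (R : Subalgebra (𝓞 F) B) {D : F} (𝔞 : (FractionalIdeal (𝓞 F)⁰ F)ˣ)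
    (j : QuadExt D →ₐ[F] B) : Set (BHat F B)ˣ :=
  {x | ∃ S, IsQuadOrder D 𝔞 S ∧ ∀ z ∈ S, j z ∈ orderAt R x}

/-- The image of `Kˣ` in `B̂ˣ`. -/
def fieldUnits {D : F} (j : QuadExt D →ₐ[F] B) : Subgroup (BHat F B)ˣ :=
  ((globalUnits F B).comp (Units.map (j : QuadExt D →* B))).range

/-- `[𝓞_xˣ : (𝓞 F)ˣ]`, where `𝓞_x = R_x ∩ K`. -/
def unitIndex (R : Subalgebra (𝓞 F) B) {D : F} (j : QuadExt D →ₐ[F] B) (x : (BHat F B)ˣ) : ℕ :=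
  (intUnits F (QuadExt D)).relIndex
    ((orderAtUnits R x).comap (Units.map (j : QuadExt D →* B)))

/-- `η_{D,𝔞} = ∑_{x ∈ X_{D,𝔞}} [𝓞_xˣ : (𝓞 F)ˣ]⁻¹ φ_{x,P_D}`, where
`X_{D,𝔞} = R̂ˣ \ X̃_{D,𝔞} / Kˣ` and `P_D` is the polynomial attached to `ω ∈ K`. -/
def etaForm (ι : (F →+* ℝ) → B →+* Quaternion ℝ) (R : Subalgebra (𝓞 F) B)
    (k : (F →+* ℝ) → ℕ) {D : F} (𝔞 : (FractionalIdeal (𝓞 F)⁰ F)ˣ) (j : QuadExt D →ₐ[F] B)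
    (ω : QuadExt D) : (BHat F B)ˣ → WeightPoly F :=
  ∑ᶠ c ∈ DoubleCoset.mk (orderHatUnits R) (fieldUnits j) '' specialPoints R 𝔞 j,
    (unitIndex R j c.out : ℂ)⁻¹ • minSupp ι R c.out (polyAt ι k (j ω))

/-! ## Theta series -/

/-- `e_F(ξ, z/2) = exp(2πi ∑_τ τ(ξ) z_τ / 2)`. -/
def expHalf (ξ : F) (z : (F →+* ℝ) → UpperHalfPlane) : ℂ :=
  Complex.exp (2 * Real.pi * Complex.I * ∑ τ : F →+* ℝ, ((τ ξ : ℝ) : ℂ) * ((z τ : ℂ) / 2))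

/-- The lattice `L_x = R_x / 𝓞_F` in `B / F`. -/
def latticeAt (R : Subalgebra (𝓞 F) B) (x : (BHat F B)ˣ) : Set (B ⧸ (1 : Submodule F B)) :=
  (Submodule.mkQ (1 : Submodule F B)) '' (orderAt R x : Set B)

/-- `ϑ_{x,P}(z) = ∑_{y ∈ L_x} P(y) e_F(-disc(y), z/2)`; both `P` and `disc` only depend on the class
of `y` in `B / F`. -/
def thetaAt (ι : (F →+* ℝ) → B →+* Quaternion ℝ) (R : Subalgebra (𝓞 F) B) (x : (BHat F B)ˣ)
    (P : WeightPoly F) (z : (F →+* ℝ) → UpperHalfPlane) : ℂ :=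
  ∑' y : latticeAt R x, evalAt ι P (Quotient.out y.1) *
    expHalf (-quatDisc F (Quotient.out y.1)) z

/-- `ϑ(φ) = ∑_{x ∈ cl(R)} (1 / w_x) ϑ_{x,φ(x)}`. -/
def thetaLift (ι : (F →+* ℝ) → B →+* Quaternion ℝ) (R : Subalgebra (𝓞 F) B)
    (φ : (BHat F B)ˣ → WeightPoly F) (z : (F →+* ℝ) → UpperHalfPlane) : ℂ :=
  ∑ᶠ c : ClassSet R, (stabCard R c.out : ℂ)⁻¹ * thetaAt ι R c.out (φ c.out) z

end Forms

/-! ## Fourier coefficients of half-integral weight forms at the cusp `𝔞` -/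

section Cusps

variable {F : Type*} [Field F] [NumberField F]

/-- The absolute norm of a fractional ideal. -/
def idealNorm (𝔞 : (FractionalIdeal (𝓞 F)⁰ F)ˣ) : ℝ :=
  ((FractionalIdeal.absNorm (𝔞 : FractionalIdeal (𝓞 F)⁰ F) : ℚ) : ℝ)

/-- The basic theta series at the cusp `𝔞`, `N(𝔞)^{-1/2} ∑_{ξ ∈ 𝔞⁻¹} e_F(ξ², z/2)`. For `𝔞 = 1` it is
the theta series `θ(z) = ∑_{ξ ∈ 𝓞_F} e_F(ξ², z/2)` defining the half-integral weight factor. -/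
def basicTheta (𝔞 : (FractionalIdeal (𝓞 F)⁰ F)ˣ) (z : (F →+* ℝ) → UpperHalfPlane) : ℂ :=
  ((Real.sqrt (idealNorm 𝔞))⁻¹ : ℝ) *
    ∑' ξ : {ξ : F // ξ ∈ ((𝔞⁻¹ : (FractionalIdeal (𝓞 F)⁰ F)ˣ) : FractionalIdeal (𝓞 F)⁰ F)},
      expHalf (ξ.1 ^ 2) z

/-- The componentwise action of `SL₂(F)` on the product of upper half-planes. -/
def moebius (β : Matrix.SpecialLinearGroup (Fin 2) F) (z : (F →+* ℝ) → UpperHalfPlane) :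
    (F →+* ℝ) → UpperHalfPlane :=
  fun τ => Matrix.SpecialLinearGroup.map τ β • z τ

/-- `j(β, z)^𝐤 = ∏_τ (τ(c) z_τ + τ(d))^{k_τ}`. -/
def autFactor (k : (F →+* ℝ) → ℕ) (β : Matrix.SpecialLinearGroup (Fin 2) F)
    (z : (F →+* ℝ) → UpperHalfPlane) : ℂ :=
  ∏ τ : F →+* ℝ, (((τ (β.1 1 0) : ℝ) : ℂ) * (z τ : ℂ) + ((τ (β.1 1 1) : ℝ) : ℂ)) ^ k τ

/-- `2^{-1} 𝔡_F`, with `𝔡_F` the different of `F` over `ℚ`. -/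
def halfDifferent (F : Type*) [Field F] [NumberField F] : FractionalIdeal (𝓞 F)⁰ F :=
  FractionalIdeal.spanSingleton (𝓞 F)⁰ ((2 : F)⁻¹) *
    ((differentIdeal ℤ (𝓞 F) : Ideal (𝓞 F)) : FractionalIdeal (𝓞 F)⁰ F)

/-- The matrices of `SL₂(F)` carrying the cusp `𝔞` at level `4𝔠`: those of the form
`diag(r, r⁻¹) · w` at the finite places, where `r` is an idele of ideal `𝔞` and `w` lies in the
adelic congruence group `D[2𝔡⁻¹, 2⁻¹ · 4𝔠 𝔡]`. By strong approximation there always are such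
matrices; for `𝔞 = 1` they form the congruence subgroup `Γ[2𝔡⁻¹, 2⁻¹ · 4𝔠 𝔡]`. -/
def cuspMatrices (𝔠 : Ideal (𝓞 F)) (𝔞 : (FractionalIdeal (𝓞 F)⁰ F)ˣ) :
    Set (Matrix.SpecialLinearGroup (Fin 2) F) :=
  {β | β.1 0 0 ∈ (𝔞 : FractionalIdeal (𝓞 F)⁰ F) ∧
    β.1 0 1 ∈ (halfDifferent F)⁻¹ * (𝔞 : FractionalIdeal (𝓞 F)⁰ F) ∧
    β.1 1 0 ∈ FractionalIdeal.spanSingleton (𝓞 F)⁰ (4 : F) * (𝔠 : FractionalIdeal (𝓞 F)⁰ F) *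
      halfDifferent F * (𝔞 : FractionalIdeal (𝓞 F)⁰ F)⁻¹ ∧
    β.1 1 1 ∈ (𝔞 : FractionalIdeal (𝓞 F)⁰ F)⁻¹}

/-- `h = h(β, ·)` is the factor of weight `1/2` attached to a matrix `β` carrying the cusp `𝔞`: the
continuous function with `θ_𝔞(β w) = h(w) θ(w)`. It is unique, because the zeros of `θ` have empty
interior. -/
def IsHalfFactor (𝔞 : (FractionalIdeal (𝓞 F)⁰ F)ˣ) (β : Matrix.SpecialLinearGroup (Fin 2) F)
    (h : ((F →+* ℝ) → UpperHalfPlane) → ℂ) : Prop :=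
  Continuous h ∧ ∀ w, h w * basicTheta 1 w = basicTheta 𝔞 (moebius β w)

/-- `lam` is the family of Fourier coefficients at the cusp `𝔞` of the function `f` of weight
`3/2 + 𝐤`: for some level `4𝔠` and all matrices `β` carrying the cusp `𝔞` at that level,
`(f ‖ β⁻¹)(z) = N(𝔞)^{-1/2} ∑_ξ lam(ξ) e_F(ξ, z/2)`, where
`(f ‖ β⁻¹)(β w) = h(β, w)³ j(β, w)^𝐤 f(w)`. Since `h(β, ·)²` is `j(β, ·)` up to the character attached to
`F(√-1)/F`, the factor `h³ j^𝐤` is that of weight `3/2 + 𝐤` with this character. -/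
def HasFourierExpansionAt (k : (F →+* ℝ) → ℕ) (𝔞 : (FractionalIdeal (𝓞 F)⁰ F)ˣ)
    (f : ((F →+* ℝ) → UpperHalfPlane) → ℂ) (lam : F → ℂ) : Prop :=
  ∃ 𝔠 : Ideal (𝓞 F), 𝔠 ≠ ⊥ ∧ ∀ β ∈ cuspMatrices 𝔠 𝔞,
    ∃ h : ((F →+* ℝ) → UpperHalfPlane) → ℂ, IsHalfFactor 𝔞 β h ∧
      ∀ w, HasSum (fun ξ : F => ((Real.sqrt (idealNorm 𝔞))⁻¹ : ℝ) * lam ξ *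
        expHalf ξ (moebius β w)) (h w ^ 3 * autFactor k β w * f w)

/-- `c` is the `D`-th Fourier coefficient `λ(D, 𝔞; f)` at the cusp `𝔞` of the function `f` of weight
`3/2 + 𝐤`. -/
def IsFourierCoeffAt (k : (F →+* ℝ) → ℕ) (𝔞 : (FractionalIdeal (𝓞 F)⁰ F)ˣ)
    (f : ((F →+* ℝ) → UpperHalfPlane) → ℂ) (D : F) (c : ℂ) : Prop :=
  ∃ lam : F → ℂ, HasFourierExpansionAt k 𝔞 f lam ∧ lam D = c

end Cusps

end

/-! Put `L_x = R_x / 𝓞_F` with the form `-disc`: a positive definite ternary lattice over `F`. The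
proof has an analytic half (the expansion at the cusp, with coefficients given by sums over vectors
of fixed length) and an arithmetic half (such vectors correspond to special points).

Analytic half. For `β = (a b; c d)` one has `d² β w = b d + w'` with `-1/w' = -1/w - c/d`.
Substituting `y = d v`, the theta series of `𝔞⁻¹L` at `β w` becomes a sum over the classes `v` of
`d⁻¹𝔞⁻¹L / L` of the character value `ψ(b d q(v) / 2)` times the theta series of `v + L` at `w'`.
Poisson summation for harmonic polynomials times Gaussians (`exists_hasSum_polyGauss`, resting on
`IsHermiteMap.eq_of_isMultiHarmonic`), a completion of the square in the dual variable, and Poisson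
summation back at `w` give `hasSum_theta_moebius`: `Θ_{𝔞⁻¹L}(β w) = G_L ρ(w)^n j(β,w)^𝐤 Θ_L(w)`.
Here `G_L` is a quadratic Gauss sum over `d⁻¹𝔞⁻¹L / L` and `ρ` is a quotient of square roots not
depending on `L`. For the form `x y` on `F` this formula computes the factor of weight `1/2`, namely
`h = N(𝔞)^{-1/2} G_𝓞 ρ`. For `L = L_x` it fits `h³ j^𝐤` because `G_L = G_𝓞³` (`gaussSum_eq_cube`).
Indeed `-disc` takes the shape `-α x² - β y² + α β z²` in an orthogonal basis. At a sufficiently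
divisible level the lattice may be replaced by the span of that basis, and `2`, `α`, `β` act
invertibly on the quotient. The identity for the diagonal form (`scalarGauss_ternary`) then holds
since `α x² - α y²` is hyperbolic and `x² - α y²` represents every unit. Consequently `h³ j^𝐤 ϑ(φ)`
is `N(𝔞)^{-3/2}` times a weighted sum over `cl(R)` of theta series of `𝔞⁻¹L_x` at `β w`. Its
coefficient at `ξ` is `N(𝔞)⁻¹` times the weighted sum of `φ(x)(v)` over the `v` in `𝔞⁻¹L_x` of
length `ξ` (`hasFourierExpansionAt_thetaLift`).

Arithmetic half. A vector `v` of `𝔞⁻¹L_y` of length `D` is the class of `γ⁻¹ω γ` for some `γ ∈ Bˣ`,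
unique up to `Kˣ` on the left. The point `x = y γ⁻¹` is special, its class in `X_{D,𝔞}` depends only
on `v`, and the elements of `Γ_{x,y}` carrying `ω` to `v` form a torsor under `𝓞_xˣ / 𝓞_Fˣ`
(`exists_class_of_vector`). The weights in `η_{D,𝔞}` therefore cancel (`sum_specialClasses`).
Invariance of the inner product and the defining property of `P_D` give `⟨φ(y), P_D·γ⟩ = φ(y)(γ⁻¹ω
γ)`, so summing over `cl(R)` produces `⟨φ, η_{D,𝔞}⟩`. If `K` does not embed in `B`, no vector has
length `D` and both sides vanish.

The finite sums are genuine: `cl(R)` is finite by a Euclidean argument (`finite_classSet`), and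
vectors of given length and unit indices are finite by definiteness. -/

noncomputable section

/-! ## Poisson summation on `ℤ^ι` -/

section Poisson

open MeasureTheory Set

set_option linter.unusedSectionVars false

variable {ι : Type*} [Fintype ι]

/-- An integral vector as a real vector. -/
def intVec (n : ι → ℤ) : ι → ℝ := fun i => n i

lemma intVec_add (m n : ι → ℤ) : intVec (m + n) = intVec m + intVec n := by
  ext i; simp [intVec]

lemma summable_one_add_norm_pow_inv (r : ℕ) (hr : Fintype.card ι < r) :
    Summable fun n : ι → ℤ => ((1 + ‖intVec n‖) ^ r)⁻¹ := by
  classical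
  set L := Submodule.span ℤ (Set.range (Pi.basisFun ℝ ι)) with hL
  have hfr : Module.finrank ℤ L = Fintype.card ι := by
    rw [ZLattice.rank ℝ]; simp
  have h1 := ZLattice.summable_norm_pow_inv L r (by rw [hfr]; exact hr)
  have hmem : ∀ n : ι → ℤ, intVec n ∈ L := fun n => by
    rw [hL, Module.Basis.mem_span_iff_repr_mem]
    intro i
    exact ⟨n i, by simp [intVec]⟩
  have hinj : Function.Injective (fun n : ι → ℤ => (⟨intVec n, hmem n⟩ : L)) := by
    intro m n h
    ext i
    have := congrFun (congrArg Subtype.val h) i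
    simpa [intVec] using this
  have h2 := h1.comp_injective hinj
  refine Summable.of_norm_bounded_eventually h2 ?_
  refine Set.Finite.subset (Set.finite_singleton (0 : ι → ℤ)) fun n hn => ?_
  by_contra h0
  apply hn
  have hpos : 0 < ‖intVec n‖ := by
    rw [norm_pos_iff]
    intro h
    apply h0
    ext i
    simpa [intVec] using congrFun h i
  have e : ‖(⟨intVec n, hmem n⟩ : L)‖ = ‖intVec n‖ := rfl
  change ‖((1 + ‖intVec n‖) ^ r)⁻¹‖ ≤ ‖(⟨intVec n, hmem n⟩ : L)‖⁻¹ ^ r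
  rw [e, Real.norm_of_nonneg (by positivity), inv_pow]
  gcongr
  linarith

/-- The half open unit cube with lower corner `n`. -/
def unitCube (n : ι → ℤ) : Set (ι → ℝ) := {x | ∀ i, x i ∈ Ioc (n i : ℝ) (n i + 1)}

lemma measurableSet_unitCube (n : ι → ℤ) : MeasurableSet (unitCube n) := by
  have : unitCube n = Set.pi univ fun i => Ioc (n i : ℝ) (n i + 1) := by ext; simp [unitCube]
  rw [this]
  exact MeasurableSet.univ_pi fun i => measurableSet_Ioc

lemma iUnion_unitCube : ⋃ n : ι → ℤ, unitCube n = univ := by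
  ext x
  simp only [mem_iUnion, mem_univ, iff_true]
  -- The cubes are open at their lower faces, hence the ceiling minus one instead of the floor.
  refine ⟨fun i => ⌈x i⌉ - 1, fun i => ⟨?_, ?_⟩⟩
  · push_cast; linarith [Int.ceil_lt_add_one (x i)]
  · push_cast; linarith [Int.le_ceil (x i)]

lemma pairwise_disjoint_unitCube :
    Pairwise (Function.onFun Disjoint (unitCube : (ι → ℤ) → Set (ι → ℝ))) := by
  intro m n hmn
  rw [Function.onFun, Set.disjoint_left]
  intro x hm hn
  apply hmn
  ext i
  have h1 := hm i
  have h2 := hn i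
  have a : (m i : ℝ) < n i + 1 := h1.1.trans_le h2.2
  have b : (n i : ℝ) < m i + 1 := h2.1.trans_le h1.2
  norm_cast at a b
  omega

lemma setIntegral_unitCube (g : (ι → ℝ) → ℂ) (n : ι → ℤ) :
    ∫ x in unitCube n, g x = ∫ x in unitCube 0, g (x + intVec n) := by
  have := (measurePreserving_add_right (volume : Measure (ι → ℝ)) (intVec n)).setIntegral_preimage_emb
    (MeasurableEquiv.addRight (intVec n)).measurableEmbedding g (unitCube n)
  rw [← this]
  congr 2
  ext x
  simp only [unitCube, intVec, mem_preimage, mem_ofPred_eq, Pi.add_apply, Pi.zero_apply, Int.cast_zero, mem_Ioc]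
  refine forall_congr' fun i => ⟨fun h => ⟨by linarith [h.1], by linarith [h.2]⟩,
    fun h => ⟨by linarith [h.1], by linarith [h.2]⟩⟩

lemma hasSum_setIntegral_unitCube {g : (ι → ℝ) → ℂ} (hg : Integrable g) :
    HasSum (fun n : ι → ℤ => ∫ x in unitCube 0, g (x + intVec n)) (∫ x, g x) := by
  have := hasSum_integral_iUnion (f := g) (μ := volume) (s := (unitCube : (ι → ℤ) → Set (ι → ℝ)))
    measurableSet_unitCube pairwise_disjoint_unitCube hg.integrableOn
  rw [iUnion_unitCube, setIntegral_univ] at this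
  simpa only [setIntegral_unitCube g] using this

/-- `exp(2πi n·x)`. -/
def expDot (y x : ι → ℝ) : ℂ := Complex.exp (2 * Real.pi * Complex.I * ∑ i, (y i : ℂ) * x i)

lemma expDot_add_right (y x x' : ι → ℝ) : expDot y (x + x') = expDot y x * expDot y x' := by
  rw [expDot, expDot, expDot, ← Complex.exp_add]
  rw [← mul_add, ← Finset.sum_add_distrib]
  simp only [Pi.add_apply, Complex.ofReal_add, mul_add]

lemma norm_expDot (y x : ι → ℝ) : ‖expDot y x‖ = 1 := by
  have : (2 * Real.pi * Complex.I * ∑ i, (y i : ℂ) * x i) =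
      ((2 * Real.pi * ∑ i, y i * x i : ℝ) : ℂ) * Complex.I := by
    push_cast; ring
  rw [expDot, this, Complex.norm_exp_ofReal_mul_I]

lemma expDot_intVec (m n : ι → ℤ) : expDot (intVec m) (intVec n) = 1 := by
  rw [expDot, Complex.exp_eq_one_iff]
  exact ⟨∑ i, m i * n i, by simp [intVec]; ring⟩

lemma continuous_expDot (y : ι → ℝ) : Continuous (expDot y) := by
  unfold expDot; fun_prop

lemma mFourier_eq_expDot (n : ι → ℤ) (x : ι → ℝ) :
    UnitAddTorus.mFourier n (fun i => (x i : UnitAddCircle)) = expDot (intVec n) x := by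
  simp only [UnitAddTorus.mFourier, ContinuousMap.coe_mk, fourier_coe_apply, expDot, intVec]
  rw [← Complex.exp_sum, Finset.mul_sum]
  congr 1
  refine Finset.sum_congr rfl fun i _ => ?_
  simp; ring

/-- The periodization of a function on `ℝ^ι`. -/
def periodize (f : (ι → ℝ) → ℂ) (x : ι → ℝ) : ℂ := ∑' n : ι → ℤ, f (x + intVec n)

lemma periodize_add (f : (ι → ℝ) → ℂ) (x : ι → ℝ) (m : ι → ℤ) :
    periodize f (x + intVec m) = periodize f x := by
  unfold periodize
  rw [← (Equiv.addLeft m).tsum_eq (fun n => f (x + intVec n))]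
  refine tsum_congr fun n => ?_
  simp [intVec_add, add_assoc]

variable {f : (ι → ℝ) → ℂ} {r : ℕ} {C : ℝ}

/-- The triangle inequality gives `1 + ‖n‖ ≤ (1 + K) (1 + ‖x + n‖)`. The resulting majorant is
uniform for `x` in a bounded set, as needed both for continuity of the periodization and for
exchanging sum and integral over the unit cube. -/
lemma norm_add_intVec_le (hf : ∀ x, ‖f x‖ ≤ C * ((1 + ‖x‖) ^ r)⁻¹) (K : ℝ) (x : ι → ℝ)
    (hx : ‖x‖ ≤ K) (n : ι → ℤ) :
    ‖f (x + intVec n)‖ ≤ C * (1 + K) ^ r * ((1 + ‖intVec n‖) ^ r)⁻¹ := by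
  have hC : 0 ≤ C := by
    have := (norm_nonneg _).trans (hf 0)
    simpa using this
  have hK : 0 ≤ K := (norm_nonneg _).trans hx
  refine (hf _).trans ?_
  rw [mul_assoc]
  gcongr
  rw [← div_eq_mul_inv, le_div_iff₀ (by positivity), inv_mul_le_iff₀ (by positivity), ← mul_pow]
  gcongr
  have h1 : ‖intVec n‖ ≤ ‖x + intVec n‖ + ‖x‖ := by
    have := norm_sub_le (x + intVec n) x
    simpa using this
  nlinarith [norm_nonneg (x + intVec n), norm_nonneg x]

lemma summable_periodize (hr : Fintype.card ι < r)
    (hf : ∀ x, ‖f x‖ ≤ C * ((1 + ‖x‖) ^ r)⁻¹) (x : ι → ℝ) :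
    Summable fun n : ι → ℤ => f (x + intVec n) :=
  Summable.of_norm_bounded ((summable_one_add_norm_pow_inv r hr).mul_left _)
    (norm_add_intVec_le hf ‖x‖ x le_rfl)

lemma continuous_periodize (hr : Fintype.card ι < r) (hc : Continuous f)
    (hf : ∀ x, ‖f x‖ ≤ C * ((1 + ‖x‖) ^ r)⁻¹) : Continuous (periodize f) := by
  rw [continuous_iff_continuousAt]
  intro x
  have h : ContinuousOn (periodize f) (Metric.ball 0 (‖x‖ + 1)) :=
    continuousOn_tsum (fun n => (hc.comp (continuous_add_const _)).continuousOn)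
      ((summable_one_add_norm_pow_inv r hr).mul_left _) fun n y hy =>
        norm_add_intVec_le hf (‖x‖ + 1) y (by simpa using (mem_ball_zero_iff.1 hy).le) n
  exact h.continuousAt (Metric.isOpen_ball.mem_nhds (by simp))

/-- A product of the open quotient maps `ℝ → ℝ/ℤ` is again an open quotient map, so a continuous
periodic function descends to the torus, where the theory of Fourier series applies. -/
lemma exists_torus_lift {g : (ι → ℝ) → ℂ} (hg : Continuous g)
    (hper : ∀ x m, g (x + intVec m) = g x) :
    ∃ G : C(UnitAddTorus ι, ℂ), ∀ x : ι → ℝ, G (fun i => (x i : UnitAddCircle)) = g x := by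
  let q : (ι → ℝ) → UnitAddTorus ι := fun x i => (x i : UnitAddCircle)
  have hq : IsOpenQuotientMap q :=
    IsOpenQuotientMap.piMap fun _ => QuotientAddGroup.isOpenQuotientMap_mk
  have hcompat : ∀ x y, q x = q y → g x = g y := by
    intro x y h
    have : ∀ i, ∃ n : ℤ, x i - y i = n := fun i => by
      obtain ⟨n, hn⟩ := AddSubgroup.mem_zmultiples_iff.1 (QuotientAddGroup.eq_iff_sub_mem.1 (congrFun h i))
      exact ⟨n, by simpa using hn.symm⟩
    choose m hm using this
    have : x = y + intVec m := by
      ext i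
      simp [intVec, ← hm]
    rw [this, hper]
  refine ⟨⟨fun t => g (Function.surjInv hq.surjective t), ?_⟩, fun x => ?_⟩
  · rw [hq.isQuotientMap.continuous_iff]
    have : (fun t => g (Function.surjInv hq.surjective t)) ∘ q = g := by
      ext x
      exact hcompat _ _ (Function.surjInv_eq hq.surjective _)
    rwa [this]
  · exact hcompat _ _ (Function.surjInv_eq hq.surjective (q x))

/-- Poisson summation on `ℤ^ι` for functions of sufficient decay. -/
theorem hasSum_poisson (hr : Fintype.card ι < r) (hc : Continuous f)
    (hf : ∀ x, ‖f x‖ ≤ C * ((1 + ‖x‖) ^ r)⁻¹)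
    (hF : Summable fun n : ι → ℤ => ∫ x, expDot (-intVec n) x * f x) (s : ι → ℝ) :
    HasSum (fun n : ι → ℤ => (∫ x, expDot (-intVec n) x * f x) * expDot (intVec n) s)
      (∑' n : ι → ℤ, f (s + intVec n)) := by
  obtain ⟨G, hG⟩ := exists_torus_lift (continuous_periodize hr hc hf) (periodize_add f)
  have hint : Integrable f := by
    have h1 : Integrable fun x : ι → ℝ => C * ((1 + ‖x‖) ^ r)⁻¹ := by
      have := (integrable_one_add_norm (E := ι → ℝ) (μ := volume) (r := r) (by simpa using hr)).const_mul C
      refine this.congr (Filter.Eventually.of_forall fun x => ?_)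
      simp only [Real.rpow_neg (by positivity : (0:ℝ) ≤ 1 + ‖x‖), Real.rpow_natCast]
    exact h1.mono' hc.aestronglyMeasurable (Filter.Eventually.of_forall hf)
  -- Unfolding: the integral over `ℝ^ι` is cut into translated unit cubes, and the character does
  -- not see integral translations, so what remains is a Fourier coefficient of the periodization.
  have hcoef : ∀ m, UnitAddTorus.mFourierCoeff G m = ∫ x, expDot (-intVec m) x * f x := by
    intro m
    have hint' : Integrable fun x => expDot (-intVec m) x * f x := by
      refine hint.mono (((continuous_expDot _).mul hc).aestronglyMeasurable)
        (Filter.Eventually.of_forall fun x => ?_)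
      rw [norm_mul, norm_expDot, one_mul]
    rw [UnitAddTorus.mFourierCoeff_eq_integral _ _ 0]
    have hS : {x : ι → ℝ | ∀ i, x i ∈ Ioc ((0 : ι → ℝ) i) ((0 : ι → ℝ) i + 1)} = unitCube 0 := by
      ext x; simp [unitCube]
    rw [hS]
    have h1 := (hasSum_setIntegral_unitCube hint')
    have hneg : intVec (-m) = -intVec m := by ext i; simp [intVec]
    have h2 : ∀ x n, expDot (-intVec m) (x + intVec n) * f (x + intVec n) =
        expDot (-intVec m) x * f (x + intVec n) := by
      intro x n
      rw [expDot_add_right, ← hneg, expDot_intVec, mul_one]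
    simp only [h2] at h1
    have hvol : volume (unitCube (0 : ι → ℤ)) < ⊤ := by
      have : unitCube (0 : ι → ℤ) ⊆ Icc 0 1 := fun x hx =>
        ⟨fun i => by simpa using (hx i).1.le, fun i => by simpa using (hx i).2⟩
      exact (measure_mono this).trans_lt isCompact_Icc.measure_lt_top
    have hbd : ∀ n : ι → ℤ, ∀ x ∈ unitCube (0 : ι → ℤ), ‖expDot (-intVec m) x * f (x + intVec n)‖ ≤
        C * (1 + 1) ^ r * ((1 + ‖intVec n‖) ^ r)⁻¹ := by
      intro n x hx
      rw [norm_mul, norm_expDot, one_mul]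
      refine norm_add_intVec_le hf 1 x ?_ n
      rw [pi_norm_le_iff_of_nonneg zero_le_one]
      intro i
      have := hx i
      simp only [Pi.zero_apply, Int.cast_zero, zero_add, mem_Ioc] at this
      rw [Real.norm_of_nonneg this.1.le]; exact this.2
    have hmeas : ∀ n : ι → ℤ, IntegrableOn (fun x => expDot (-intVec m) x * f (x + intVec n))
        (unitCube 0) := fun n =>
      IntegrableOn.of_bound hvol
        (((continuous_expDot _).mul (hc.comp (continuous_add_const _))).aestronglyMeasurable)
        (C * (1 + 1) ^ r * ((1 + ‖intVec n‖) ^ r)⁻¹)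
        ((ae_restrict_iff' (measurableSet_unitCube 0)).2 (Filter.Eventually.of_forall (hbd n)))
    have h3 := hasSum_integral_of_summable_integral_norm (μ := volume.restrict (unitCube 0))
      (F := fun (n : ι → ℤ) x => expDot (-intVec m) x * f (x + intVec n)) hmeas (by
        refine Summable.of_nonneg_of_le (fun n => integral_nonneg fun x => norm_nonneg _) (fun n => ?_)
          (((summable_one_add_norm_pow_inv r hr).mul_left (C * (1 + 1) ^ r)).mul_right
            (volume.real (unitCube (0 : ι → ℤ))))
        have := norm_setIntegral_le_of_norm_le_const (μ := volume) hvol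
          (f := fun x => ‖expDot (-intVec m) x * f (x + intVec n)‖) (C := C * (1 + 1) ^ r * ((1 + ‖intVec n‖) ^ r)⁻¹)
          (fun x hx => by rw [norm_norm]; exact hbd n x hx)
        exact (le_abs_self _).trans this)
    rw [h1.unique h3]
    refine setIntegral_congr_fun (measurableSet_unitCube 0) fun x _ => ?_
    simp only [mFourier_eq_expDot, hG, hneg, smul_eq_mul, periodize]
    rw [tsum_mul_left]
  have hsum : Summable (UnitAddTorus.mFourierCoeff G) := by
    rw [show UnitAddTorus.mFourierCoeff G = _ from funext hcoef]; exact hF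
  have := UnitAddTorus.hasSum_mFourier_series_apply_of_summable hsum (fun i => (s i : UnitAddCircle))
  simpa only [hcoef, mFourier_eq_expDot, hG, smul_eq_mul, periodize] using this

end Poisson

/-! ## Fourier transforms of polynomials times Gaussians -/

section PolyGauss

set_option linter.unusedSectionVars false

open MeasureTheory MvPolynomial

variable {σ : Type*} [Fintype σ]

/-- A real vector as a complex vector. -/
def toCVec (x : σ → ℝ) : σ → ℂ := fun p => x p

/-- `exp(πi ∑ z_p x_p²)`. -/
def gaussC (z : σ → ℂ) (x : σ → ℝ) : ℂ :=
  Complex.exp (Real.pi * Complex.I * ∑ p, z p * (x p : ℂ) ^ 2)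

/-- The product of the polynomial function `P` and a Gaussian. -/
def polyGauss (z : σ → ℂ) (P : MvPolynomial σ ℂ) (x : σ → ℝ) : ℂ :=
  eval (toCVec x) P * gaussC z x

lemma continuous_eval_toCVec (P : MvPolynomial σ ℂ) :
    Continuous fun x : σ → ℝ => eval (toCVec x) P :=
  (MvPolynomial.continuous_eval P).comp (by unfold toCVec; fun_prop)

lemma continuous_gaussC (z : σ → ℂ) : Continuous (gaussC z) := by
  unfold gaussC; fun_prop

lemma continuous_polyGauss (z : σ → ℂ) (P : MvPolynomial σ ℂ) : Continuous (polyGauss z P) :=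
  (continuous_eval_toCVec P).mul (continuous_gaussC z)

lemma norm_gaussC (z : σ → ℂ) (x : σ → ℝ) :
    ‖gaussC z x‖ = Real.exp (-(Real.pi * ∑ p, (z p).im * x p ^ 2)) := by
  rw [gaussC, Complex.norm_exp]
  congr 1
  have : ∀ p, (z p * (x p : ℂ) ^ 2).im = (z p).im * x p ^ 2 := fun p => by
    rw [← Complex.ofReal_pow, Complex.im_mul_ofReal]
  rw [mul_assoc, Complex.re_ofReal_mul, Complex.I_mul_re, Complex.im_sum]
  simp only [this]; ring

lemma exists_norm_eval_le (P : MvPolynomial σ ℂ) :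
    ∃ (C : ℝ) (d : ℕ), 0 ≤ C ∧ ∀ x : σ → ℝ, ‖eval (toCVec x) P‖ ≤ C * (1 + ‖x‖) ^ d := by
  induction P using MvPolynomial.induction_on with
  | C a => exact ⟨‖a‖, 0, norm_nonneg _, fun x => by simp⟩
  | add P Q hP hQ =>
    obtain ⟨C, d, hC, h⟩ := hP
    obtain ⟨C', d', hC', h'⟩ := hQ
    refine ⟨C + C', d + d', by positivity, fun x => ?_⟩
    have h1 : (1 : ℝ) ≤ 1 + ‖x‖ := by linarith [norm_nonneg x]
    have e1 := pow_le_pow_right₀ h1 (Nat.le_add_right d d')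
    have e2 := pow_le_pow_right₀ h1 (Nat.le_add_left d' d)
    rw [map_add]
    refine (norm_add_le _ _).trans ?_
    rw [add_mul]
    exact add_le_add ((h x).trans (by gcongr)) ((h' x).trans (by gcongr))
  | mul_X P p hP =>
    obtain ⟨C, d, hC, h⟩ := hP
    refine ⟨C, d + 1, hC, fun x => ?_⟩
    rw [map_mul, norm_mul, eval_X, pow_succ, ← mul_assoc]
    have : ‖toCVec x p‖ ≤ 1 + ‖x‖ := by
      have := norm_le_pi_norm x p
      simp only [toCVec, Complex.norm_real]; linarith
    gcongr
    exact h x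

/-- With `ε` the least of the `π Im z_p`, the Gaussian is at most `exp(-ε ‖x‖²)` in the sup norm.
The power is absorbed by `(1 + ‖x‖)^M ≤ 2^M (1 + ‖x‖²)^M` and one term of the exponential series at
`ε (1 + ‖x‖²)`, which accounts for the constant. -/
lemma exists_norm_gaussC_le {z : σ → ℂ} (hz : ∀ p, 0 < (z p).im) (M : ℕ) :
    ∃ C : ℝ, ∀ x : σ → ℝ, (1 + ‖x‖) ^ M * ‖gaussC z x‖ ≤ C := by
  obtain ⟨ε, hε, hε'⟩ : ∃ ε : ℝ, 0 < ε ∧ ∀ p, ε ≤ Real.pi * (z p).im := by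
    rcases isEmpty_or_nonempty σ with h | h
    · exact ⟨1, one_pos, fun p => h.elim p⟩
    · obtain ⟨p, hp⟩ := Finite.exists_min fun p => Real.pi * (z p).im
      exact ⟨_, mul_pos Real.pi_pos (hz p), hp⟩
  refine ⟨2 ^ M * (M.factorial * (ε ^ M)⁻¹ * Real.exp ε), fun x => ?_⟩
  have h1 : ‖gaussC z x‖ ≤ Real.exp (-(ε * ‖x‖ ^ 2)) := by
    rw [norm_gaussC, Real.exp_le_exp, neg_le_neg_iff]
    have h2 : ‖x‖ ^ 2 ≤ ∑ p, x p ^ 2 := by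
      have : ‖x‖ ≤ Real.sqrt (∑ p, x p ^ 2) := by
        rw [pi_norm_le_iff_of_nonneg (Real.sqrt_nonneg _)]
        intro p
        rw [Real.norm_eq_abs, ← Real.sqrt_sq_eq_abs]
        exact Real.sqrt_le_sqrt (Finset.single_le_sum (f := fun p => x p ^ 2)
          (fun _ _ => sq_nonneg _) (Finset.mem_univ p))
      calc ‖x‖ ^ 2 ≤ (Real.sqrt (∑ p, x p ^ 2)) ^ 2 := by gcongr
        _ = _ := Real.sq_sqrt (Finset.sum_nonneg fun _ _ => sq_nonneg _)
    calc ε * ‖x‖ ^ 2 ≤ ε * ∑ p, x p ^ 2 := by gcongr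
      _ ≤ Real.pi * ∑ p, (z p).im * x p ^ 2 := by
        rw [Finset.mul_sum, Finset.mul_sum]
        refine Finset.sum_le_sum fun p _ => ?_
        rw [← mul_assoc]
        exact mul_le_mul_of_nonneg_right (hε' p) (sq_nonneg _)
  have h3 : (1 + ‖x‖) ^ M ≤ 2 ^ M * (1 + ‖x‖ ^ 2) ^ M := by
    rw [← mul_pow]
    refine pow_le_pow_left₀ (by positivity) ?_ M
    nlinarith [sq_nonneg (‖x‖ - 1)]
  have h4 : (1 + ‖x‖ ^ 2) ^ M ≤ M.factorial * (ε ^ M)⁻¹ * Real.exp (ε * (1 + ‖x‖ ^ 2)) := by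
    have := Real.pow_div_factorial_le_exp (ε * (1 + ‖x‖ ^ 2)) (by positivity) M
    rw [div_le_iff₀ (by positivity), mul_pow] at this
    rw [mul_assoc, mul_comm, mul_assoc, ← div_eq_inv_mul, le_div_iff₀ (by positivity)]
    linarith
  calc (1 + ‖x‖) ^ M * ‖gaussC z x‖
      ≤ (2 ^ M * (M.factorial * (ε ^ M)⁻¹ * Real.exp (ε * (1 + ‖x‖ ^ 2)))) *
        Real.exp (-(ε * ‖x‖ ^ 2)) := by
        refine mul_le_mul (h3.trans ?_) h1 (norm_nonneg _) (by positivity)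
        gcongr
    _ = 2 ^ M * (M.factorial * (ε ^ M)⁻¹ * Real.exp ε) := by
        rw [mul_assoc, mul_assoc (_ * _), ← Real.exp_add]
        ring_nf

lemma exists_norm_polyGauss_le {z : σ → ℂ} (hz : ∀ p, 0 < (z p).im) (P : MvPolynomial σ ℂ)
    (r : ℕ) : ∃ C : ℝ, ∀ x, ‖polyGauss z P x‖ ≤ C * ((1 + ‖x‖) ^ r)⁻¹ := by
  obtain ⟨C, d, hC, h⟩ := exists_norm_eval_le P
  obtain ⟨C', h'⟩ := exists_norm_gaussC_le hz (d + r)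
  refine ⟨C * C', fun x => ?_⟩
  rw [← div_eq_mul_inv, le_div_iff₀ (by positivity), polyGauss, norm_mul]
  calc ‖eval (toCVec x) P‖ * ‖gaussC z x‖ * (1 + ‖x‖) ^ r
      ≤ C * (1 + ‖x‖) ^ d * ‖gaussC z x‖ * (1 + ‖x‖) ^ r := by gcongr; exact h x
    _ = C * ((1 + ‖x‖) ^ (d + r) * ‖gaussC z x‖) := by ring
    _ ≤ C * C' := by gcongr; exact h' x

lemma integrable_polyGauss {z : σ → ℂ} (hz : ∀ p, 0 < (z p).im) (P : MvPolynomial σ ℂ) :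
    Integrable (polyGauss z P) := by
  obtain ⟨C, h⟩ := exists_norm_polyGauss_le hz P (Fintype.card σ + 1)
  have h1 : Integrable fun x : σ → ℝ => C * ((1 + ‖x‖) ^ (Fintype.card σ + 1))⁻¹ := by
    have := (integrable_one_add_norm (E := σ → ℝ) (μ := volume)
      (r := ((Fintype.card σ + 1 : ℕ) : ℝ)) (by simp)).const_mul C
    refine this.congr (Filter.Eventually.of_forall fun x => ?_)
    simp only [Real.rpow_neg (by positivity : (0:ℝ) ≤ 1 + ‖x‖), Real.rpow_natCast]
  exact h1.mono' (continuous_polyGauss z P).aestronglyMeasurable (Filter.Eventually.of_forall h)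

/-- `∏ (-i z_p)^{1/2}`. -/
def rootFactor (z : σ → ℂ) : ℂ := ∏ p, (-Complex.I * z p) ^ (1 / 2 : ℂ)

lemma rootFactor_ne_zero {z : σ → ℂ} (hz : ∀ p, 0 < (z p).im) : rootFactor z ≠ 0 := by
  refine Finset.prod_ne_zero_iff.2 fun p _ => ?_
  rw [Complex.cpow_ne_zero_iff]
  left
  intro h
  have := hz p
  rcases mul_eq_zero.1 h with h | h
  · simp at h
  · simp [h] at this

lemma integral_expDot_gaussC {z : σ → ℂ} (hz : ∀ p, 0 < (z p).im) (ξ : σ → ℝ) :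
    ∫ x, expDot (-ξ) x * gaussC z x = (rootFactor z)⁻¹ * gaussC (fun p => -(z p)⁻¹) ξ := by
  have hz0 : ∀ p, z p ≠ 0 := fun p h => by have := hz p; simp [h] at this
  have hb : ∀ p, 0 < (-Real.pi * Complex.I * z p).re := fun p => by
    have := hz p
    simp only [neg_mul, Complex.neg_re, Complex.mul_re, Complex.mul_im, Complex.ofReal_re,
      Complex.ofReal_im, Complex.I_re, Complex.I_im]
    simp
    exact mul_pos Real.pi_pos this
  have h := GaussianFourier.integral_cexp_neg_sum_mul_add hb (fun p => -2 * Real.pi * Complex.I * ξ p)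
  have e : ∀ x : σ → ℝ, expDot (-ξ) x * gaussC z x =
      Complex.exp (-∑ i, -Real.pi * Complex.I * z i * (x i : ℂ) ^ 2 +
        ∑ i, -2 * Real.pi * Complex.I * ξ i * x i) := by
    intro x
    rw [expDot, gaussC, ← Complex.exp_add, Finset.mul_sum, Finset.mul_sum, add_comm,
      ← Finset.sum_neg_distrib]
    congr 2
    · exact Finset.sum_congr rfl fun i _ => by ring
    · exact Finset.sum_congr rfl fun i _ => by simp; ring
  simp_rw [e]
  rw [h, Finset.prod_mul_distrib, ← Complex.exp_sum, gaussC, rootFactor, Finset.mul_sum,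
    ← Finset.prod_inv_distrib]
  congr 1
  · refine Finset.prod_congr rfl fun p _ => ?_
    -- The principal square root commutes with inversion here because `-i z_p` lies in the right
    -- half plane, away from the cut.
    rw [← Complex.inv_cpow]
    · congr 1
      have := hz0 p
      have := Real.pi_ne_zero
      field_simp
    · have : 0 < (-Complex.I * z p).re := by simpa using hz p
      intro h
      rw [Complex.arg_eq_pi_iff] at h
      linarith [h.1]
  · congr 1
    refine Finset.sum_congr rfl fun p _ => ?_
    have := hz0 p
    have := Real.pi_ne_zero
    field_simp
    ring_nf

/-- Abstract characterization of the operator on polynomials by which the Fourier transform acts on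
polynomials times Gaussians. -/
def IsHermiteMap (z : σ → ℂ) (U : MvPolynomial σ ℂ →ₗ[ℂ] MvPolynomial σ ℂ) : Prop :=
  U 1 = 1 ∧ ∀ p Q, U (X p * Q) = C (z p)⁻¹ * (X p * U Q) +
    C (Complex.I / (2 * Real.pi)) * pderiv p (U Q)

/-- The commutator of two derivations is a derivation, and it kills every variable. -/
lemma pderiv_comm' (p q : σ) (Q : MvPolynomial σ ℂ) :
    pderiv p (pderiv q Q) = pderiv q (pderiv p Q) := by
  classical
  have : ⁅(pderiv p : Derivation ℂ (MvPolynomial σ ℂ) (MvPolynomial σ ℂ)),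
      (pderiv q : Derivation ℂ (MvPolynomial σ ℂ) (MvPolynomial σ ℂ))⁆ = 0 := by
    refine MvPolynomial.derivation_ext fun i => ?_
    rw [Derivation.commutator_apply, pderiv_X, pderiv_X]
    rcases eq_or_ne i p with rfl | h1 <;> rcases eq_or_ne i q with rfl | h2 <;> simp [*]
  have h := DFunLike.congr_fun this Q
  rw [Derivation.commutator_apply] at h
  exact sub_eq_zero.1 h

-- Pairwise commuting elements generate a commutative subalgebra, on which the evaluation of
-- polynomials is available although `A` itself is not commutative.
open scoped IsMulCommutative in
lemma exists_algHom_of_commute {A : Type*} [Ring A] [Algebra ℂ A] (d : σ → A)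
    (hcomm : ∀ p q, d p * d q = d q * d p) :
    ∃ f : MvPolynomial σ ℂ →ₐ[ℂ] A, ∀ p, f (X p) = d p := by
  have hS : IsMulCommutative (Algebra.adjoin ℂ (Set.range d)) :=
    Algebra.isMulCommutative_adjoin ℂ (by rintro _ ⟨p, rfl⟩ _ ⟨q, rfl⟩; exact hcomm p q)
  let v : σ → Algebra.adjoin ℂ (Set.range d) := fun p => ⟨d p, Algebra.subset_adjoin ⟨p, rfl⟩⟩
  refine ⟨(Algebra.adjoin ℂ (Set.range d)).val.comp
    (aeval (S₁ := Algebra.adjoin ℂ (Set.range d)) v), fun p => ?_⟩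
  rw [AlgHom.comp_apply, aeval_X]
  rfl

/-- The recursion says that multiplication by `X_p` is turned into the operator `z_p⁻¹ X_p + (i/2π)
∂_p`. These operators commute with each other, so a polynomial can be evaluated in them; `U Q` is
the result applied to `1`. -/
lemma exists_isHermiteMap (z : σ → ℂ) : ∃ U, IsHermiteMap z U := by
  classical
  obtain ⟨d, hd⟩ : ∃ d : σ → Module.End ℂ (MvPolynomial σ ℂ), ∀ p Q,
      d p Q = C (z p)⁻¹ * (X p * Q) + C (Complex.I / (2 * Real.pi)) * pderiv p Q :=
    ⟨fun p => (z p)⁻¹ • LinearMap.mulLeft ℂ (X p) + (Complex.I / (2 * Real.pi)) •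
      ((pderiv p : Derivation ℂ (MvPolynomial σ ℂ) (MvPolynomial σ ℂ)) :
        MvPolynomial σ ℂ →ₗ[ℂ] MvPolynomial σ ℂ), fun p Q => by
      rw [LinearMap.add_apply, LinearMap.smul_apply, LinearMap.smul_apply, MvPolynomial.smul_eq_C_mul,
        MvPolynomial.smul_eq_C_mul]
      rfl⟩
  have hcomm : ∀ p q, d p * d q = d q * d p := by
    intro p q
    rcases eq_or_ne p q with rfl | hpq
    · rfl
    refine LinearMap.ext fun Q => ?_
    have e1 : pderiv p (X q : MvPolynomial σ ℂ) = 0 := pderiv_X_of_ne hpq.symm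
    have e2 : pderiv q (X p : MvPolynomial σ ℂ) = 0 := pderiv_X_of_ne hpq
    have e3 : pderiv p (pderiv q Q) = pderiv q (pderiv p Q) := pderiv_comm' p q Q
    simp only [Module.End.mul_apply, hd, map_add, Derivation.leibniz, smul_eq_mul, pderiv_C, e1, e2, e3]
    ring
  obtain ⟨f, hf⟩ := exists_algHom_of_commute d hcomm
  refine ⟨(LinearMap.applyₗ (1 : MvPolynomial σ ℂ)).comp f.toLinearMap, ?_, ?_⟩
  · change (f 1) 1 = 1
    rw [map_one f]; rfl
  · intro p Q
    change (f (X p * Q)) 1 = _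
    rw [map_mul, hf, Module.End.mul_apply, hd]
    rfl

end PolyGauss

/-! ### Harmonic polynomials under the Fourier transform -/

section HermiteMap

open MeasureTheory MvPolynomial

set_option linter.unusedSectionVars false

variable {σ : Type*} [Fintype σ]

lemma hasDerivAt_eval_line [DecidableEq σ] (ξ : σ → ℝ) (p : σ) (Q : MvPolynomial σ ℂ) (t : ℝ) :
    HasDerivAt (fun t : ℝ => eval (toCVec (ξ + t • Pi.single p 1)) Q)
      (eval (toCVec (ξ + t • Pi.single p 1)) (pderiv p Q)) t := by
  induction Q using MvPolynomial.induction_on with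
  | C a => simpa using hasDerivAt_const t a
  | add P Q hP hQ =>
    simp only [map_add]
    exact hP.add hQ
  | mul_X P q hP =>
    have hX : HasDerivAt (fun t : ℝ => toCVec (ξ + t • Pi.single p 1) q)
        (eval (toCVec (ξ + t • Pi.single p 1)) (pderiv p (X q : MvPolynomial σ ℂ))) t := by
      rw [pderiv_X]
      rcases eq_or_ne q p with rfl | h
      · have : HasDerivAt (fun t : ℝ => ((ξ q + t : ℝ) : ℂ)) ((1 : ℝ) : ℂ) t :=
          ((hasDerivAt_id t).const_add (ξ q)).ofReal_comp
        simpa [toCVec] using this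
      · simpa [toCVec, h] using hasDerivAt_const t ((ξ q : ℝ) : ℂ)
    have := hP.mul hX
    simp only [map_mul, eval_X, pderiv_mul, map_add]
    exact this

lemma hasDerivAt_gaussC_line [DecidableEq σ] (z : σ → ℂ) (ξ : σ → ℝ) (p : σ) (t : ℝ) :
    HasDerivAt (fun t : ℝ => gaussC z (ξ + t • Pi.single p 1))
      (gaussC z (ξ + t • Pi.single p 1) * (2 * Real.pi * Complex.I * z p *
        toCVec (ξ + t • Pi.single p 1) p)) t := by
  have h := (hasDerivAt_eval_line ξ p (∑ q, C (z q) * X q ^ 2) t).const_mul (Real.pi * Complex.I)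
  have h2 := h.cexp
  have e : ∀ x : σ → ℝ, eval (toCVec x) (∑ q, C (z q) * X q ^ 2) = ∑ q, z q * (x q : ℂ) ^ 2 :=
    fun x => by simp [toCVec]
  have e2 : pderiv p (∑ q, C (z q) * X q ^ 2) = C (z p) * (2 * X p) := by
    rw [map_sum, Finset.sum_eq_single p]
    · rw [pderiv_C_mul, pderiv_pow, pderiv_X_self]; simp
    · intro q _ hq
      rw [pderiv_C_mul, pderiv_pow, pderiv_X_of_ne hq]; simp
    · simp
  rw [e2] at h2
  simp only [e] at h2
  refine h2.congr_deriv ?_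
  simp [gaussC]
  ring

/-- The Fourier transform of a polynomial times a Gaussian. -/
lemma integral_expDot_polyGauss {z : σ → ℂ} (hz : ∀ p, 0 < (z p).im)
    {U : MvPolynomial σ ℂ →ₗ[ℂ] MvPolynomial σ ℂ} (hU : IsHermiteMap z U) (P : MvPolynomial σ ℂ)
    (ξ : σ → ℝ) :
    ∫ x, expDot (-ξ) x * polyGauss z P x =
      (rootFactor z)⁻¹ * polyGauss (fun p => -(z p)⁻¹) (U P) ξ := by
  classical
  have hz0 : ∀ p, z p ≠ 0 := fun p h => by have := hz p; simp [h] at this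
  induction P using MvPolynomial.induction_on generalizing ξ with
  | C a =>
    have e : U (C a) = C a := by
      have : (C a : MvPolynomial σ ℂ) = a • 1 := by rw [MvPolynomial.smul_eq_C_mul, mul_one]
      rw [this, map_smul, hU.1]
    rw [e]
    simp only [polyGauss, eval_C]
    have : ∀ x, expDot (-ξ) x * (a * gaussC z x) = a * (expDot (-ξ) x * gaussC z x) :=
      fun x => by ring
    simp_rw [this]
    rw [integral_const_mul, integral_expDot_gaussC hz]
    ring
  | add P Q hP hQ =>
    have hint : ∀ P : MvPolynomial σ ℂ, Integrable fun x => expDot (-ξ) x * polyGauss z P x :=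
      fun P => (integrable_polyGauss hz P).mono
        (((continuous_expDot _).mul (continuous_polyGauss z P)).aestronglyMeasurable)
        (Filter.Eventually.of_forall fun x => by rw [norm_mul, norm_expDot, one_mul])
    have e : ∀ (w : σ → ℂ) P Q x, polyGauss w (P + Q) x = polyGauss w P x + polyGauss w Q x := by
      intros; simp [polyGauss, add_mul]
    simp only [e, mul_add, map_add]
    rw [integral_add (hint P) (hint Q), hP, hQ]
  | mul_X P p hP =>
    -- An extra factor `x_p` in the integrand comes from differentiating in `ξ_p`. The induction
    -- hypothesis, valid for all frequencies, is differentiated at `t = 0` along the `p`-th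
    -- coordinate line through `ξ`; the recursion for `U` is what the right side produces.
    let ξt : ℝ → σ → ℝ := fun t => ξ + t • Pi.single p 1
    have hexp : ∀ t x, HasDerivAt (fun t => expDot (-ξt t) x)
        (expDot (-ξt t) x * (-(2 * Real.pi * Complex.I * x p))) t := by
      intro t x
      have h1 : HasDerivAt (fun t : ℝ => (2 * Real.pi * Complex.I * ∑ i, (((-ξt t) i : ℝ) : ℂ) * x i))
          (-(2 * Real.pi * Complex.I * x p)) t := by
        have h2 := (hasDerivAt_eval_line ξ p (∑ i, X i * C (x i : ℂ)) t).const_mul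
          (-(2 * Real.pi * Complex.I))
        have e2 : pderiv p (∑ i, X i * C (x i : ℂ)) = C (x p : ℂ) := by
          rw [map_sum, Finset.sum_eq_single p]
          · rw [mul_comm, pderiv_C_mul, pderiv_X_self]; simp
          · intro q _ hq
            rw [mul_comm, pderiv_C_mul, pderiv_X_of_ne hq]; simp
          · simp
        rw [e2] at h2
        refine (h2.congr_deriv (by simp)).congr_of_eventuallyEq (Filter.Eventually.of_forall fun t => ?_)
        simp only [ξt, toCVec, map_sum, map_mul, eval_X, eval_C, Pi.neg_apply, Complex.ofReal_neg, neg_mul,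
          Finset.sum_neg_distrib, mul_neg]
      exact h1.cexp
    have hl := hasDerivAt_integral_of_dominated_loc_of_deriv_le (μ := volume)
      (F := fun t x => expDot (-ξt t) x * polyGauss z P x)
      (F' := fun t x => expDot (-ξt t) x * (-(2 * Real.pi * Complex.I * x p)) * polyGauss z P x)
      (x₀ := 0) (s := Set.univ) (bound := fun x => 2 * Real.pi * ‖polyGauss z (P * X p) x‖)
      Filter.univ_mem
      (Filter.Eventually.of_forall fun t =>
        ((continuous_expDot _).mul (continuous_polyGauss z P)).aestronglyMeasurable)
      ((integrable_polyGauss hz P).mono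
        (((continuous_expDot _).mul (continuous_polyGauss z P)).aestronglyMeasurable)
        (Filter.Eventually.of_forall fun x => by rw [norm_mul, norm_expDot, one_mul]))
      (by
        refine Continuous.aestronglyMeasurable ?_
        have := continuous_expDot (-ξt 0)
        have := continuous_polyGauss z P
        fun_prop)
      (Filter.Eventually.of_forall fun x t _ => by
        rw [norm_mul, norm_mul, norm_expDot, polyGauss, polyGauss, map_mul, eval_X, norm_mul, norm_mul,
          norm_mul]
        simp [toCVec, abs_of_pos Real.pi_pos]
        apply le_of_eq; ring)
      ((integrable_polyGauss hz _).norm.const_mul _)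
      (Filter.Eventually.of_forall fun x t _ => (hexp t x).mul_const _)
    have hr := (((hasDerivAt_eval_line ξ p (U P) 0).mul
      (hasDerivAt_gaussC_line (fun p => -(z p)⁻¹) ξ p 0)).const_mul (rootFactor z)⁻¹)
    have heq : (fun t => ∫ x, expDot (-ξt t) x * polyGauss z P x) = fun t =>
        (rootFactor z)⁻¹ * polyGauss (fun p => -(z p)⁻¹) (U P) (ξt t) := funext fun t => hP (ξt t)
    have h3 := hl.2
    rw [heq] at h3
    have h4 := h3.unique hr
    have h0 : ξt 0 = ξ := by simp [ξt]
    have h0' : ξ + (0 : ℝ) • Pi.single p (1 : ℝ) = ξ := by simp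
    rw [h0'] at h4
    rw [h0] at h4
    have e1 : ∀ x, expDot (-ξ) x * (-(2 * Real.pi * Complex.I * x p)) * polyGauss z P x =
        (-(2 * Real.pi * Complex.I)) * (expDot (-ξ) x * polyGauss z (P * X p) x) := by
      intro x
      simp only [polyGauss, map_mul, eval_X, toCVec]
      ring
    simp_rw [e1] at h4
    rw [integral_const_mul] at h4
    have hpi : (2 * Real.pi * Complex.I : ℂ) ≠ 0 := Complex.two_pi_I_ne_zero
    have hpi' : (Real.pi : ℂ) ≠ 0 := by exact_mod_cast Real.pi_ne_zero
    refine mul_left_cancel₀ (neg_ne_zero.2 hpi) (h4.trans ?_)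
    rw [mul_comm P, hU.2]
    simp only [polyGauss, map_add, map_mul, eval_C, eval_X]
    field_simp
    ring_nf
    simp only [Complex.I_sq]
    ring

/-- `∂_p` has commutator `z_p⁻¹` with the operator attached to `X_p` and commutes with those of the
other variables, so induction over the variables applies. Through this relation harmonicity of `P`
controls the derivative terms of `U P`. -/
lemma IsHermiteMap.pderiv {z : σ → ℂ} {U : MvPolynomial σ ℂ →ₗ[ℂ] MvPolynomial σ ℂ}
    (hU : IsHermiteMap z U) (p : σ) (P : MvPolynomial σ ℂ) :
    U (pderiv p P) * C (z p)⁻¹ = pderiv p (U P) := by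
  classical
  induction P using MvPolynomial.induction_on with
  | C a =>
    have e : U (C a) = C a := by
      have : (C a : MvPolynomial σ ℂ) = a • 1 := by rw [MvPolynomial.smul_eq_C_mul, mul_one]
      rw [this, map_smul, hU.1]
    simp [e]
  | add P Q hP hQ => simp only [map_add, add_mul, hP, hQ]
  | mul_X P q hP =>
    rw [mul_comm P, pderiv_mul, map_add, hU.2, hU.2, add_mul, add_mul, map_add, pderiv_C_mul,
      pderiv_C_mul, pderiv_mul, pderiv_comm' p q (U P), ← hP]
    rcases eq_or_ne q p with rfl | h
    · rw [pderiv_X_self, one_mul, one_mul]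
      rw [pderiv_mul, pderiv_C]
      ring
    · rw [pderiv_X_of_ne h, zero_mul, zero_mul, map_zero, pderiv_mul, pderiv_C]
      ring

/-- Polynomials of multidegree `k` that are harmonic in each block of variables. -/
def IsMultiHarmonic {T : Type*} {n : ℕ} (k : T → ℕ) (P : MvPolynomial (T × Fin n) ℂ) : Prop :=
  (∀ m ∈ P.support, ∀ τ, ∑ l, m (τ, l) = k τ) ∧
    ∀ τ, ∑ l, MvPolynomial.pderiv (τ, l) (MvPolynomial.pderiv (τ, l) P) = 0

lemma coeff_X_mul_pderiv (p : σ) (Q : MvPolynomial σ ℂ) (m : σ →₀ ℕ) :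
    coeff m (X p * MvPolynomial.pderiv p Q) = m p * coeff m Q := by
  classical
  induction Q using MvPolynomial.induction_on' with
  | add P Q hP hQ => simp only [map_add, mul_add, coeff_add, hP, hQ]
  | monomial s a =>
    rw [pderiv_monomial, X, monomial_mul, coeff_monomial, coeff_monomial, one_mul]
    rcases Nat.eq_zero_or_pos (s p) with h | h
    · rw [h]
      rcases eq_or_ne s m with rfl | hm
      · simp [h]
      · simp [hm]
    · have : Finsupp.single p 1 + (s - Finsupp.single p 1) = s := by
        rw [add_comm, tsub_add_cancel_of_le]
        simpa using Nat.succ_le_of_lt h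
      rw [this]
      rcases eq_or_ne s m with rfl | hm
      · simp [mul_comm]
      · simp [hm]

/-- The derivative part of each operator lowers the degree. In degrees at least that of the monomial
only the multiplications by `z_p⁻¹ X_p` survive. -/
lemma IsHermiteMap.coeff_eq {z : σ → ℂ} {U : MvPolynomial σ ℂ →ₗ[ℂ] MvPolynomial σ ℂ}
    (hU : IsHermiteMap z U) (s : σ →₀ ℕ) (m : σ →₀ ℕ) (hm : s.degree ≤ m.degree) :
    coeff m (U (monomial s 1)) = if s = m then ∏ p, (z p)⁻¹ ^ s p else 0 := by
  classical
  induction hn : s.degree generalizing s m with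
  | zero =>
    have hs : s = 0 := (Finsupp.degree_eq_zero_iff s).1 hn
    subst hs
    have : (monomial (0 : σ →₀ ℕ) (1 : ℂ)) = 1 := rfl
    rw [this, hU.1, coeff_one]
    simp
  | succ d ih =>
    obtain ⟨p, hp⟩ : ∃ p, 0 < s p := by
      by_contra! h
      have : s = 0 := Finsupp.ext fun p => Nat.le_zero.1 (h p)
      rw [this] at hn
      simp at hn
    obtain ⟨t, rfl⟩ : ∃ t, s = Finsupp.single p 1 + t :=
      ⟨s - Finsupp.single p 1, by
        rw [add_comm, tsub_add_cancel_of_le]; simpa using Nat.succ_le_of_lt hp⟩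
    have hdeg : ∀ m : σ →₀ ℕ, (Finsupp.single p 1 + m).degree = m.degree + 1 := fun m => by
      rw [map_add, Finsupp.degree_single, add_comm]
    have ht : t.degree = d := by rw [hdeg] at hn; omega
    have e : (monomial (Finsupp.single p 1 + t) (1 : ℂ)) = X p * monomial t 1 := by
      rw [X, monomial_mul, one_mul]
    rw [hdeg] at hm
    have hz : coeff m (MvPolynomial.pderiv p (U (monomial t 1))) = 0 := by
      have h1 := coeff_X_mul_pderiv p (U (monomial t 1)) (Finsupp.single p 1 + m)
      rw [coeff_X_mul, ih t _ (by rw [hdeg]; omega) ht, if_neg, mul_zero] at h1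
      · exact h1
      · intro h
        have := congrArg Finsupp.degree h
        rw [hdeg] at this; omega
    rw [e, hU.2, coeff_add, coeff_C_mul, coeff_C_mul, hz, mul_zero, add_zero, coeff_X_mul']
    by_cases hpm : p ∈ m.support
    · rw [if_pos hpm]
      obtain ⟨m', rfl⟩ : ∃ m', m = Finsupp.single p 1 + m' :=
        ⟨m - Finsupp.single p 1, by
          rw [add_comm, tsub_add_cancel_of_le]
          simpa [Nat.one_le_iff_ne_zero] using hpm⟩
      rw [hdeg] at hm
      rw [add_tsub_cancel_left, ih t m' (by omega) ht]
      simp only [add_right_inj]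
      split_ifs with h
      · have hsplit : ∀ i, (z i)⁻¹ ^ (Finsupp.single p 1 + t : σ →₀ ℕ) i =
            (if i = p then (z p)⁻¹ else 1) * (z i)⁻¹ ^ t i := by
          intro i
          rcases eq_or_ne i p with rfl | hi
          · simp [pow_add]
          · simp [hi]
        simp only [hsplit, Finset.prod_mul_distrib, Finset.prod_ite_eq', Finset.mem_univ, if_true]
      · simp
    · rw [if_neg hpm, mul_zero, if_neg]
      rintro rfl
      apply hpm
      simp

/-- Applying `U` to Euler's identity in a block of variables, the derivative terms add up to the
Laplacian of that block, which vanishes on `P`. So `U P` satisfies the same Euler identities and has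
the same multidegree as `P`; by `IsHermiteMap.coeff_eq` its coefficients in that degree are those of
`P` times a scalar. This is why a harmonic polynomial times a Gaussian is reproduced by the Fourier
transform without lower order terms. -/
lemma IsHermiteMap.eq_of_isMultiHarmonic {T : Type*} [Fintype T] {n : ℕ} {z : T → ℂ}
    {U : MvPolynomial (T × Fin n) ℂ →ₗ[ℂ] MvPolynomial (T × Fin n) ℂ}
    (hU : IsHermiteMap (fun p => z p.1) U) {k : T → ℕ} {P : MvPolynomial (T × Fin n) ℂ}
    (hP : IsMultiHarmonic k P) : U P = C (∏ τ, (z τ)⁻¹ ^ k τ) * P := by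
  classical
  have hpd : ∀ p Q, MvPolynomial.pderiv p (U Q) = C (z p.1)⁻¹ * U (MvPolynomial.pderiv p Q) :=
    fun p Q => by rw [← hU.pderiv, mul_comm]
  have hEP : ∀ τ, ∑ l, X (τ, l) * MvPolynomial.pderiv (τ, l) P = C (k τ : ℂ) * P := by
    intro τ
    ext m
    rw [coeff_sum, coeff_C_mul]
    simp only [coeff_X_mul_pderiv]
    rw [← Finset.sum_mul]
    by_cases hm : m ∈ P.support
    · rw [← hP.1 m hm τ]; push_cast; rfl
    · rw [notMem_support_iff.1 hm, mul_zero, mul_zero]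
  have hEU : ∀ τ, ∑ l, X (τ, l) * MvPolynomial.pderiv (τ, l) (U P) = C (k τ : ℂ) * U P := by
    intro τ
    have h1 := congrArg U (hEP τ)
    rw [map_sum, ← MvPolynomial.smul_eq_C_mul, map_smul, MvPolynomial.smul_eq_C_mul] at h1
    rw [← h1]
    simp only [hU.2]
    have h2 : ∑ l, C (Complex.I / (2 * Real.pi)) *
        MvPolynomial.pderiv (τ, l) (U (MvPolynomial.pderiv (τ, l) P)) = 0 := by
      simp only [hpd]
      rw [← Finset.mul_sum, ← Finset.mul_sum, ← map_sum, hP.2 τ]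
      simp
    rw [Finset.sum_add_distrib, h2, add_zero]
    refine Finset.sum_congr rfl fun l _ => ?_
    rw [hpd]; ring
  have hUhom : ∀ m, coeff m (U P) ≠ 0 → ∀ τ, ∑ l, m (τ, l) = k τ := by
    intro m hm τ
    have h1 := congrArg (coeff m) (hEU τ)
    rw [coeff_sum, coeff_C_mul] at h1
    simp only [coeff_X_mul_pderiv] at h1
    rw [← Finset.sum_mul] at h1
    have := mul_right_cancel₀ hm h1
    exact_mod_cast this
  have hdeg : ∀ m : T × Fin n →₀ ℕ, (∀ τ, ∑ l, m (τ, l) = k τ) → m.degree = ∑ τ, k τ := by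
    intro m hm
    rw [Finsupp.degree_eq_sum, Fintype.sum_prod_type]
    exact Finset.sum_congr rfl fun τ _ => hm τ
  ext m
  rw [coeff_C_mul]
  by_cases hm : ∀ τ, ∑ l, m (τ, l) = k τ
  · conv_lhs => rw [P.as_sum, map_sum, coeff_sum]
    have : ∀ s ∈ P.support, coeff m (U (monomial s (coeff s P))) =
        if s = m then (∏ p : T × Fin n, (z p.1)⁻¹ ^ s p) * coeff s P else 0 := by
      intro s hs
      have e : (monomial s (coeff s P)) = coeff s P • monomial s (1 : ℂ) := by
        rw [smul_monomial, smul_eq_mul, mul_one]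
      rw [e, map_smul, coeff_smul, hU.coeff_eq s m (by rw [hdeg m hm, hdeg s (hP.1 s hs)]), smul_eq_mul]
      split_ifs <;> ring
    rw [Finset.sum_congr rfl this, Finset.sum_ite_eq']
    have hprod : (∏ p : T × Fin n, (z p.1)⁻¹ ^ m p) = ∏ τ, (z τ)⁻¹ ^ k τ := by
      rw [Fintype.prod_prod_type]
      refine Finset.prod_congr rfl fun τ _ => ?_
      change ∏ y, (z τ)⁻¹ ^ m (τ, y) = _
      rw [Finset.prod_pow_eq_pow_sum, hm τ]
    split_ifs with h
    · rw [hprod]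
    · rw [notMem_support_iff.1 h, mul_zero]
  · have h1 : coeff m (U P) = 0 := by
      by_contra h; exact hm (hUhom m h)
    have h2 : coeff m P = 0 := by
      by_contra h; exact hm (hP.1 m (mem_support_iff.2 h))
    rw [h1, h2, mul_zero]

end HermiteMap

/-! ## Poisson summation for lattices and harmonic polynomials times Gaussians -/

section LatticePoisson

set_option linter.unusedSectionVars false

open MeasureTheory

variable {σ ι : Type*} [Fintype σ] [Fintype ι] [DecidableEq ι]

/-- Biorthogonal families in `ℝ^σ`. -/
def IsDualPair (b b' : ι → σ → ℝ) : Prop := ∀ i j, ∑ p, b i p * b' j p = if i = j then 1 else 0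

lemma IsDualPair.symm {b b' : ι → σ → ℝ} (h : IsDualPair b b') : IsDualPair b' b := by
  intro i j
  simp only [mul_comm (b' i _)]
  rw [h j i]
  simp only [eq_comm]

/-- The linear combination of a family with given real coefficients. -/
def combo (b : ι → σ → ℝ) : (ι → ℝ) →ₗ[ℝ] (σ → ℝ) where
  toFun t := ∑ i, t i • b i
  map_add' s t := by simp [add_smul, Finset.sum_add_distrib]
  map_smul' c t := by simp [Finset.smul_sum, smul_smul]

lemma combo_apply (b : ι → σ → ℝ) (t : ι → ℝ) (p : σ) : combo b t p = ∑ i, t i * b i p := by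
  simp [combo]

lemma IsDualPair.sum_combo {b b' : ι → σ → ℝ} (h : IsDualPair b b') (t : ι → ℝ) (j : ι) :
    ∑ p, combo b t p * b' j p = t j := by
  simp only [combo_apply, Finset.sum_mul, mul_assoc]
  rw [Finset.sum_comm]
  simp only [← Finset.mul_sum, h _ j]
  simp

/-- The coefficients are recovered by pairing with the dual family, hence bounded by its entries.
The summand `1` in the constant only secures `1 ≤ K`, which is needed to compare `1 + ‖t‖` with `K
(1 + ‖combo b t‖)`. -/
lemma IsDualPair.exists_norm_le {b b' : ι → σ → ℝ} (h : IsDualPair b b') :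
    ∃ K : ℝ, 1 ≤ K ∧ ∀ t, ‖t‖ ≤ K * ‖combo b t‖ := by
  refine ⟨1 + ∑ j, ∑ p, |b' j p|, by
    have : 0 ≤ ∑ j, ∑ p, |b' j p| := Finset.sum_nonneg fun _ _ => Finset.sum_nonneg fun _ _ => abs_nonneg _
    linarith, fun t => ?_⟩
  have hnn : ∀ j, 0 ≤ ∑ p, |b' j p| := fun j => Finset.sum_nonneg fun _ _ => abs_nonneg _
  have hnn' : 0 ≤ ∑ j, ∑ p, |b' j p| := Finset.sum_nonneg fun j _ => hnn j
  rw [pi_norm_le_iff_of_nonneg (by positivity)]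
  intro j
  rw [← h.sum_combo t j]
  calc ‖∑ p, combo b t p * b' j p‖ ≤ ∑ p, ‖combo b t‖ * |b' j p| := by
        refine norm_sum_le_of_le _ fun p _ => ?_
        rw [norm_mul, Real.norm_eq_abs (b' j p)]
        exact mul_le_mul_of_nonneg_right (norm_le_pi_norm _ p) (abs_nonneg _)
    _ = (∑ p, |b' j p|) * ‖combo b t‖ := by rw [← Finset.mul_sum, mul_comm]
    _ ≤ (1 + ∑ j, ∑ p, |b' j p|) * ‖combo b t‖ := by
        gcongr
        have := Finset.single_le_sum (f := fun j => ∑ p, |b' j p|) (fun j _ => hnn j) (Finset.mem_univ j)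
        linarith

lemma IsDualPair.norm_comp_le {b b' : ι → σ → ℝ} (h : IsDualPair b b') {f : (σ → ℝ) → ℂ} {r : ℕ}
    (hf : ∃ C : ℝ, ∀ x, ‖f x‖ ≤ C * ((1 + ‖x‖) ^ r)⁻¹) :
    ∃ C : ℝ, ∀ t, ‖f (combo b t)‖ ≤ C * ((1 + ‖t‖) ^ r)⁻¹ := by
  obtain ⟨C, hC⟩ := hf
  obtain ⟨K, hK1, hK⟩ := h.exists_norm_le
  have hC0 : 0 ≤ C := by simpa using (norm_nonneg _).trans (hC 0)
  refine ⟨C * K ^ r, fun t => (hC _).trans ?_⟩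
  rw [mul_assoc]
  gcongr
  rw [← div_eq_mul_inv, le_div_iff₀ (by positivity), inv_mul_le_iff₀ (by positivity), ← mul_pow]
  gcongr
  nlinarith [hK t, norm_nonneg (combo b t), norm_nonneg t]

lemma IsDualPair.injective {b b' : ι → σ → ℝ} (h : IsDualPair b b') :
    Function.Injective (combo b) := by
  intro s t hst
  ext j
  rw [← h.sum_combo s j, hst, h.sum_combo]

lemma IsDualPair.expDot_combo {b b' : ι → σ → ℝ} (h : IsDualPair b b') (m t : ι → ℝ) :
    expDot (combo b' m) (combo b t) = expDot m t := by
  unfold expDot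
  congr 2
  have : ∑ p, combo b' m p * combo b t p = ∑ j, m j * t j := by
    simp only [combo_apply b', Finset.sum_mul]
    rw [Finset.sum_comm]
    refine Finset.sum_congr rfl fun j _ => ?_
    rw [← h.sum_combo t j, Finset.mul_sum]
    exact Finset.sum_congr rfl fun p _ => by ring
  exact_mod_cast this

/-- The push-forward of Lebesgue measure under a linear isomorphism is a Haar measure, hence a
multiple of Lebesgue measure. The factor is never computed: it cancels when Poisson summation is
used in both directions. -/
lemma IsDualPair.exists_integral_comp {b b' : ι → σ → ℝ} (h : IsDualPair b b')
    (hcard : Fintype.card ι = Fintype.card σ) :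
    ∃ c : ℂ, ∀ g : (σ → ℝ) → ℂ, ∫ t, g (combo b t) = c * ∫ x, g x := by
  let A := (combo b).linearEquivOfInjective h.injective (by simpa using hcard)
  let A' := A.toContinuousLinearEquiv
  let Aₘ : MeasurableEquiv (ι → ℝ) (σ → ℝ) := A'.toHomeomorph.toMeasurableEquiv
  have hA : ∀ t, Aₘ t = combo b t := fun t => by
    change A t = combo b t
    exact LinearMap.linearEquivOfInjective_apply (f := combo b) h.injective _ t
  have : (Measure.map Aₘ volume).IsAddHaarMeasure := A'.isAddHaarMeasure_map volume
  refine ⟨((Measure.addHaarScalarFactor (Measure.map Aₘ volume) volume : ℝ) : ℂ), fun g => ?_⟩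
  have h1 := integral_map_equiv (μ := volume) Aₘ g
  rw [Measure.isAddLeftInvariant_eq_smul (Measure.map Aₘ volume) volume, integral_smul_nnreal_measure] at h1
  simp only [hA] at h1
  rw [← h1]
  rfl

end LatticePoisson

/-! ### Poisson summation with harmonic coefficients -/

section HarmonicPoisson

variable {T ι : Type*} [Fintype T] [Fintype ι] [DecidableEq ι] {n : ℕ}

/-- `∏_τ (-i z_τ)^{1/2}`. -/
def halfRoot (z : T → ℂ) : ℂ := ∏ τ, (-Complex.I * z τ) ^ (1 / 2 : ℂ)

lemma rootFactor_fst (z : T → ℂ) : rootFactor (fun p : T × Fin n => z p.1) = halfRoot z ^ n := by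
  rw [rootFactor, halfRoot, Fintype.prod_prod_type, ← Finset.prod_pow]
  simp

lemma halfRoot_ne_zero {z : T → ℂ} (hz : ∀ τ, 0 < (z τ).im) : halfRoot z ≠ 0 :=
  rootFactor_ne_zero hz

lemma summable_polyGauss_combo {σ : Type*} [Fintype σ] {b b' : ι → σ → ℝ} (h : IsDualPair b b')
    {z : σ → ℂ} (hz : ∀ p, 0 < (z p).im) (P : MvPolynomial σ ℂ) (t : ι → ℝ) :
    Summable fun m : ι → ℤ => polyGauss z P (combo b (t + intVec m)) := by
  obtain ⟨C, hC⟩ := h.norm_comp_le (exists_norm_polyGauss_le hz P (Fintype.card ι + 1))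
  exact summable_periodize (f := fun t => polyGauss z P (combo b t)) (Nat.lt_succ_self _) hC t

/-- The inversion formula for theta series of lattices with harmonic coefficients. -/
theorem exists_hasSum_polyGauss {b b' : ι → (T × Fin n) → ℝ} (h : IsDualPair b b')
    (hcard : Fintype.card ι = Fintype.card (T × Fin n)) :
    ∃ c : ℂ, ∀ (z : T → ℂ) (_ : ∀ τ, 0 < (z τ).im) (k : T → ℕ) (P : MvPolynomial (T × Fin n) ℂ)
      (_ : IsMultiHarmonic k P) (s : T × Fin n → ℝ),
      HasSum (fun m : ι → ℤ => c * (halfRoot z ^ n)⁻¹ * (∏ τ, (z τ)⁻¹ ^ k τ) *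
        (polyGauss (fun p => -(z p.1)⁻¹) P (combo b' (intVec m)) * expDot (combo b' (intVec m)) s))
        (∑' m : ι → ℤ, polyGauss (fun p => z p.1) P (s + combo b (intVec m))) := by
  -- The constant depends on the lattice alone and is fixed before `z`, `k`, `P` and `s`; this
  -- uniformity is what allows its later cancellation.
  obtain ⟨c, hc⟩ := h.exists_integral_comp hcard
  refine ⟨c, fun z hz k P hP s => ?_⟩
  have hz0 : ∀ τ, z τ ≠ 0 := fun τ h => by have := hz τ; simp [h] at this
  have hz' : ∀ p : T × Fin n, 0 < (-(z p.1)⁻¹).im := fun p => by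
    rw [Complex.neg_im, Complex.inv_im, neg_div, neg_neg]
    exact div_pos (hz _) (Complex.normSq_pos.2 (hz0 _))
  obtain ⟨U, hU⟩ := exists_isHermiteMap (fun p : T × Fin n => z p.1)
  have hUP : U P = MvPolynomial.C (∏ τ, (z τ)⁻¹ ^ k τ) * P :=
    hU.eq_of_isMultiHarmonic hP
  have hI := integral_expDot_polyGauss (z := fun p : T × Fin n => z p.1) (fun p => hz p.1) hU P
  obtain ⟨C, hC⟩ := h.norm_comp_le
    (exists_norm_polyGauss_le (z := fun p : T × Fin n => z p.1) (fun p => hz p.1) P (Fintype.card ι + 1))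
  have hcoef : ∀ m : ι → ℤ, ∫ t, expDot (-intVec m) t * polyGauss (fun p : T × Fin n => z p.1) P (combo b t) =
      c * (halfRoot z ^ n)⁻¹ * (∏ τ, (z τ)⁻¹ ^ k τ) *
        polyGauss (fun p => -(z p.1)⁻¹) P (combo b' (intVec m)) := by
    intro m
    have e : ∀ t, expDot (-intVec m) t * polyGauss (fun p : T × Fin n => z p.1) P (combo b t) =
        (fun x => expDot (-combo b' (intVec m)) x * polyGauss (fun p : T × Fin n => z p.1) P x)
          (combo b t) := by
      intro t
      simp only
      rw [← map_neg, h.expDot_combo]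
    simp_rw [e]
    rw [hc (fun x => expDot (-combo b' (intVec m)) x * polyGauss (fun p : T × Fin n => z p.1) P x),
      hI, rootFactor_fst, hUP]
    simp only [polyGauss, map_mul, MvPolynomial.eval_C]
    ring
  obtain ⟨t, rfl⟩ : ∃ t, combo b t = s := by
    have := LinearMap.injective_iff_surjective_of_finrank_eq_finrank (f := combo b)
      (by simpa using hcard)
    exact this.1 h.injective s
  have := hasSum_poisson (f := fun t => polyGauss (fun p : T × Fin n => z p.1) P (combo b t))
    (Nat.lt_succ_self _) ((continuous_polyGauss _ P).comp (combo b).continuous_of_finiteDimensional)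
    hC (by
      simp_rw [hcoef]
      refine Summable.mul_left _ ?_
      simpa using summable_polyGauss_combo h.symm hz' P 0) t
  simp only [hcoef, map_add] at this
  simpa only [h.expDot_combo, mul_assoc] using this

end HarmonicPoisson

/-! ## Traces and lattices over totally real fields -/

section Trace

variable {F : Type*} [Field F] [NumberField F]

/-- Real embeddings of a totally real field are the same as its complex embeddings. -/
def realEmbEquiv (F : Type*) [Field F] [NumberField F] [NumberField.IsTotallyReal F] :
    (F →+* ℝ) ≃ (F →+* ℂ) where
  toFun τ := Complex.ofRealHom.comp τ
  invFun φ := (NumberField.IsTotallyReal.complexEmbedding_isReal φ).embedding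
  left_inv τ := by
    ext x
    simp [NumberField.ComplexEmbedding.IsReal.embedding]
  right_inv φ := by
    ext x
    simp

lemma trace_eq_sum_realEmb [NumberField.IsTotallyReal F] (x : F) :
    ((Algebra.trace ℚ F x : ℚ) : ℝ) = ∑ τ : F →+* ℝ, τ x := by
  have h := trace_eq_sum_embeddings (K := ℚ) (L := F) ℂ (x := x)
  have h2 : ∑ σ : F →ₐ[ℚ] ℂ, σ x = ∑ τ : F →+* ℝ, ((τ x : ℝ) : ℂ) := by
    refine Fintype.sum_equiv ((realEmbEquiv F).trans (RingHom.equivRatAlgHom F ℂ)).symm _ _ fun σ => ?_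
    obtain ⟨τ, rfl⟩ := ((realEmbEquiv F).trans (RingHom.equivRatAlgHom F ℂ)).surjective σ
    simp only [Equiv.symm_apply_apply]
    rfl
  rw [h2] at h
  have h3 : (((Algebra.trace ℚ F x : ℚ) : ℝ) : ℂ) = ((∑ τ : F →+* ℝ, τ x : ℝ) : ℂ) := by
    push_cast
    simpa using h
  exact_mod_cast h3

lemma card_realEmb [NumberField.IsTotallyReal F] : Fintype.card (F →+* ℝ) = Module.finrank ℚ F := by
  rw [Fintype.card_congr (realEmbEquiv F), NumberField.Embeddings.card]

instance [NumberField.IsTotallyReal F] : Nonempty (F →+* ℝ) := (realEmbEquiv F).nonempty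

/-- The additive character `x ↦ exp(2πi tr(x))`. -/
def traceChar (x : F) : ℂ := Complex.exp (2 * Real.pi * Complex.I * (Algebra.trace ℚ F x : ℚ))

lemma traceChar_add (x y : F) : traceChar (x + y) = traceChar x * traceChar y := by
  rw [traceChar, traceChar, traceChar, ← Complex.exp_add, map_add]
  push_cast; ring_nf

lemma traceChar_zero : traceChar (0 : F) = 1 := by simp [traceChar]

/-- The elements of integral trace. -/
def integralTrace (F : Type*) [Field F] [NumberField F] : AddSubgroup F :=
  (Int.castAddHom ℚ).range.comap (Algebra.trace ℚ F).toAddMonoidHom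

lemma mem_integralTrace {x : F} : x ∈ integralTrace F ↔ ∃ n : ℤ, (n : ℚ) = Algebra.trace ℚ F x :=
  Iff.rfl

lemma traceChar_eq_one_iff {x : F} : traceChar x = 1 ↔ x ∈ integralTrace F := by
  rw [traceChar, Complex.exp_eq_one_iff, mem_integralTrace]
  constructor
  · rintro ⟨n, hn⟩
    refine ⟨n, ?_⟩
    have := mul_left_cancel₀ Complex.two_pi_I_ne_zero (hn.trans (mul_comm _ _))
    exact_mod_cast this.symm
  · rintro ⟨n, hn⟩
    exact ⟨n, by rw [← hn]; push_cast; ring⟩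

lemma traceChar_add_of_mem {x y : F} (hy : y ∈ integralTrace F) : traceChar (x + y) = traceChar x := by
  rw [traceChar_add, traceChar_eq_one_iff.2 hy, mul_one]

lemma fracIdeal_one_ne_zero : (1 : FractionalIdeal (𝓞 F)⁰ F) ≠ 0 := one_ne_zero

/-- The inverse different is the dual of `𝓞_F` under the trace form; it is tested against `1`. -/
lemma mem_integralTrace_of_mem_inv_different {x : F}
    (hx : x ∈ ((differentIdeal ℤ (𝓞 F) : Ideal (𝓞 F)) : FractionalIdeal (𝓞 F)⁰ F)⁻¹) :
    x ∈ integralTrace F := by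
  rw [coeIdeal_differentIdeal ℤ ℚ, inv_inv, FractionalIdeal.mem_dual fracIdeal_one_ne_zero] at hx
  obtain ⟨n, hn⟩ := hx 1 (FractionalIdeal.one_mem_one _)
  exact ⟨n, by simpa using hn⟩

end Trace

/-! ### Lattices over the ring of integers -/

section Lattice

set_option linter.unusedSectionVars false

variable {F : Type*} [Field F] [NumberField F] {V : Type*} [AddCommGroup V] [Module F V] [Module (𝓞 F) V]
  [IsScalarTower (𝓞 F) F V]

/-- An `𝓞 F`-lattice of the `F`-vector space `V`. -/
def IsLattice (L : Submodule (𝓞 F) V) : Prop := L.FG ∧ Submodule.span F (L : Set V) = ⊤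

lemma exists_nat_mul_integral (a : F) : ∃ m : ℕ, m ≠ 0 ∧ ∃ x : 𝓞 F, (x : F) = (m : F) * a := by
  have : Algebra.IsAlgebraic ℤ F := (IsFractionRing.comap_isAlgebraic_iff (K := ℚ)).2 inferInstance
  obtain ⟨y, hy, h⟩ := ((Algebra.IsAlgebraic.isAlgebraic (R := ℤ) a)).exists_integral_multiple
  refine ⟨y.natAbs, by simpa using hy, ?_⟩
  have h' : IsIntegral ℤ ((y.natAbs : F) * a) := by
    rcases Int.natAbs_eq y with e | e
    · rw [e] at h; simpa [zsmul_eq_mul] using h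
    · rw [e] at h; simpa [zsmul_eq_mul] using h.neg
  exact ⟨⟨_, h'⟩, rfl⟩

lemma natCast_smul_mem (L : Submodule (𝓞 F) V) (m : ℕ) {v : V} (hv : v ∈ L) : (m : F) • v ∈ L := by
  rw [Nat.cast_smul_eq_nsmul]; exact nsmul_mem hv m

lemma int_smul_mem (L : Submodule (𝓞 F) V) (x : 𝓞 F) {v : V} (hv : v ∈ L) : (x : F) • v ∈ L :=
  by
  have := L.smul_mem x hv
  rwa [← algebraMap_smul F x v] at this

lemma IsLattice.exists_nat_smul_mem {L : Submodule (𝓞 F) V} (hL : IsLattice L) (v : V) :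
    ∃ m : ℕ, m ≠ 0 ∧ (m : F) • v ∈ L := by
  have hv : v ∈ Submodule.span F (L : Set V) := hL.2 ▸ Submodule.mem_top
  induction hv using Submodule.span_induction with
  | mem v hv => exact ⟨1, one_ne_zero, by simpa using hv⟩
  | zero => exact ⟨1, one_ne_zero, by simp⟩
  | add v w _ _ hv hw =>
    obtain ⟨m, hm, h⟩ := hv
    obtain ⟨m', hm', h'⟩ := hw
    refine ⟨m * m', mul_ne_zero hm hm', ?_⟩
    rw [smul_add, Nat.cast_mul]
    refine L.add_mem ?_ ?_
    · rw [mul_comm, mul_smul]; exact natCast_smul_mem L m' h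
    · rw [mul_smul]; exact natCast_smul_mem L m h'
  | smul a v _ hv =>
    obtain ⟨m, hm, h⟩ := hv
    obtain ⟨m', hm', x, hx⟩ := exists_nat_mul_integral a
    refine ⟨m * m', mul_ne_zero hm hm', ?_⟩
    have : ((m * m' : ℕ) : F) • a • v = (x : F) • (m : F) • v := by
      rw [smul_smul, smul_smul, hx]; congr 1; push_cast; ring
    rw [this]
    exact int_smul_mem L x h

/-- A finitely generated module is contained in a multiple of a lattice. -/
lemma IsLattice.exists_nat_smul_le {L : Submodule (𝓞 F) V} (hL : IsLattice L)
    {M : Submodule (𝓞 F) V} (hM : M.FG) : ∃ m : ℕ, m ≠ 0 ∧ ∀ v ∈ M, (m : F) • v ∈ L := by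
  obtain ⟨S, rfl⟩ := hM
  choose m hm h using hL.exists_nat_smul_mem
  refine ⟨∏ s ∈ S, m s, Finset.prod_ne_zero_iff.2 fun s _ => hm s, fun v hv => ?_⟩
  induction hv using Submodule.span_induction with
  | mem v hv =>
    classical
    rw [← Finset.prod_erase_mul _ _ hv, Nat.cast_mul, mul_smul]
    exact natCast_smul_mem L _ (h v)
  | zero => simp
  | add v w _ _ hv hw => rw [smul_add]; exact L.add_mem hv hw
  | smul a v _ hv => rw [smul_comm]; exact L.smul_mem a hv

/-- Multiplication by `a` embeds `M` into a noetherian module, and `b L ⊆ M` makes `M` span. All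
lattices below arise from known ones by this commensurability criterion. -/
lemma isLattice_of_smul_mem {L M : Submodule (𝓞 F) V} (hL : IsLattice L) {a b : F} (ha : a ≠ 0)
    (hb : b ≠ 0) (hM : ∀ v ∈ M, a • v ∈ L) (hLM : ∀ v ∈ L, b • v ∈ M) : IsLattice M := by
  constructor
  · have : IsNoetherian (𝓞 F) L := isNoetherian_of_fg_of_noetherian L hL.1
    let f : M →ₗ[𝓞 F] L :=
      { toFun := fun v => ⟨a • (v : V), hM v v.2⟩
        map_add' := fun v w => Subtype.ext (smul_add a (v : V) w)
        map_smul' := fun c v => Subtype.ext (smul_comm a c (v : V)) }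
    have hf : Function.Injective f := fun v w h => Subtype.ext
      (smul_right_injective V ha (congrArg Subtype.val h))
    have := isNoetherian_of_injective f hf
    exact (Module.Finite.iff_fg).1 inferInstance
  · rw [eq_top_iff, ← hL.2, Submodule.span_le]
    intro v hv
    have : v = b⁻¹ • b • v := by rw [smul_smul, inv_mul_cancel₀ hb, one_smul]
    rw [this]
    exact Submodule.smul_mem _ _ (Submodule.subset_span (hLM v hv))

/-- `𝔞⁻¹ L`. -/
def colonLattice (𝔞 : FractionalIdeal (𝓞 F)⁰ F) (L : Submodule (𝓞 F) V) : Submodule (𝓞 F) V where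
  carrier := {v | ∀ a ∈ 𝔞, a • v ∈ L}
  add_mem' hv hw a ha := by rw [smul_add]; exact L.add_mem (hv a ha) (hw a ha)
  zero_mem' a _ := by simp
  smul_mem' c v hv a ha := by rw [smul_comm]; exact L.smul_mem c (hv a ha)

lemma mem_colonLattice {𝔞 : FractionalIdeal (𝓞 F)⁰ F} {L : Submodule (𝓞 F) V} {v : V} :
    v ∈ colonLattice 𝔞 L ↔ ∀ a ∈ 𝔞, a • v ∈ L := Iff.rfl

/-- `a⁻¹ L`. -/
def scaleLattice (a : F) (L : Submodule (𝓞 F) V) : Submodule (𝓞 F) V where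
  carrier := {v | a • v ∈ L}
  add_mem' hv hw := by simpa only [Set.mem_ofPred_eq, smul_add] using L.add_mem hv hw
  zero_mem' := by simp
  smul_mem' c v hv := by
    simp only [Set.mem_ofPred_eq] at hv ⊢
    rw [smul_comm]; exact L.smul_mem c hv

lemma mem_scaleLattice {a : F} {L : Submodule (𝓞 F) V} {v : V} :
    v ∈ scaleLattice a L ↔ a • v ∈ L := Iff.rfl

lemma IsLattice.scale {L : Submodule (𝓞 F) V} (hL : IsLattice L) {a : F} (ha : a ≠ 0) :
    IsLattice (scaleLattice a L) :=
  isLattice_of_smul_mem hL ha (inv_ne_zero ha) (fun _ h => h) fun v hv => by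
    rw [mem_scaleLattice, smul_smul, mul_inv_cancel₀ ha, one_smul]; exact hv

lemma IsLattice.colon {L : Submodule (𝓞 F) V} (hL : IsLattice L)
    {𝔞 : FractionalIdeal (𝓞 F)⁰ F} (h𝔞 : 𝔞 ≠ 0) : IsLattice (colonLattice 𝔞 L) := by
  obtain ⟨a, ha, ha0⟩ : ∃ a ∈ 𝔞, a ≠ 0 := by
    by_contra! h
    exact h𝔞 (FractionalIdeal.eq_zero_iff.2 h)
  obtain ⟨d, hd, hd'⟩ := 𝔞.isFractional
  have hd0 : (d : F) ≠ 0 := by simpa using nonZeroDivisors.ne_zero hd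
  refine isLattice_of_smul_mem hL ha0 hd0 (fun v hv => hv a ha) fun v hv b hb => ?_
  obtain ⟨x, hx⟩ := hd' b hb
  have : b • (d : F) • v = (x : F) • v := by
    rw [smul_smul, mul_comm]
    congr 1
    rw [Algebra.smul_def] at hx
    exact hx.symm
  rw [this]
  exact int_smul_mem L x hv

lemma mem_colonLattice_top {𝔞 : FractionalIdeal (𝓞 F)⁰ F} (h𝔞 : 𝔞 ≠ 0) {x : F} :
    x ∈ colonLattice 𝔞 (1 : Submodule (𝓞 F) F) ↔ x ∈ 𝔞⁻¹ := by
  rw [FractionalIdeal.mem_inv_iff h𝔞, mem_colonLattice]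
  refine forall₂_congr fun a _ => ?_
  rw [smul_eq_mul, mul_comm, ← FractionalIdeal.mem_coe, FractionalIdeal.coe_one]

end Lattice

/-! ## Definite quadratic spaces over totally real fields -/

/-- A totally positive definite quadratic space over `F` of dimension `n`, with orthonormal real
coordinates for each real embedding. -/
structure QuadCoord (F : Type*) [Field F] [NumberField F] (V : Type*) [AddCommGroup V] [Module F V]
    (n : ℕ) where
  form : V →ₗ[F] V →ₗ[F] F
  coord : (F →+* ℝ) → Fin n → V →+ ℝ
  coord_smul : ∀ τ l a v, coord τ l (a • v) = τ a * coord τ l v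
  map_form : ∀ τ u v, τ (form u v) = ∑ l, coord τ l u * coord τ l v
  form_self_ne : ∀ v, v ≠ 0 → form v v ≠ 0
  finrank_eq : Module.finrank F V = n
  finite : Module.Finite F V

namespace QuadCoord

set_option linter.unusedSectionVars false

variable {F : Type*} [Field F] [NumberField F] [NumberField.IsTotallyReal F]
  {V : Type*} [AddCommGroup V] [Module F V]
  [Module (𝓞 F) V] [IsScalarTower (𝓞 F) F V] {n : ℕ} (X : QuadCoord F V n)

/-- All coordinates of a vector. -/
def vec (v : V) : (F →+* ℝ) × Fin n → ℝ := fun p => X.coord p.1 p.2 v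

lemma vec_add (u v : V) : X.vec (u + v) = X.vec u + X.vec v := by
  ext p; simp [vec]

lemma vec_sum {ι : Type*} (s : Finset ι) (f : ι → V) : X.vec (∑ i ∈ s, f i) = ∑ i ∈ s, X.vec (f i) := by
  ext p; simp [vec]

lemma vec_zsmul (m : ℤ) (v : V) : X.vec (m • v) = (m : ℝ) • X.vec v := by
  ext p; simp [vec]

lemma form_comm (u v : V) : X.form u v = X.form v u := by
  obtain ⟨τ⟩ : Nonempty (F →+* ℝ) := inferInstance
  apply τ.injective
  rw [X.map_form, X.map_form]
  exact Finset.sum_congr rfl fun l _ => mul_comm _ _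

lemma sum_vec_mul_vec (u v : V) :
    ∑ p, X.vec u p * X.vec v p = ((Algebra.trace ℚ F (X.form u v) : ℚ) : ℝ) := by
  rw [trace_eq_sum_realEmb, Fintype.sum_prod_type]
  exact Finset.sum_congr rfl fun τ _ => (X.map_form τ u v).symm

lemma expDot_vec (u v : V) : expDot (X.vec u) (X.vec v) = traceChar (X.form u v) := by
  rw [expDot, traceChar]
  congr 2
  have := X.sum_vec_mul_vec u v
  exact_mod_cast congrArg (fun x : ℝ => (x : ℂ)) this

lemma gaussC_vec (z : (F →+* ℝ) → ℂ) (v : V) :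
    gaussC (fun p => z p.1) (X.vec v) =
      Complex.exp (Real.pi * Complex.I * ∑ τ, z τ * ((τ (X.form v v) : ℝ) : ℂ)) := by
  rw [gaussC, Fintype.sum_prod_type]
  congr 2
  refine Finset.sum_congr rfl fun τ _ => ?_
  rw [X.map_form]
  push_cast
  rw [Finset.mul_sum]
  exact Finset.sum_congr rfl fun l _ => by simp only [vec]; ring

lemma trace_form_self_pos {v : V} (hv : v ≠ 0) : 0 < Algebra.trace ℚ F (X.form v v) := by
  have h : (0 : ℝ) < ((Algebra.trace ℚ F (X.form v v) : ℚ) : ℝ) := by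
    rw [trace_eq_sum_realEmb]
    refine Finset.sum_pos (fun τ _ => ?_) Finset.univ_nonempty
    have h1 : 0 ≤ τ (X.form v v) := by
      rw [X.map_form]; exact Finset.sum_nonneg fun l _ => mul_self_nonneg _
    exact lt_of_le_of_ne h1 fun h => X.form_self_ne v hv (τ.injective (by rw [← h, map_zero]))
  exact_mod_cast h

/-- The dual lattice for the trace form. -/
def dual (L : Submodule (𝓞 F) V) : Set V := {u | ∀ l ∈ L, X.form u l ∈ integralTrace F}

lemma finite_int {L : Submodule (𝓞 F) V} (hL : L.FG) : Module.Finite ℤ L := by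
  have : Module.Finite (𝓞 F) L := Module.Finite.iff_fg.2 hL
  exact Module.Finite.trans (𝓞 F) L

lemma torsionFree_int (F : Type*) [Field F] [NumberField F] (V : Type*) [AddCommGroup V]
    [Module F V] : Module.IsTorsionFree ℤ V := by
  have h : ∀ (m : ℤ) (v : V), m • v = 0 → m = 0 ∨ v = 0 := by
    intro m v h
    rw [← Int.cast_smul_eq_zsmul F, smul_eq_zero] at h
    simpa using h
  exact Module.IsTorsionFree.of_smul_eq_zero h

lemma trace_form_sum_smul {ι : Type*} (s : Finset ι) (u : V) (q : ι → ℚ) (e : ι → V) :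
    Algebra.trace ℚ F (X.form u (∑ i ∈ s, (q i : F) • e i)) =
      ∑ i ∈ s, q i * Algebra.trace ℚ F (X.form u (e i)) := by
  rw [map_sum, map_sum]
  refine Finset.sum_congr rfl fun i _ => ?_
  rw [map_smul, smul_eq_mul, ← Rat.smul_def, map_smul, smul_eq_mul]

/-- Multiples of an `F`-basis that lie in `L` generate a copy of `(𝓞 F)^n`, of rank `n [F : ℚ]` over
`ℤ`. As `F` is totally real, this is the number of real coordinates. -/
lemma card_le_finrank [Module.Finite F V] (hn : Module.finrank F V = n)
    {L : Submodule (𝓞 F) V} (hL : IsLattice L) :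
    Fintype.card ((F →+* ℝ) × Fin n) ≤ Module.finrank ℤ L := by
  have := finite_int (F := F) hL.1
  have := torsionFree_int F V
  let v := Module.finBasisOfFinrankEq F V hn
  choose m hm h using hL.exists_nat_smul_mem
  let f : (Fin n → 𝓞 F) →ₗ[ℤ] L :=
    { toFun := fun x => ∑ i, x i • ⟨(m (v i) : F) • v i, h (v i)⟩
      map_add' := fun x y => by simp only [Pi.add_apply, add_smul, Finset.sum_add_distrib]
      map_smul' := fun c x => by
        simp only [Pi.smul_apply, smul_assoc, Finset.smul_sum, RingHom.id_apply] }
  have hf : Function.Injective f := by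
    rw [injective_iff_map_eq_zero]
    intro x hx
    have h1 : ∑ i, ((x i : F) * (m (v i) : F)) • v i = 0 := by
      have := congrArg Subtype.val hx
      simp only [f, LinearMap.coe_mk, AddHom.coe_mk, AddSubmonoidClass.coe_finsetSum,
        Submodule.coe_smul, ZeroMemClass.coe_zero] at this
      rw [← this]
      refine Finset.sum_congr rfl fun i _ => ?_
      rw [mul_smul, ← algebraMap_smul F (x i)]
    ext i
    have h2 := Fintype.linearIndependent_iff.1 v.linearIndependent _ h1 i
    rcases mul_eq_zero.1 h2 with h3 | h3
    · simpa using h3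
    · exact absurd (Nat.cast_eq_zero.1 h3) (hm _)
  have h3 := LinearMap.finrank_le_finrank_of_injective hf
  rw [Module.finrank_pi_fintype] at h3
  simp only [Finset.sum_const, Finset.card_univ, Fintype.card_fin, smul_eq_mul,
    NumberField.RingOfIntegers.rank] at h3
  rw [Fintype.card_prod, card_realEmb, Fintype.card_fin]
  linarith

lemma isDualPair_vec {ι : Type*} [DecidableEq ι] {e e' : ι → V}
    (h : ∀ i j, Algebra.trace ℚ F (X.form (e i) (e' j)) = if i = j then 1 else 0) :
    IsDualPair (fun i => X.vec (e i)) (fun i => X.vec (e' i)) := by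
  intro i j
  rw [X.sum_vec_mul_vec, h]
  split_ifs <;> simp

/-- A lattice is the `ℤ`-span of a basis; it has a dual basis for the trace form. -/
theorem exists_dual_basis {L : Submodule (𝓞 F) V} (hL : IsLattice L) :
    ∃ (r : ℕ) (e : Module.Basis (Fin r) ℤ L) (e' : Fin r → V),
      (∀ i j, Algebra.trace ℚ F (X.form (e i) (e' j)) = if i = j then 1 else 0) ∧
      Fintype.card (Fin r) = Fintype.card ((F →+* ℝ) × Fin n) := by
  classical
  have := finite_int (F := F) hL.1
  have := torsionFree_int F V
  let e : Module.Basis (Fin (Module.finrank ℤ L)) ℤ L := Module.finBasis ℤ L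
  let M : Matrix (Fin (Module.finrank ℤ L)) (Fin (Module.finrank ℤ L)) ℚ :=
    fun i j => Algebra.trace ℚ F (X.form (e i) (e j))
  -- A rational vector in the kernel of the Gram matrix, after clearing denominators, gives a
  -- lattice vector orthogonal to the basis and hence to itself; positivity of the trace form makes
  -- it zero. The inverse of the Gram matrix then supplies the dual basis.
  have hdet : M.det ≠ 0 := by
    intro h0
    obtain ⟨v, hv0, hv⟩ := Matrix.exists_mulVec_eq_zero_iff.2 h0
    obtain ⟨⟨b, hb⟩, hbv⟩ := IsLocalization.exist_integer_multiples_of_finite (nonZeroDivisors ℤ) v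
    have hb0 : b ≠ 0 := nonZeroDivisors.ne_zero hb
    choose c hc using hbv
    have hc' : ∀ i, ((c i : ℤ) : ℚ) = b * v i := fun i => by simpa [Algebra.smul_def] using hc i
    let u : V := ∑ i, ((c i : ℚ) : F) • (e i : V)
    have hu1 : ∀ j, Algebra.trace ℚ F (X.form (e j) u) = 0 := by
      intro j
      rw [X.trace_form_sum_smul]
      have h1 := congrFun hv j
      simp only [Matrix.mulVec, dotProduct, Pi.zero_apply] at h1
      calc ∑ i, ((c i : ℤ) : ℚ) * M j i = b * ∑ i, M j i * v i := by
            rw [Finset.mul_sum]; exact Finset.sum_congr rfl fun i _ => by rw [hc']; ring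
        _ = 0 := by rw [h1, mul_zero]
    have hu0 : u = 0 := by
      by_contra hne
      have := X.trace_form_self_pos hne
      have h2 : Algebra.trace ℚ F (X.form u u) = 0 := by
        conv_lhs => arg 2; arg 2; simp only [u]
        rw [X.trace_form_sum_smul]
        refine Finset.sum_eq_zero fun i _ => ?_
        rw [X.form_comm, hu1, mul_zero]
      linarith
    have h3 : ∑ i, c i • e i = 0 := by
      apply Subtype.ext
      simp only [AddSubmonoidClass.coe_finsetSum, ZeroMemClass.coe_zero]
      rw [← hu0]
      refine Finset.sum_congr rfl fun i _ => ?_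
      rw [Submodule.coe_smul_of_tower, Rat.cast_intCast, Int.cast_smul_eq_zsmul]
    apply hv0
    ext i
    have h4 := Fintype.linearIndependent_iff.1 e.linearIndependent c h3 i
    have h5 := hc' i
    rw [h4] at h5
    simpa [hb0] using h5.symm
  have hdual : ∀ i j, Algebra.trace ℚ F (X.form (e i) (∑ i, ((M⁻¹ i j : ℚ) : F) • (e i : V))) =
      if i = j then 1 else 0 := by
    intro i j
    rw [X.trace_form_sum_smul]
    have h1 : (M * M⁻¹) i j = if i = j then 1 else 0 := by
      rw [Matrix.mul_nonsing_inv _ (Ne.isUnit hdet), Matrix.one_apply]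
    rw [← h1, Matrix.mul_apply]
    exact Finset.sum_congr rfl fun k _ => mul_comm _ _
  -- One inequality holds because real vectors with a biorthogonal family are independent, the other
  -- because `L` is large enough to span `V` over `F`.
  refine ⟨_, e, _, hdual, le_antisymm ?_ ?_⟩
  · have h1 := LinearMap.finrank_le_finrank_of_injective (X.isDualPair_vec (e := fun i => (e i : V)) hdual).injective
    simpa using h1
  · have := X.finite
    rw [Fintype.card_fin]
    exact card_le_finrank X.finrank_eq hL

/-- The summand of the theta series of a lattice. -/
def term (z : (F →+* ℝ) → ℂ) (P : MvPolynomial ((F →+* ℝ) × Fin n) ℂ) (v : V) : ℂ :=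
  polyGauss (fun p => z p.1) P (X.vec v)

/-- The vector with given integral coordinates in a family. -/
def intCombo {r : ℕ} (e : Fin r → V) (m : Fin r → ℤ) : V := ∑ i, m i • e i

lemma vec_intCombo {r : ℕ} (e : Fin r → V) (m : Fin r → ℤ) :
    X.vec (intCombo e m) = combo (fun i => X.vec (e i)) (intVec m) := by
  rw [intCombo, X.vec_sum]
  simp only [X.vec_zsmul]
  rfl

lemma intCombo_basis {L : Submodule (𝓞 F) V} {r : ℕ} (e : Module.Basis (Fin r) ℤ L) (m : Fin r → ℤ) :
    intCombo (fun i => (e i : V)) m = (e.equivFun.symm m : L) := by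
  rw [Module.Basis.equivFun_symm_apply, AddSubmonoidClass.coe_finsetSum]
  rfl

lemma summable_term {L : Submodule (𝓞 F) V} (hL : IsLattice L) {z : (F →+* ℝ) → ℂ}
    (hz : ∀ τ, 0 < (z τ).im) (P : MvPolynomial ((F →+* ℝ) × Fin n) ℂ) (v : V) :
    Summable fun l : L => X.term z P (v + l) := by
  obtain ⟨r, e, e', hee, hcard⟩ := X.exists_dual_basis hL
  have hd := X.isDualPair_vec (e := fun i => (e i : V)) hee
  obtain ⟨t, ht⟩ : ∃ t, combo (fun i => X.vec (e i)) t = X.vec v :=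
    (LinearMap.injective_iff_surjective_of_finrank_eq_finrank (by simpa using hcard)).1 hd.injective _
  have := summable_polyGauss_combo hd (z := fun p => z p.1) (fun p => hz p.1) P t
  rw [← e.equivFun.symm.toEquiv.summable_iff]
  refine this.congr fun m => ?_
  simp only [Function.comp, term, LinearEquiv.coe_toEquiv]
  rw [X.vec_add, ← intCombo_basis, X.vec_intCombo, map_add, ht]

/-- The inversion formula for the theta series of a coset of a lattice. -/
theorem exists_hasSum_term {L : Submodule (𝓞 F) V} (hL : IsLattice L) :
    ∃ (r : ℕ) (u : (Fin r → ℤ) → V) (c : ℂ), (∀ m, u m ∈ X.dual L) ∧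
      ∀ (z : (F →+* ℝ) → ℂ) (_ : ∀ τ, 0 < (z τ).im) (k : (F →+* ℝ) → ℕ)
        (P : MvPolynomial ((F →+* ℝ) × Fin n) ℂ) (_ : IsMultiHarmonic k P) (v : V),
        HasSum (fun m => c * (halfRoot z ^ n)⁻¹ * (∏ τ, (z τ)⁻¹ ^ k τ) *
          (X.term (fun τ => -(z τ)⁻¹) P (u m) * traceChar (X.form (u m) v)))
          (∑' l : L, X.term z P (v + l)) := by
  obtain ⟨r, e, e', hee, hcard⟩ := X.exists_dual_basis hL
  have hd := X.isDualPair_vec (e := fun i => (e i : V)) hee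
  obtain ⟨c, hc⟩ := exists_hasSum_polyGauss hd hcard
  refine ⟨r, intCombo e', c, fun m l hl => ?_, fun z hz k P hP v => ?_⟩
  · obtain ⟨t, ht⟩ := e.equivFun.symm.surjective ⟨l, hl⟩
    have hl' : l = intCombo (fun i => (e i : V)) t := by rw [intCombo_basis, ht]
    rw [hl', intCombo, intCombo, map_sum]
    refine AddSubgroup.sum_mem _ fun i _ => ?_
    rw [map_zsmul]
    refine AddSubgroup.zsmul_mem _ ?_ _
    rw [X.form_comm, map_sum]
    refine AddSubgroup.sum_mem _ fun j _ => ?_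
    rw [map_zsmul]
    refine AddSubgroup.zsmul_mem _ ?_ _
    refine mem_integralTrace.2 ⟨if i = j then 1 else 0, ?_⟩
    rw [hee]
    split_ifs <;> simp
  · have h := hc z hz k P hP (X.vec v)
    have e1 : ∑' m : Fin r → ℤ, polyGauss (fun p : (F →+* ℝ) × Fin n => z p.1) P
        (X.vec v + combo (fun i => X.vec (e i)) (intVec m)) = ∑' l : L, X.term z P (v + l) := by
      rw [← e.equivFun.symm.toEquiv.tsum_eq]
      refine tsum_congr fun m => ?_
      simp only [term, LinearEquiv.coe_toEquiv]
      rw [X.vec_add, ← intCombo_basis, X.vec_intCombo]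
    rw [e1] at h
    simp only [← X.vec_intCombo, X.expDot_vec] at h
    exact h

end QuadCoord

/-! ## Sums over quotients of lattices -/

section QuotSum

variable {V V' : Type*} [AddCommGroup V] [AddCommGroup V']

/-- The quotient `M / L` of subgroups of an abelian group. -/
abbrev QuotOf (L M : AddSubgroup V) : Type _ := M ⧸ L.addSubgroupOf M

/-- A representative in `V` of an element of `M / L`. -/
def quotRep {L M : AddSubgroup V} (r : QuotOf L M) : V := (Quotient.out r : M)

lemma quotRep_mem {L M : AddSubgroup V} (r : QuotOf L M) : quotRep r ∈ M := (Quotient.out r).2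

/-- The class of an element of `M` in `M / L`. -/
def quotMk (L : AddSubgroup V) {M : AddSubgroup V} (v : V) (hv : v ∈ M) : QuotOf L M :=
  QuotientAddGroup.mk (⟨v, hv⟩ : M)

lemma quotMk_eq_iff {L M : AddSubgroup V} {v w : V} (hv : v ∈ M) (hw : w ∈ M) :
    quotMk L v hv = quotMk L w hw ↔ w - v ∈ L := by
  rw [quotMk, quotMk, QuotientAddGroup.eq, AddSubgroup.mem_addSubgroupOf]
  simp [neg_add_eq_sub]

lemma quotMk_rep {L M : AddSubgroup V} (r : QuotOf L M) : quotMk L (quotRep r) (quotRep_mem r) = r :=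
  QuotientAddGroup.out_eq' r

lemma quotRep_mk_sub {L M : AddSubgroup V} {v : V} (hv : v ∈ M) :
    quotRep (quotMk L v hv) - v ∈ L := by
  rw [← quotMk_eq_iff hv (quotRep_mem _), quotMk_rep]

/-- The sum over `M / L` of an `L`-periodic function on `M`. -/
def quotSum (L M : AddSubgroup V) (f : V → ℂ) : ℂ := ∑ᶠ r : QuotOf L M, f (quotRep r)

/-- `f` is an `L`-periodic function on `M`. -/
def PeriodicOn (L M : AddSubgroup V) (f : V → ℂ) : Prop :=
  ∀ v ∈ M, ∀ l ∈ L, f (v + l) = f v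

lemma PeriodicOn.apply_rep {L M : AddSubgroup V} {f : V → ℂ} (hf : PeriodicOn L M f) {v : V}
    (hv : v ∈ M) : f (quotRep (quotMk L v hv)) = f v := by
  have := hf v hv _ (quotRep_mk_sub (L := L) hv)
  rwa [add_sub_cancel] at this

lemma quotSum_congr {L M : AddSubgroup V} {f g : V → ℂ} (h : ∀ v ∈ M, f v = g v) :
    quotSum L M f = quotSum L M g :=
  finsum_congr fun r => h _ (quotRep_mem r)

/-- Since `φ` need only respect differences modulo the two subgroups, and need not be additive, this
covers translations as well as linear substitutions. -/
lemma quotSum_eq_of_map {L M : AddSubgroup V} {L' M' : AddSubgroup V'} (φ : V → V')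
    (hφ : ∀ v ∈ M, φ v ∈ M') (hker : ∀ v ∈ M, ∀ w ∈ M, φ w - φ v ∈ L' ↔ w - v ∈ L)
    (hsurj : ∀ v' ∈ M', ∃ v ∈ M, v' - φ v ∈ L') {f : V → ℂ} {f' : V' → ℂ}
    (hf' : PeriodicOn L' M' f') (hff' : ∀ v ∈ M, f' (φ v) = f v) :
    quotSum L M f = quotSum L' M' f' := by
  refine finsum_eq_of_bijective (fun r : QuotOf L M => (quotMk L' (φ (quotRep r)) (hφ _ (quotRep_mem r))))
    ⟨fun r s h => ?_, fun r' => ?_⟩ fun r => ?_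
  · rw [quotMk_eq_iff, hker _ (quotRep_mem r) _ (quotRep_mem s),
      ← quotMk_eq_iff (quotRep_mem r) (quotRep_mem s), quotMk_rep, quotMk_rep] at h
    exact h
  · obtain ⟨v, hv, h⟩ := hsurj _ (quotRep_mem r')
    refine ⟨quotMk L v hv, ?_⟩
    simp only
    rw [← quotMk_rep r', quotMk_eq_iff]
    have h1 : φ (quotRep (quotMk L v hv)) - φ v ∈ L' :=
      (hker v hv _ (quotRep_mem _)).2 (quotRep_mk_sub hv)
    have := L'.sub_mem h h1
    simpa using this
  · rw [hf'.apply_rep, hff' _ (quotRep_mem r)]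

lemma quotSum_shift {L M : AddSubgroup V} {f : V → ℂ} (hf : PeriodicOn L M f)
    {v₀ : V} (hv₀ : v₀ ∈ M) : quotSum L M (fun v => f (v + v₀)) = quotSum L M f :=
  quotSum_eq_of_map (fun v => v + v₀) (fun v hv => M.add_mem hv hv₀)
    (fun v _ w _ => by simp) (fun v hv => ⟨v - v₀, M.sub_mem hv hv₀, by simp⟩) hf fun _ _ => rfl

lemma quotSum_mul_left {L M : AddSubgroup V} [Finite (QuotOf L M)] (c : ℂ) (f : V → ℂ) :
    quotSum L M (fun v => c * f v) = c * quotSum L M f := by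
  have := Fintype.ofFinite (QuotOf L M)
  rw [quotSum, quotSum, finsum_eq_sum_of_fintype, finsum_eq_sum_of_fintype, Finset.mul_sum]

/-- Products of sums over quotients. -/
lemma quotSum_prod {L M : AddSubgroup V} {L' M' : AddSubgroup V'} [Finite (QuotOf L M)]
    [Finite (QuotOf L' M')] {f : V → ℂ} {f' : V' → ℂ} (hf : PeriodicOn L M f)
    (hf' : PeriodicOn L' M' f') :
    quotSum (L.prod L') (M.prod M') (fun v => f v.1 * f' v.2) = quotSum L M f * quotSum L' M' f' := by
  have := Fintype.ofFinite (QuotOf L M)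
  have := Fintype.ofFinite (QuotOf L' M')
  have hmem : ∀ p : QuotOf L M × QuotOf L' M', ((quotRep p.1, quotRep p.2) : V × V') ∈ M.prod M' :=
    fun p => AddSubgroup.mem_prod.2 ⟨quotRep_mem p.1, quotRep_mem p.2⟩
  have hp : PeriodicOn (L.prod L') (M.prod M') (fun v => f v.1 * f' v.2) := by
    intro v hv l hl
    obtain ⟨hv1, hv2⟩ := AddSubgroup.mem_prod.1 hv
    obtain ⟨hl1, hl2⟩ := AddSubgroup.mem_prod.1 hl
    simp only [Prod.fst_add, Prod.snd_add]
    rw [hf _ hv1 _ hl1, hf' _ hv2 _ hl2]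
  rw [quotSum, quotSum, quotSum, finsum_eq_sum_of_fintype (M := ℂ) (fun r : QuotOf L M => f (quotRep r)),
    finsum_eq_sum_of_fintype (M := ℂ) (fun r : QuotOf L' M' => f' (quotRep r)), Finset.sum_mul_sum,
    ← Finset.sum_product', Finset.univ_product_univ, ← finsum_eq_sum_of_fintype]
  symm
  refine finsum_eq_of_bijective (fun p => quotMk (L.prod L') _ (hmem p))
    ⟨fun p q h => ?_, fun r => ?_⟩ fun p => (hp.apply_rep (hmem p)).symm
  · have h' := (quotMk_eq_iff (hmem p) (hmem q)).1 h
    obtain ⟨h1, h2⟩ := AddSubgroup.mem_prod.1 h'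
    have h3 := (quotMk_eq_iff (L := L) (quotRep_mem p.1) (quotRep_mem q.1)).2 h1
    have h4 := (quotMk_eq_iff (L := L') (quotRep_mem p.2) (quotRep_mem q.2)).2 h2
    rw [quotMk_rep, quotMk_rep] at h3 h4
    exact Prod.ext h3 h4
  · obtain ⟨hr1, hr2⟩ := AddSubgroup.mem_prod.1 (quotRep_mem r)
    refine ⟨(quotMk L (quotRep r).1 hr1, quotMk L' (quotRep r).2 hr2), ?_⟩
    refine Eq.trans ?_ (quotMk_rep r)
    refine (quotMk_eq_iff (hmem _) (quotRep_mem r)).2 (AddSubgroup.mem_prod.2 ⟨?_, ?_⟩)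
    · have := L.neg_mem (quotRep_mk_sub (L := L) hr1)
      rwa [neg_sub] at this
    · have := L'.neg_mem (quotRep_mk_sub (L := L') hr2)
      rwa [neg_sub] at this

/-- A sum over `M` of a periodic function times a function summable on cosets of `L`. -/
lemma hasSum_quot {L M : AddSubgroup V} (hLM : L ≤ M) [Fintype (QuotOf L M)] {f : V → ℂ}
    (hf : PeriodicOn L M f) {Φ : V → ℂ} (hΦ : ∀ v, Summable fun l : L => Φ (v + l)) :
    HasSum (fun v : M => f v * Φ v)
      (∑ r : QuotOf L M, f (quotRep r) * ∑' l : L, Φ (quotRep r + l)) := by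
  classical
  let g : QuotOf L M × L → M := fun p => ⟨quotRep p.1 + p.2, M.add_mem (quotRep_mem _) (hLM p.2.2)⟩
  have hg : Function.Bijective g := by
    constructor
    · rintro ⟨r, l⟩ ⟨s, m⟩ h
      have h1 : quotRep r + l = quotRep s + m := congrArg Subtype.val h
      have h2 : r = s := by
        rw [← quotMk_rep r, ← quotMk_rep s, quotMk_eq_iff]
        have : quotRep s - quotRep r = l - m := by rw [sub_eq_sub_iff_add_eq_add, ← h1, add_comm]
        rw [this]
        exact L.sub_mem l.2 m.2
      subst h2
      have h3 : l = m := Subtype.ext (add_left_cancel h1)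
      rw [h3]
    · intro v
      refine ⟨(quotMk L v v.2, ⟨v - quotRep (quotMk L (v : V) v.2), ?_⟩), ?_⟩
      · have := L.neg_mem (quotRep_mk_sub (L := L) v.2)
        simpa using this
      · apply Subtype.ext
        simp [g]
  rw [← (Equiv.ofBijective g hg).hasSum_iff]
  -- Each coset contributes a family extended by zero to the whole product, so that only a finite
  -- sum of convergent families has to be formed.
  have h1 : ∀ r : QuotOf L M, HasSum (fun p : QuotOf L M × L =>
      if p.1 = r then f (quotRep r) * Φ (quotRep r + p.2) else 0)
      (f (quotRep r) * ∑' l : L, Φ (quotRep r + l)) := by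
    intro r
    have hinj : Function.Injective (fun l : L => (r, l)) := Prod.mk_right_injective r
    rw [← hinj.hasSum_iff]
    · simp only [Function.comp_def, if_true]
      exact (hΦ _).hasSum.mul_left _
    · rintro ⟨s, l⟩ hs
      rw [if_neg]
      rintro rfl
      exact hs ⟨l, rfl⟩
  refine (hasSum_sum fun r (_ : r ∈ Finset.univ) => h1 r).congr_fun ?_
  rintro ⟨r, l⟩
  simp only [Function.comp, Equiv.ofBijective_apply, g, Finset.sum_ite_eq, Finset.mem_univ, if_true]
  rw [hf _ (quotRep_mem r) _ l.2]

end QuotSum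

/-! ## Transformation of theta series under `SL₂(F)` -/

section Moebius

set_option linter.unusedSectionVars false

variable {F : Type*} [Field F] [NumberField F]

/-- The numbers `w' = (w⁻¹ + c/d)⁻¹`, for which `β w = b/d + w'/d²`. -/
def innerPoint (β : Matrix.SpecialLinearGroup (Fin 2) F) (w : (F →+* ℝ) → UpperHalfPlane) :
    (F →+* ℝ) → ℂ :=
  fun τ => ((w τ : ℂ)⁻¹ + ((τ (β.1 1 0 / β.1 1 1) : ℝ) : ℂ))⁻¹

lemma inv_add_im_neg (z : UpperHalfPlane) (x : ℝ) : ((z : ℂ)⁻¹ + (x : ℂ)).im < 0 := by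
  have h := z.im_pos
  have h0 : 0 < Complex.normSq (z : ℂ) := Complex.normSq_pos.2 z.ne_zero
  rw [Complex.add_im, Complex.ofReal_im, add_zero, Complex.inv_im]
  exact div_neg_of_neg_of_pos (neg_neg_of_pos h) h0

lemma innerPoint_im_pos (β : Matrix.SpecialLinearGroup (Fin 2) F)
    (w : (F →+* ℝ) → UpperHalfPlane) (τ : F →+* ℝ) : 0 < (innerPoint β w τ).im := by
  have h := inv_add_im_neg (w τ) (τ (β.1 1 0 / β.1 1 1))
  rw [innerPoint, Complex.inv_im]
  refine div_pos (neg_pos.2 h) (Complex.normSq_pos.2 fun h0 => ?_)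
  rw [h0] at h
  exact absurd h (by simp)

lemma neg_inv_innerPoint (β : Matrix.SpecialLinearGroup (Fin 2) F)
    (w : (F →+* ℝ) → UpperHalfPlane) (τ : F →+* ℝ) :
    -(innerPoint β w τ)⁻¹ = -(w τ : ℂ)⁻¹ - ((τ (β.1 1 0 / β.1 1 1) : ℝ) : ℂ) := by
  rw [innerPoint, inv_inv]; ring

lemma coe_moebius (β : Matrix.SpecialLinearGroup (Fin 2) F) (w : (F →+* ℝ) → UpperHalfPlane)
    (τ : F →+* ℝ) : ((moebius β w τ : UpperHalfPlane) : ℂ) =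
      (((τ (β.1 0 0) : ℝ) : ℂ) * (w τ : ℂ) + ((τ (β.1 0 1) : ℝ) : ℂ)) /
      (((τ (β.1 1 0) : ℝ) : ℂ) * (w τ : ℂ) + ((τ (β.1 1 1) : ℝ) : ℂ)) := by
  rw [moebius, UpperHalfPlane.coe_specialLinearGroup_apply]
  rfl

lemma det_entries (β : Matrix.SpecialLinearGroup (Fin 2) F) :
    β.1 0 0 * β.1 1 1 - β.1 0 1 * β.1 1 0 = 1 := by
  rw [← Matrix.det_fin_two]; exact β.2

lemma moebius_denom_ne_zero {β : Matrix.SpecialLinearGroup (Fin 2) F} (hd : β.1 1 1 ≠ 0)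
    (w : (F →+* ℝ) → UpperHalfPlane) (τ : F →+* ℝ) :
    ((τ (β.1 1 0) : ℝ) : ℂ) * (w τ : ℂ) + ((τ (β.1 1 1) : ℝ) : ℂ) ≠ 0 := by
  intro h
  have h1 := congrArg Complex.im h
  have h2 := congrArg Complex.re h
  simp only [Complex.add_im, Complex.re_ofReal_mul, Complex.im_ofReal_mul, Complex.ofReal_im, add_zero, Complex.zero_im,
    Complex.add_re, Complex.ofReal_re, Complex.zero_re] at h1 h2
  rcases mul_eq_zero.1 h1 with h3 | h3
  · rw [h3] at h2
    simp only [zero_mul, zero_add, map_eq_zero] at h2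
    exact hd h2
  · exact absurd h3 (w τ).im_pos.ne'

lemma moebius_identity {a b c d z : ℂ} (h : c * z + d ≠ 0) (hdet : a * d - b * c = 1) :
    (a * z + b) / (c * z + d) * d ^ 2 = b * d + d * z / (c * z + d) := by
  rw [div_mul_eq_mul_div, div_eq_iff h, add_mul (b * d), div_mul_cancel₀ _ h]
  linear_combination d * z * hdet

lemma moebius_eq_innerPoint {β : Matrix.SpecialLinearGroup (Fin 2) F} (hd : β.1 1 1 ≠ 0)
    (w : (F →+* ℝ) → UpperHalfPlane) (τ : F →+* ℝ) :
    ((moebius β w τ : UpperHalfPlane) : ℂ) * ((τ (β.1 1 1) : ℝ) : ℂ) ^ 2 =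
      ((τ (β.1 0 1 * β.1 1 1) : ℝ) : ℂ) + innerPoint β w τ := by
  have h0 := moebius_denom_ne_zero hd w τ
  have hd' : ((τ (β.1 1 1) : ℝ) : ℂ) ≠ 0 := by simpa using hd
  have hw := (w τ).ne_zero
  have hdet : ((τ (β.1 0 0) : ℝ) : ℂ) * ((τ (β.1 1 1) : ℝ) : ℂ) -
      ((τ (β.1 0 1) : ℝ) : ℂ) * ((τ (β.1 1 0) : ℝ) : ℂ) = 1 := by
    have := congrArg (fun x : F => ((τ x : ℝ) : ℂ)) (det_entries β)
    simpa using this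
  have e : innerPoint β w τ = ((τ (β.1 1 1) : ℝ) : ℂ) * (w τ : ℂ) /
      (((τ (β.1 1 0) : ℝ) : ℂ) * (w τ : ℂ) + ((τ (β.1 1 1) : ℝ) : ℂ)) := by
    rw [innerPoint, map_div₀, Complex.ofReal_div, inv_eq_iff_eq_inv, inv_div]
    field_simp
    ring
  rw [coe_moebius, e, map_mul, Complex.ofReal_mul]
  exact moebius_identity h0 hdet

/-- This identity merges the factors `d^k` from rescaling, `w'^(-k)` from Poisson summation at `w'`
and `w^k` from Poisson summation at `w` into `j(β, w)^𝐤`. -/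
lemma innerPoint_inv_mul {β : Matrix.SpecialLinearGroup (Fin 2) F} (hd : β.1 1 1 ≠ 0)
    (w : (F →+* ℝ) → UpperHalfPlane) (τ : F →+* ℝ) :
    ((τ (β.1 1 1) : ℝ) : ℂ) * (innerPoint β w τ)⁻¹ =
      (((τ (β.1 1 0) : ℝ) : ℂ) * (w τ : ℂ) + ((τ (β.1 1 1) : ℝ) : ℂ)) * (w τ : ℂ)⁻¹ := by
  have hd' : ((τ (β.1 1 1) : ℝ) : ℂ) ≠ 0 := by simpa using hd
  have hw := (w τ).ne_zero
  rw [innerPoint, inv_inv, map_div₀, Complex.ofReal_div]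
  field_simp
  ring

end Moebius

/-! ### Finiteness of quotients of lattices -/

section FiniteQuot

set_option linter.unusedSectionVars false

variable {F : Type*} [Field F] [NumberField F] {V : Type*} [AddCommGroup V] [Module F V]
  [Module (𝓞 F) V] [IsScalarTower (𝓞 F) F V]

/-- `M / L` is finite if `L` is a lattice and `M` is finitely generated. -/
lemma IsLattice.finite_quotOf {L M : Submodule (𝓞 F) V} (hL : IsLattice L) (hM : M.FG) :
    Finite (QuotOf L.toAddSubgroup M.toAddSubgroup) := by
  obtain ⟨m, hm, hmL⟩ := hL.exists_nat_smul_le hM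
  have : Module.Finite (𝓞 F) M := Module.Finite.iff_fg.2 hM
  have : Module.Finite ℤ M.toAddSubgroup := Module.Finite.trans (R := ℤ) (𝓞 F) M
  have : Module.Finite ℤ (QuotOf L.toAddSubgroup M.toAddSubgroup) :=
    Module.Finite.of_surjective (QuotientAddGroup.mk' _).toIntLinearMap
      (QuotientAddGroup.mk'_surjective _)
  refine Module.finite_of_fg_torsion _ fun {x} => ?_
  obtain ⟨v, rfl⟩ := QuotientAddGroup.mk_surjective x
  refine ⟨⟨(m : ℤ), mem_nonZeroDivisors_of_ne_zero (by exact_mod_cast hm)⟩, ?_⟩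
  change (m : ℤ) • (QuotientAddGroup.mk v : QuotOf L.toAddSubgroup M.toAddSubgroup) = 0
  rw [← QuotientAddGroup.mk_zsmul, QuotientAddGroup.eq_zero_iff, AddSubgroup.mem_addSubgroupOf]
  have := hmL v v.2
  rw [Nat.cast_smul_eq_nsmul] at this
  simpa using this

end FiniteQuot

/-! ### The theta transformation formula with its Gauss sum -/

namespace QuadCoord

set_option linter.unusedSectionVars false

variable {F : Type*} [Field F] [NumberField F] [NumberField.IsTotallyReal F]
  {V : Type*} [AddCommGroup V] [Module F V]
  [Module (𝓞 F) V] [IsScalarTower (𝓞 F) F V] {n : ℕ} (X : QuadCoord F V n)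

lemma eval_smul {k : (F →+* ℝ) → ℕ} {P : MvPolynomial ((F →+* ℝ) × Fin n) ℂ}
    (hP : IsMultiHarmonic k P) (a : F) (v : V) :
    MvPolynomial.eval (toCVec (X.vec (a • v))) P =
      (∏ τ, ((τ a : ℝ) : ℂ) ^ k τ) * MvPolynomial.eval (toCVec (X.vec v)) P := by
  rw [MvPolynomial.eval_eq', MvPolynomial.eval_eq', Finset.mul_sum]
  refine Finset.sum_congr rfl fun m hm => ?_
  have : ∏ p, toCVec (X.vec (a • v)) p ^ m p =
      (∏ τ, ((τ a : ℝ) : ℂ) ^ k τ) * ∏ p, toCVec (X.vec v) p ^ m p := by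
    have h1 : ∀ p, toCVec (X.vec (a • v)) p ^ m p =
        ((p.1 a : ℝ) : ℂ) ^ m p * toCVec (X.vec v) p ^ m p := fun p => by
      rw [← mul_pow]; simp [toCVec, vec, X.coord_smul]
    rw [Finset.prod_congr rfl fun p _ => h1 p, Finset.prod_mul_distrib, Fintype.prod_prod_type]
    congr 1
    refine Finset.prod_congr rfl fun τ _ => ?_
    simp only
    rw [Finset.prod_pow_eq_pow_sum, hP.1 m hm τ]
  rw [this]; ring

lemma exp_sum_eq_traceChar (x : F) :
    Complex.exp (Real.pi * Complex.I * ∑ τ : F →+* ℝ, ((τ x : ℝ) : ℂ)) = traceChar (x / 2) := by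
  have h := trace_eq_sum_realEmb (F := F) (x / 2)
  rw [traceChar]
  congr 1
  have h' : ((Algebra.trace ℚ F (x / 2) : ℚ) : ℂ) = ∑ τ : F →+* ℝ, ((τ (x / 2) : ℝ) : ℂ) := by
    rw [← Complex.ofReal_sum, ← h]; simp
  rw [h']
  simp only [map_div₀, map_ofNat, Complex.ofReal_div, Complex.ofReal_ofNat]
  rw [← Finset.sum_div]
  ring

/-- Translating the argument of the Gaussian by real numbers. -/
lemma term_of_eq_add {z z' : (F →+* ℝ) → ℂ} {x : F} (h : ∀ τ, z τ = ((τ x : ℝ) : ℂ) + z' τ)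
    (P : MvPolynomial ((F →+* ℝ) × Fin n) ℂ) (v : V) :
    X.term z P v = traceChar (x / 2 * X.form v v) * X.term z' P v := by
  rw [term, term, polyGauss, polyGauss, X.gaussC_vec (fun τ => z τ), X.gaussC_vec (fun τ => z' τ)]
  have : Complex.exp (Real.pi * Complex.I * ∑ τ, z τ * ((τ (X.form v v) : ℝ) : ℂ)) =
      traceChar (x / 2 * X.form v v) *
        Complex.exp (Real.pi * Complex.I * ∑ τ, z' τ * ((τ (X.form v v) : ℝ) : ℂ)) := by
    have e : x / 2 * X.form v v = (x * X.form v v) / 2 := by ring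
    rw [e, ← exp_sum_eq_traceChar, ← Complex.exp_add, ← mul_add, ← Finset.sum_add_distrib]
    congr 2
    refine Finset.sum_congr rfl fun τ _ => ?_
    rw [h τ]
    push_cast [map_mul]
    ring
  rw [this]; ring

lemma term_smul {k : (F →+* ℝ) → ℕ} {P : MvPolynomial ((F →+* ℝ) × Fin n) ℂ}
    (hP : IsMultiHarmonic k P) (z : (F →+* ℝ) → ℂ) (a : F) (v : V) :
    X.term z P (a • v) = (∏ τ, ((τ a : ℝ) : ℂ) ^ k τ) *
      X.term (fun τ => z τ * ((τ a : ℝ) : ℂ) ^ 2) P v := by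
  rw [term, term, polyGauss, polyGauss, X.eval_smul hP, X.gaussC_vec (fun τ => z τ),
    X.gaussC_vec (fun τ => z τ * ((τ a : ℝ) : ℂ) ^ 2), mul_assoc]
  have (τ : F →+* ℝ) : z τ * ((τ (X.form (a • v) (a • v)) : ℝ) : ℂ) =
      z τ * ((τ a : ℝ) : ℂ) ^ 2 * ((τ (X.form v v) : ℝ) : ℂ) := by
    simp only [map_smul, LinearMap.smul_apply, smul_eq_mul, map_mul]
    push_cast
    ring
  simp only [this]

/-- The lattice `d⁻¹ 𝔞⁻¹ L`. -/
abbrev gaussLattice (𝔞 : FractionalIdeal (𝓞 F)⁰ F) (d : F) (L : Submodule (𝓞 F) V) :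
    Submodule (𝓞 F) V := scaleLattice d (colonLattice 𝔞 L)

/-- The Gauss sum `∑_{v ∈ d⁻¹𝔞⁻¹L/L} ψ(b d q(v) / 2)`. -/
def gaussSum (𝔞 : FractionalIdeal (𝓞 F)⁰ F) (b d : F) (L : Submodule (𝓞 F) V) : ℂ :=
  quotSum L.toAddSubgroup (gaussLattice 𝔞 d L).toAddSubgroup
    fun v => traceChar (b * d / 2 * X.form v v)

/-- After expanding the form at `v + l`, the increments are `b/2` times elements of `𝔞⁻¹`: `d (v,
l)` lies there because `𝔞 d v ⊆ L` and the form is integral on `L`, and `d (l, l)` because `d ∈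
𝔞⁻¹`. The condition on `b` gives them integral trace. -/
lemma periodicOn_gauss {𝔞 : FractionalIdeal (𝓞 F)⁰ F} {L : Submodule (𝓞 F) V} (h𝔞 : 𝔞 ≠ 0) {b d : F}
    (hb : ∀ x ∈ 𝔞⁻¹, b * x / 2 ∈ integralTrace F) (hd : d ∈ 𝔞⁻¹)
    (hint : ∀ u ∈ L, ∀ v ∈ L, X.form u v ∈ (1 : FractionalIdeal (𝓞 F)⁰ F)) :
    PeriodicOn L.toAddSubgroup (gaussLattice 𝔞 d L).toAddSubgroup
      fun v => traceChar (b * d / 2 * X.form v v) := by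
  intro v hv l hl
  have hv' : ∀ a ∈ 𝔞, a • d • v ∈ L := hv
  have h1 : d * X.form v l ∈ 𝔞⁻¹ := by
    rw [FractionalIdeal.mem_inv_iff h𝔞]
    intro a ha
    have := hint _ (hv' a ha) l hl
    rw [map_smul, map_smul, LinearMap.smul_apply, LinearMap.smul_apply, smul_eq_mul, smul_eq_mul] at this
    rwa [mul_comm]
  have h2 : d * X.form l l ∈ 𝔞⁻¹ := by
    rw [FractionalIdeal.mem_inv_iff h𝔞] at hd ⊢
    intro a ha
    have := FractionalIdeal.mul_mem_mul (hd a ha) (hint l hl l hl)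
    rw [one_mul] at this
    convert this using 1
    ring
  have e : b * d / 2 * X.form (v + l) (v + l) = b * d / 2 * X.form v v +
      ((b * (d * X.form v l) / 2 + b * (d * X.form v l) / 2) + b * (d * X.form l l) / 2) := by
    simp only [map_add, LinearMap.add_apply, X.form_comm l v]
    ring
  simp only
  rw [e]
  exact traceChar_add_of_mem (add_mem (add_mem (hb _ h1) (hb _ h1)) (hb _ h2))

/-- The theta series of `𝔞⁻¹ L` at `β w` in terms of the theta series of `L` at `w`. -/
theorem hasSum_theta_moebius {𝔞 : FractionalIdeal (𝓞 F)⁰ F} (h𝔞 : 𝔞 ≠ 0) {L : Submodule (𝓞 F) V}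
    (hL : IsLattice L) (hint : ∀ u ∈ L, ∀ v ∈ L, X.form u v ∈ (1 : FractionalIdeal (𝓞 F)⁰ F))
    {β : Matrix.SpecialLinearGroup (Fin 2) F} (ha : β.1 0 0 ∈ 𝔞)
    (hb : ∀ x ∈ 𝔞⁻¹, β.1 0 1 * x / 2 ∈ integralTrace F) (hd : β.1 1 1 ∈ 𝔞⁻¹) (hd0 : β.1 1 1 ≠ 0)
    (hc1 : ∀ u ∈ X.dual L, β.1 1 0 • u ∈ colonLattice 𝔞 L)
    (hc2 : ∀ u ∈ X.dual L, β.1 0 0 * β.1 1 0 / 2 * X.form u u ∈ integralTrace F)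
    {k : (F →+* ℝ) → ℕ} {P : MvPolynomial ((F →+* ℝ) × Fin n) ℂ} (hP : IsMultiHarmonic k P)
    (w : (F →+* ℝ) → UpperHalfPlane) :
    HasSum (fun y : colonLattice 𝔞 L => X.term (fun τ => (moebius β w τ : ℂ)) P y)
      (X.gaussSum 𝔞 (β.1 0 1) (β.1 1 1) L *
        (halfRoot (fun τ => (w τ : ℂ)) / halfRoot (innerPoint β w)) ^ n * autFactor k β w *
        ∑' l : L, X.term (fun τ => (w τ : ℂ)) P l) := by
  set a := β.1 0 0 with ha_def
  set b := β.1 0 1 with hb_def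
  set c := β.1 1 0 with hc_def
  set d := β.1 1 1 with hd_def
  have hdet : a * d - b * c = 1 := det_entries β
  set M := gaussLattice 𝔞 d L with hM
  have hMl : IsLattice M := (hL.colon h𝔞).scale hd0
  have hLM : L ≤ M := fun v hv a' ha' => by
    rw [smul_smul]
    obtain ⟨x, hx⟩ := (FractionalIdeal.mem_one_iff _).1 ((FractionalIdeal.mem_inv_iff h𝔞).1 hd a' ha')
    rw [mul_comm, ← hx]
    exact int_smul_mem L x hv
  have hfin : Finite (QuotOf L.toAddSubgroup M.toAddSubgroup) := hL.finite_quotOf hMl.1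
  have := Fintype.ofFinite (QuotOf L.toAddSubgroup M.toAddSubgroup)
  have hper := X.periodicOn_gauss h𝔞 hb hd hint
  have hw : ∀ τ, 0 < ((w τ : ℂ)).im := fun τ => (w τ).im_pos
  have hw' := innerPoint_im_pos β w
  obtain ⟨r, u, κ, hu, hsum⟩ := X.exists_hasSum_term hL
  -- the sum over `M` as a sum over `M / L`
  set f : V → ℂ := fun v => traceChar (b * d / 2 * X.form v v) with hf
  have h1 : HasSum (fun v : M => f v * X.term (innerPoint β w) P v)
      (∑ r : QuotOf L.toAddSubgroup M.toAddSubgroup, f (quotRep r) *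
        ∑' l : L, X.term (innerPoint β w) P (quotRep r + l)) := hasSum_quot (L := L.toAddSubgroup) (M := M.toAddSubgroup) hLM hper
    (fun v => X.summable_term hL hw' P v)
  set G := X.gaussSum 𝔞 b d L with hG
  -- completing the square
  have hsq : ∀ m, ∑ r : QuotOf L.toAddSubgroup M.toAddSubgroup,
      f (quotRep r) * traceChar (X.form (u m) (quotRep r)) =
        traceChar (c / d / 2 * X.form (u m) (u m)) * G := by
    intro m
    have hv₀ : (c / d) • u m ∈ M.toAddSubgroup := by
      change d • (c / d) • u m ∈ colonLattice 𝔞 L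
      rw [smul_smul, mul_div_cancel₀ _ hd0]
      exact hc1 _ (hu m)
    have hper2 : PeriodicOn L.toAddSubgroup M.toAddSubgroup
        (fun v => f v * traceChar (X.form (u m) v)) := by
      intro v hv l hl
      simp only
      rw [hper v hv l hl, map_add, traceChar_add_of_mem (hu m l hl)]
    have h2 := quotSum_shift hper2 hv₀
    have h3 : ∀ v ∈ M.toAddSubgroup, f (v + (c / d) • u m) *
        traceChar (X.form (u m) (v + (c / d) • u m)) =
          traceChar (c / d / 2 * X.form (u m) (u m)) * f v := by
      intro v hv
      have hv' : ∀ a' ∈ 𝔞, a' • d • v ∈ L := hv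
      have e1 : X.form (u m) (a • d • v) ∈ integralTrace F := hu m _ (hv' a ha)
      have e2 := hc2 _ (hu m)
      rw [hf]
      simp only
      rw [← traceChar_add, ← traceChar_add]
      -- As `b c + 1 = a d`, the cross terms collapse to the pairing of `u` with `a d v ∈ L`. The
      -- coefficient of `(u, u)` is `(c / 2d)(b c + 2) = c / 2d + a c / 2`, of which the second part
      -- has integral trace by `hc2`.
      have e : b * d / 2 * X.form (v + (c / d) • u m) (v + (c / d) • u m) +
          X.form (u m) (v + (c / d) • u m) =
          (c / d / 2 * X.form (u m) (u m) + b * d / 2 * X.form v v) +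
            (X.form (u m) (a • d • v) + a * c / 2 * X.form (u m) (u m)) := by
        simp only [map_add, map_smul, LinearMap.add_apply, LinearMap.smul_apply, smul_eq_mul,
          X.form_comm v (u m)]
        field_simp
        linear_combination (X.form (u m) (u m) * c * (-1) - 2 * d * X.form (u m) v) * hdet
      rw [e]
      exact traceChar_add_of_mem (add_mem e1 e2)
    rw [quotSum_congr h3, quotSum_mul_left] at h2
    rw [hG, gaussSum, h2, quotSum, finsum_eq_sum_of_fintype]
  have h4 : HasSum (fun m => ∑ r : QuotOf L.toAddSubgroup M.toAddSubgroup, f (quotRep r) *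
      (κ * (halfRoot (innerPoint β w) ^ n)⁻¹ * (∏ τ, (innerPoint β w τ)⁻¹ ^ k τ) *
        (X.term (fun τ => -(innerPoint β w τ)⁻¹) P (u m) * traceChar (X.form (u m) (quotRep r)))))
      (∑ r : QuotOf L.toAddSubgroup M.toAddSubgroup, f (quotRep r) *
        ∑' l : L, X.term (innerPoint β w) P (quotRep r + l)) :=
    hasSum_sum fun r _ => (hsum _ hw' k P hP (quotRep r)).mul_left _
  have h5 := hsum _ hw k P hP 0
  simp only [map_zero, traceChar_zero, mul_one, zero_add] at h5
  have hs0 := halfRoot_ne_zero hw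
  have h6 := h5.mul_left (G * (halfRoot (fun τ => (w τ : ℂ)) / halfRoot (innerPoint β w)) ^ n *
    ∏ τ, ((w τ : ℂ) * (innerPoint β w τ)⁻¹) ^ k τ)
  have hval : (∑ r : QuotOf L.toAddSubgroup M.toAddSubgroup, f (quotRep r) *
        ∑' l : L, X.term (innerPoint β w) P (quotRep r + l)) =
      G * (halfRoot (fun τ => (w τ : ℂ)) / halfRoot (innerPoint β w)) ^ n *
        (∏ τ, ((w τ : ℂ) * (innerPoint β w τ)⁻¹) ^ k τ) *
          ∑' l : L, X.term (fun τ => (w τ : ℂ)) P l := by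
    -- Both expansions run over the same dual vectors `u m` with the same constant `κ`, so they are
    -- compared term by term. The Gaussians match because `-1/w = c/d - 1/w'`, and the resulting
    -- character is the one left over by completing the square.
    refine h4.unique (h6.congr_fun fun m => ?_)
    have e1 : X.term (fun τ => -(w τ : ℂ)⁻¹) P (u m) =
        traceChar (c / d / 2 * X.form (u m) (u m)) *
          X.term (fun τ => -(innerPoint β w τ)⁻¹) P (u m) :=
      X.term_of_eq_add (fun τ => by rw [neg_inv_innerPoint]; ring) P (u m)
    have e2 : ∀ r : QuotOf L.toAddSubgroup M.toAddSubgroup, f (quotRep r) *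
        (κ * (halfRoot (innerPoint β w) ^ n)⁻¹ * (∏ τ, (innerPoint β w τ)⁻¹ ^ k τ) *
        (X.term (fun τ => -(innerPoint β w τ)⁻¹) P (u m) * traceChar (X.form (u m) (quotRep r)))) =
        (κ * (halfRoot (innerPoint β w) ^ n)⁻¹ * (∏ τ, (innerPoint β w τ)⁻¹ ^ k τ) *
        X.term (fun τ => -(innerPoint β w τ)⁻¹) P (u m)) *
          (f (quotRep r) * traceChar (X.form (u m) (quotRep r))) := fun r => by ring
    have e3 : ∏ τ, ((w τ : ℂ) * (innerPoint β w τ)⁻¹) ^ k τ * (w τ : ℂ)⁻¹ ^ k τ =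
        ∏ τ, (innerPoint β w τ)⁻¹ ^ k τ := by
      refine Finset.prod_congr rfl fun τ _ => ?_
      rw [← mul_pow, mul_right_comm, mul_inv_cancel₀ (w τ).ne_zero, one_mul]
    rw [Finset.sum_congr rfl fun r _ => e2 r, ← Finset.mul_sum, hsq m, e1, ← e3,
      Finset.prod_mul_distrib, div_pow]
    field_simp
  rw [hval] at h1
  -- the substitution `y = d v`
  let g : M ≃ colonLattice 𝔞 L :=
    { toFun := fun v => ⟨d • (v : V), v.2⟩
      invFun := fun y => ⟨d⁻¹ • (y : V), by
        change d • d⁻¹ • (y : V) ∈ colonLattice 𝔞 L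
        rw [smul_smul, mul_inv_cancel₀ hd0, one_smul]; exact y.2⟩
      left_inv := fun v => Subtype.ext (by simp [smul_smul, inv_mul_cancel₀ hd0])
      right_inv := fun v => Subtype.ext (by simp [smul_smul, mul_inv_cancel₀ hd0]) }
  rw [← g.hasSum_iff]
  have h7 := h1.mul_left (∏ τ, ((τ d : ℝ) : ℂ) ^ k τ)
  have e4 : (∏ τ, ((τ d : ℝ) : ℂ) ^ k τ) * ∏ τ, ((w τ : ℂ) * (innerPoint β w τ)⁻¹) ^ k τ =
      autFactor k β w := by
    rw [autFactor, ← Finset.prod_mul_distrib]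
    refine Finset.prod_congr rfl fun τ _ => ?_
    rw [← mul_pow, mul_left_comm, innerPoint_inv_mul hd0, mul_comm, mul_assoc,
      inv_mul_cancel₀ (w τ).ne_zero, mul_one]
  have e5 : G * (halfRoot (fun τ => (w τ : ℂ)) / halfRoot (innerPoint β w)) ^ n * autFactor k β w *
      ∑' l : L, X.term (fun τ => (w τ : ℂ)) P l = (∏ τ, ((τ d : ℝ) : ℂ) ^ k τ) *
      (G * (halfRoot (fun τ => (w τ : ℂ)) / halfRoot (innerPoint β w)) ^ n *
        (∏ τ, ((w τ : ℂ) * (innerPoint β w τ)⁻¹) ^ k τ) *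
          ∑' l : L, X.term (fun τ => (w τ : ℂ)) P l) := by
    rw [← e4]; ring
  rw [e5]
  refine h7.congr_fun fun v => ?_
  simp only [Function.comp, g, Equiv.coe_fn_mk]
  rw [X.term_smul hP, X.term_of_eq_add (z' := innerPoint β w) (x := b * d)
    (fun τ => moebius_eq_innerPoint hd0 w τ)]

end QuadCoord

/-! ## Binary forms over finite rings -/

section FiniteRing

variable {A : Type*} [CommRing A] [Finite A]

/-- In a finite ring in which `2` is invertible, `1 + n` is a square for nilpotent `n`. -/
lemma exists_sq_eq_one_add (h2 : IsUnit (2 : A)) {n : A} (hn : IsNilpotent n) :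
    ∃ s : A, IsUnit s ∧ s ^ 2 = 1 + n := by
  let U := {u : A // IsNilpotent u}
  let g : U → U := fun u => ⟨u.1 * (2 + u.1), (Commute.all _ _).isNilpotent_mul_right u.2⟩
  -- The difference of two values is `(u - v)(2 + u + v)`, whose second factor is a unit. On the
  -- finite set of nilpotents `u ↦ u (2 + u) = (1 + u)² - 1` is therefore also surjective.
  have hg : Function.Injective g := by
    intro u v huv
    have h1 : u.1 * (2 + u.1) = v.1 * (2 + v.1) := congrArg Subtype.val huv
    have h3 : (u.1 - v.1) * (2 + (u.1 + v.1)) = 0 := by linear_combination h1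
    have h4 : IsUnit (2 + (u.1 + v.1)) := by
      rw [add_comm]
      exact ((Commute.all _ _).isNilpotent_add u.2 v.2).isUnit_add_right_of_commute h2 (Commute.all _ _)
    exact Subtype.ext (sub_eq_zero.1 (h4.mul_left_eq_zero.1 h3))
  obtain ⟨u, hu⟩ := Finite.surjective_of_injective hg ⟨n, hn⟩
  refine ⟨1 + u.1, IsNilpotent.isUnit_one_add u.2, ?_⟩
  have : u.1 * (2 + u.1) = n := congrArg Subtype.val hu
  rw [← this]; ring

/-- In a finite ring in which `2` is invertible, binary forms `x² - α y²` with `α` a unit represent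
all units. -/
theorem exists_sq_sub_mul_sq (h2 : IsUnit (2 : A)) {α β : A} (hα : IsUnit α) (hβ : IsUnit β) :
    ∃ x y : A, x ^ 2 - α * y ^ 2 = β := by
  -- Residue fields have odd characteristic, where a pigeonhole count solves `x² - α y² = β`.
  have key : ∀ I : MaximalSpectrum A, ∃ x y : A ⧸ I.asIdeal,
      x ^ 2 - Ideal.Quotient.mk _ α * y ^ 2 = Ideal.Quotient.mk _ β := by
    intro I
    have := I.isMaximal
    let _ : Field (A ⧸ I.asIdeal) := Ideal.Quotient.field I.asIdeal
    have : Fintype (A ⧸ I.asIdeal) :=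
      @Fintype.ofFinite _ (Finite.of_surjective _ (Ideal.Quotient.mk_surjective (I := I.asIdeal)))
    have h2' : IsUnit (2 : A ⧸ I.asIdeal) := by
      have := h2.map (Ideal.Quotient.mk I.asIdeal)
      rwa [map_ofNat] at this
    have hodd : Fintype.card (A ⧸ I.asIdeal) % 2 = 1 := by
      refine FiniteField.odd_card_of_char_ne_two fun h => ?_
      have := ringChar.spec (A ⧸ I.asIdeal) 2
      rw [h] at this
      exact h2'.ne_zero (by exact_mod_cast this.2 dvd_rfl)
    have hα' : Ideal.Quotient.mk I.asIdeal α ≠ 0 := (hα.map (Ideal.Quotient.mk I.asIdeal)).ne_zero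
    obtain ⟨x, y, h⟩ := FiniteField.exists_root_sum_quadratic
      (f := Polynomial.X ^ 2 - Polynomial.C (Ideal.Quotient.mk I.asIdeal β))
      (g := Polynomial.C (-Ideal.Quotient.mk I.asIdeal α) * Polynomial.X ^ 2)
      (Polynomial.degree_X_pow_sub_C (by norm_num) _)
      (Polynomial.degree_C_mul_X_pow 2 (neg_ne_zero.2 hα')) hodd
    refine ⟨x, y, ?_⟩
    simp only [Polynomial.eval_sub, Polynomial.eval_pow, Polynomial.eval_X, Polynomial.eval_C,
      Polynomial.eval_mul] at h
    linear_combination h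
  choose x y hxy using key
  -- Modulo its nilradical a finite ring is the product of its residue fields, so the local
  -- solutions lift simultaneously with nilpotent error.
  obtain ⟨x₀, hx₀⟩ := Ideal.Quotient.mk_surjective ((IsArtinianRing.quotNilradicalEquivPi A).symm x)
  obtain ⟨y₀, hy₀⟩ := Ideal.Quotient.mk_surjective ((IsArtinianRing.quotNilradicalEquivPi A).symm y)
  have hx : ∀ I : MaximalSpectrum A, Ideal.Quotient.mk I.asIdeal x₀ = x I := fun I => by
    have : (IsArtinianRing.quotNilradicalEquivPi A) (Ideal.Quotient.mk _ x₀) = x := by rw [hx₀, AlgEquiv.apply_symm_apply]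
    rw [← this]; rfl
  have hy : ∀ I : MaximalSpectrum A, Ideal.Quotient.mk I.asIdeal y₀ = y I := fun I => by
    have : (IsArtinianRing.quotNilradicalEquivPi A) (Ideal.Quotient.mk _ y₀) = y := by rw [hy₀, AlgEquiv.apply_symm_apply]
    rw [← this]; rfl
  have hnil : IsNilpotent (x₀ ^ 2 - α * y₀ ^ 2 - β) := by
    rw [← mem_nilradical, ← Ideal.Quotient.eq_zero_iff_mem,
      ← (IsArtinianRing.quotNilradicalEquivPi A).map_eq_zero_iff]
    funext I
    change Ideal.Quotient.mk I.asIdeal (x₀ ^ 2 - α * y₀ ^ 2 - β) = 0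
    rw [map_sub, map_sub, map_mul, map_pow, map_pow, hx, hy, hxy, sub_self]
  -- The represented value is `β (1 + nilpotent) = β s²`; dividing `x₀` and `y₀` by `s` makes it
  -- exact.
  obtain ⟨β', hβ'⟩ := hβ.exists_right_inv
  obtain ⟨s, hs, hs2⟩ := exists_sq_eq_one_add h2
    ((Commute.all β' _).isNilpotent_mul_left hnil)
  obtain ⟨s', hs'⟩ := hs.exists_right_inv
  refine ⟨x₀ * s', y₀ * s', ?_⟩
  have e : x₀ ^ 2 - α * y₀ ^ 2 = β * s ^ 2 := by
    rw [hs2]; linear_combination (-(x₀ ^ 2 - α * y₀ ^ 2 - β)) * hβ'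
  calc (x₀ * s') ^ 2 - α * (y₀ * s') ^ 2 = (x₀ ^ 2 - α * y₀ ^ 2) * s' ^ 2 := by ring
    _ = β * (s * s') ^ 2 := by rw [e]; ring
    _ = β := by rw [hs']; ring

end FiniteRing

/-! ## Quadratic Gauss sums -/

section GaussSums

set_option linter.unusedSectionVars false

variable {F : Type*} [Field F] [NumberField F]

/-- The ideal of those integers which carry a submodule of `F` into `𝓞 F`. -/
def conductorIdeal (M : Submodule (𝓞 F) F) : Ideal (𝓞 F) where
  carrier := {a | ∀ x ∈ M, algebraMap (𝓞 F) F a * x ∈ (1 : Submodule (𝓞 F) F)}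
  add_mem' ha hb x hx := by
    rw [map_add, add_mul]; exact add_mem (ha x hx) (hb x hx)
  zero_mem' x _ := by simp
  smul_mem' c a ha x hx := by
    rw [smul_eq_mul, map_mul, mul_assoc]; exact int_smul_mem _ c (ha x hx)

lemma mem_conductorIdeal {M : Submodule (𝓞 F) F} {a : 𝓞 F} :
    a ∈ conductorIdeal M ↔ ∀ x ∈ M, algebraMap (𝓞 F) F a * x ∈ (1 : Submodule (𝓞 F) F) := Iff.rfl

lemma isLattice_one : IsLattice (1 : Submodule (𝓞 F) F) := by
  refine ⟨?_, ?_⟩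
  · rw [Submodule.one_eq_span]; exact Submodule.fg_span_singleton 1
  · rw [eq_top_iff]
    intro x _
    have : x = x • (1 : F) := by simp
    rw [this]
    exact Submodule.smul_mem _ _ (Submodule.subset_span (Submodule.mem_one.2 ⟨1, map_one _⟩))

lemma coe_mem_one (a : 𝓞 F) : (a : F) ∈ (1 : Submodule (𝓞 F) F) := Submodule.mem_one.2 ⟨a, rfl⟩

variable (M : Submodule (𝓞 F) F) (θ : F)

/-- The Gauss sum `∑_{x ∈ M/𝓞_F} ψ(θ α x²)`. -/
def scalarGauss (α : 𝓞 F) : ℂ :=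
  quotSum (1 : Submodule (𝓞 F) F).toAddSubgroup M.toAddSubgroup fun x => traceChar (θ * (α * x ^ 2))

/-- `a` is invertible on `M / 𝓞_F`. -/
def IsInvertibleOn (a : 𝓞 F) : Prop := ∃ b, a * b - 1 ∈ conductorIdeal M

variable {M θ}

lemma IsInvertibleOn.mul {a b : 𝓞 F} (ha : IsInvertibleOn M a) (hb : IsInvertibleOn M b) :
    IsInvertibleOn M (a * b) := by
  obtain ⟨a', ha⟩ := ha
  obtain ⟨b', hb⟩ := hb
  refine ⟨a' * b', ?_⟩
  have : a * b * (a' * b') - 1 = a * a' * (b * b' - 1) + (a * a' - 1) := by ring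
  rw [this]
  exact add_mem (Ideal.mul_mem_left _ _ hb) ha

lemma isInvertibleOn_iff {a : 𝓞 F} :
    IsInvertibleOn M a ↔ IsUnit (Ideal.Quotient.mk (conductorIdeal M) a) := by
  rw [isUnit_iff_exists_inv]
  constructor
  · rintro ⟨b, hb⟩
    refine ⟨Ideal.Quotient.mk _ b, ?_⟩
    rw [← map_mul, ← map_one (Ideal.Quotient.mk (conductorIdeal M)), Ideal.Quotient.eq]
    exact hb
  · rintro ⟨b, hb⟩
    obtain ⟨b, rfl⟩ := Ideal.Quotient.mk_surjective b
    rw [← map_mul, ← map_one (Ideal.Quotient.mk (conductorIdeal M)), Ideal.Quotient.eq] at hb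
    exact ⟨b, hb⟩

lemma conductorIdeal_ne_bot (hM : M.FG) : conductorIdeal M ≠ ⊥ := by
  obtain ⟨m, hm, h⟩ := (isLattice_one (F := F)).exists_nat_smul_le hM
  intro h0
  have : (m : 𝓞 F) ∈ conductorIdeal M := fun x hx => by simpa using h x hx
  rw [h0, Ideal.mem_bot] at this
  exact hm (by exact_mod_cast this)

lemma exists_sq_sub_mul_sq_mem (hM : M.FG) (h2 : IsInvertibleOn M 2) {α β : 𝓞 F}
    (hα : IsInvertibleOn M α) (hβ : IsInvertibleOn M β) :
    ∃ x y : 𝓞 F, x ^ 2 - α * y ^ 2 - β ∈ conductorIdeal M := by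
  have : Finite (𝓞 F ⧸ conductorIdeal M) :=
    Ideal.finiteQuotientOfFreeOfNeBot _ (conductorIdeal_ne_bot hM)
  have h2' := isInvertibleOn_iff.1 h2
  rw [map_ofNat] at h2'
  obtain ⟨x, y, h⟩ := exists_sq_sub_mul_sq h2' (isInvertibleOn_iff.1 hα) (isInvertibleOn_iff.1 hβ)
  obtain ⟨x, rfl⟩ := Ideal.Quotient.mk_surjective x
  obtain ⟨y, rfl⟩ := Ideal.Quotient.mk_surjective y
  refine ⟨x, y, ?_⟩
  rw [← Ideal.Quotient.eq]
  simpa using h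

lemma smul_mem' (a : 𝓞 F) {x : F} {N : Submodule (𝓞 F) F} (hx : x ∈ N) : (a : F) * x ∈ N :=
  int_smul_mem N a hx

/-- A `2 × 2` matrix with invertible determinant preserves sums over `(M/𝓞_F)²`. -/
lemma quotSum_matrix {p q r s : 𝓞 F} (hdet : IsInvertibleOn M (p * s - q * r))
    {f f' : F × F → ℂ}
    (hf' : PeriodicOn ((1 : Submodule (𝓞 F) F).toAddSubgroup.prod (1 : Submodule (𝓞 F) F).toAddSubgroup)
      (M.toAddSubgroup.prod M.toAddSubgroup) f')
    (h : ∀ u ∈ M, ∀ v ∈ M, f' (p * u + q * v, r * u + s * v) = f (u, v)) :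
    quotSum ((1 : Submodule (𝓞 F) F).toAddSubgroup.prod (1 : Submodule (𝓞 F) F).toAddSubgroup)
      (M.toAddSubgroup.prod M.toAddSubgroup) f =
    quotSum ((1 : Submodule (𝓞 F) F).toAddSubgroup.prod (1 : Submodule (𝓞 F) F).toAddSubgroup)
      (M.toAddSubgroup.prod M.toAddSubgroup) f' := by
  obtain ⟨e, he⟩ := hdet
  have he' : ∀ x ∈ M, ((p * s - q * r : 𝓞 F) : F) * (e * x) - x ∈ (1 : Submodule (𝓞 F) F) := by
    intro x hx
    have := he x hx
    simp only [map_sub, map_mul, map_one] at this ⊢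
    convert this using 1
    ring
  -- The adjugate matrix times the inverse `e` of the determinant undoes the substitution modulo
  -- `𝓞_F`.
  have key : ∀ u ∈ M, ∀ v ∈ M, (p * u + q * v : F) ∈ (1 : Submodule (𝓞 F) F) →
      (r * u + s * v : F) ∈ (1 : Submodule (𝓞 F) F) → u ∈ (1 : Submodule (𝓞 F) F) ∧
        v ∈ (1 : Submodule (𝓞 F) F) := by
    intro u hu v hv h1 h2
    constructor
    · have := sub_mem (smul_mem' e (sub_mem (smul_mem' s h1) (smul_mem' q h2))) (he' u hu)
      convert this using 1
      simp only [map_sub, map_mul]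
      ring
    · have := sub_mem (smul_mem' e (sub_mem (smul_mem' p h2) (smul_mem' r h1))) (he' v hv)
      convert this using 1
      simp only [map_sub, map_mul]
      ring
  refine quotSum_eq_of_map (fun v : F × F => ((p * v.1 + q * v.2, r * v.1 + s * v.2) : F × F))
    ?_ ?_ ?_ hf' ?_
  · intro v hv
    obtain ⟨h1, h2⟩ := AddSubgroup.mem_prod.1 hv
    exact AddSubgroup.mem_prod.2 ⟨add_mem (smul_mem' (N := M) p h1) (smul_mem' (N := M) q h2),
      add_mem (smul_mem' (N := M) r h1) (smul_mem' (N := M) s h2)⟩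
  · intro v hv w hw
    obtain ⟨h1, h2⟩ := AddSubgroup.mem_prod.1 hv
    obtain ⟨h3, h4⟩ := AddSubgroup.mem_prod.1 hw
    have e1 : (p * w.1 + q * w.2 : F) - (p * v.1 + q * v.2) = p * (w.1 - v.1) + q * (w.2 - v.2) := by ring
    have e2 : (r * w.1 + s * w.2 : F) - (r * v.1 + s * v.2) = r * (w.1 - v.1) + s * (w.2 - v.2) := by ring
    simp only [AddSubgroup.mem_prod, Prod.fst_sub, Prod.snd_sub]
    rw [e1, e2]
    constructor
    · rintro ⟨h5, h6⟩
      exact key _ (sub_mem h3 h1) _ (sub_mem h4 h2) h5 h6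
    · rintro ⟨h5, h6⟩
      exact ⟨add_mem (smul_mem' (N := 1) p h5) (smul_mem' (N := 1) q h6),
        add_mem (smul_mem' (N := 1) r h5) (smul_mem' (N := 1) s h6)⟩
  · intro v hv
    obtain ⟨h1, h2⟩ := AddSubgroup.mem_prod.1 hv
    refine ⟨(e * (s * v.1 - q * v.2), e * (p * v.2 - r * v.1)), AddSubgroup.mem_prod.2
      ⟨smul_mem' (N := M) e (sub_mem (smul_mem' (N := M) s h1) (smul_mem' (N := M) q h2)),
        smul_mem' (N := M) e (sub_mem (smul_mem' (N := M) p h2) (smul_mem' (N := M) r h1))⟩,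
      AddSubgroup.mem_prod.2 ⟨?_, ?_⟩⟩
    · have := neg_mem (he' _ h1)
      change v.1 - _ ∈ (1 : Submodule (𝓞 F) F)
      convert this using 1
      simp only [map_sub, map_mul]
      ring
    · have := neg_mem (he' _ h2)
      change v.2 - _ ∈ (1 : Submodule (𝓞 F) F)
      convert this using 1
      simp only [map_sub, map_mul]
      ring
  · intro v hv
    obtain ⟨h1, h2⟩ := AddSubgroup.mem_prod.1 hv
    exact h _ h1 _ h2

variable (hθ : ∀ x ∈ M, θ * x ∈ integralTrace F)
include hθ

lemma traceChar_mul_add {x y : F} (hy : y ∈ M) : traceChar (θ * (x + y)) = traceChar (θ * x) := by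
  rw [mul_add]; exact traceChar_add_of_mem (hθ y hy)

lemma mul_mem_of_mem_one {x l : F} (hx : x ∈ M) (hl : l ∈ (1 : Submodule (𝓞 F) F)) : x * l ∈ M := by
  obtain ⟨o, rfl⟩ := Submodule.mem_one.1 hl
  rw [mul_comm]
  exact smul_mem' o hx

lemma periodicOn_scalar (h1M : 1 ≤ M) (α : 𝓞 F) :
    PeriodicOn (1 : Submodule (𝓞 F) F).toAddSubgroup M.toAddSubgroup
      fun x => traceChar (θ * (α * x ^ 2)) := by
  intro x hx l hl
  have e : (α : F) * (x + l) ^ 2 = α * x ^ 2 + α * (x * l + x * l + l * l) := by ring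
  simp only
  rw [e]
  exact traceChar_mul_add hθ (smul_mem' α (add_mem (add_mem (mul_mem_of_mem_one hθ hx hl)
    (mul_mem_of_mem_one hθ hx hl)) (mul_mem_of_mem_one hθ (h1M hl) hl)))

lemma scalarGauss_mul (hM : M.FG) (h1M : 1 ≤ M) (α β : 𝓞 F) :
    scalarGauss M θ α * scalarGauss M θ β =
      quotSum ((1 : Submodule (𝓞 F) F).toAddSubgroup.prod (1 : Submodule (𝓞 F) F).toAddSubgroup)
      (M.toAddSubgroup.prod M.toAddSubgroup)
        fun v => traceChar (θ * (α * v.1 ^ 2)) * traceChar (θ * (β * v.2 ^ 2)) := by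
  have := (isLattice_one (F := F)).finite_quotOf hM
  rw [scalarGauss, scalarGauss, ← quotSum_prod (periodicOn_scalar hθ h1M α) (periodicOn_scalar hθ h1M β)]

lemma periodicOn_prod (h1M : 1 ≤ M) (α β : 𝓞 F) :
    PeriodicOn ((1 : Submodule (𝓞 F) F).toAddSubgroup.prod (1 : Submodule (𝓞 F) F).toAddSubgroup)
      (M.toAddSubgroup.prod M.toAddSubgroup)
        fun v => traceChar (θ * (α * v.1 ^ 2)) * traceChar (θ * (β * v.2 ^ 2)) := by
  intro v hv l hl
  obtain ⟨h1, h2⟩ := AddSubgroup.mem_prod.1 hv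
  obtain ⟨h3, h4⟩ := AddSubgroup.mem_prod.1 hl
  have e1 := periodicOn_scalar hθ h1M α v.1 h1 l.1 h3
  have e2 := periodicOn_scalar hθ h1M β v.2 h2 l.2 h4
  simp only [Prod.fst_add, Prod.snd_add] at e1 e2 ⊢
  rw [e1, e2]

/-- The form `α x² - α y² = α (x - y) · (x + y)` becomes the hyperbolic form `x y`, by a
substitution of determinant `2 α`; the result no longer involves `α`. -/
lemma scalarGauss_mul_neg (hM : M.FG) (h1M : 1 ≤ M) (h2 : IsInvertibleOn M 2) {α : 𝓞 F}
    (hα : IsInvertibleOn M α) :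
    scalarGauss M θ α * scalarGauss M θ (-α) = scalarGauss M θ 1 * scalarGauss M θ (-1) := by
  have key : ∀ α : 𝓞 F, IsInvertibleOn M α → scalarGauss M θ α * scalarGauss M θ (-α) =
      quotSum ((1 : Submodule (𝓞 F) F).toAddSubgroup.prod (1 : Submodule (𝓞 F) F).toAddSubgroup)
        (M.toAddSubgroup.prod M.toAddSubgroup) fun v => traceChar (θ * (v.1 * v.2)) := by
    intro α hα
    rw [scalarGauss_mul hθ hM h1M]
    refine quotSum_matrix (p := α) (q := -α) (r := 1) (s := 1) ?_ ?_ ?_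
    · have : α * 1 - -α * 1 = 2 * α := by ring
      rw [this]
      exact h2.mul hα
    · intro v hv l hl
      obtain ⟨h1, h2⟩ := AddSubgroup.mem_prod.1 hv
      obtain ⟨h3, h4⟩ := AddSubgroup.mem_prod.1 hl
      have e : (v + l).1 * (v + l).2 = v.1 * v.2 + (v.1 * l.2 + v.2 * l.1 + l.1 * l.2) := by
        simp only [Prod.fst_add, Prod.snd_add]; ring
      simp only
      rw [e]
      exact traceChar_mul_add hθ (add_mem (add_mem (mul_mem_of_mem_one hθ h1 h4)
        (mul_mem_of_mem_one hθ h2 h3)) (mul_mem_of_mem_one hθ (h1M h3) h4))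
    · intro u _ v _
      rw [← traceChar_add, ← mul_add]
      congr 2
      simp only [map_neg, map_one]
      ring
  have h1 : IsInvertibleOn M 1 := ⟨1, by simp⟩
  rw [key α hα, key 1 h1]

/-- Modulo the conductor `β` is a norm `x² - α y²`. Multiplication by `x + y √α` then carries the
form `-β (u² - α v²)` to `-(u² - α v²)`. -/
lemma scalarGauss_neg_mul (hM : M.FG) (h1M : 1 ≤ M) (h2 : IsInvertibleOn M 2) {α β : 𝓞 F}
    (hα : IsInvertibleOn M α) (hβ : IsInvertibleOn M β) :
    scalarGauss M θ (-β) * scalarGauss M θ (α * β) = scalarGauss M θ (-1) * scalarGauss M θ α := by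
  obtain ⟨x, y, hxy⟩ := exists_sq_sub_mul_sq_mem hM h2 hα hβ
  rw [scalarGauss_mul hθ hM h1M, scalarGauss_mul hθ hM h1M]
  refine quotSum_matrix (p := x) (q := α * y) (r := y) (s := x) ?_ (periodicOn_prod hθ h1M _ _) ?_
  · obtain ⟨β', hβ'⟩ := hβ
    refine ⟨β', ?_⟩
    have : (x * x - α * y * y) * β' - 1 = β' * (x ^ 2 - α * y ^ 2 - β) + (β * β' - 1) := by ring
    rw [this]
    exact add_mem (Ideal.mul_mem_left _ _ hxy) hβ'
  · intro u hu v hv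
    simp only
    rw [← traceChar_add, ← traceChar_add, ← mul_add, ← mul_add]
    have e1 := mul_mem_of_mem_one hθ hu (mem_conductorIdeal.1 hxy u hu)
    have e2 := mul_mem_of_mem_one hθ hv (mem_conductorIdeal.1 hxy v hv)
    have e3 := add_mem (neg_mem e1) (smul_mem' α e2)
    refine Eq.trans ?_ (traceChar_mul_add hθ e3)
    congr 2
    simp only [map_neg, map_one, map_sub, map_mul, map_pow]
    ring

/-- The Gauss sum of the form `-α x² - β y² + α β z²`. -/
theorem scalarGauss_ternary (hM : M.FG) (h1M : 1 ≤ M) (h2 : IsInvertibleOn M 2) {α β : 𝓞 F}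
    (hα : IsInvertibleOn M α) (hβ : IsInvertibleOn M β) :
    scalarGauss M θ (-α) * (scalarGauss M θ (-β) * scalarGauss M θ (α * β)) =
      scalarGauss M θ 1 ^ 3 := by
  have h1 : IsInvertibleOn M (-1) := ⟨-1, by simp⟩
  -- Taking `α = β = -1` yields `G(1)² = G(-1)²`. It turns the remaining product `G(-1) · G(1)
  -- G(-1)` into `G(1)³`.
  have e := scalarGauss_neg_mul hθ hM h1M h2 h1 h1
  rw [neg_neg, neg_mul_neg, one_mul] at e
  have e2 := scalarGauss_mul_neg hθ hM h1M h2 hα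
  rw [scalarGauss_neg_mul hθ hM h1M h2 hα hβ]
  calc _ = scalarGauss M θ (-1) * (scalarGauss M θ α * scalarGauss M θ (-α)) := by ring
    _ = _ := by rw [e2, pow_three, e]; ring

end GaussSums

/-! ### Gauss sums of ternary lattices -/

section GaussTernary

set_option linter.unusedSectionVars false

variable {F : Type*} [Field F] [NumberField F] [NumberField.IsTotallyReal F]

variable (F) in
/-- The field `F` with the form `x y`. -/
def selfCoord : QuadCoord F F 1 where
  form := LinearMap.mul F F
  coord τ _ := τ
  coord_smul τ _ a v := map_mul τ a v
  map_form τ u v := by simp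
  form_self_ne v hv := mul_self_ne_zero.2 hv
  finrank_eq := Module.finrank_self F
  finite := inferInstance

lemma selfCoord_form (x y : F) : (selfCoord F).form x y = x * y := rfl

lemma gaussSum_selfCoord (𝔞 : FractionalIdeal (𝓞 F)⁰ F) (b d : F) :
    (selfCoord F).gaussSum 𝔞 b d 1 =
      scalarGauss (QuadCoord.gaussLattice 𝔞 d (1 : Submodule (𝓞 F) F)) (b * d / 2) 1 :=
  quotSum_congr fun v _ => by rw [selfCoord_form]; simp only [map_one, one_mul, pow_two]

variable {V : Type*} [AddCommGroup V] [Module F V]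
  [Module (𝓞 F) V] [IsScalarTower (𝓞 F) F V] (X : QuadCoord F V 3)

namespace QuadCoord

/-- The Gauss sum of a ternary form which is equivalent to `-α x² - β y² + αβ z²` up to an
integer `t ≡ 1`. -/
theorem gaussSum_eq_cube {𝔞 : FractionalIdeal (𝓞 F)⁰ F} (h𝔞 : 𝔞 ≠ 0) {L : Submodule (𝓞 F) V}
    (hint : ∀ u ∈ L, ∀ v ∈ L, X.form u v ∈ (1 : FractionalIdeal (𝓞 F)⁰ F)) {a b d : F} (ha : a ∈ 𝔞)
    (hb : ∀ x ∈ 𝔞⁻¹, b * x / 2 ∈ integralTrace F) (hd : d ∈ 𝔞⁻¹) (hd0 : d ≠ 0)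
    (e : Module.Basis (Fin 3) F V) (horth : ∀ i j, i ≠ j → X.form (e i) (e j) = 0) {α β t : 𝓞 F}
    (h0 : X.form (e 0) (e 0) = -(α : F)) (h1 : X.form (e 1) (e 1) = -(β : F))
    (h2 : X.form (e 2) (e 2) = (α : F) * β) (ht : (t : F) = 1 - a * d)
    (ht1 : ∀ i, (t : F) • e i ∈ L) (ht2 : ∀ v ∈ L, ∀ i, (t : F) * e.repr v i ∈ (1 : Submodule (𝓞 F) F))
    (h2t : (2 : 𝓞 F) ∣ t) (hαt : α ∣ t) (hβt : β ∣ t) :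
    X.gaussSum 𝔞 b d L = (selfCoord F).gaussSum 𝔞 b d 1 ^ 3 := by
  set M := gaussLattice 𝔞 d (1 : Submodule (𝓞 F) F) with hM
  have hMl : IsLattice M := (isLattice_one.colon h𝔞).scale hd0
  have hmemM : ∀ x ∈ M, ∀ a' ∈ 𝔞, a' * (d * x) ∈ (1 : Submodule (𝓞 F) F) := fun x hx a' ha' => hx a' ha'
  have hθ : ∀ x ∈ M, b * d / 2 * x ∈ integralTrace F := by
    intro x hx
    have : d * x ∈ 𝔞⁻¹ := (mem_colonLattice_top h𝔞).1 hx
    convert hb _ this using 1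
    ring
  have hadO : ∀ a' ∈ 𝔞, ∃ o : 𝓞 F, (o : F) = a' * d := by
    intro a' ha'
    obtain ⟨o, ho⟩ := (FractionalIdeal.mem_one_iff _).1 ((FractionalIdeal.mem_inv_iff h𝔞).1 hd a' ha')
    exact ⟨o, by rw [mul_comm]; exact ho⟩
  have h1M : 1 ≤ M := by
    intro x hx a' ha'
    obtain ⟨o, ho⟩ := hadO a' ha'
    rw [smul_eq_mul, smul_eq_mul, ← mul_assoc, ← ho]
    exact smul_mem' o hx
  obtain ⟨n, hn⟩ := hadO a ha
  -- The integer `n = a d` annihilates `M / 𝓞_F`. Thus `t = 1 - n` acts on it as the identity, and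
  -- every divisor of `t` acts invertibly.
  have hnM : ∀ x ∈ M, (n : F) * x ∈ (1 : Submodule (𝓞 F) F) := by
    intro x hx
    rw [hn, mul_assoc]
    exact hmemM x hx a ha
  have htn : (t : F) = 1 - n := by rw [hn, ht]
  have hinv : ∀ γ : 𝓞 F, γ ∣ t → IsInvertibleOn M γ := by
    rintro γ ⟨s, hs⟩
    refine ⟨s, fun x hx => ?_⟩
    have e : algebraMap (𝓞 F) F (γ * s - 1) = -(n : F) := by
      rw [← hs, map_sub, map_one, sub_eq_iff_eq_add]
      exact htn.trans (by ring)
    rw [e, neg_mul]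
    exact neg_mem (hnM x hx)
  rw [gaussSum_selfCoord, ← hM, ← scalarGauss_ternary hθ hMl.1 h1M (hinv 2 h2t) (hinv α hαt) (hinv β hβt)]
  have hfin := (isLattice_one (F := F)).finite_quotOf hMl.1
  have hfin2 : Finite (QuotOf ((1 : Submodule (𝓞 F) F).toAddSubgroup.prod
      (1 : Submodule (𝓞 F) F).toAddSubgroup) (M.toAddSubgroup.prod M.toAddSubgroup)) := by
    refine Finite.of_injective (fun r => (⟨quotMk (1 : Submodule (𝓞 F) F).toAddSubgroup (quotRep r).1
      (AddSubgroup.mem_prod.1 (quotRep_mem r)).1, quotMk (1 : Submodule (𝓞 F) F).toAddSubgroup (quotRep r).2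
      (AddSubgroup.mem_prod.1 (quotRep_mem r)).2⟩ :
        QuotOf (1 : Submodule (𝓞 F) F).toAddSubgroup M.toAddSubgroup ×
        QuotOf (1 : Submodule (𝓞 F) F).toAddSubgroup M.toAddSubgroup)) fun r s h => ?_
    have e1 := (quotMk_eq_iff _ _).1 (congrArg Prod.fst h)
    have e2 := (quotMk_eq_iff _ _).1 (congrArg Prod.snd h)
    have := (quotMk_eq_iff (quotRep_mem r) (quotRep_mem s)).2 (AddSubgroup.mem_prod.2 ⟨e1, e2⟩)
    rwa [quotMk_rep, quotMk_rep] at this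
  rw [scalarGauss_mul hθ hMl.1 h1M, scalarGauss,
    ← quotSum_prod (periodicOn_scalar hθ h1M (-α)) (periodicOn_prod hθ h1M (-β) (α * β)), gaussSum]
  symm
  have ht2' : ∀ x ∈ M, x - (t : F) * ((t : F) * x) ∈ (1 : Submodule (𝓞 F) F) := by
    intro x hx
    have := smul_mem' (2 - n) (hnM x hx)
    convert this using 1
    rw [htn]
    simp only [map_sub, map_ofNat]
    ring
  have hrepr : ∀ (x : F × F × F) (i : Fin 3),
      e.repr ((t : F) • (x.1 • e 0 + x.2.1 • e 1 + x.2.2 • e 2)) i = (t : F) * ![x.1, x.2.1, x.2.2] i := by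
    intro x i
    simp only [map_smul, map_add, Finsupp.smul_apply, Finsupp.add_apply, Module.Basis.repr_self,
      smul_eq_mul]
    fin_cases i <;> simp
  have hsub : ∀ v w : F × F × F,
      (t : F) • (w.1 • e 0 + w.2.1 • e 1 + w.2.2 • e 2) - (t : F) • (v.1 • e 0 + v.2.1 • e 1 + v.2.2 • e 2)
      = (t : F) • ((w - v).1 • e 0 + (w - v).2.1 • e 1 + (w - v).2.2 • e 2) := by
    intro v w
    simp only [Prod.fst_sub, Prod.snd_sub, sub_smul, smul_add, smul_sub]
    abel
  have hmemL : ∀ x : F × F × F, x.1 ∈ (1 : Submodule (𝓞 F) F) → x.2.1 ∈ (1 : Submodule (𝓞 F) F) →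
      x.2.2 ∈ (1 : Submodule (𝓞 F) F) → (t : F) • (x.1 • e 0 + x.2.1 • e 1 + x.2.2 • e 2) ∈ L := by
    rintro ⟨x, y, z⟩ hx hy hz
    obtain ⟨x, rfl⟩ := Submodule.mem_one.1 hx
    obtain ⟨y, rfl⟩ := Submodule.mem_one.1 hy
    obtain ⟨z, rfl⟩ := Submodule.mem_one.1 hz
    rw [smul_add, smul_add, smul_comm _ (_ : F), smul_comm _ (_ : F) (e 1), smul_comm _ (_ : F) (e 2)]
    exact add_mem (add_mem (int_smul_mem L x (ht1 0)) (int_smul_mem L y (ht1 1)))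
      (int_smul_mem L z (ht1 2))
  -- The factor `t` clears denominators between `L` and the span of the basis in both directions,
  -- yet is invisible on the quotients. Hence `x ↦ t ∑ x_i e_i` identifies the quotient for `𝓞_F³`
  -- with the one for `L` even though the two lattices differ.
  refine quotSum_eq_of_map (fun x : F × F × F => (t : F) • (x.1 • e 0 + x.2.1 • e 1 + x.2.2 • e 2))
    ?_ ?_ ?_ (X.periodicOn_gauss h𝔞 hb hd hint) ?_
  · intro x hx a' ha'
    obtain ⟨hx1, hx2⟩ := AddSubgroup.mem_prod.1 hx
    obtain ⟨hx2, hx3⟩ := AddSubgroup.mem_prod.1 hx2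
    have := hmemL (a' * (d * x.1), a' * (d * x.2.1), a' * (d * x.2.2)) (hmemM _ hx1 a' ha')
      (hmemM _ hx2 a' ha') (hmemM _ hx3 a' ha')
    convert this using 1
    simp only [smul_add, smul_smul]
    congr 1
    · congr 1
      all_goals congr 1; ring
    · congr 1; ring
  · intro v hv w hw
    have hwv := sub_mem hw hv
    obtain ⟨hx1, hx2⟩ := AddSubgroup.mem_prod.1 hwv
    obtain ⟨hx2, hx3⟩ := AddSubgroup.mem_prod.1 hx2
    rw [hsub, AddSubgroup.mem_prod, AddSubgroup.mem_prod]
    constructor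
    · intro h
      have key : ∀ i, (t : F) * ((t : F) * ![(w - v).1, (w - v).2.1, (w - v).2.2] i) ∈
          (1 : Submodule (𝓞 F) F) := fun i => by rw [← hrepr]; exact ht2 _ h i
      refine ⟨?_, ?_, ?_⟩
      · have := add_mem (ht2' _ hx1) (key 0); simpa using this
      · have := add_mem (ht2' _ hx2) (key 1); simpa using this
      · have := add_mem (ht2' _ hx3) (key 2); simpa using this
    · rintro ⟨h3, h4, h5⟩
      exact hmemL _ h3 h4 h5
  · intro v' hv'
    have hmem : ∀ i, (t : F) * e.repr v' i ∈ M := by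
      intro i a' ha'
      have := ht2 _ (hv' a' ha') i
      simp only [map_smul, Finsupp.smul_apply, smul_eq_mul] at this ⊢
      convert this using 1
      ring
    refine ⟨((t : F) * e.repr v' 0, (t : F) * e.repr v' 1, (t : F) * e.repr v' 2),
      AddSubgroup.mem_prod.2 ⟨hmem 0, AddSubgroup.mem_prod.2 ⟨hmem 1, hmem 2⟩⟩, ?_⟩
    have hv : v' = e.repr v' 0 • e 0 + e.repr v' 1 • e 1 + e.repr v' 2 • e 2 := by
      conv_lhs => rw [← e.sum_repr v', Fin.sum_univ_three]
    have e1 : v' - (t : F) • (((t : F) * e.repr v' 0) • e 0 + ((t : F) * e.repr v' 1) • e 1 +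
        ((t : F) * e.repr v' 2) • e 2) = ((2 - n : 𝓞 F) : F) • (a • d • v') := by
      simp only [mul_smul, ← smul_add]
      rw [← hv, smul_smul, smul_smul a, ← hn, smul_smul]
      have : v' - ((t : F) * t) • v' = (1 - (t : F) * t) • v' := by rw [sub_smul, one_smul]
      rw [this]
      congr 1
      rw [htn]
      simp only [map_sub, map_ofNat]
      ring
    simp only
    rw [e1]
    exact int_smul_mem L _ (hv' a ha)
  · intro x hx
    obtain ⟨hx1, hx2⟩ := AddSubgroup.mem_prod.1 hx
    obtain ⟨hx2, hx3⟩ := AddSubgroup.mem_prod.1 hx2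
    rw [← traceChar_add, ← mul_add, ← traceChar_add, ← mul_add]
    -- The form at the image is `t²` times the diagonal form, and `t² - 1 = n (n - 2)`. The
    -- discrepancy lies in `M`, where the character is trivial.
    have hsq : ∀ y ∈ M, ∀ γ : 𝓞 F, (γ : F) * (((n - 2 : 𝓞 F) : F) * (y * (n * y))) ∈ M := fun y hy γ =>
      smul_mem' γ (smul_mem' _ (mul_mem_of_mem_one hθ hy (hnM y hy)))
    refine Eq.trans ?_ (traceChar_mul_add hθ (add_mem (hsq _ hx1 (-α)) (add_mem (hsq _ hx2 (-β))
      (hsq _ hx3 (α * β)))))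
    congr 2
    simp only [map_smul, map_add, LinearMap.smul_apply, LinearMap.add_apply, smul_eq_mul, h0, h1, h2,
      horth 0 1 (by decide), horth 0 2 (by decide), horth 1 0 (by decide), horth 1 2 (by decide),
      horth 2 0 (by decide), horth 2 1 (by decide), map_neg, map_mul, map_sub, map_ofNat, htn]
    ring

end QuadCoord

end GaussTernary

/-! ## Definite quaternion algebras -/

section Quaternion

set_option linter.unusedSectionVars false

lemma quaternion_re_mul_comm (p q : Quaternion ℝ) : (p * q).re = (q * p).re := by
  simp only [Quaternion.re_mul]; ring

variable {F : Type*} [Field F] [NumberField F]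
  {B : Type*} [Ring B] [Algebra F B]

/-- Standard generators of a quaternion algebra. -/
structure QuatGens (F : Type*) [Field F] (B : Type*) [Ring B] [Algebra F B] where
  i : B
  j : B
  sqI : F
  sqJ : F
  i_sq : i * i = algebraMap F B sqI
  j_sq : j * j = algebraMap F B sqJ
  anti : i * j = -(j * i)
  i_ne : i ≠ 0
  j_ne : j ≠ 0

section Existence

variable [Algebra.IsCentral F B] [IsDomain B]

/-- The commutative division algebra `F[b]` has degree dividing `4`, and not equal to `4` because
`c` does not commute with `b`. So `1, b, b²` are dependent, and `b²` must occur in the relation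
since `b` is not a scalar. -/
lemma exists_quadratic (hB : Module.finrank F B = 4) {b c : B} (hbc : b * c ≠ c * b) :
    ∃ s n : F, b * b = algebraMap F B s * b - algebraMap F B n := by
  have hfin : FiniteDimensional F B := Module.finite_of_finrank_pos (by omega)
  let K := Algebra.adjoin F {b}
  have hbK : b ∈ K := Algebra.self_mem_adjoin_singleton F b
  have hcomm : ∀ x ∈ K, b * x = x * b := by
    intro x hx
    induction hx using Algebra.adjoin_induction with
    | mem x hx => rw [Set.mem_singleton_iff.1 hx]
    | algebraMap r => exact (Algebra.commutes r b).symm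
    | add x y _ _ hx hy => rw [mul_add, add_mul, hx, hy]
    | mul x y _ _ hx hy => rw [← mul_assoc, hx, mul_assoc, hy, mul_assoc]
  have hK4 : Module.finrank F K ≠ 4 := by
    intro h
    have : Subalgebra.toSubmodule K = ⊤ := Submodule.eq_top_of_finrank_eq (by rw [hB]; exact h)
    exact hbc (hcomm c (by
      have : c ∈ Subalgebra.toSubmodule K := this ▸ Submodule.mem_top
      exact this))
  have hbF : ∀ r : F, b ≠ algebraMap F B r := by
    rintro r rfl
    exact hbc (Algebra.commutes r c)
  have hmul : Module.finrank F K * Module.finrank K B = 4 := by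
    let _ : DivisionRing K := divisionRingOfFiniteDimensional F K
    rw [← hB]
    exact Module.finrank_mul_finrank F K B
  have hle : Module.finrank F K ≤ 2 := by
    have h1 : Module.finrank F K ∣ 4 := ⟨_, hmul.symm⟩
    have h2 : Module.finrank F K ≤ 4 := Nat.le_of_dvd (by norm_num) h1
    interval_cases h : Module.finrank F K
    · norm_num
    · norm_num
    · norm_num
    · omega
    · exact absurd rfl hK4
  have hdep : ¬ LinearIndependent F ![(1 : K), ⟨b, hbK⟩, ⟨b, hbK⟩ * ⟨b, hbK⟩] := by
    intro h
    have := h.fintype_card_le_finrank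
    simp at this
    omega
  rw [Fintype.not_linearIndependent_iff] at hdep
  obtain ⟨g, hg, l, hl⟩ := hdep
  have hg' : algebraMap F B (g 0) + algebraMap F B (g 1) * b + algebraMap F B (g 2) * (b * b) = 0 := by
    have := congrArg (fun x : K => (x : B)) hg
    simp only [Fin.sum_univ_three] at this
    simpa [Algebra.smul_def] using this
  have h2 : g 2 ≠ 0 := by
    intro h2
    rw [h2, map_zero, zero_mul, add_zero] at hg'
    have h1 : g 1 = 0 := by
      by_contra h1
      refine hbF (-(g 0) / g 1) ?_
      have : algebraMap F B (g 1)⁻¹ * (algebraMap F B (g 0) + algebraMap F B (g 1) * b) = 0 := by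
        rw [hg', mul_zero]
      rw [mul_add, ← mul_assoc, ← map_mul, ← map_mul, inv_mul_cancel₀ h1, map_one, one_mul] at this
      rw [eq_neg_of_add_eq_zero_right this, ← map_neg]
      congr 1
      field_simp
    rw [h1, map_zero, zero_mul, add_zero, map_eq_zero_iff _ (algebraMap F B).injective] at hg'
    fin_cases l
    · exact hl hg'
    · exact hl h1
    · exact hl h2
  refine ⟨-(g 1) / g 2, g 0 / g 2, ?_⟩
  have : algebraMap F B (g 2)⁻¹ * (algebraMap F B (g 0) + algebraMap F B (g 1) * b +
      algebraMap F B (g 2) * (b * b)) = 0 := by rw [hg', mul_zero]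
  rw [mul_add, mul_add, ← mul_assoc, ← mul_assoc _ _ (b * b), ← map_mul, ← map_mul, ← map_mul,
    inv_mul_cancel₀ h2, map_one, one_mul] at this
  rw [eq_neg_of_add_eq_zero_right this, neg_div, map_neg, neg_mul, div_eq_inv_mul, div_eq_inv_mul]
  abel

/-- A central division algebra of dimension four has standard generators. -/
theorem exists_quatGens (hB : Module.finrank F B = 4) : Nonempty (QuatGens F B) := by
  have hcent : ∀ x : B, (∀ y, x * y = y * x) → ∃ r : F, algebraMap F B r = x := by
    intro x hx
    have : x ∈ Subalgebra.center F B := Subalgebra.mem_center_iff.2 fun y => (hx y).symm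
    rwa [Algebra.IsCentral.center_eq_bot, Algebra.mem_bot] at this
  obtain ⟨b, c, hbc⟩ : ∃ b c : B, b * c ≠ c * b := by
    by_contra! h
    have : (⊤ : Submodule F B) ≤ Submodule.span F {1} := by
      intro x _
      obtain ⟨r, hr⟩ := hcent x (h x)
      rw [← hr, Algebra.algebraMap_eq_smul_one]
      exact Submodule.smul_mem _ _ (Submodule.mem_span_singleton_self 1)
    have h1 := finrank_span_singleton (K := F) (one_ne_zero (α := B))
    rw [top_le_iff.1 this, finrank_top, hB] at h1
    omega
  obtain ⟨s, n, hsn⟩ := exists_quadratic hB hbc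
  -- Completing the square in the quadratic equation of `b` makes the square of `i` central.
  let i := b - algebraMap F B (s / 2)
  have h2 : algebraMap F B s = algebraMap F B (s / 2) + algebraMap F B (s / 2) := by
    rw [← map_add, add_halves]
  have hi : i * i = algebraMap F B (s / 2 * (s / 2) - n) := by
    have hc := Algebra.commutes (s / 2) b
    simp only [i, sub_mul, mul_sub, hsn, h2, map_sub, map_mul, add_mul]
    rw [← hc]
    abel
  have hic : i * c ≠ c * i := by
    intro h
    apply hbc
    have hc := Algebra.commutes (s / 2) c
    simp only [i, sub_mul, mul_sub, hc] at h
    exact sub_left_injective h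
  -- A commutator with `i` anticommutes with `i`, because `i²` is central.
  let j := i * c - c * i
  have hj0 : j ≠ 0 := sub_ne_zero.2 hic
  have hi0 : i ≠ 0 := by
    rintro h
    exact hic (by rw [h, zero_mul, mul_zero])
  have hanti : i * j = -(j * i) := by
    have hc := Algebra.commutes (s / 2 * (s / 2) - n) c
    simp only [j, mul_sub, sub_mul]
    rw [← mul_assoc, hi, mul_assoc c, hi, hc, mul_assoc]
    abel
  clear_value j
  clear_value i
  have hne : ∀ x : B, x ≠ 0 → x ≠ -x := by
    intro x hx h
    have : (algebraMap F B 2) * x = 0 := by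
      rw [map_ofNat, two_mul]
      exact eq_neg_iff_add_eq_zero.1 h
    rcases mul_eq_zero.1 this with h' | h'
    · rw [map_eq_zero_iff _ (algebraMap F B).injective] at h'
      exact two_ne_zero h'
    · exact hx h'
  have hij0 : i * j ≠ 0 := mul_ne_zero hi0 hj0
  have hji : j * i ≠ i * j := by
    intro h
    exact hne (j * i) (by rw [← neg_ne_zero, ← hanti]; exact hij0) (h.trans hanti)
  obtain ⟨s', n', hsn'⟩ := exists_quadratic hB hji
  have hs' : s' = 0 := by
    -- conjugating `j² = s' j - n'` by `i`
    have e1 : i * (j * j) = (j * j) * i := by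
      rw [← mul_assoc, hanti, neg_mul, mul_assoc, hanti, mul_neg, neg_neg, mul_assoc]
    rw [hsn', mul_sub, sub_mul, ← Algebra.commutes n' i, sub_left_inj, ← mul_assoc,
      ← Algebra.commutes s' i, mul_assoc, hanti, mul_neg, mul_assoc] at e1
    by_contra h0
    have h1 : algebraMap F B s' * (j * i) ≠ 0 := mul_ne_zero
      ((map_ne_zero_iff _ (algebraMap F B).injective).2 h0)
      (by rw [← neg_ne_zero, ← hanti]; exact hij0)
    exact hne _ h1 e1.symm
  refine ⟨⟨i, j, _, -n', hi, ?_, hanti, hi0, hj0⟩⟩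
  rw [hsn', hs', map_zero, zero_mul, zero_sub, map_neg]

end Existence

end Quaternion

/-! ### Reduced trace and norm through the Hamilton quaternions -/

section QuatTrace

set_option linter.unusedSectionVars false

lemma quaternion_re_coe_mul (r : ℝ) (q : Quaternion ℝ) : ((r : Quaternion ℝ) * q).re = r * q.re := by
  simp

/-- The real part of `p̄ q p` is `|p|² Re q` by cyclicity, while anticommutation gives the opposite
sign. -/
lemma quaternion_re_eq_zero {q p : Quaternion ℝ} (h : q * p = -(p * q)) (hp : p ≠ 0) : q.re = 0 := by
  have h1 : (star p * (q * p)).re = (Quaternion.normSq p) * q.re := by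
    rw [quaternion_re_mul_comm, mul_assoc, Quaternion.self_mul_star, quaternion_re_mul_comm,
      quaternion_re_coe_mul]
  have h2 : (star p * (q * p)).re = -((Quaternion.normSq p) * q.re) := by
    rw [h, mul_neg, ← mul_assoc, Quaternion.star_mul_self, Quaternion.re_neg, quaternion_re_coe_mul]
  have h3 : Quaternion.normSq p ≠ 0 := Quaternion.normSq_ne_zero.2 hp
  have h4 : Quaternion.normSq p * q.re = 0 := by linarith
  exact (mul_eq_zero.1 h4).resolve_left h3

variable {F : Type*} [Field F] [NumberField F] {B : Type*} [Ring B] [Algebra F B]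

/-- The real part of the image in the Hamilton quaternions. -/
def reHom (f : B →+* Quaternion ℝ) : B →+ ℝ where
  toFun b := (f b).re
  map_zero' := by rw [map_zero, Quaternion.re_zero]
  map_add' x y := by rw [map_add, Quaternion.re_add]

lemma reHom_apply (f : B →+* Quaternion ℝ) (b : B) : reHom f b = (f b).re := rfl

lemma reHom_smul {τ : F →+* ℝ} {f : B →+* Quaternion ℝ}
    (hτ : ∀ a : F, f (algebraMap F B a) = ((τ a : ℝ) : Quaternion ℝ)) (a : F) (b : B) :
    reHom f (a • b) = τ a * reHom f b := by
  rw [reHom_apply, reHom_apply, Algebra.smul_def, map_mul, hτ, quaternion_re_coe_mul]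

variable (F B) in
/-- The reduced trace as a linear map. -/
def redTraceLin : B →ₗ[F] F := (2 : F)⁻¹ • (LinearMap.trace F B ∘ₗ LinearMap.mul F B)

lemma redTraceLin_apply (b : B) : redTraceLin F B b = redTrace F b := by
  rw [redTrace, div_eq_inv_mul]; rfl

namespace QuatGens

variable (g : QuatGens F B)

lemma sqI_ne [IsDomain B] : g.sqI ≠ 0 := fun h => mul_ne_zero g.i_ne g.i_ne (by rw [g.i_sq, h, map_zero])

lemma sqJ_ne [IsDomain B] : g.sqJ ≠ 0 := fun h => mul_ne_zero g.j_ne g.j_ne (by rw [g.j_sq, h, map_zero])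

lemma anti' : g.j * g.i = -(g.i * g.j) := by rw [g.anti, neg_neg]

lemma anti_ij : g.i * g.j * g.i = -(g.i * (g.i * g.j)) := by
  rw [mul_assoc, g.anti', mul_neg]

/-- The standard basis `1, i, j, ij`. -/
def vec4 : Fin 4 → B := ![1, g.i, g.j, g.i * g.j]

variable {τ : F →+* ℝ} {f : B →+* Quaternion ℝ}

lemma re_i (hf : Function.Injective f) : (f g.i).re = 0 :=
  quaternion_re_eq_zero (p := f g.j) (by rw [← map_mul, g.anti, map_neg, map_mul])
    ((map_ne_zero_iff f hf).2 g.j_ne)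

lemma re_j (hf : Function.Injective f) : (f g.j).re = 0 :=
  quaternion_re_eq_zero (p := f g.i) (by rw [← map_mul, g.anti', map_neg, map_mul])
    ((map_ne_zero_iff f hf).2 g.i_ne)

lemma re_ij (hf : Function.Injective f) : (f (g.i * g.j)).re = 0 :=
  quaternion_re_eq_zero (p := f g.i) (by rw [← map_mul, g.anti_ij, map_neg, map_mul])
    ((map_ne_zero_iff f hf).2 g.i_ne)

lemma re_mul_of_anti {x y : B} (h : x * y = -(y * x)) : (f (x * y)).re = 0 := by
  have h1 : (f (x * y)).re = (f (y * x)).re := by rw [map_mul, map_mul, quaternion_re_mul_comm]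
  have h2 : (f (x * y)).re = -(f (y * x)).re := by rw [h, map_neg, Quaternion.re_neg]
  linarith

lemma anti_ij_j : g.i * g.j * g.j = -(g.j * (g.i * g.j)) := by
  rw [← mul_assoc, g.anti', neg_mul, neg_neg]

lemma ij_sq : g.i * g.j * (g.i * g.j) = algebraMap F B (-(g.sqI * g.sqJ)) := by
  rw [← mul_assoc, g.anti_ij, ← mul_assoc, g.i_sq, neg_mul, mul_assoc, g.j_sq, map_neg, map_mul]

lemma re_vec4_mul (hf : Function.Injective f) {l m : Fin 4} (h : m ≠ l) :
    (f (g.vec4 m * g.vec4 l)).re = 0 := by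
  have h1 := g.re_i hf
  have h2 := g.re_j hf
  have h3 := g.re_ij hf
  have h4 := re_mul_of_anti (f := f) g.anti
  have h5 := re_mul_of_anti (f := f) g.anti'
  have h6 := re_mul_of_anti (f := f) g.anti_ij
  have h7 := re_mul_of_anti (f := f) g.anti_ij_j
  have h8 := re_mul_of_anti (f := f) (x := g.i) (y := g.i * g.j) (by rw [g.anti_ij, neg_neg])
  have h9 := re_mul_of_anti (f := f) (x := g.j) (y := g.i * g.j) (by rw [g.anti_ij_j, neg_neg])
  fin_cases m <;> fin_cases l <;> first | exact absurd rfl h | skip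
  all_goals
    simp only [vec4, Fin.mk_zero, Fin.mk_one, Fin.reduceFinMk, Matrix.cons_val, mul_one, one_mul]
    assumption

lemma vec4_sq_re [IsDomain B] (hτ : ∀ a : F, f (algebraMap F B a) = ((τ a : ℝ) : Quaternion ℝ))
    (l : Fin 4) : ∃ a : F, a ≠ 0 ∧ (f (g.vec4 l * g.vec4 l)).re = τ a := by
  fin_cases l
  · exact ⟨1, one_ne_zero, by simp [vec4, Quaternion.re_one]⟩
  · refine ⟨g.sqI, g.sqI_ne, ?_⟩
    change (f (g.i * g.i)).re = _
    rw [g.i_sq, hτ, Quaternion.re_coe]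
  · refine ⟨g.sqJ, g.sqJ_ne, ?_⟩
    change (f (g.j * g.j)).re = _
    rw [g.j_sq, hτ, Quaternion.re_coe]
  · refine ⟨-(g.sqI * g.sqJ), neg_ne_zero.2 (mul_ne_zero g.sqI_ne g.sqJ_ne), ?_⟩
    change (f (g.i * g.j * (g.i * g.j))).re = _
    rw [g.ij_sq, hτ, Quaternion.re_coe]

/-- The vectors `1, i, j, ij` are orthogonal for `Re(x y)` with nonzero diagonal values, so each
coefficient of a relation can be isolated by pairing. -/
lemma linearIndependent [IsDomain B] (hf : Function.Injective f)
    (hτ : ∀ a : F, f (algebraMap F B a) = ((τ a : ℝ) : Quaternion ℝ)) :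
    LinearIndependent F g.vec4 := by
  rw [Fintype.linearIndependent_iff]
  intro c hc m
  obtain ⟨a, ha, hm⟩ := g.vec4_sq_re hτ m
  have h : reHom f (g.vec4 m * ∑ l, c l • g.vec4 l) = τ (c m * a) := by
    rw [Finset.mul_sum, map_sum, Finset.sum_eq_single_of_mem m (Finset.mem_univ m), map_mul τ, ← hm]
    · rw [mul_smul_comm, reHom_smul hτ, reHom_apply]
    · intro l _ hl
      rw [mul_smul_comm, reHom_smul hτ, reHom_apply, g.re_vec4_mul hf hl.symm, mul_zero]
  rw [hc, mul_zero, map_zero, eq_comm, map_eq_zero] at h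
  exact (mul_eq_zero.1 h).resolve_right ha

variable (hB : Module.finrank F B = 4) [IsDomain B] (hf : Function.Injective f)
    (hτ : ∀ a : F, f (algebraMap F B a) = ((τ a : ℝ) : Quaternion ℝ))

/-- The standard basis of a quaternion algebra. -/
def basis4 : Module.Basis (Fin 4) F B :=
  basisOfLinearIndependentOfCardEqFinrank (g.linearIndependent hf hτ) (by simp [hB])

lemma basis4_apply (l : Fin 4) : g.basis4 hB hf hτ l = g.vec4 l := by
  rw [basis4, coe_basisOfLinearIndependentOfCardEqFinrank]

-- Cyclicity of the trace and `u v = -v u` show that the operator `u v v` has trace equal to its own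
-- negative; but `v v` is the nonzero scalar `c`.
omit [IsDomain B] in
lemma redTrace_eq_zero {u v : B} {c : F} (hc : c ≠ 0) (hv : v * v = algebraMap F B c)
    (huv : u * v = -(v * u)) : redTrace F u = 0 := by
  have h1 : LinearMap.mulLeft F u * LinearMap.mulLeft F v = -(LinearMap.mulLeft F v * LinearMap.mulLeft F u) := by
    ext x
    simp only [Module.End.mul_apply, LinearMap.mulLeft_apply, LinearMap.neg_apply]
    rw [← mul_assoc, huv, neg_mul, mul_assoc]
  have h2 : LinearMap.mulLeft F u * LinearMap.mulLeft F v * LinearMap.mulLeft F v =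
      c • LinearMap.mulLeft F u := by
    ext x
    simp only [Module.End.mul_apply, LinearMap.mulLeft_apply, LinearMap.smul_apply]
    rw [← mul_assoc v, hv, ← Algebra.smul_def, mul_smul_comm]
  have h3 : LinearMap.trace F B (LinearMap.mulLeft F u * LinearMap.mulLeft F v * LinearMap.mulLeft F v) =
      -LinearMap.trace F B (LinearMap.mulLeft F u * LinearMap.mulLeft F v * LinearMap.mulLeft F v) := by
    have h5 : LinearMap.mulLeft F v * (LinearMap.mulLeft F u * LinearMap.mulLeft F v) =
        -(LinearMap.mulLeft F u * LinearMap.mulLeft F v * LinearMap.mulLeft F v) := by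
      ext x
      simp only [Module.End.mul_apply, LinearMap.neg_apply, LinearMap.mulLeft_apply]
      rw [← mul_assoc v u, show v * u = -(u * v) by rw [huv, neg_neg], neg_mul, mul_assoc]
    rw [← map_neg, ← h5, LinearMap.trace_mul_comm]
  rw [h2, map_smul, smul_eq_mul] at h3
  have h4 : LinearMap.trace F B (LinearMap.mulLeft F u) = 0 := by
    have : c * LinearMap.trace F B (LinearMap.mulLeft F u) = 0 := self_eq_neg.1 h3
    exact (mul_eq_zero.1 this).resolve_left hc
  rw [redTrace, h4, zero_div]

include g hB hf hτ

/-- The reduced trace is twice the real part. -/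
theorem map_redTrace (b : B) : τ (redTrace F b) = 2 * (f b).re := by
  have hfin : FiniteDimensional F B := Module.finite_of_finrank_pos (by omega)
  have key : ∀ l, τ (redTraceLin F B (g.vec4 l)) = 2 * reHom f (g.vec4 l) := by
    intro l
    rw [redTraceLin_apply, reHom_apply]
    fin_cases l
    · change τ (redTrace F 1) = 2 * (f 1).re
      have : LinearMap.mulLeft F (1 : B) = 1 := LinearMap.mulLeft_one F B
      rw [redTrace, this, LinearMap.trace_one, hB, map_one, Quaternion.re_one]
      rw [show ((4 : ℕ) : F) / 2 = 2 by norm_num, map_ofNat, mul_one]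
    · change τ (redTrace F g.i) = 2 * (f g.i).re
      rw [redTrace_eq_zero g.sqJ_ne g.j_sq g.anti, g.re_i hf, map_zero, mul_zero]
    · change τ (redTrace F g.j) = 2 * (f g.j).re
      rw [redTrace_eq_zero g.sqI_ne g.i_sq g.anti', g.re_j hf, map_zero, mul_zero]
    · change τ (redTrace F (g.i * g.j)) = 2 * (f (g.i * g.j)).re
      rw [redTrace_eq_zero g.sqI_ne g.i_sq g.anti_ij, g.re_ij hf, map_zero, mul_zero]
  rw [← redTraceLin_apply, ← reHom_apply, ← (g.basis4 hB hf hτ).sum_repr b, map_sum, map_sum, map_sum,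
    Finset.mul_sum]
  refine Finset.sum_congr rfl fun l _ => ?_
  rw [basis4_apply, map_smul, smul_eq_mul, map_mul, key, reHom_smul hτ]
  ring

/-- The reduced norm is the square of the absolute value. -/
theorem map_redNorm (b : B) : τ (redNorm F b) = Quaternion.normSq (f b) := by
  rw [redNorm, map_div₀, map_sub, map_pow, g.map_redTrace hB hf hτ, g.map_redTrace hB hf hτ, map_pow,
    Quaternion.normSq_def', pow_two (f b), Quaternion.re_mul, map_ofNat]
  ring

theorem map_quatDisc (b : B) : τ (quatDisc F b) = -∑ l, (2 * imCoord (f b) l) ^ 2 := by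
  rw [quatDisc, map_sub, map_mul, map_pow, g.map_redTrace hB hf hτ, g.map_redNorm hB hf hτ, map_ofNat,
    Quaternion.normSq_def', Fin.sum_univ_three]
  simp only [imCoord, Matrix.cons_val]
  ring

/-- The Cayley–Hamilton identity. -/
theorem mul_self_eq (b : B) :
    b * b = algebraMap F B (redTrace F b) * b - algebraMap F B (redNorm F b) := by
  apply hf
  rw [map_sub, map_mul, map_mul, hτ, hτ, g.map_redTrace hB hf hτ, g.map_redNorm hB hf hτ,
    Quaternion.normSq_def']
  ext
  all_goals
    simp only [Quaternion.re_mul, Quaternion.imI_mul, Quaternion.imJ_mul, Quaternion.imK_mul, Quaternion.re_sub,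
      Quaternion.imI_sub, Quaternion.imJ_sub, Quaternion.imK_sub, Quaternion.re_coe, Quaternion.imI_coe,
      Quaternion.imJ_coe, Quaternion.imK_coe]
    ring

end QuatGens

end QuatTrace

/-! ## The ternary quadratic space of a definite quaternion algebra -/

section DefiniteQuaternion

set_option linter.unusedSectionVars false

/-- A definite quaternion division algebra with embeddings into the Hamilton quaternions. -/
structure DefiniteQuat (F : Type*) [Field F] (B : Type*) [Ring B] [Algebra F B] where
  ι : (F →+* ℝ) → B →+* Quaternion ℝ
  map_algebraMap : ∀ τ a, ι τ (algebraMap F B a) = ((τ a : ℝ) : Quaternion ℝ)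
  inj : ∀ τ, Function.Injective (ι τ)
  finrank_eq : Module.finrank F B = 4
  gens : QuatGens F B

variable {F : Type*} [Field F] [NumberField F] {B : Type*} [Ring B] [Algebra F B]

lemma isDomain_of_injective [Nontrivial B] {f : B →+* Quaternion ℝ} (hf : Function.Injective f) :
    IsDomain B := by
  have : NoZeroDivisors B := hf.noZeroDivisors f (map_zero f) (map_mul f)
  exact NoZeroDivisors.to_isDomain B

variable [IsDomain B]

namespace DefiniteQuat

variable (H : DefiniteQuat F B)

include H

lemma finite : FiniteDimensional F B :=
  Module.finite_of_finrank_pos (by rw [H.finrank_eq]; norm_num)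

lemma map_redTrace (τ : F →+* ℝ) (b : B) : τ (redTrace F b) = 2 * (H.ι τ b).re :=
  H.gens.map_redTrace H.finrank_eq (H.inj τ) (H.map_algebraMap τ) b

lemma map_redNorm (τ : F →+* ℝ) (b : B) : τ (redNorm F b) = Quaternion.normSq (H.ι τ b) :=
  H.gens.map_redNorm H.finrank_eq (H.inj τ) (H.map_algebraMap τ) b

lemma map_quatDisc (τ : F →+* ℝ) (b : B) :
    τ (quatDisc F b) = -∑ l, (2 * imCoord (H.ι τ b) l) ^ 2 :=
  H.gens.map_quatDisc H.finrank_eq (H.inj τ) (H.map_algebraMap τ) b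

end DefiniteQuat

variable [NumberField.IsTotallyReal F]

lemma exists_realEmb (F : Type*) [Field F] [NumberField F] [NumberField.IsTotallyReal F] :
    ∃ _ : F →+* ℝ, True := ⟨Classical.arbitrary _, trivial⟩

namespace DefiniteQuat

variable (H : DefiniteQuat F B)

include H

lemma mul_self_eq (b : B) :
    b * b = algebraMap F B (redTrace F b) * b - algebraMap F B (redNorm F b) := by
  obtain ⟨τ, -⟩ := exists_realEmb F
  exact H.gens.mul_self_eq H.finrank_eq (H.inj τ) (H.map_algebraMap τ) b

lemma redTrace_algebraMap (a : F) : redTrace F (algebraMap F B a) = 2 * a := by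
  obtain ⟨τ, -⟩ := exists_realEmb F
  apply τ.injective
  rw [H.map_redTrace, H.map_algebraMap, map_mul, map_ofNat, Quaternion.re_coe]

lemma redNorm_algebraMap (a : F) : redNorm F (algebraMap F B a) = a ^ 2 := by
  obtain ⟨τ, -⟩ := exists_realEmb F
  apply τ.injective
  rw [H.map_redNorm, H.map_algebraMap, map_pow, Quaternion.normSq_coe]

lemma redNorm_mul (a b : B) : redNorm F (a * b) = redNorm F a * redNorm F b := by
  obtain ⟨τ, -⟩ := exists_realEmb F
  apply τ.injective
  rw [H.map_redNorm, map_mul, map_mul, map_mul, H.map_redNorm, H.map_redNorm]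

lemma redNorm_eq_zero {b : B} : redNorm F b = 0 ↔ b = 0 := by
  obtain ⟨τ, -⟩ := exists_realEmb F
  rw [← map_eq_zero_iff τ τ.injective, H.map_redNorm, Quaternion.normSq_eq_zero,
    map_eq_zero_iff _ (H.inj τ)]

lemma redTrace_mul_comm (x y : B) : redTrace F (x * y) = redTrace F (y * x) := by
  obtain ⟨τ, -⟩ := exists_realEmb F
  apply τ.injective
  rw [H.map_redTrace, H.map_redTrace, map_mul, map_mul, quaternion_re_mul_comm]

lemma redTrace_mul_algebraMap (x : B) (a : F) : redTrace F (x * algebraMap F B a) = a * redTrace F x := by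
  rw [← Algebra.commutes, ← Algebra.smul_def, ← redTraceLin_apply, map_smul, redTraceLin_apply, smul_eq_mul]

end DefiniteQuat

variable (F B) in
/-- The form `tr x tr y - 2 tr(x y)` polarizing `-disc`. -/
def discForm : B →ₗ[F] B →ₗ[F] F :=
  LinearMap.mk₂ F (fun x y => redTraceLin F B x * redTraceLin F B y - 2 * redTraceLin F B (x * y))
    (fun x x' y => by rw [add_mul, map_add, map_add]; ring)
    (fun c x y => by rw [smul_mul_assoc, map_smul, map_smul]; simp only [smul_eq_mul]; ring)
    (fun x y y' => by rw [mul_add, map_add, map_add]; ring)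
    (fun c x y => by rw [mul_smul_comm, map_smul, map_smul]; simp only [smul_eq_mul]; ring)

lemma discForm_apply (x y : B) :
    discForm F B x y = redTrace F x * redTrace F y - 2 * redTrace F (x * y) := by
  rw [discForm, LinearMap.mk₂_apply, redTraceLin_apply, redTraceLin_apply, redTraceLin_apply]

lemma discForm_self (x : B) : discForm F B x x = -quatDisc F x := by
  rw [discForm_apply, quatDisc, redNorm, pow_two x]; ring

/-- The space `B / F`. -/
abbrev TraceQuot (F : Type*) [Field F] (B : Type*) [Ring B] [Algebra F B] : Type _ :=
  B ⧸ (1 : Submodule F B)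

namespace DefiniteQuat

variable (H : DefiniteQuat F B)

include H in
lemma discForm_algebraMap (a : F) : discForm F B (algebraMap F B a) = 0 := by
  ext y
  rw [discForm_apply, H.redTrace_algebraMap, Algebra.commutes a y, H.redTrace_mul_algebraMap,
    LinearMap.zero_apply]
  ring

include H in
lemma discForm_algebraMap_right (x : B) (a : F) : discForm F B x (algebraMap F B a) = 0 := by
  rw [discForm_apply, H.redTrace_algebraMap, H.redTrace_mul_algebraMap]
  ring

/-- The form on `B / F`. -/
def quotForm : TraceQuot F B →ₗ[F] TraceQuot F B →ₗ[F] F :=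
  Submodule.liftQ 1 (Submodule.liftQ 1 (discForm F B) (by
    intro x hx
    obtain ⟨a, rfl⟩ := Submodule.mem_one.1 hx
    exact H.discForm_algebraMap a)).flip (by
    intro x hx
    obtain ⟨a, rfl⟩ := Submodule.mem_one.1 hx
    rw [LinearMap.mem_ker]
    ext y
    exact H.discForm_algebraMap_right y a)

lemma quotForm_mk (x y : B) :
    H.quotForm (Submodule.Quotient.mk x) (Submodule.Quotient.mk y) = discForm F B y x := rfl

lemma imCoord_add (p q : Quaternion ℝ) (l : Fin 3) : imCoord (p + q) l = imCoord p l + imCoord q l := by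
  fin_cases l <;> simp [imCoord]

lemma imCoord_coe (r : ℝ) (l : Fin 3) : imCoord (r : Quaternion ℝ) l = 0 := by
  fin_cases l <;> simp [imCoord]

lemma imCoord_coe_mul (r : ℝ) (q : Quaternion ℝ) (l : Fin 3) :
    imCoord ((r : Quaternion ℝ) * q) l = r * imCoord q l := by
  fin_cases l <;> simp [imCoord]

/-- The coordinates on `B / F`. -/
def quotCoord (τ : F →+* ℝ) (l : Fin 3) : TraceQuot F B →+ ℝ :=
  QuotientAddGroup.lift (1 : Submodule F B).toAddSubgroup
    { toFun := fun b => 2 * imCoord (H.ι τ b) l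
      map_zero' := by
        have := imCoord_coe 0 l
        rw [map_zero, ← Quaternion.coe_zero, this, mul_zero]
      map_add' := fun x y => by rw [map_add, imCoord_add, mul_add] } (by
    intro x hx
    obtain ⟨a, rfl⟩ := Submodule.mem_one.1 hx
    change 2 * imCoord (H.ι τ (algebraMap F B a)) l = 0
    rw [H.map_algebraMap, imCoord_coe, mul_zero])

lemma quotCoord_mk (τ : F →+* ℝ) (l : Fin 3) (b : B) :
    H.quotCoord τ l (Submodule.Quotient.mk b) = 2 * imCoord (H.ι τ b) l := rfl

lemma map_discForm (τ : F →+* ℝ) (x y : B) : τ (discForm F B x y) =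
    ∑ l, (2 * imCoord (H.ι τ x) l) * (2 * imCoord (H.ι τ y) l) := by
  rw [discForm_apply, map_sub, map_mul, map_mul, H.map_redTrace, H.map_redTrace, H.map_redTrace, map_ofNat,
    map_mul, Quaternion.re_mul, Fin.sum_univ_three]
  simp only [imCoord, Matrix.cons_val]
  ring

include H in
lemma finrank_quot : Module.finrank F (TraceQuot F B) = 3 := by
  have := H.finite
  have h1 := Submodule.finrank_quotient_add_finrank (1 : Submodule F B)
  have h2 : Module.finrank F (1 : Submodule F B) = 1 := by
    rw [Submodule.one_eq_span]
    exact finrank_span_singleton one_ne_zero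
  rw [h2, H.finrank_eq] at h1
  exact Nat.succ_injective h1

-- Definiteness at a single real place suffices: a vanishing sum of squares kills the imaginary
-- part, leaving `b = tr(b) / 2`.
include H in
lemma mem_one_of_quatDisc {b : B} (h : quatDisc F b = 0) : b ∈ (1 : Submodule F B) := by
  obtain ⟨τ, -⟩ := exists_realEmb F
  have h1 := H.map_quatDisc τ b
  rw [h, map_zero, Fin.sum_univ_three] at h1
  simp only [imCoord, Matrix.cons_val] at h1
  refine Submodule.mem_one.2 ⟨redTrace F b / 2, H.inj τ ?_⟩
  rw [H.map_algebraMap, map_div₀, H.map_redTrace, map_ofNat]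
  have hI : (H.ι τ b).imI = 0 := by nlinarith [sq_nonneg (H.ι τ b).imI, sq_nonneg (H.ι τ b).imJ, sq_nonneg (H.ι τ b).imK]
  have hJ : (H.ι τ b).imJ = 0 := by nlinarith [sq_nonneg (H.ι τ b).imI, sq_nonneg (H.ι τ b).imJ, sq_nonneg (H.ι τ b).imK]
  have hK : (H.ι τ b).imK = 0 := by nlinarith [sq_nonneg (H.ι τ b).imI, sq_nonneg (H.ι τ b).imJ, sq_nonneg (H.ι τ b).imK]
  ext
  · rw [Quaternion.re_coe]; ring
  · rw [Quaternion.imI_coe, hI]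
  · rw [Quaternion.imJ_coe, hJ]
  · rw [Quaternion.imK_coe, hK]

/-- The quadratic space `B / F` with the form `-disc`. -/
def quadCoord : QuadCoord F (TraceQuot F B) 3 where
  form := H.quotForm
  coord := H.quotCoord
  coord_smul τ l a v := by
    obtain ⟨b, rfl⟩ := Submodule.Quotient.mk_surjective _ v
    rw [← Submodule.Quotient.mk_smul, quotCoord_mk, quotCoord_mk, Algebra.smul_def, map_mul,
      H.map_algebraMap, imCoord_coe_mul]
    ring
  map_form τ u v := by
    obtain ⟨x, rfl⟩ := Submodule.Quotient.mk_surjective _ u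
    obtain ⟨y, rfl⟩ := Submodule.Quotient.mk_surjective _ v
    rw [quotForm_mk, H.map_discForm]
    exact Finset.sum_congr rfl fun l _ => by rw [quotCoord_mk, quotCoord_mk, mul_comm]
  form_self_ne v hv := by
    obtain ⟨b, rfl⟩ := Submodule.Quotient.mk_surjective _ v
    rw [quotForm_mk, discForm_self]
    intro h
    exact hv ((Submodule.Quotient.mk_eq_zero _).2 (H.mem_one_of_quatDisc (neg_eq_zero.1 h)))
  finrank_eq := H.finrank_quot
  finite := by
    have := H.finite
    infer_instance

lemma quadCoord_form_mk (x y : B) :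
    H.quadCoord.form (Submodule.Quotient.mk x) (Submodule.Quotient.mk y) = discForm F B y x := rfl

/-- The summands of the theta series in terms of the quadratic space `B / F`. -/
lemma evalAt_mul_expHalf (P : WeightPoly F) (b : B) (z : (F →+* ℝ) → UpperHalfPlane) :
    evalAt H.ι P b * expHalf (-quatDisc F b) z =
      H.quadCoord.term (fun τ => (z τ : ℂ)) P (Submodule.Quotient.mk b) := by
  rw [QuadCoord.term, polyGauss, H.quadCoord.gaussC_vec (fun τ => (z τ : ℂ)), quadCoord_form_mk, discForm_self]
  congr 1
  rw [expHalf]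
  congr 1
  rw [Finset.mul_sum, Finset.mul_sum]
  exact Finset.sum_congr rfl fun τ _ => by ring

/-- An orthogonal basis with values `-α, -β, αβ`. -/
theorem exists_orthogonal_basis : ∃ (e : Module.Basis (Fin 3) F (TraceQuot F B)) (α β : 𝓞 F),
    α ≠ 0 ∧ β ≠ 0 ∧ (∀ i j, i ≠ j → H.quadCoord.form (e i) (e j) = 0) ∧
      H.quadCoord.form (e 0) (e 0) = -(α : F) ∧ H.quadCoord.form (e 1) (e 1) = -(β : F) ∧
        H.quadCoord.form (e 2) (e 2) = (α : F) * β := by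
  set g := H.gens
  obtain ⟨m, hm, x, hx⟩ := exists_nat_mul_integral (4 * g.sqI)
  obtain ⟨m', hm', y, hy⟩ := exists_nat_mul_integral (4 * g.sqJ)
  have hmF : (m : F) ≠ 0 := by exact_mod_cast hm
  have hmF' : (m' : F) ≠ 0 := by exact_mod_cast hm'
  -- The form takes the values `-4 i²`, `-4 j²`, `4 i² j²` on `i`, `j`, `ij`. The multipliers `m`,
  -- `m'` make `α = 4 m² i²` and `β = 4 m'² j²` integral, and `2 m m'` is what makes the third value
  -- equal to `α β` exactly.
  let v : Fin 3 → TraceQuot F B := ![Submodule.Quotient.mk ((m : F) • g.i), Submodule.Quotient.mk ((m' : F) • g.j),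
    Submodule.Quotient.mk ((2 * m * m' : F) • (g.i * g.j))]
  have ti : redTrace F g.i = 0 := QuatGens.redTrace_eq_zero g.sqJ_ne g.j_sq g.anti
  have tj : redTrace F g.j = 0 := QuatGens.redTrace_eq_zero g.sqI_ne g.i_sq g.anti'
  have tij : redTrace F (g.i * g.j) = 0 := QuatGens.redTrace_eq_zero g.sqI_ne g.i_sq g.anti_ij
  have hanti : ∀ p q : B, p * q = -(q * p) → redTrace F (p * q) = 0 := by
    intro p q h
    have h1 := H.redTrace_mul_comm p q
    have h2 : redTrace F (p * q) = -redTrace F (q * p) := by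
      rw [h, ← redTraceLin_apply, ← redTraceLin_apply, map_neg]
    rw [← h1] at h2
    exact self_eq_neg.1 h2
  have hd : ∀ (p q : B) (a b : F), redTrace F p = 0 → discForm F B (a • p) (b • q) = -2 * a * b * redTrace F (p * q) := by
    intro p q a b h
    rw [map_smul, map_smul, LinearMap.smul_apply, discForm_apply, h]
    simp only [smul_eq_mul]
    ring
  have horth : ∀ i j, i ≠ j → H.quadCoord.form (v i) (v j) = 0 := by
    have h1 := hanti _ _ g.anti
    have h2 := hanti _ _ g.anti'
    have h3 := hanti _ _ g.anti_ij
    have h4 := hanti _ _ g.anti_ij_j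
    have h5 := hanti g.i (g.i * g.j) (by rw [g.anti_ij, neg_neg])
    have h6 := hanti g.j (g.i * g.j) (by rw [g.anti_ij_j, neg_neg])
    intro i j hij
    fin_cases i <;> fin_cases j <;> first | exact absurd rfl hij | skip
    · exact (hd _ _ _ _ tj).trans (by rw [h2, mul_zero])
    · exact (hd _ _ _ _ tij).trans (by rw [h3, mul_zero])
    · exact (hd _ _ _ _ ti).trans (by rw [h1, mul_zero])
    · exact (hd _ _ _ _ tij).trans (by rw [h4, mul_zero])
    · exact (hd _ _ _ _ ti).trans (by rw [h5, mul_zero])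
    · exact (hd _ _ _ _ tj).trans (by rw [h6, mul_zero])
  have q0 : H.quadCoord.form (v 0) (v 0) = -((m * x : 𝓞 F) : F) := by
    refine (hd _ _ _ _ ti).trans ?_
    rw [g.i_sq, H.redTrace_algebraMap]
    simp only [map_mul, map_natCast, hx]
    ring
  have q1 : H.quadCoord.form (v 1) (v 1) = -((m' * y : 𝓞 F) : F) := by
    refine (hd _ _ _ _ tj).trans ?_
    rw [g.j_sq, H.redTrace_algebraMap]
    simp only [map_mul, map_natCast, hy]
    ring
  have q2 : H.quadCoord.form (v 2) (v 2) = ((m * x : 𝓞 F) : F) * ((m' * y : 𝓞 F) : F) := by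
    refine (hd _ _ _ _ tij).trans ?_
    rw [g.ij_sq, H.redTrace_algebraMap]
    simp only [map_mul, map_natCast, hx, hy]
    ring
  have hx0 : m * x ≠ 0 := by
    refine mul_ne_zero (by exact_mod_cast hm) fun h => ?_
    rw [h] at hx
    have : (m : F) * (4 * g.sqI) ≠ 0 := mul_ne_zero hmF (mul_ne_zero (by norm_num) g.sqI_ne)
    exact this (by rw [← hx]; exact map_zero _)
  have hy0 : m' * y ≠ 0 := by
    refine mul_ne_zero (by exact_mod_cast hm') fun h => ?_
    rw [h] at hy
    have : (m' : F) * (4 * g.sqJ) ≠ 0 := mul_ne_zero hmF' (mul_ne_zero (by norm_num) g.sqJ_ne)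
    exact this (by rw [← hy]; exact map_zero _)
  have hcoe : ∀ o : 𝓞 F, o ≠ 0 → (o : F) ≠ 0 := fun o ho =>
    (map_ne_zero_iff _ (FaithfulSMul.algebraMap_injective (𝓞 F) F)).2 ho
  have hlin : LinearIndependent F v := by
    rw [Fintype.linearIndependent_iff]
    intro c hc i
    have h1 := congrArg (fun w => H.quadCoord.form (v i) w) hc
    simp only [map_sum, map_smul, map_zero, smul_eq_mul] at h1
    rw [Finset.sum_eq_single_of_mem i (Finset.mem_univ i) (fun j _ hj => by rw [horth i j hj.symm, mul_zero])] at h1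
    refine (mul_eq_zero.1 h1).resolve_right ?_
    fin_cases i
    · exact fun h => neg_ne_zero.2 (hcoe _ hx0) (q0.symm.trans h)
    · exact fun h => neg_ne_zero.2 (hcoe _ hy0) (q1.symm.trans h)
    · exact fun h => mul_ne_zero (hcoe _ hx0) (hcoe _ hy0) (q2.symm.trans h)
  let e := basisOfLinearIndependentOfCardEqFinrank hlin (by simp [H.finrank_quot])
  have he : ∀ i, e i = v i := fun i => by
    rw [coe_basisOfLinearIndependentOfCardEqFinrank]
  refine ⟨e, m * x, m' * y, hx0, hy0, fun i j hij => ?_, ?_, ?_, ?_⟩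
  · rw [he, he]; exact horth i j hij
  · rw [he]; exact q0
  · rw [he]; exact q1
  · rw [he]; exact q2

end DefiniteQuat

/-- The data of a totally definite quaternion algebra. -/
theorem exists_definiteQuat [Algebra.IsCentral F B] (hB : Module.finrank F B = 4)
    (ι : (F →+* ℝ) → B →+* Quaternion ℝ) (hinj : ∀ τ, Function.Injective (ι τ))
    (hι : ∀ (τ : F →+* ℝ) (a : F), ι τ (algebraMap F B a) = ((τ a : ℝ) : Quaternion ℝ)) :
    ∃ H : DefiniteQuat F B, H.ι = ι := by
  obtain ⟨g⟩ := exists_quatGens (F := F) hB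
  exact ⟨⟨ι, hι, hinj, hB, g⟩, rfl⟩

end DefiniteQuaternion

/-! ## Finite adeles -/

section FiniteAdeles

set_option linter.unusedSectionVars false

variable {F : Type*} [Field F] [NumberField F]

open IsDedekindDomain HeightOneSpectrum

/-- The everywhere integral finite adeles. -/
def IsIntegralAdele (a : FinAdele F) : Prop := ∀ v, a v ∈ v.adicCompletionIntegers F

lemma adele_sub_apply (a b : FinAdele F) (v : HeightOneSpectrum (𝓞 F)) : (a - b) v = a v - b v := rfl
lemma adele_algebraMap_apply (k : F) (v : HeightOneSpectrum (𝓞 F)) :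
    (algebraMap F (FinAdele F) k) v = (k : v.adicCompletion F) := rfl

lemma IsIntegralAdele.add {a b : FinAdele F} (ha : IsIntegralAdele a) (hb : IsIntegralAdele b) :
    IsIntegralAdele (a + b) := fun v => add_mem (ha v) (hb v)

lemma IsIntegralAdele.mul {a b : FinAdele F} (ha : IsIntegralAdele a) (hb : IsIntegralAdele b) :
    IsIntegralAdele (a * b) := fun v => mul_mem (ha v) (hb v)

lemma isIntegralAdele_one : IsIntegralAdele (1 : FinAdele F) := fun _ => one_mem _

lemma isIntegralAdele_zero : IsIntegralAdele (0 : FinAdele F) := fun _ => zero_mem _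

lemma coe_mem_iff {k : F} {v : HeightOneSpectrum (𝓞 F)} :
    (k : v.adicCompletion F) ∈ v.adicCompletionIntegers F ↔ v.valuation F k ≤ 1 := by
  rw [mem_adicCompletionIntegers, valuedAdicCompletion_eq_valuation']

lemma isIntegralAdele_algebraMap_iff {k : F} :
    IsIntegralAdele (algebraMap F (FinAdele F) k) ↔ k ∈ (1 : Submodule (𝓞 F) F) := by
  constructor
  · intro h
    obtain ⟨o, rfl⟩ := mem_integers_of_valuation_le_one (R := 𝓞 F) F k fun v => coe_mem_iff.1 (h v)
    exact coe_mem_one o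
  · intro h v
    obtain ⟨o, rfl⟩ := Submodule.mem_one.1 h
    exact coe_mem_iff.2 (valuation_le_one v o)

/-- `F` is dense in its completion and the valuation ring is open. -/
lemma exists_sub_mem_completion (v : HeightOneSpectrum (𝓞 F)) (a : v.adicCompletion F) :
    ∃ k : F, a - (k : v.adicCompletion F) ∈ v.adicCompletionIntegers F := by
  have hopen : IsOpen {y : v.adicCompletion F | a - y ∈ v.adicCompletionIntegers F} :=
    (Valued.isOpen_valuationSubring _).preimage (continuous_const.sub continuous_id)
  obtain ⟨k, hk⟩ := (denseRange_algebraMap F v).exists_mem_open hopen ⟨a, by simp⟩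
  exact ⟨k, hk⟩

/-- Strong approximation for the additive group: `𝔸_f = F + 𝓞̂`. -/
theorem exists_sub_isIntegralAdele (a : FinAdele F) :
    ∃ k : F, IsIntegralAdele (a - algebraMap F (FinAdele F) k) := by
  classical
  have hS : {v : HeightOneSpectrum (𝓞 F) | a v ∉ v.adicCompletionIntegers F}.Finite := a.2
  choose κ hκ using fun v => exists_sub_mem_completion v (a v)
  choose m hm x hx using fun v => exists_nat_mul_integral (F := F) (κ v)
  let M : ℕ := ∏ v ∈ hS.toFinset, m v
  have hM : M ≠ 0 := Finset.prod_ne_zero_iff.2 fun v _ => hm v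
  have hMF : ((M : 𝓞 F) : F) ≠ 0 := by simpa using hM
  have hM0 : (M : 𝓞 F) ≠ 0 := by exact_mod_cast hM
  have hMκ : ∀ v ∈ hS.toFinset, ∃ y : 𝓞 F, (y : F) = ((M : 𝓞 F) : F) * κ v := by
    intro v hv
    refine ⟨((∏ u ∈ hS.toFinset.erase v, m u : ℕ) : 𝓞 F) * x v, ?_⟩
    simp only [map_mul, map_natCast, hx]
    rw [← mul_assoc, ← Nat.cast_mul, Finset.prod_erase_mul _ _ hv]
  let y : HeightOneSpectrum (𝓞 F) → 𝓞 F := fun v => if h : v ∈ hS.toFinset then (hMκ v h).choose else 0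
  have hyS : ∀ v ∈ hS.toFinset, (y v : F) = ((M : 𝓞 F) : F) * κ v := fun v hv => by
    simp only [y, dif_pos hv]
    exact (hMκ v hv).choose_spec
  have hyS' : ∀ v, v ∉ hS.toFinset → y v = 0 := fun v hv => by simp only [y, dif_neg hv]
  have hfin : {v : HeightOneSpectrum (𝓞 F) | (M : 𝓞 F) ∈ v.asIdeal}.Finite := by
    have := Ideal.finite_factors (I := Ideal.span {(M : 𝓞 F)}) (by simpa using hM0)
    refine this.subset fun v hv => ?_
    exact (Ideal.dvd_span_singleton).2 hv
  let T := hS.toFinset ∪ hfin.toFinset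
  let e : HeightOneSpectrum (𝓞 F) → ℕ := fun v => multiplicity v.asIdeal (Ideal.span {(M : 𝓞 F)})
  -- By the Chinese remainder theorem the numerator `o` agrees with `M κ_v` at the finitely many bad
  -- places, and with `0` at the other primes dividing `M`, to the precision of `M` itself. Then `o
  -- / M` is the required global element.
  obtain ⟨o, ho⟩ := exists_forall_sub_mem_ideal (s := T)
    (fun v : HeightOneSpectrum (𝓞 F) => v.asIdeal) e (fun v _ => v.prime)
    (fun v _ u _ h h' => h (HeightOneSpectrum.ext h')) (fun v => y v)
  have hval : ∀ v : HeightOneSpectrum (𝓞 F), v.valuation F (((o : 𝓞 F) : F) - y v) ≤ v.valuation F ((M : 𝓞 F) : F) := by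
    intro v
    have e1 : ((o : 𝓞 F) : F) - y v = ((o - y v : 𝓞 F) : F) := by simp only [map_sub]
    rw [e1, valuation_of_algebraMap, valuation_of_algebraMap]
    by_cases hv : v ∈ T
    · rw [intValuation_eq_exp_neg_multiplicity v hM0]
      exact (v.intValuation_le_pow_iff_mem _ _).2 (ho v hv)
    · have h1 : (M : 𝓞 F) ∉ v.asIdeal := fun h => hv (Finset.mem_union_right _ (hfin.mem_toFinset.2 h))
      have h2 : v.intValuation (M : 𝓞 F) = 1 := (v.intValuation_eq_one_iff_mem_primeCompl _).2 h1
      rw [h2]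
      exact v.intValuation_le_one _
  have hval' : ∀ v : HeightOneSpectrum (𝓞 F),
      v.valuation F ((((o : 𝓞 F) : F) - y v) / ((M : 𝓞 F) : F)) ≤ 1 := by
    intro v
    rw [map_div₀]
    exact div_le_one_of_le₀ (hval v) zero_le
  refine ⟨(o : F) / ((M : 𝓞 F) : F), fun v => ?_⟩
  rw [adele_sub_apply, adele_algebraMap_apply]
  have h3 := coe_mem_iff.2 (hval' v)
  by_cases hv : v ∈ hS.toFinset
  · have e2 : (o : F) / ((M : 𝓞 F) : F) = κ v + (((o : 𝓞 F) : F) - y v) / ((M : 𝓞 F) : F) := by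
      rw [hyS v hv]; field_simp; ring
    rw [e2, adicCompletion.coe_add, ← sub_sub]
    exact sub_mem (hκ v) h3
  · rw [hyS' v hv] at h3
    have e2 : (((o : 𝓞 F) : F) - ((0 : 𝓞 F) : F)) / ((M : 𝓞 F) : F) = (o : F) / ((M : 𝓞 F) : F) := by
      simp only [map_zero, sub_zero]
    rw [e2] at h3
    have h4 : a v ∈ v.adicCompletionIntegers F := by
      by_contra h
      exact hv (hS.mem_toFinset.2 h)
    exact sub_mem h4 h3

/-- Every finite adele has a nonzero integral multiple. -/
theorem exists_nat_mul_isIntegralAdele (a : FinAdele F) :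
    ∃ m : ℕ, m ≠ 0 ∧ IsIntegralAdele ((m : FinAdele F) * a) := by
  obtain ⟨k, hk⟩ := exists_sub_isIntegralAdele a
  obtain ⟨m, hm, x, hx⟩ := exists_nat_mul_integral (F := F) k
  refine ⟨m, hm, ?_⟩
  have h1 : IsIntegralAdele (m : FinAdele F) := fun v => natCast_mem (v.adicCompletionIntegers F) m
  have h2 : (m : FinAdele F) * a = m * (a - algebraMap F (FinAdele F) k) + algebraMap F (FinAdele F) (x : F) := by
    rw [hx, map_mul, map_natCast]; ring
  rw [h2]
  exact (h1.mul hk).add (isIntegralAdele_algebraMap_iff.2 (coe_mem_one x))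

end FiniteAdeles

/-! ## The orders `R̂` and `R_x` -/

section LocalOrders

set_option linter.unusedSectionVars false

variable {F : Type*} [Field F] [NumberField F] {B : Type*} [Ring B] [Algebra F B]

lemma IsOrder.isLattice {R : Subalgebra (𝓞 F) B} (hR : IsOrder F R) :
    IsLattice (Subalgebra.toSubmodule R) := hR

/-- Compares `R` with a free lattice, up to the bounded index `N`. Membership in `R̂` can then be
tested, up to `N`, on adelic coordinates. -/
lemma exists_basis_mem_order [FiniteDimensional F B] {R : Subalgebra (𝓞 F) B} (hR : IsOrder F R) :
    ∃ (e : Module.Basis (Fin (Module.finrank F B)) F B) (N : ℕ), N ≠ 0 ∧ (∀ i, e i ∈ R) ∧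
      ∀ r ∈ R, ∀ i, (N : F) * e.repr r i ∈ (1 : Submodule (𝓞 F) F) := by
  let b := Module.finBasis F B
  choose m hm h using fun i => hR.isLattice.exists_nat_smul_mem (b i)
  let e : Module.Basis (Fin (Module.finrank F B)) F B :=
    b.isUnitSMul (w := fun i => (m i : F)) fun i => IsUnit.mk0 _ (by exact_mod_cast hm i)
  have he : ∀ i, e i ∈ R := fun i => by
    rw [Module.Basis.isUnitSMul_apply]
    exact h i
  let M : Submodule (𝓞 F) B := Submodule.span (𝓞 F) (Set.range e)
  have hM : IsLattice M := ⟨Submodule.fg_span (Set.finite_range e), by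
    rw [Submodule.span_span_of_tower, e.span_eq]⟩
  obtain ⟨N, hN, hN'⟩ := hM.exists_nat_smul_le hR.1
  refine ⟨e, N, hN, he, fun r hr i => ?_⟩
  have h1 := hN' r hr
  rw [← smul_eq_mul, ← Finsupp.smul_apply, ← map_smul]
  generalize (N : F) • r = y at h1
  induction h1 using Submodule.span_induction with
  | mem y hy =>
    obtain ⟨l, rfl⟩ := hy
    rw [e.repr_self, Finsupp.single_apply]
    split_ifs
    · exact Submodule.one_le.1 le_rfl
    · exact zero_mem _
  | zero => simp
  | add y z _ _ hy hz => rw [map_add]; exact add_mem hy hz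
  | smul a y _ hy =>
    rw [← algebraMap_smul F a y, map_smul, Finsupp.smul_apply, algebraMap_smul]
    exact Submodule.smul_mem _ a hy

/-! ### The ring `R̂` -/

/-- The generators are closed under products, so the additive group they generate is already the
ring; this permits induction over sums alone. -/
lemma mem_orderHat_iff {R : Subalgebra (𝓞 F) B} {x : BHat F B} :
    x ∈ orderHat R ↔ x ∈ AddSubgroup.closure {t : BHat F B | ∃ a : FinAdele F, IsIntegralAdele a ∧
      ∃ r ∈ R, t = a ⊗ₜ[F] r} := by
  let S : Submonoid (BHat F B) :=
    { carrier := {t : BHat F B | ∃ a : FinAdele F, IsIntegralAdele a ∧ ∃ r ∈ R, t = a ⊗ₜ[F] r}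
      one_mem' := ⟨1, isIntegralAdele_one, 1, R.one_mem, rfl⟩
      mul_mem' := by
        rintro _ _ ⟨a, ha, r, hr, rfl⟩ ⟨b, hb, s, hs, rfl⟩
        exact ⟨a * b, ha.mul hb, r * s, R.mul_mem hr hs, by rw [Algebra.TensorProduct.tmul_mul_tmul]⟩ }
  change x ∈ Subring.closure (S : Set (BHat F B)) ↔ x ∈ AddSubgroup.closure (S : Set (BHat F B))
  rw [Subring.mem_closure_iff, Submonoid.closure_eq]

lemma tmul_mem_orderHat {R : Subalgebra (𝓞 F) B} {a : FinAdele F} (ha : IsIntegralAdele a) {r : B}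
    (hr : r ∈ R) : a ⊗ₜ[F] r ∈ orderHat R := Subring.subset_closure ⟨a, ha, r, hr, rfl⟩

lemma smul_mem_orderHat {R : Subalgebra (𝓞 F) B} {a : FinAdele F} (ha : IsIntegralAdele a)
    {x : BHat F B} (hx : x ∈ orderHat R) : a • x ∈ orderHat R := by
  have : a • x = a ⊗ₜ[F] (1 : B) * x := by
    rw [← one_mul x, ← smul_mul_assoc, one_mul, Algebra.TensorProduct.one_def, TensorProduct.smul_tmul',
      smul_eq_mul, mul_one]
  rw [this]
  exact (orderHat R).mul_mem (tmul_mem_orderHat ha R.one_mem) hx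

lemma mem_orderHat_of_repr {R : Subalgebra (𝓞 F) B} {n : ℕ} {e : Module.Basis (Fin n) F B}
    (he : ∀ i, e i ∈ R) {x : BHat F B}
    (hx : ∀ i, IsIntegralAdele ((e.baseChange (FinAdele F)).repr x i)) : x ∈ orderHat R := by
  rw [← (e.baseChange (FinAdele F)).sum_repr x]
  refine (orderHat R).sum_mem fun i _ => smul_mem_orderHat (hx i) ?_
  rw [Module.Basis.baseChange_apply]
  exact tmul_mem_orderHat isIntegralAdele_one (he i)

lemma isIntegralAdele_repr {R : Subalgebra (𝓞 F) B} {n : ℕ} {e : Module.Basis (Fin n) F B} {N : ℕ}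
    (hN : ∀ r ∈ R, ∀ i, (N : F) * e.repr r i ∈ (1 : Submodule (𝓞 F) F)) {x : BHat F B}
    (hx : x ∈ orderHat R) (i : Fin n) :
    IsIntegralAdele ((N : FinAdele F) * (e.baseChange (FinAdele F)).repr x i) := by
  rw [mem_orderHat_iff] at hx
  induction hx using AddSubgroup.closure_induction with
  | mem x hx =>
    obtain ⟨a, ha, r, hr, rfl⟩ := hx
    have : (N : FinAdele F) * (e.baseChange (FinAdele F)).repr (a ⊗ₜ[F] r) i =
        algebraMap F (FinAdele F) ((N : F) * e.repr r i) * a := by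
      rw [Module.Basis.baseChange_repr_tmul, Algebra.smul_def, map_mul, map_natCast, mul_assoc]
    rw [this]
    exact (isIntegralAdele_algebraMap_iff.2 (hN r hr i)).mul ha
  | zero => rw [map_zero, Finsupp.zero_apply, mul_zero]; exact isIntegralAdele_zero
  | add x y _ _ hx hy => rw [map_add, Finsupp.add_apply, mul_add]; exact hx.add hy
  | neg x _ hx =>
    rw [map_neg, Finsupp.neg_apply, mul_neg]
    exact fun v => neg_mem (hx v)

lemma natCast_mul_mem_orderHat {R : Subalgebra (𝓞 F) B} (m : ℕ) {x : BHat F B} (hx : x ∈ orderHat R) :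
    (m : BHat F B) * x ∈ orderHat R := (orderHat R).mul_mem (natCast_mem _ m) hx

/-! ### The order `R_x` -/

lemma mem_orderAt {R : Subalgebra (𝓞 F) B} {x : (BHat F B)ˣ} {b : B} :
    b ∈ orderAt R x ↔ (x : BHat F B) * (1 ⊗ₜ[F] b) * ((x⁻¹ : (BHat F B)ˣ) : BHat F B) ∈ orderHat R :=
  Iff.rfl

/-- `R_x` as an `𝓞 F`-subalgebra. -/
def orderAtAlg (R : Subalgebra (𝓞 F) B) (x : (BHat F B)ˣ) : Subalgebra (𝓞 F) B :=
  { orderAt R x with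
    algebraMap_mem' := fun o => by
      change algebraMap (𝓞 F) B o ∈ orderAt R x
      rw [mem_orderAt, IsScalarTower.algebraMap_apply (𝓞 F) F B, Algebra.algebraMap_eq_smul_one,
        TensorProduct.tmul_smul, ← Algebra.TensorProduct.one_def, mul_smul_comm, mul_one, smul_mul_assoc,
        Units.mul_inv, ← algebraMap_smul (FinAdele F)]
      exact smul_mem_orderHat (isIntegralAdele_algebraMap_iff.2 (coe_mem_one o)) (orderHat R).one_mem }

lemma mem_orderAtAlg {R : Subalgebra (𝓞 F) B} {x : (BHat F B)ˣ} {b : B} :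
    b ∈ orderAtAlg R x ↔ b ∈ orderAt R x := Iff.rfl

lemma tmul_natCast_smul (m : ℕ) (b : B) :
    (1 : FinAdele F) ⊗ₜ[F] ((m : F) • b) = (m : BHat F B) * (1 ⊗ₜ[F] b) := by
  rw [TensorProduct.tmul_smul, Nat.cast_smul_eq_nsmul, nsmul_eq_mul]

variable [FiniteDimensional F B]

lemma exists_nat_mul_mem_orderHat {R : Subalgebra (𝓞 F) B} (hR : IsOrder F R) (x : BHat F B) :
    ∃ m : ℕ, m ≠ 0 ∧ (m : BHat F B) * x ∈ orderHat R := by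
  obtain ⟨e, N, hN, he, -⟩ := exists_basis_mem_order hR
  choose m hm h using fun i => exists_nat_mul_isIntegralAdele ((e.baseChange (FinAdele F)).repr x i)
  refine ⟨∏ i, m i, Finset.prod_ne_zero_iff.2 fun i _ => hm i, mem_orderHat_of_repr he fun i => ?_⟩
  rw [← nsmul_eq_mul, map_nsmul, Finsupp.smul_apply, nsmul_eq_mul,
    ← Finset.prod_erase_mul _ _ (Finset.mem_univ i), Nat.cast_mul, mul_assoc]
  exact IsIntegralAdele.mul (fun v => natCast_mem (v.adicCompletionIntegers F) _) (h i)

lemma natCast_unit_BHat {m : ℕ} (hm : m ≠ 0) (x : BHat F B) : ∃ y : BHat F B, (m : BHat F B) * y = x := by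
  refine ⟨(m : F)⁻¹ • x, ?_⟩
  rw [← nsmul_eq_mul, ← Nat.cast_smul_eq_nsmul F, smul_smul, mul_inv_cancel₀ (by exact_mod_cast hm), one_smul]

/-- Strong approximation `B̂ = B + m R̂`. -/
theorem exists_sub_mem_orderHat {R : Subalgebra (𝓞 F) B} (hR : IsOrder F R) {m : ℕ} (hm : m ≠ 0)
    (x : BHat F B) : ∃ b : B, ∃ ρ ∈ orderHat R, x = 1 ⊗ₜ[F] b + (m : BHat F B) * ρ := by
  obtain ⟨e, N, hN, he, -⟩ := exists_basis_mem_order hR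
  obtain ⟨y, rfl⟩ := natCast_unit_BHat hm x
  choose κ hκ using fun i => exists_sub_isIntegralAdele ((e.baseChange (FinAdele F)).repr y i)
  let c : B := ∑ i, κ i • e i
  refine ⟨(m : F) • c, y - 1 ⊗ₜ[F] c, mem_orderHat_of_repr he fun i => ?_, ?_⟩
  · have : (e.baseChange (FinAdele F)).repr ((1 : FinAdele F) ⊗ₜ[F] c) i = algebraMap F (FinAdele F) (κ i) := by
      rw [Module.Basis.baseChange_repr_tmul, e.repr_sum_self, Algebra.smul_def, mul_one]
    rw [map_sub, Finsupp.sub_apply, this]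
    exact hκ i
  · rw [mul_sub, TensorProduct.tmul_smul, Nat.cast_smul_eq_nsmul, nsmul_eq_mul]
    abel

/-- Commensurability of `B ∩ R̂` with `R` is all that is used; it avoids proving `B ∩ R̂ = R`. -/
lemma exists_nat_smul_mem_of_tmul_mem {R : Subalgebra (𝓞 F) B} (hR : IsOrder F R) :
    ∃ N : ℕ, N ≠ 0 ∧ ∀ b : B, (1 : FinAdele F) ⊗ₜ[F] b ∈ orderHat R → (N : F) • b ∈ R := by
  obtain ⟨e, N, hN, he, hNe⟩ := exists_basis_mem_order hR
  refine ⟨N, hN, fun b hb => ?_⟩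
  rw [← e.sum_repr b, Finset.smul_sum]
  refine R.toSubmodule.sum_mem fun i _ => ?_
  have h1 := isIntegralAdele_repr hNe hb i
  rw [Module.Basis.baseChange_repr_tmul, Algebra.smul_def, mul_one, ← map_natCast (algebraMap F (FinAdele F)), ← map_mul] at h1
  obtain ⟨o, ho⟩ := Submodule.mem_one.1 (isIntegralAdele_algebraMap_iff.1 h1)
  rw [smul_smul, ← ho]
  exact int_smul_mem _ o (he i)

/-- The integers `p` and `q` clear the denominators of `x` and `x⁻¹`, and `N` leads from `B ∩ R̂`
back into `R`. Commensurability with `R` then makes `R_x` an order. -/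
theorem exists_nat_smul_orderAt {R : Subalgebra (𝓞 F) B} (hR : IsOrder F R) (x : (BHat F B)ˣ) :
    ∃ m : ℕ, m ≠ 0 ∧ (∀ r ∈ R, (m : F) • r ∈ orderAt R x) ∧ ∀ b ∈ orderAt R x, (m : F) • b ∈ R := by
  obtain ⟨p, hp, hp'⟩ := exists_nat_mul_mem_orderHat hR (x : BHat F B)
  obtain ⟨q, hq, hq'⟩ := exists_nat_mul_mem_orderHat hR ((x⁻¹ : (BHat F B)ˣ) : BHat F B)
  obtain ⟨N, hN, hN'⟩ := exists_nat_smul_mem_of_tmul_mem hR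
  refine ⟨N * (p * q), mul_ne_zero hN (mul_ne_zero hp hq), fun r hr => ?_, fun b hb => ?_⟩
  · rw [mem_orderAt, tmul_natCast_smul]
    have : (x : BHat F B) * (((N * (p * q) : ℕ) : BHat F B) * (1 ⊗ₜ[F] r)) * ((x⁻¹ : (BHat F B)ˣ) : BHat F B)
        = (N : BHat F B) * (((p : BHat F B) * (x : BHat F B)) * (1 ⊗ₜ[F] r) * ((q : BHat F B) * ((x⁻¹ : (BHat F B)ˣ) : BHat F B))) := by
      simp only [← nsmul_eq_mul, mul_smul_comm, smul_mul_assoc, smul_smul]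
      congr 1; ring
    rw [this]
    exact natCast_mul_mem_orderHat N ((orderHat R).mul_mem ((orderHat R).mul_mem hp'
      (tmul_mem_orderHat isIntegralAdele_one hr)) hq')
  · have e1 : ((N * (p * q) : ℕ) : F) • b = (N : F) • (((p * q : ℕ) : F) • b) := by
      rw [smul_smul, Nat.cast_mul]
    rw [e1]
    refine hN' _ ?_
    rw [tmul_natCast_smul]
    have : ((p * q : ℕ) : BHat F B) * ((1 : FinAdele F) ⊗ₜ[F] b) =
        ((q : BHat F B) * ((x⁻¹ : (BHat F B)ˣ) : BHat F B)) * ((x : BHat F B) * (1 ⊗ₜ[F] b) *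
          ((x⁻¹ : (BHat F B)ˣ) : BHat F B)) * ((p : BHat F B) * (x : BHat F B)) := by
      simp only [← nsmul_eq_mul, mul_smul_comm, smul_mul_assoc, smul_smul, mul_assoc,
        Units.inv_mul, mul_one, Units.inv_mul_cancel_left]
    rw [this]
    exact (orderHat R).mul_mem ((orderHat R).mul_mem hq' hb) hp'

theorem isOrder_orderAtAlg {R : Subalgebra (𝓞 F) B} (hR : IsOrder F R) (x : (BHat F B)ˣ) :
    IsOrder F (orderAtAlg R x) := by
  obtain ⟨m, hm, h1, h2⟩ := exists_nat_smul_orderAt hR x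
  exact isLattice_of_smul_mem (a := (m : F)) (b := (m : F)) hR.isLattice (by exact_mod_cast hm)
    (by exact_mod_cast hm) h2 h1

end LocalOrders

/-! ### Integrality -/

section Integrality

set_option linter.unusedSectionVars false

variable {F : Type*} [Field F] [NumberField F] [NumberField.IsTotallyReal F]
  {B : Type*} [Ring B] [Algebra F B] [IsDomain B] (H : DefiniteQuat F B)

include H

-- An element of an order is integral. If it is not a scalar, `X² - tr X + n` is its minimal
-- polynomial and divides a monic polynomial over `𝓞_F`; Gauss's lemma over the integrally closed
-- ring makes its coefficients integral. Scalars are treated directly.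
open Polynomial in
theorem DefiniteQuat.redTrace_redNorm_mem {S : Subalgebra (𝓞 F) B} (hS : IsOrder F S) {b : B} (hb : b ∈ S) :
    redTrace F b ∈ (1 : Submodule (𝓞 F) F) ∧ redNorm F b ∈ (1 : Submodule (𝓞 F) F) := by
  have hint : IsIntegral (𝓞 F) b := IsIntegral.of_mem_of_fg S hS.1 b hb
  have hinjB : Function.Injective (algebraMap F B) := FaithfulSMul.algebraMap_injective F B
  by_cases hbF : ∃ a : F, algebraMap F B a = b
  · obtain ⟨a, rfl⟩ := hbF
    have ha : IsIntegral (𝓞 F) a := (isIntegral_algHom_iff (IsScalarTower.toAlgHom (𝓞 F) F B) hinjB).1 hint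
    obtain ⟨o, rfl⟩ := IsIntegrallyClosed.isIntegral_iff.1 ha
    rw [H.redTrace_algebraMap, H.redNorm_algebraMap]
    refine ⟨Submodule.mem_one.2 ⟨2 * o, ?_⟩, Submodule.mem_one.2 ⟨o ^ 2, ?_⟩⟩
    · rw [map_mul, map_ofNat]
    · rw [map_pow]
  · obtain ⟨f, hf, hfb⟩ := hint
    set p : F[X] := X ^ 2 + C (-redTrace F b) * X + C (redNorm F b) with hp
    have hdeg : (C (-redTrace F b) * X + C (redNorm F b) : F[X]).degree < 2 :=
      lt_of_le_of_lt degree_linear_le (by norm_num)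
    have hpm : p.Monic := by
      rw [hp, add_assoc]; exact monic_X_pow_add hdeg
    have hpd : p.degree = 2 := by
      rw [hp, add_assoc, degree_add_eq_left_of_degree_lt] <;> rw [degree_X_pow]
      · rfl
      · exact hdeg
    have hpb : aeval b p = 0 := by
      rw [hp]
      simp only [map_add, map_mul, aeval_X, aeval_C, map_neg, map_pow]
      rw [pow_two, H.mul_self_eq]
      noncomm_ring
    have hfb' : aeval b (f.map (algebraMap (𝓞 F) F)) = 0 := by
      rw [aeval_map_algebraMap]; exact hfb
    have hr : aeval b (f.map (algebraMap (𝓞 F) F) %ₘ p) = 0 := by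
      have h := congrArg (aeval b) (modByMonic_add_div (f.map (algebraMap (𝓞 F) F)) p)
      rw [map_add, map_mul, hpb, zero_mul, add_zero, hfb'] at h
      exact h
    have hrd : (f.map (algebraMap (𝓞 F) F) %ₘ p).degree ≤ 1 := by
      have := degree_modByMonic_lt (f.map (algebraMap (𝓞 F) F)) hpm
      rw [hpd] at this
      exact Order.le_of_lt_succ this
    have hzero : f.map (algebraMap (𝓞 F) F) %ₘ p = 0 := by
      have huv := eq_X_add_C_of_degree_le_one hrd
      generalize (f.map (algebraMap (𝓞 F) F) %ₘ p).coeff 1 = u at huv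
      generalize (f.map (algebraMap (𝓞 F) F) %ₘ p).coeff 0 = v at huv
      rw [huv, map_add, map_mul, aeval_X, aeval_C, aeval_C] at hr
      have hu : u = 0 := by
        by_contra hu
        refine hbF ⟨-(u⁻¹ * v), ?_⟩
        have h1 : algebraMap F B u⁻¹ * (algebraMap F B u * b + algebraMap F B v) = 0 := by
          rw [hr, mul_zero]
        rw [mul_add, ← mul_assoc, ← map_mul, ← map_mul, inv_mul_cancel₀ hu, map_one, one_mul] at h1
        rw [map_neg]
        exact (eq_neg_of_add_eq_zero_left h1).symm
      have hv : v = 0 := by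
        rw [hu, map_zero, zero_mul, zero_add] at hr
        exact (map_eq_zero_iff _ hinjB).1 hr
      rw [huv, hu, hv, C_0, zero_mul, add_zero]
    obtain ⟨g, hg⟩ := IsIntegrallyClosed.eq_map_mul_C_of_dvd F hf
      ((modByMonic_eq_zero_iff_dvd hpm).1 hzero)
    rw [hpm.leadingCoeff, C_1, mul_one] at hg
    have h1 := congrArg (fun q => coeff q 1) hg
    have h0 := congrArg (fun q => coeff q 0) hg
    simp only [coeff_map, hp, coeff_add, coeff_X_pow, coeff_C_mul, coeff_X, coeff_C] at h1 h0
    norm_num at h1 h0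
    refine ⟨?_, ?_⟩
    · rw [← neg_neg (redTrace F b), ← h1]
      exact neg_mem (coe_mem_one _)
    · rw [← h0]; exact coe_mem_one _

lemma DefiniteQuat.mem_one_of_algebraMap_mem {S : Subalgebra (𝓞 F) B} (hS : IsOrder F S) {a : F}
    (ha : algebraMap F B a ∈ S) : a ∈ (1 : Submodule (𝓞 F) F) := by
  have hint : IsIntegral (𝓞 F) (algebraMap F B a) := IsIntegral.of_mem_of_fg S hS.1 _ ha
  have ha : IsIntegral (𝓞 F) a := (isIntegral_algHom_iff (IsScalarTower.toAlgHom (𝓞 F) F B)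
    (FaithfulSMul.algebraMap_injective F B)).1 hint
  obtain ⟨o, rfl⟩ := IsIntegrallyClosed.isIntegral_iff.1 ha
  exact coe_mem_one o

/-! ### The lattice `R_x / 𝓞_F` -/

omit [IsDomain B] H [NumberField.IsTotallyReal F] in
/-- The image of an order in `B / F`. -/
def quotLattice (S : Subalgebra (𝓞 F) B) : Submodule (𝓞 F) (TraceQuot F B) :=
  (Subalgebra.toSubmodule S).map ((Submodule.mkQ (1 : Submodule F B)).restrictScalars (𝓞 F))

omit [IsDomain B] H [NumberField.IsTotallyReal F] in
lemma mem_quotLattice {S : Subalgebra (𝓞 F) B} {v : TraceQuot F B} :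
    v ∈ quotLattice S ↔ ∃ b ∈ S, (Submodule.Quotient.mk b : TraceQuot F B) = v := Iff.rfl

omit [IsDomain B] H [NumberField.IsTotallyReal F] in
lemma IsOrder.isLattice_quotLattice {S : Subalgebra (𝓞 F) B} (hS : IsOrder F S) :
    IsLattice (quotLattice S) := by
  refine ⟨hS.1.map _, ?_⟩
  have h : (quotLattice S : Set (TraceQuot F B)) = Submodule.mkQ (1 : Submodule F B) '' (S : Set B) := rfl
  rw [h, Submodule.span_image, hS.2, Submodule.map_top, Submodule.range_mkQ]

lemma DefiniteQuat.form_mem_one {S : Subalgebra (𝓞 F) B} (hS : IsOrder F S) {u v : TraceQuot F B}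
    (hu : u ∈ quotLattice S) (hv : v ∈ quotLattice S) :
    H.quadCoord.form u v ∈ (1 : Submodule (𝓞 F) F) := by
  obtain ⟨x, hx, rfl⟩ := hu
  obtain ⟨y, hy, rfl⟩ := hv
  obtain ⟨a, ha⟩ := Submodule.mem_one.1 (H.redTrace_redNorm_mem hS hx).1
  obtain ⟨b, hb⟩ := Submodule.mem_one.1 (H.redTrace_redNorm_mem hS hy).1
  obtain ⟨c, hc⟩ := Submodule.mem_one.1 (H.redTrace_redNorm_mem hS (S.mul_mem hy hx)).1
  have h := H.quadCoord_form_mk x y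
  refine Submodule.mem_one.2 ⟨b * a - 2 * c, ?_⟩
  change _ = H.quadCoord.form (Submodule.Quotient.mk x) (Submodule.Quotient.mk y)
  rw [h, discForm_apply, ← ha, ← hb, ← hc]
  simp only [map_sub, map_mul, map_ofNat]

end Integrality

/-! ## Finiteness of the class set -/

section Pigeonhole

/-- Simultaneous approximation with bounded denominators. -/
lemma exists_nat_mul_near_int {κ : Type*} [Fintype κ] {n : ℕ} (hn : 0 < n) :
    ∃ M : ℕ, ∀ c : κ → ℝ, ∃ t : ℕ, 0 < t ∧ t ≤ M ∧ ∃ z : κ → ℤ, ∀ i, |t * c i - z i| < 1 / n := by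
  classical
  refine ⟨n ^ Fintype.card κ, fun c => ?_⟩
  have hn' : (0 : ℝ) < n := by exact_mod_cast hn
  have hlt : ∀ x : ℝ, ⌊Int.fract x * n⌋₊ < n := fun x => by
    rw [Nat.floor_lt (mul_nonneg (Int.fract_nonneg x) hn'.le)]
    nlinarith [Int.fract_lt_one x]
  -- Dirichlet's box principle: the fractional parts of one more multiple of `c` than there are
  -- boxes of side `1/n`.
  let f : Fin (n ^ Fintype.card κ + 1) → κ → Fin n := fun j i => ⟨⌊Int.fract ((j : ℕ) * c i) * n⌋₊, hlt _⟩
  obtain ⟨j, j', hne, h⟩ := Fintype.exists_ne_map_eq_of_card_lt f (by simp)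
  wlog hjj : (j : ℕ) < j' generalizing j j'
  · exact this j' j hne.symm h.symm (lt_of_le_of_ne (not_lt.1 hjj) fun e => hne (Fin.ext e.symm))
  refine ⟨(j' : ℕ) - j, by omega, by have := j'.2; omega, fun i => ⌊((j' : ℕ) : ℝ) * c i⌋ - ⌊((j : ℕ) : ℝ) * c i⌋, fun i => ?_⟩
  have h1 : ⌊Int.fract (((j : ℕ) : ℝ) * c i) * n⌋₊ = ⌊Int.fract (((j' : ℕ) : ℝ) * c i) * n⌋₊ :=
    congrArg (fun g => ((g i : Fin n) : ℕ)) h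
  have e : (((j' : ℕ) - (j : ℕ) : ℕ) : ℝ) * c i - ((⌊((j' : ℕ) : ℝ) * c i⌋ - ⌊((j : ℕ) : ℝ) * c i⌋ : ℤ) : ℝ) =
      Int.fract (((j' : ℕ) : ℝ) * c i) - Int.fract (((j : ℕ) : ℝ) * c i) := by
    rw [Nat.cast_sub hjj.le, Int.fract, Int.fract]
    push_cast; ring
  rw [e]
  have a1 := Nat.floor_le (mul_nonneg (Int.fract_nonneg (((j : ℕ) : ℝ) * c i)) hn'.le)
  have a2 := Nat.floor_le (mul_nonneg (Int.fract_nonneg (((j' : ℕ) : ℝ) * c i)) hn'.le)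
  have a3 := Nat.lt_floor_add_one (Int.fract (((j : ℕ) : ℝ) * c i) * n)
  have a4 := Nat.lt_floor_add_one (Int.fract (((j' : ℕ) : ℝ) * c i) * n)
  rw [h1] at a1 a3
  rw [lt_div_iff₀ hn', ← abs_of_pos hn', ← abs_mul, abs_lt]
  constructor <;> linarith

end Pigeonhole

/-! ### Heights and a weak Euclidean algorithm -/

section ClassNumber

set_option linter.unusedSectionVars false

variable {F : Type*} [Field F] [NumberField F] [NumberField.IsTotallyReal F]

lemma norm_eq_prod_realEmb (x : F) : ((Algebra.norm ℚ x : ℚ) : ℝ) = ∏ τ : F →+* ℝ, τ x := by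
  have h := Algebra.norm_eq_prod_embeddings ℚ ℂ x
  have h2 : ∏ σ : F →ₐ[ℚ] ℂ, σ x = ∏ τ : F →+* ℝ, ((τ x : ℝ) : ℂ) := by
    refine Fintype.prod_equiv ((realEmbEquiv F).trans (RingHom.equivRatAlgHom F ℂ)).symm _ _ fun σ => ?_
    obtain ⟨τ, rfl⟩ := ((realEmbEquiv F).trans (RingHom.equivRatAlgHom F ℂ)).surjective σ
    simp only [Equiv.symm_apply_apply]
    rfl
  rw [h2] at h
  have h3 : (((Algebra.norm ℚ x : ℚ) : ℝ) : ℂ) = ((∏ τ : F →+* ℝ, τ x : ℝ) : ℂ) := by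
    push_cast
    simpa using h
  exact_mod_cast h3

variable {B : Type*} [Ring B] [Algebra F B] [IsDomain B] (H : DefiniteQuat F B)

namespace DefiniteQuat

/-- The absolute norm of the reduced norm. -/
def height (b : B) : ℝ := ∏ τ, Quaternion.normSq (H.ι τ b)

lemma height_mul (a b : B) : H.height (a * b) = H.height a * H.height b := by
  simp only [height, map_mul, Finset.prod_mul_distrib]

lemma height_nonneg (b : B) : 0 ≤ H.height b := Finset.prod_nonneg fun _ _ => Quaternion.normSq_nonneg

lemma height_eq_zero {b : B} : H.height b = 0 ↔ b = 0 := by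
  constructor
  · intro h
    obtain ⟨τ, -, h⟩ := Finset.prod_eq_zero_iff.1 h
    exact (map_eq_zero_iff _ (H.inj τ)).1 (Quaternion.normSq_eq_zero.1 h)
  · rintro rfl
    obtain ⟨τ, -⟩ := exists_realEmb F
    exact Finset.prod_eq_zero (Finset.mem_univ τ) (by simp)

lemma height_pos {b : B} (hb : b ≠ 0) : 0 < H.height b :=
  lt_of_le_of_ne (H.height_nonneg b) fun h => hb (H.height_eq_zero.1 h.symm)

lemma height_eq_norm (b : B) : H.height b = ((Algebra.norm ℚ (redNorm F b) : ℚ) : ℝ) := by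
  rw [norm_eq_prod_realEmb, height]
  exact Finset.prod_congr rfl fun τ _ => (H.map_redNorm τ b).symm

lemma exists_nat_height {S : Subalgebra (𝓞 F) B} (hS : IsOrder F S) {b : B} (hb : b ∈ S) :
    ∃ n : ℕ, H.height b = n := by
  obtain ⟨o, ho⟩ := Submodule.mem_one.1 (H.redTrace_redNorm_mem hS hb).2
  have h : H.height b = ((Algebra.norm ℤ o : ℤ) : ℝ) := by
    rw [H.height_eq_norm, ← ho, ← Algebra.coe_norm_int]
    simp
  have h0 : 0 ≤ Algebra.norm ℤ o := by
    have := H.height_nonneg b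
    rw [h] at this
    exact_mod_cast this
  exact ⟨(Algebra.norm ℤ o).toNat, by rw [h]; exact_mod_cast (Int.toNat_of_nonneg h0).symm⟩

/-- A weak form of the Euclidean algorithm in an order. -/
theorem exists_euclid {R : Subalgebra (𝓞 F) B} (hR : IsOrder F R) :
    ∃ M : ℕ, ∀ b : B, ∃ t : ℕ, 0 < t ∧ t ≤ M ∧ ∃ r ∈ R, H.height ((t : F) • b - r) < 1 := by
  have := H.finite
  obtain ⟨e, -, -, he, -⟩ := exists_basis_mem_order hR
  let w := NumberField.integralBasis F
  let κ := Fin (Module.finrank F B) × Module.Free.ChooseBasisIndex ℤ (𝓞 F)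
  let f : κ → B := fun p => w p.2 • e p.1
  have hf : ∀ p, f p ∈ R := fun p => by
    simp only [f, w, NumberField.integralBasis_apply]
    exact int_smul_mem (Subalgebra.toSubmodule R) _ (he p.1)
  obtain ⟨C, hC⟩ : ∃ C : ℕ, ∀ τ, ∑ p, ‖H.ι τ (f p)‖ < C := by
    choose C hC using fun τ => exists_nat_gt (∑ p, ‖H.ι τ (f p)‖)
    exact ⟨∑ τ, C τ, fun τ => (hC τ).trans_le
      (by exact_mod_cast Finset.single_le_sum (f := C) (fun _ _ => Nat.zero_le _) (Finset.mem_univ τ))⟩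
  have hC0 : 0 < C := by
    obtain ⟨τ, -⟩ := exists_realEmb F
    exact_mod_cast (Finset.sum_nonneg fun p _ => norm_nonneg (H.ι τ (f p))).trans_lt (hC τ)
  -- Precision `1/C` is enough: since the norms of the `f p` add up to less than `C` at every real
  -- place, a remainder with coordinates below `1/C` has norm below `1` there.
  obtain ⟨M, hM⟩ := exists_nat_mul_near_int (κ := κ) hC0
  refine ⟨M, fun b => ?_⟩
  let c : κ → ℚ := fun p => w.repr (e.repr b p.1) p.2
  have hb : b = ∑ p, ((c p : ℚ) : F) • f p := by
    rw [Fintype.sum_prod_type]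
    conv_lhs => rw [← e.sum_repr b]
    refine Finset.sum_congr rfl fun i _ => ?_
    conv_lhs => rw [← w.sum_repr (e.repr b i), Finset.sum_smul]
    refine Finset.sum_congr rfl fun l _ => ?_
    rw [Algebra.smul_def (w.repr (e.repr b i) l), eq_ratCast, mul_smul]
  obtain ⟨t, ht, htM, z, hz⟩ := hM fun p => (c p : ℝ)
  refine ⟨t, ht, htM, ∑ p, (z p : B) * f p, R.sum_mem fun p _ => R.mul_mem (intCast_mem R (z p)) (hf p), ?_⟩
  have hdiff : (t : F) • b - ∑ p, (z p : B) * f p = ∑ p, (((t * c p - z p : ℚ)) : F) • f p := by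
    conv_lhs => rw [hb]
    rw [Finset.smul_sum, ← Finset.sum_sub_distrib]
    refine Finset.sum_congr rfl fun p _ => ?_
    rw [smul_smul, ← zsmul_eq_mul, ← Int.cast_smul_eq_zsmul F, ← sub_smul]
    push_cast; rfl
  rw [hdiff, height]
  have hτ : ∀ τ, ‖H.ι τ (∑ p, (((t * c p - z p : ℚ)) : F) • f p)‖ < 1 := by
    intro τ
    rw [map_sum]
    refine (norm_sum_le _ _).trans_lt ?_
    have h1 : ∀ p, ‖H.ι τ ((((t * c p - z p : ℚ)) : F) • f p)‖ ≤ 1 / C * ‖H.ι τ (f p)‖ := by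
      intro p
      rw [Algebra.smul_def, map_mul, H.map_algebraMap, map_ratCast, norm_mul, Quaternion.norm_coe, Real.norm_eq_abs]
      refine mul_le_mul_of_nonneg_right ?_ (norm_nonneg _)
      have := (hz p).le
      push_cast
      exact this
    refine (Finset.sum_le_sum fun p _ => h1 p).trans_lt ?_
    rw [← Finset.mul_sum, one_div, ← div_eq_inv_mul, div_lt_one (by exact_mod_cast hC0)]
    exact hC τ
  have hτ' : ∀ τ, Quaternion.normSq (H.ι τ (∑ p, (((t * c p - z p : ℚ)) : F) • f p)) < 1 := by
    intro τ
    rw [Quaternion.normSq_eq_norm_mul_self]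
    have := hτ τ
    nlinarith [norm_nonneg (H.ι τ (∑ p, (((t * c p - z p : ℚ)) : F) • f p))]
  obtain ⟨τ₀, -⟩ := exists_realEmb F
  classical
  rw [← Finset.mul_prod_erase _ _ (Finset.mem_univ τ₀)]
  refine (mul_le_of_le_one_right Quaternion.normSq_nonneg
    (Finset.prod_le_one (fun _ _ => Quaternion.normSq_nonneg) fun τ _ => (hτ' τ).le)).trans_lt (hτ' τ₀)

end DefiniteQuat
end ClassNumber

/-! ### Left ideals and finiteness of the class set -/

section ClassSetFinite

set_option linter.unusedSectionVars false

variable {F : Type*} [Field F] [NumberField F] {B : Type*} [Ring B] [Algebra F B]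

/-- The left ideal `B ∩ R̂ x` of `B`. -/
def leftIdealAt (R : Subalgebra (𝓞 F) B) (x : (BHat F B)ˣ) : AddSubgroup B where
  carrier := {b | (1 : FinAdele F) ⊗ₜ[F] b * ((x⁻¹ : (BHat F B)ˣ) : BHat F B) ∈ orderHat R}
  add_mem' ha hb := by
    simp only [Set.mem_ofPred_eq, TensorProduct.tmul_add, add_mul]
    exact (orderHat R).add_mem ha hb
  zero_mem' := by simp [(orderHat R).zero_mem]
  neg_mem' ha := by
    simp only [Set.mem_ofPred_eq, TensorProduct.tmul_neg, neg_mul]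
    exact (orderHat R).neg_mem ha

lemma mem_leftIdealAt {R : Subalgebra (𝓞 F) B} {x : (BHat F B)ˣ} {b : B} :
    b ∈ leftIdealAt R x ↔
      (1 : FinAdele F) ⊗ₜ[F] b * ((x⁻¹ : (BHat F B)ˣ) : BHat F B) ∈ orderHat R := Iff.rfl

lemma one_tmul_mul (a b : B) : (1 : FinAdele F) ⊗ₜ[F] (a * b) = (1 ⊗ₜ[F] a) * ((1 : FinAdele F) ⊗ₜ[F] b) := by
  rw [Algebra.TensorProduct.tmul_mul_tmul, one_mul]

lemma mul_mem_leftIdealAt {R : Subalgebra (𝓞 F) B} {x : (BHat F B)ˣ} {r b : B} (hr : r ∈ R)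
    (hb : b ∈ leftIdealAt R x) : r * b ∈ leftIdealAt R x := by
  rw [mem_leftIdealAt, one_tmul_mul, mul_assoc]
  exact (orderHat R).mul_mem (tmul_mem_orderHat isIntegralAdele_one hr) hb

lemma natCast_tmul (m : ℕ) : (1 : FinAdele F) ⊗ₜ[F] (m : B) = (m : BHat F B) :=
  map_natCast (Algebra.TensorProduct.includeRight : B →ₐ[F] BHat F B) m

lemma natCast_mem_leftIdealAt {R : Subalgebra (𝓞 F) B} {x : (BHat F B)ˣ} {m : ℕ} :
    (m : B) ∈ leftIdealAt R x ↔ (m : BHat F B) * ((x⁻¹ : (BHat F B)ˣ) : BHat F B) ∈ orderHat R := by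
  rw [mem_leftIdealAt, natCast_tmul]

lemma mem_orderHatUnits {R : Subalgebra (𝓞 F) B} {u : (BHat F B)ˣ} :
    u ∈ orderHatUnits R ↔ (u : BHat F B) ∈ orderHat R ∧ ((u⁻¹ : (BHat F B)ˣ) : BHat F B) ∈ orderHat R :=
  Submonoid.mem_units_iff _ _

lemma coe_globalUnits (γ : Bˣ) : ((globalUnits F B γ : (BHat F B)ˣ) : BHat F B) = 1 ⊗ₜ[F] (γ : B) := rfl

variable [FiniteDimensional F B]

/-- `R̂ x` is generated by its intersection with `B`. -/
lemma exists_eq_add_mul {R : Subalgebra (𝓞 F) B} (hR : IsOrder F R) {x : (BHat F B)ˣ} {m : ℕ}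
    (hm : m ≠ 0) (hmx : (m : B) ∈ leftIdealAt R x) :
    ∃ b ∈ leftIdealAt R x, ∃ ρ ∈ orderHat R, (x : BHat F B) = 1 ⊗ₜ[F] b + ρ * (m : BHat F B) := by
  obtain ⟨b, ρ, hρ, h⟩ := exists_sub_mem_orderHat hR hm (x : BHat F B)
  refine ⟨b, ?_, ρ, hρ, by rw [h, Nat.cast_comm]⟩
  have : (1 : FinAdele F) ⊗ₜ[F] b = x - ρ * (m : BHat F B) := by rw [h, Nat.cast_comm]; abel
  rw [mem_leftIdealAt, this, sub_mul, Units.mul_inv, mul_assoc]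
  exact (orderHat R).sub_mem (orderHat R).one_mem ((orderHat R).mul_mem hρ (natCast_mem_leftIdealAt.1 hmx))

lemma exists_natCast_mem_leftIdealAt {R : Subalgebra (𝓞 F) B} (hR : IsOrder F R) (x : (BHat F B)ˣ) :
    ∃ m : ℕ, m ≠ 0 ∧ (m : B) ∈ leftIdealAt R x := by
  obtain ⟨m, hm, h⟩ := exists_nat_mul_mem_orderHat hR ((x⁻¹ : (BHat F B)ˣ) : BHat F B)
  exact ⟨m, hm, natCast_mem_leftIdealAt.2 h⟩

/-- By strong approximation `R̂ x` is generated by its global part, so an inclusion of the global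
ideals forces `R̂ x ⊆ R̂ y`. -/
lemma mul_inv_mem_of_leftIdealAt_le {R : Subalgebra (𝓞 F) B} (hR : IsOrder F R) {x y : (BHat F B)ˣ}
    (h : leftIdealAt R x ≤ leftIdealAt R y) :
    (x : BHat F B) * ((y⁻¹ : (BHat F B)ˣ) : BHat F B) ∈ orderHat R := by
  obtain ⟨m, hm, hmx⟩ := exists_natCast_mem_leftIdealAt hR x
  obtain ⟨b, hb, ρ, hρ, e⟩ := exists_eq_add_mul hR hm hmx
  rw [e, add_mul, mul_assoc]
  exact (orderHat R).add_mem (h hb) ((orderHat R).mul_mem hρ (natCast_mem_leftIdealAt.1 (h hmx)))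

lemma mul_inv_mem_orderHatUnits {R : Subalgebra (𝓞 F) B} (hR : IsOrder F R) {x y : (BHat F B)ˣ}
    (h : leftIdealAt R x = leftIdealAt R y) : x * y⁻¹ ∈ orderHatUnits R := by
  refine mem_orderHatUnits.2 ⟨?_, ?_⟩
  · rw [Units.val_mul]; exact mul_inv_mem_of_leftIdealAt_le hR h.le
  · rw [mul_inv_rev, inv_inv, Units.val_mul]; exact mul_inv_mem_of_leftIdealAt_le hR h.ge

variable [NumberField.IsTotallyReal F] [IsDomain B] (H : DefiniteQuat F B)

/-- An element of minimal height in `B ∩ R̂ x`. -/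
lemma exists_minimal_height {R : Subalgebra (𝓞 F) B} (hR : IsOrder F R) (x : (BHat F B)ˣ) :
    ∃ γ ∈ leftIdealAt R x, γ ≠ 0 ∧ ∀ b ∈ leftIdealAt R x, b ≠ 0 → H.height γ ≤ H.height b := by
  classical
  obtain ⟨p, hp, hp'⟩ := exists_nat_mul_mem_orderHat hR (x : BHat F B)
  obtain ⟨N, hN, hN'⟩ := exists_nat_smul_mem_of_tmul_mem hR
  -- The ideal need not lie in `R`, but the multiple by `N p` does. There heights are natural
  -- numbers, so a nonzero element of least height exists.
  have hmem : ∀ b ∈ leftIdealAt R x, ((N * p : ℕ) : B) * b ∈ R := by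
    intro b hb
    have h1 : ((N * p : ℕ) : B) * b = (N : F) • ((p : F) • b) := by
      rw [smul_smul, ← nsmul_eq_mul, ← Nat.cast_smul_eq_nsmul F, Nat.cast_mul]
    rw [h1]
    refine hN' _ ?_
    rw [tmul_natCast_smul]
    have := (orderHat R).mul_mem hb hp'
    rw [(Nat.cast_commute p _).eq, mul_assoc, ← mul_assoc _ (x : BHat F B), Units.inv_mul, one_mul] at this
    rwa [(Nat.cast_commute p _).eq]
  have hNp : ((N * p : ℕ) : B) ≠ 0 := by
    have := charZero_of_injective_algebraMap (FaithfulSMul.algebraMap_injective F B)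
    exact_mod_cast mul_ne_zero hN hp
  choose f hf using fun b : leftIdealAt R x => H.exists_nat_height hR (hmem b b.2)
  obtain ⟨m, hm, hmx⟩ := exists_natCast_mem_leftIdealAt hR x
  have hm0 : (m : B) ≠ 0 := by
    have := charZero_of_injective_algebraMap (FaithfulSMul.algebraMap_injective F B)
    exact_mod_cast hm
  let S : Set (leftIdealAt R x) := {b | (b : B) ≠ 0}
  obtain ⟨γ, hγ, hmin⟩ := WellFounded.has_min (InvImage.wf f Nat.lt_wfRel.wf) S ⟨⟨m, hmx⟩, hm0⟩
  refine ⟨γ, γ.2, hγ, fun b hb hb0 => ?_⟩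
  have h1 : f γ ≤ f ⟨b, hb⟩ := not_lt.1 (hmin ⟨b, hb⟩ hb0)
  have h2 : H.height (((N * p : ℕ) : B) * γ) ≤ H.height (((N * p : ℕ) : B) * b) := by
    rw [hf γ, hf ⟨b, hb⟩]; exact_mod_cast h1
  rw [H.height_mul, H.height_mul] at h2
  exact le_of_mul_le_mul_left h2 (H.height_pos hNp)

include H in
/-- Every class has a representative in a bounded set. -/
lemma exists_bounded_rep {R : Subalgebra (𝓞 F) B} (hR : IsOrder F R)
    (hdiv : ∀ b : B, b ≠ 0 → IsUnit b) :
    ∃ Q : ℕ, Q ≠ 0 ∧ ∀ x : (BHat F B)ˣ, ∃ γ : Bˣ,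
      (((x * globalUnits F B γ)⁻¹ : (BHat F B)ˣ) : BHat F B) ∈ orderHat R ∧
      (Q : BHat F B) * ((x * globalUnits F B γ : (BHat F B)ˣ) : BHat F B) ∈ orderHat R := by
  obtain ⟨M, hM⟩ := H.exists_euclid hR
  refine ⟨M.factorial, Nat.factorial_ne_zero M, fun x => ?_⟩
  obtain ⟨γ₀, hγ, hγ0, hmin⟩ := exists_minimal_height H hR x
  obtain ⟨γ, rfl⟩ := hdiv γ₀ hγ0
  -- Division with remainder of `t b` by the minimal element `γ` leaves an element of the ideal of
  -- smaller height, necessarily zero. Since `t ≤ M`, the factor `M!` serves for all `b` at once.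
  have key : ∀ b ∈ leftIdealAt R x, (M.factorial : B) * b * ((γ⁻¹ : Bˣ) : B) ∈ R := by
    intro b hb
    obtain ⟨t, ht, htM, r, hr, hlt⟩ := hM (b * ((γ⁻¹ : Bˣ) : B))
    have h1 : ((t : F) • (b * ((γ⁻¹ : Bˣ) : B)) - r) * (γ : B) = (t : B) * b - r * γ := by
      rw [sub_mul, smul_mul_assoc, mul_assoc, Units.inv_mul, mul_one, Nat.cast_smul_eq_nsmul, nsmul_eq_mul]
    have h2 : (t : B) * b - r * γ ∈ leftIdealAt R x :=
      AddSubgroup.sub_mem _ (mul_mem_leftIdealAt (natCast_mem R t) hb) (mul_mem_leftIdealAt hr hγ)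
    have h3 : (t : B) * b - r * γ = 0 := by
      by_contra hne
      have h4 := hmin _ h2 hne
      rw [← h1, H.height_mul] at h4
      have := H.height_pos hγ0
      nlinarith
    obtain ⟨s, hs⟩ := Nat.dvd_factorial ht htM
    have h5 : (M.factorial : B) * b * ((γ⁻¹ : Bˣ) : B) = (s : B) * r := by
      rw [hs, mul_comm t s, Nat.cast_mul, mul_assoc (s : B), sub_eq_zero.1 h3, mul_assoc, mul_assoc,
        Units.mul_inv, mul_one]
    rw [h5]
    exact R.mul_mem (natCast_mem R s) hr
  refine ⟨γ⁻¹, ?_, ?_⟩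
  · rw [mul_inv_rev, Units.val_mul, map_inv, inv_inv, coe_globalUnits]
    exact hγ
  · obtain ⟨m, hm, hmx⟩ := exists_natCast_mem_leftIdealAt hR x
    obtain ⟨b, hb, ρ, hρ, e⟩ := exists_eq_add_mul hR hm hmx
    rw [Units.val_mul, e, coe_globalUnits]
    have h1 := tmul_mem_orderHat isIntegralAdele_one (key b hb)
    have h2 := tmul_mem_orderHat isIntegralAdele_one (key m hmx)
    rw [one_tmul_mul, one_tmul_mul, natCast_tmul] at h1 h2
    rw [natCast_tmul] at h2
    have : (M.factorial : BHat F B) * ((1 ⊗ₜ[F] b + ρ * (m : BHat F B)) * 1 ⊗ₜ[F] ((γ⁻¹ : Bˣ) : B)) =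
        (M.factorial : BHat F B) * 1 ⊗ₜ[F] b * 1 ⊗ₜ[F] ((γ⁻¹ : Bˣ) : B) +
          ρ * ((M.factorial : BHat F B) * (m : BHat F B) * 1 ⊗ₜ[F] ((γ⁻¹ : Bˣ) : B)) := by
      rw [add_mul, mul_add, ← mul_assoc, ← mul_assoc, ← mul_assoc, ← mul_assoc, ← mul_assoc,
        (Nat.cast_commute M.factorial ρ).eq]
    rw [this]
    exact (orderHat R).add_mem h1 ((orderHat R).mul_mem hρ h2)

-- Each class has a representative `y` with `R̂ ⊆ R̂ y ⊆ Q⁻¹ R̂`, where `Q` does not depend on the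
-- class. Its global ideal lies between `M = B ∩ R̂` and `Q⁻¹ M`, hence is determined by a subset of
-- the finite group `Q⁻¹M / M`, and the global ideal determines the class.
include H in
theorem finite_classSet {R : Subalgebra (𝓞 F) B} (hR : IsOrder F R)
    (hdiv : ∀ b : B, b ≠ 0 → IsUnit b) : Finite (ClassSet R) := by
  obtain ⟨Q, hQ, hQ'⟩ := exists_bounded_rep H hR hdiv
  have hQF : (Q : F) ≠ 0 := by exact_mod_cast hQ
  let M : Submodule (𝓞 F) B := Subalgebra.toSubmodule (orderAtAlg R 1)
  have hM : IsLattice M := (isOrder_orderAtAlg hR 1).isLattice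
  let L := scaleLattice (Q : F) M
  have hfin : Finite (QuotOf M.toAddSubgroup L.toAddSubgroup) := hM.finite_quotOf (hM.scale hQF).1
  have hmemM : ∀ b, b ∈ M ↔ (1 : FinAdele F) ⊗ₜ[F] b ∈ orderHat R := fun b => by
    change b ∈ orderAt R 1 ↔ _
    rw [mem_orderAt]; simp
  choose γ h1 h2 using fun c : ClassSet R => hQ' c.out
  let y : ClassSet R → (BHat F B)ˣ := fun c => c.out * globalUnits F B (γ c)
  have hML : ∀ c, M.toAddSubgroup ≤ leftIdealAt R (y c) := fun c b hb =>
    mem_leftIdealAt.2 ((orderHat R).mul_mem ((hmemM b).1 hb) (h1 c))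
  have hLJ : ∀ c, ∀ b ∈ leftIdealAt R (y c), b ∈ L := fun c b hb => by
    rw [mem_scaleLattice, hmemM, tmul_natCast_smul, (Nat.cast_commute Q _).eq]
    have := (orderHat R).mul_mem hb (h2 c)
    rwa [(Nat.cast_commute Q _).eq, mul_assoc, ← mul_assoc _ _ (Q : BHat F B), Units.inv_mul, one_mul] at this
  let f : ClassSet R → Set (QuotOf M.toAddSubgroup L.toAddSubgroup) := fun c =>
    {q | quotRep q ∈ leftIdealAt R (y c)}
  refine Finite.of_injective f fun c c' h => ?_
  have hle : ∀ c c', f c = f c' → leftIdealAt R (y c) ≤ leftIdealAt R (y c') := by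
    intro c c' h b hb
    have hs := quotRep_mk_sub (L := M.toAddSubgroup) (M := L.toAddSubgroup) (hLJ c b hb)
    have h3 : quotMk M.toAddSubgroup b (hLJ c b hb) ∈ f c := by
      have := AddSubgroup.add_mem _ (hML c hs) hb
      rwa [sub_add_cancel] at this
    rw [h] at h3
    have := AddSubgroup.sub_mem _ h3 (hML c' hs)
    rwa [sub_sub_cancel] at this
  have hu := mul_inv_mem_orderHatUnits hR (le_antisymm (hle c c' h) (hle c' c h.symm))
  have hc : ∀ c : ClassSet R, DoubleCoset.mk (orderHatUnits R) (globalUnits F B).range (y c) = c := by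
    intro c
    conv_rhs => rw [← Quotient.out_eq c]
    refine (DoubleCoset.eq _ _ _ _).2 ⟨1, one_mem _, (globalUnits F B (γ c))⁻¹, inv_mem ⟨_, rfl⟩, ?_⟩
    simp [y]
  rw [← hc c, ← hc c']
  refine (DoubleCoset.eq _ _ _ _).2 ⟨(y c * (y c')⁻¹)⁻¹, inv_mem hu, 1, one_mem _, ?_⟩
  simp
end ClassSetFinite

/-! ## Vectors of given length -/

namespace QuadCoord

set_option linter.unusedSectionVars false

variable {F : Type*} [Field F] [NumberField F] [NumberField.IsTotallyReal F]
  {V : Type*} [AddCommGroup V] [Module F V]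
  [Module (𝓞 F) V] [IsScalarTower (𝓞 F) F V] {n : ℕ} (X : QuadCoord F V n)

-- All vectors of length `ξ` contribute terms of the same nonzero absolute value to the convergent
-- theta series at `z = i`, so there are only finitely many of them.
include X in
theorem finite_form_eq {L : Submodule (𝓞 F) V} (hL : IsLattice L) (ξ : F) :
    {v : V | v ∈ L ∧ X.form v v = ξ}.Finite := by
  have hs := X.summable_term hL (z := fun _ => Complex.I) (by simp) 1 0
  have hval : ∀ v : V, X.form v v = ξ → X.term (fun _ => Complex.I) 1 v =
      Complex.exp (Real.pi * Complex.I * ∑ τ : F →+* ℝ, ((τ ξ : ℝ) : ℂ) * Complex.I) := by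
    intro v hv
    rw [term, polyGauss, X.gaussC_vec (fun _ => Complex.I), hv, map_one, one_mul, Finset.mul_sum, Finset.mul_sum]
    congr 1
    exact Finset.sum_congr rfl fun τ _ => by ring
  set c := Complex.exp (Real.pi * Complex.I * ∑ τ : F →+* ℝ, ((τ ξ : ℝ) : ℂ) * Complex.I) with hc
  have hc0 : 0 < ‖c‖ := norm_pos_iff.2 (Complex.exp_ne_zero _)
  have h0 := hs.tendsto_cofinite_zero
  have h1 : ∀ᶠ l : L in Filter.cofinite, ‖X.term (fun _ => Complex.I) 1 (0 + (l : V))‖ < ‖c‖ := by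
    have := (tendsto_zero_iff_norm_tendsto_zero.1 h0).eventually (gt_mem_nhds hc0)
    exact this
  rw [Filter.eventually_cofinite] at h1
  refine (h1.image Subtype.val).subset fun v hv => ⟨⟨v, hv.1⟩, ?_, rfl⟩
  simp only [Set.mem_ofPred_eq, zero_add, hval v hv.2, lt_irrefl, not_false_eq_true]

end QuadCoord

/-! ## Conjugation in a quaternion algebra -/

section Conjugation

set_option linter.unusedSectionVars false

variable {F : Type*} [Field F] [NumberField F] [NumberField.IsTotallyReal F]
  {B : Type*} [Ring B] [Algebra F B] [IsDomain B] (H : DefiniteQuat F B)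

lemma redTrace_add (x y : B) : redTrace F (x + y) = redTrace F x + redTrace F y := by
  rw [← redTraceLin_apply, ← redTraceLin_apply, ← redTraceLin_apply, map_add]

lemma redTrace_smul (a : F) (x : B) : redTrace F (a • x) = a * redTrace F x := by
  rw [← redTraceLin_apply, ← redTraceLin_apply, map_smul, smul_eq_mul]

namespace DefiniteQuat

include H

lemma isUnit_of_ne_zero {b : B} (hb : b ≠ 0) : IsUnit b := by
  have hn : redNorm F b ≠ 0 := fun h => hb (H.redNorm_eq_zero.1 h)
  have h1 : b * (algebraMap F B (redTrace F b) - b) = algebraMap F B (redNorm F b) := by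
    rw [mul_sub, H.mul_self_eq, ← Algebra.commutes (redTrace F b) b]; abel
  have h2 : (algebraMap F B (redTrace F b) - b) * b = algebraMap F B (redNorm F b) := by
    rw [sub_mul, H.mul_self_eq]; abel
  have h3 : algebraMap F B (redNorm F b) * algebraMap F B (redNorm F b)⁻¹ = 1 := by
    rw [← map_mul, mul_inv_cancel₀ hn, map_one]
  refine isUnit_iff_exists.2 ⟨(algebraMap F B (redTrace F b) - b) * algebraMap F B (redNorm F b)⁻¹, ?_, ?_⟩
  · rw [← mul_assoc, h1, h3]
  · rw [← Algebra.commutes, mul_assoc, h2, Algebra.commutes, h3]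

lemma redTrace_conj (γ : Bˣ) (b : B) : redTrace F ((γ⁻¹ : Bˣ) * b * (γ : B)) = redTrace F b := by
  rw [H.redTrace_mul_comm, ← mul_assoc, Units.mul_inv, one_mul]

lemma redNorm_conj (γ : Bˣ) (b : B) : redNorm F ((γ⁻¹ : Bˣ) * b * (γ : B)) = redNorm F b := by
  rw [H.redNorm_mul, H.redNorm_mul, mul_right_comm, ← H.redNorm_mul, Units.inv_mul, ← map_one (algebraMap F B),
    H.redNorm_algebraMap]
  ring

lemma quatDisc_conj (γ : Bˣ) (b : B) : quatDisc F ((γ⁻¹ : Bˣ) * b * (γ : B)) = quatDisc F b := by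
  rw [quatDisc, H.redTrace_conj, H.redNorm_conj, quatDisc]

lemma redNorm_eq (b : B) : redNorm F b = (redTrace F b ^ 2 - quatDisc F b) / 4 := by
  rw [quatDisc]; ring

/-- Elements with the same trace and norm are conjugate. -/
theorem exists_conj_eq [Algebra.IsCentral F B] {a b : B} (ha : ∀ s : F, algebraMap F B s ≠ a)
    (ht : redTrace F a = redTrace F b) (hd : quatDisc F a = quatDisc F b) :
    ∃ γ : Bˣ, ((γ⁻¹ : Bˣ) : B) * a * γ = b := by
  have hn : redNorm F a = redNorm F b := by rw [H.redNorm_eq, H.redNorm_eq, ht, hd]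
  -- With `b̄ = tr(b) - b`, every element `a x - x b̄` intertwines `a` and `b`, because both satisfy
  -- the same quadratic equation. If all of these vanish, then `a = b̄` (take `x = 1`) is central,
  -- which is excluded; otherwise any nonzero one conjugates `a` to `b`.
  have key : ∀ x : B, a * (a * x - x * (algebraMap F B (redTrace F b) - b)) =
      (a * x - x * (algebraMap F B (redTrace F b) - b)) * b := by
    intro x
    have e1 : a * (a * x) = algebraMap F B (redTrace F b) * (a * x) - algebraMap F B (redNorm F b) * x := by
      rw [← mul_assoc, H.mul_self_eq, ht, hn, sub_mul, mul_assoc]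
    have e2 : x * (algebraMap F B (redTrace F b) - b) * b = algebraMap F B (redNorm F b) * x := by
      rw [mul_assoc, sub_mul, H.mul_self_eq, sub_sub_cancel, Algebra.commutes]
    rw [mul_sub, e1, sub_mul, e2, mul_sub, mul_sub, ← mul_assoc a x, ← mul_assoc a x,
      ← Algebra.commutes (redTrace F b) (a * x)]
    abel
  by_cases h : ∀ x : B, a * x - x * (algebraMap F B (redTrace F b) - b) = 0
  · exfalso
    have h1 := h 1
    rw [mul_one, one_mul, sub_eq_zero] at h1
    have hc : a ∈ Subalgebra.center F B := by
      rw [Subalgebra.mem_center_iff]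
      intro x
      have := h x
      rw [← h1, sub_eq_zero] at this
      exact this.symm
    obtain ⟨s, hs⟩ := Algebra.mem_bot.1 (Algebra.IsCentral.out hc)
    exact ha s hs
  · push Not at h
    obtain ⟨x, hx⟩ := h
    obtain ⟨γ, hγ⟩ := H.isUnit_of_ne_zero hx
    refine ⟨γ, ?_⟩
    have := key x
    rw [← hγ] at this
    rw [mul_assoc, this, ← mul_assoc, Units.inv_mul, one_mul]

lemma mul_add_mul_comm (x y : B) (hx : redTrace F x = 0) (hy : redTrace F y = 0) :
    x * y + y * x = algebraMap F B (redTrace F (x * y)) := by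
  have h1 := H.mul_self_eq (x + y)
  have h2 := H.mul_self_eq x
  have h3 := H.mul_self_eq y
  have ht : redTrace F (x + y) = 0 := by rw [redTrace_add, hx, hy, add_zero]
  have hn : ∀ z : B, redTrace F z = 0 → redNorm F z = - redTrace F (z * z) / 2 := by
    intro z hz; rw [redNorm, hz, pow_two z]; ring
  rw [ht, hn _ ht] at h1
  rw [hx, hn _ hx] at h2
  rw [hy, hn _ hy] at h3
  have e : x * y + y * x = (x + y) * (x + y) - x * x - y * y := by noncomm_ring
  rw [e, h1, h2, h3]
  simp only [map_zero, zero_mul, zero_sub, ← map_neg, ← map_sub]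
  congr 1
  rw [add_mul, mul_add, mul_add, redTrace_add, redTrace_add, redTrace_add, H.redTrace_mul_comm y x]
  ring

/-- The centralizer of a noncentral element `a` is `F + F a`. -/
theorem exists_eq_of_commute {a b : B} (ha : ∀ s : F, algebraMap F B s ≠ a) (hab : a * b = b * a) :
    ∃ s t : F, b = algebraMap F B s + t • a := by
  set a₀ := a - algebraMap F B (redTrace F a / 2) with ha₀
  set b₀ := b - algebraMap F B (redTrace F b / 2) with hb₀
  have t0 : ∀ z : B, redTrace F (z - algebraMap F B (redTrace F z / 2)) = 0 := by
    intro z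
    rw [sub_eq_add_neg, ← map_neg, redTrace_add, H.redTrace_algebraMap]; ring
  have hcomm : a₀ * b₀ = b₀ * a₀ := by
    rw [ha₀, hb₀, sub_mul, mul_sub, mul_sub, sub_mul, mul_sub, mul_sub, hab,
      ← Algebra.commutes (redTrace F b / 2) a, ← Algebra.commutes (redTrace F a / 2) b,
      Algebra.commutes (redTrace F b / 2) (algebraMap F B (redTrace F a / 2))]
    abel
  -- For commuting elements of trace zero both `2 b₀ a₀` and `2 a₀²` are scalars. Comparing them
  -- makes `b₀` proportional to `a₀`.
  have h1 := H.mul_add_mul_comm b₀ a₀ (t0 b) (t0 a)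
  have h2 := H.mul_add_mul_comm a₀ a₀ (t0 a) (t0 a)
  rw [hcomm, ← two_mul] at h1
  rw [← two_mul] at h2
  have ha0 : a₀ ≠ 0 := fun h => ha _ (sub_eq_zero.1 h).symm
  have hd : redTrace F (a₀ * a₀) ≠ 0 := by
    intro h
    rw [h, map_zero] at h2
    have := charZero_of_injective_algebraMap (FaithfulSMul.algebraMap_injective F B)
    exact mul_ne_zero (two_ne_zero) (mul_ne_zero ha0 ha0) h2
  set d := redTrace F (a₀ * a₀)
  set f := redTrace F (b₀ * a₀)
  have h3 : d • b₀ = f • a₀ := by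
    rw [Algebra.smul_def, Algebra.smul_def, ← h1, ← h2]
    rw [mul_assoc, mul_assoc, mul_assoc, hcomm, ← mul_assoc a₀, hcomm, mul_assoc]
  have h4 : b₀ = (d⁻¹ * f) • a₀ := by
    rw [mul_smul, ← h3, smul_smul, inv_mul_cancel₀ hd, one_smul]
  refine ⟨redTrace F b / 2 - (d⁻¹ * f) * (redTrace F a / 2), d⁻¹ * f, ?_⟩
  have h5 : b = b₀ + algebraMap F B (redTrace F b / 2) := by rw [hb₀]; abel
  conv_lhs => rw [h5, h4, ha₀, smul_sub, Algebra.smul_def (d⁻¹ * f) (algebraMap F B (redTrace F a / 2)), ← map_mul]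
  rw [map_sub]
  abel

lemma quatDisc_add_smul (s t : F) (a : B) :
    quatDisc F (algebraMap F B s + t • a) = t ^ 2 * quatDisc F a := by
  have h := discForm_self (F := F) (algebraMap F B s + t • a)
  simp only [map_add, H.discForm_algebraMap, H.discForm_algebraMap_right, map_smul, LinearMap.smul_apply, zero_add, discForm_self, smul_eq_mul] at h
  rw [← neg_inj, ← h]
  ring

end DefiniteQuat

/-! ## The unit groups of orders -/

section UnitGroups

variable {R : Subalgebra (𝓞 F) B}

omit [NumberField.IsTotallyReal F] [IsDomain B] in
/-- Integral units are central. -/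
lemma intUnits_comm {ε : Bˣ} (hε : ε ∈ intUnits F B) (b : B) : (ε : B) * b = b * ε := by
  obtain ⟨o, rfl⟩ := hε
  exact Algebra.commutes (o : 𝓞 F) b

omit [NumberField.IsTotallyReal F] [IsDomain B] in
lemma mem_orderAtUnits {x : (BHat F B)ˣ} {γ : Bˣ} :
    γ ∈ orderAtUnits R x ↔ (γ : B) ∈ orderAt R x ∧ ((γ⁻¹ : Bˣ) : B) ∈ orderAt R x :=
  Submonoid.mem_units_iff _ _

omit [NumberField.IsTotallyReal F] [IsDomain B] in
lemma intUnits_le_orderAtUnits (x : (BHat F B)ˣ) : intUnits F B ≤ orderAtUnits R x := by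
  rintro _ ⟨o, rfl⟩
  refine mem_orderAtUnits.2 ⟨(orderAtAlg R x).algebraMap_mem (o : 𝓞 F), ?_⟩
  rw [← map_inv]
  exact (orderAtAlg R x).algebraMap_mem ((o⁻¹ : (𝓞 F)ˣ) : 𝓞 F)

include H

lemma DefiniteQuat.mem_intUnits_of_algebraMap (hR : IsOrder F R) {x : (BHat F B)ˣ} {γ : Bˣ}
    (hγ : γ ∈ orderAtUnits R x) {s : F} (hs : (γ : B) = algebraMap F B s) : γ ∈ intUnits F B := by
  have := H.finite
  have hS := isOrder_orderAtAlg hR x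
  obtain ⟨h1, h2⟩ := mem_orderAtUnits.1 hγ
  have hs0 : s ≠ 0 := by
    rintro rfl
    rw [map_zero] at hs
    exact γ.ne_zero hs
  have hinv : ((γ⁻¹ : Bˣ) : B) = algebraMap F B s⁻¹ := by
    rw [Units.inv_eq_of_mul_eq_one_right]
    rw [hs, ← map_mul, mul_inv_cancel₀ hs0, map_one]
  obtain ⟨o, ho⟩ := Submodule.mem_one.1 (H.mem_one_of_algebraMap_mem hS (a := s) (hs ▸ h1))
  obtain ⟨o', ho'⟩ := Submodule.mem_one.1 (H.mem_one_of_algebraMap_mem hS (a := s⁻¹) (hinv ▸ h2))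
  have hoo : o * o' = 1 := by
    apply FaithfulSMul.algebraMap_injective (𝓞 F) F
    rw [map_mul, ho, ho', mul_inv_cancel₀ hs0, map_one]
  refine ⟨⟨o, o', hoo, by rw [mul_comm, hoo]⟩, Units.ext ?_⟩
  rw [hs, ← ho]
  rfl

/-- Conjugation by a unit sends each basis element of `R_x` to a lattice vector of the same
discriminant, of which there are finitely many in `R_x / 𝓞_F`. The trace being preserved, the class
modulo `F` determines the conjugate. Units with the same action differ by a central unit of `R_x`,
that is, by an integral unit of `F`. -/
theorem relIndex_orderAtUnits_ne_zero [Algebra.IsCentral F B] (hR : IsOrder F R) (x : (BHat F B)ˣ) :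
    (intUnits F B).relIndex (orderAtUnits R x) ≠ 0 := by
  have := H.finite
  have hS := isOrder_orderAtAlg hR x
  obtain ⟨e, -, -, he, -⟩ := exists_basis_mem_order hS
  let T : Fin (Module.finrank F B) → Set (TraceQuot F B) := fun i =>
    {v | v ∈ quotLattice (orderAtAlg R x) ∧ H.quadCoord.form v v = -quatDisc F (e i)}
  have hT : ∀ i, Finite (T i) := fun i =>
    (H.quadCoord.finite_form_eq hS.isLattice_quotLattice _).to_subtype
  let f : orderAtUnits R x → ∀ i, T i := fun γ i => ⟨Submodule.Quotient.mk (((γ⁻¹ : orderAtUnits R x) : Bˣ) * e i * ((γ : Bˣ) : B)),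
    ⟨_, (orderAtAlg R x).mul_mem ((orderAtAlg R x).mul_mem (mem_orderAtUnits.1 (γ⁻¹).2).1 (he i)) (mem_orderAtUnits.1 γ.2).1, rfl⟩, by
      rw [H.quadCoord_form_mk, discForm_self]
      congr 1
      exact H.quatDisc_conj _ _⟩
  have hf : ∀ γ δ : orderAtUnits R x, f γ = f δ → ((γ⁻¹ * δ : orderAtUnits R x) : Bˣ) ∈ intUnits F B := by
    intro γ δ h
    have hconj : ∀ i, (((γ : Bˣ)⁻¹ : Bˣ) : B) * e i * ((γ : Bˣ) : B) = (((δ : Bˣ)⁻¹ : Bˣ) : B) * e i * ((δ : Bˣ) : B) := by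
      intro i
      have h1 := congrArg (fun g => ((g i : T i) : TraceQuot F B)) h
      obtain ⟨s, hs⟩ := Submodule.mem_one.1 ((Submodule.Quotient.eq _).1 h1)
      have h2 : redTrace F (algebraMap F B s) = 0 := by
        rw [hs, sub_eq_add_neg, redTrace_add, ← neg_one_smul F, redTrace_smul]
        erw [H.redTrace_conj, H.redTrace_conj]
        ring
      rw [H.redTrace_algebraMap] at h2
      have h3 : s = 0 := by simpa using h2
      rw [h3, map_zero] at hs
      exact sub_eq_zero.1 hs.symm
    set κ : Bˣ := (δ : Bˣ) * (γ : Bˣ)⁻¹ with hκ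
    have hcen : ∀ b : B, b * (κ : B) = κ * b := by
      have h1 : LinearMap.mulRight F (κ : B) = LinearMap.mulLeft F (κ : B) := by
        refine e.ext fun i => ?_
        rw [LinearMap.mulRight_apply, LinearMap.mulLeft_apply, hκ, Units.val_mul]
        have h2 := congrArg (fun b => ((δ : Bˣ) : B) * b * (((γ : Bˣ)⁻¹ : Bˣ) : B)) (hconj i)
        simp only [mul_assoc, Units.mul_inv, mul_one, Units.mul_inv_cancel_left] at h2
        rw [mul_assoc, h2]
      intro b
      exact LinearMap.congr_fun h1 b
    obtain ⟨s, hs⟩ := Algebra.mem_bot.1 (Algebra.IsCentral.out (K := F) (Subalgebra.mem_center_iff.2 hcen))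
    refine H.mem_intUnits_of_algebraMap hR (γ⁻¹ * δ).2 (s := s) ?_
    have h1 : ((γ⁻¹ * δ : orderAtUnits R x) : Bˣ) = (γ : Bˣ)⁻¹ * (κ * γ) := by
      rw [hκ, inv_mul_cancel_right]; rfl
    rw [h1, Units.val_mul, Units.val_mul, ← hcen, Units.inv_mul_cancel_left]
    exact hs.symm
  have hfin : Finite (orderAtUnits R x ⧸ (intUnits F B).subgroupOf (orderAtUnits R x)) := by
    refine Finite.of_injective (fun q => f (Quotient.out q)) fun q q' h => ?_
    rw [← QuotientGroup.out_eq' q, ← QuotientGroup.out_eq' q']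
    exact QuotientGroup.eq.2 (Subgroup.mem_subgroupOf.2 (hf _ _ h))
  exact Subgroup.index_ne_zero_of_finite

end UnitGroups

end Conjugation

/-! ## Quadratic extensions -/

section QuadraticExtension

set_option linter.unusedSectionVars false

variable {F : Type*} [Field F] [NumberField F] {D : F}

open Polynomial in
lemma quadExt_monic (D : F) : (X ^ 2 + C D : F[X]).Monic := monic_X_pow_add_C D two_ne_zero

open Polynomial in
/-- The power basis of `F(√-D)`. -/
def quadExtBasis (D : F) : Module.Basis (Fin 2) F (QuadExt D) :=
  (AdjoinRoot.powerBasis' (quadExt_monic D)).basis.reindex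
    (finCongr (by rw [AdjoinRoot.powerBasis'_dim, natDegree_X_pow_add_C]))

lemma finrank_quadExt (D : F) : Module.finrank F (QuadExt D) = 2 := by
  rw [Module.finrank_eq_card_basis (quadExtBasis D), Fintype.card_fin]

lemma quadExt_mul_self (z : QuadExt D) :
    z * z = algebraMap F _ (Algebra.trace F _ z) * z - algebraMap F _ (Algebra.norm F z) := by
  have h := Matrix.aeval_self_charpoly (Algebra.leftMulMatrix (quadExtBasis D) z)
  rw [Matrix.charpoly_fin_two, ← Algebra.trace_eq_matrix_trace, ← Algebra.norm_eq_matrix_det,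
    Polynomial.aeval_algHom_apply] at h
  have h1 := Algebra.leftMulMatrix_injective (quadExtBasis D) (h.trans (map_zero _).symm)
  simp only [map_add, map_sub, map_mul, map_pow, Polynomial.aeval_X, Polynomial.aeval_C] at h1
  rw [← pow_two]
  linear_combination h1

lemma fieldDisc_algebraMap (a : F) : fieldDisc (algebraMap F (QuadExt D) a) = 0 := by
  rw [fieldDisc, Algebra.trace_algebraMap, Algebra.norm_algebraMap, finrank_quadExt]
  ring

open Polynomial in
lemma quadExt_irreducible [NumberField.IsTotallyReal F] (hD : ∀ τ : F →+* ℝ, 0 < τ D) :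
    Irreducible (X ^ 2 + C D : F[X]) := by
  rw [(quadExt_monic D).irreducible_iff_roots_eq_zero_of_degree_le_three
    (by rw [natDegree_X_pow_add_C]) (by rw [natDegree_X_pow_add_C]; norm_num)]
  rw [Multiset.eq_zero_iff_forall_notMem]
  intro a ha
  have h := (mem_roots'.1 ha).2
  rw [IsRoot.def, eval_add, eval_pow, eval_X, eval_C] at h
  obtain ⟨τ, -⟩ := exists_realEmb F
  have h2 := congrArg τ h
  rw [map_add, map_pow, map_zero] at h2
  nlinarith [hD τ, sq_nonneg (τ a)]

end QuadraticExtension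

/-! ### The quadratic field inside the quaternion algebra -/

section Embedding

set_option linter.unusedSectionVars false

variable {F : Type*} [Field F] [NumberField F] [NumberField.IsTotallyReal F]
  {B : Type*} [Ring B] [Algebra F B] [IsDomain B] (H : DefiniteQuat F B) {D : F}
  (hD : ∀ τ : F →+* ℝ, 0 < τ D) (j : QuadExt D →ₐ[F] B)

include hD in
lemma quadExt_injective : Function.Injective j := by
  have := Fact.mk (quadExt_irreducible hD)
  exact (j : QuadExt D →+* B).injective

include hD in
lemma ne_zero_of_totallyPositive : D ≠ 0 := by
  rintro rfl
  obtain ⟨τ, -⟩ := exists_realEmb F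
  simpa using hD τ

include hD in
lemma algebraMap_ne_of_fieldDisc {ω : QuadExt D} (hω : fieldDisc ω = -D) (s : F) :
    algebraMap F B s ≠ j ω := by
  intro h
  have h1 : algebraMap F (QuadExt D) s = ω := quadExt_injective hD j (by rw [AlgHom.commutes]; exact h)
  rw [← h1, fieldDisc_algebraMap] at hω
  exact ne_zero_of_totallyPositive hD (by rw [← neg_neg D, ← hω, neg_zero])

-- Both the quaternion algebra and the field provide a monic quadratic equation for `j z`; for a
-- non-scalar the two must coincide.
include hD H in
lemma redTrace_redNorm_map (z : QuadExt D) (hz : ∀ s, algebraMap F B s ≠ j z) :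
    redTrace F (j z) = Algebra.trace F _ z ∧ redNorm F (j z) = Algebra.norm F z := by
  have h1 := H.mul_self_eq (j z)
  have h2 := congrArg j (quadExt_mul_self z)
  rw [map_mul, map_sub, map_mul, AlgHom.commutes, AlgHom.commutes, h1] at h2
  set t := redTrace F (j z)
  set n := redNorm F (j z)
  set t' := Algebra.trace F _ z
  set n' := Algebra.norm F z
  have h3 : algebraMap F B (t - t') * j z = algebraMap F B (n - n') := by
    rw [map_sub, map_sub, sub_mul]
    have : algebraMap F B t * j z = algebraMap F B t' * j z - algebraMap F B n' + algebraMap F B n := by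
      rw [← h2]; abel
    rw [this]; abel
  have ht : t - t' = 0 := by
    by_contra ht
    refine hz ((t - t')⁻¹ * (n - n')) ?_
    rw [map_mul, ← h3, ← mul_assoc, ← map_mul, inv_mul_cancel₀ ht, map_one, one_mul]
  rw [ht, map_zero, zero_mul] at h3
  exact ⟨sub_eq_zero.1 ht, sub_eq_zero.1 ((map_eq_zero_iff _ (FaithfulSMul.algebraMap_injective F B)).1 h3.symm)⟩

include hD H in
lemma quatDisc_map {z : QuadExt D} (hz : fieldDisc z = -D) : quatDisc F (j z) = -D := by
  obtain ⟨h1, h2⟩ := redTrace_redNorm_map H hD j z (algebraMap_ne_of_fieldDisc hD j hz)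
  rw [quatDisc, h1, h2, ← hz, fieldDisc]

-- The image of `z` commutes with that of `ω`, so the computation of centralizers in `B` applies.
include hD H j in
lemma exists_eq_add_smul {ω : QuadExt D} (hω : fieldDisc ω = -D) (z : QuadExt D) :
    ∃ s t : F, z = algebraMap F _ s + t • ω := by
  obtain ⟨s, t, h⟩ := H.exists_eq_of_commute (algebraMap_ne_of_fieldDisc hD j hω)
    (b := j z) (by rw [← map_mul, mul_comm, map_mul])
  refine ⟨s, t, quadExt_injective hD j ?_⟩
  rw [h, map_add, AlgHom.commutes, map_smul]

include hD H j in
lemma fieldDisc_algebraMap_add {ω : QuadExt D} (hω : fieldDisc ω = -D) (s : F) :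
    fieldDisc (algebraMap F _ s + ω) = -D := by
  have h := algebraMap_ne_of_fieldDisc hD j hω
  have h' : ∀ r, algebraMap F B r ≠ j (algebraMap F _ s + ω) := by
    intro r hr
    refine h (r - s) ?_
    rw [map_sub, hr, map_add, AlgHom.commutes]; abel
  obtain ⟨h1, h2⟩ := redTrace_redNorm_map H hD j _ h'
  rw [fieldDisc, ← h1, ← h2, ← quatDisc, map_add, AlgHom.commutes, ← one_smul F (j ω),
    H.quatDisc_add_smul, quatDisc_map H hD j hω]
  ring

end Embedding

/-! ## Special points and lattice vectors -/

section SpecialPoints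

set_option linter.unusedSectionVars false

variable {F : Type*} [Field F] [NumberField F]
  {B : Type*} [Ring B] [Algebra F B]

lemma mk_mem_quotLattice {S : Subalgebra (𝓞 F) B} {b : B} :
    (Submodule.Quotient.mk b : TraceQuot F B) ∈ quotLattice S ↔ ∃ s : F, b + algebraMap F B s ∈ S := by
  rw [mem_quotLattice]
  constructor
  · rintro ⟨c, hc, h⟩
    obtain ⟨s, hs⟩ := Submodule.mem_one.1 ((Submodule.Quotient.eq _).1 h)
    refine ⟨s, ?_⟩
    rw [hs]
    simpa using hc
  · rintro ⟨s, hs⟩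
    refine ⟨_, hs, (Submodule.Quotient.eq _).2 (Submodule.mem_one.2 ⟨s, by abel⟩)⟩

/-- Each `a v` lifts to `S` separately; a single lift of `v` working for all `a` exists because `𝔞`
is invertible. Writing `1 = ∑ c_i a_i` with `c_i ∈ 𝔞⁻¹`, `a_i ∈ 𝔞` and lifting `a_i v` to `r_i`, one
takes `∑ c_i r_i`. -/
lemma exists_lift_colonLattice (𝔞 : (FractionalIdeal (𝓞 F)⁰ F)ˣ) {S : Subalgebra (𝓞 F) B}
    {v : TraceQuot F B} (hv : v ∈ colonLattice (𝔞 : FractionalIdeal (𝓞 F)⁰ F) (quotLattice S)) :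
    ∃ b : B, (Submodule.Quotient.mk b : TraceQuot F B) = v ∧
      ∀ a ∈ (𝔞 : FractionalIdeal (𝓞 F)⁰ F), a • b ∈ S := by
  have h1 : (1 : F) ∈ ((𝔞⁻¹ : (FractionalIdeal (𝓞 F)⁰ F)ˣ) : FractionalIdeal (𝓞 F)⁰ F) * 𝔞 := by
    rw [Units.inv_mul]; exact FractionalIdeal.one_mem_one _
  rw [← one_smul F v]
  generalize (1 : F) = z at h1
  rw [← FractionalIdeal.mem_coe, FractionalIdeal.coe_mul] at h1
  induction h1 using Submodule.mul_induction_on' with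
  | mem_mul_mem c hc a' ha' =>
    obtain ⟨r, hr, h⟩ := mem_quotLattice.1 (hv a' ha')
    refine ⟨c • r, by rw [Submodule.Quotient.mk_smul, h, smul_smul], fun a ha => ?_⟩
    have hca : a * c ∈ (1 : FractionalIdeal (𝓞 F)⁰ F) := by
      rw [← Units.mul_inv 𝔞]; exact FractionalIdeal.mul_mem_mul ha hc
    obtain ⟨o, ho⟩ := (FractionalIdeal.mem_one_iff _).1 hca
    rw [smul_smul, ← ho]
    exact int_smul_mem (Subalgebra.toSubmodule S) o hr
  | add z _ w _ hz hw =>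
    obtain ⟨b, hb, hb'⟩ := hz
    obtain ⟨c, hc, hc'⟩ := hw
    exact ⟨b + c, by rw [Submodule.Quotient.mk_add, hb, hc, add_smul], fun a ha => by
      rw [smul_add]; exact S.add_mem (hb' a ha) (hc' a ha)⟩

variable [NumberField.IsTotallyReal F] [IsDomain B] (H : DefiniteQuat F B) {D : F}
  (hD : ∀ τ : F →+* ℝ, 0 < τ D) (j : QuadExt D →ₐ[F] B)

include hD H in
/-- The order `𝓞_F ⊕ 𝔞 ω`, if it is contained in an order of `B`. -/
lemma exists_isQuadOrder {S : Subalgebra (𝓞 F) B} (hS : IsOrder F S) (𝔞 : (FractionalIdeal (𝓞 F)⁰ F)ˣ)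
    {ω : QuadExt D} (hω : fieldDisc ω = -D) (h : ∀ a ∈ (𝔞 : FractionalIdeal (𝓞 F)⁰ F), a • j ω ∈ S) :
    ∃ T, IsQuadOrder D 𝔞 T ∧ ∀ z ∈ T, j z ∈ S := by
  have hinj := quadExt_injective hD j
  obtain ⟨htr, hnm⟩ := redTrace_redNorm_map H hD j ω (algebraMap_ne_of_fieldDisc hD j hω)
  set t := Algebra.trace F _ ω
  set n := Algebra.norm F ω
  have hsq := quadExt_mul_self ω
  -- Closure of `𝓞_F ⊕ 𝔞 ω` under products amounts to `𝔞 tr(ω) ⊆ 𝓞_F` and `𝔞² n(ω) ⊆ 𝓞_F`. The first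
  -- is integrality of traces in `S`; the second follows by writing `a b n(ω)` as the product of `a
  -- ω` and the conjugate of `b ω` inside `S`.
  have hta : ∀ a ∈ (𝔞 : FractionalIdeal (𝓞 F)⁰ F), a * t ∈ (1 : Submodule (𝓞 F) F) := by
    intro a ha
    rw [← htr, ← redTrace_smul]
    exact (H.redTrace_redNorm_mem hS (h a ha)).1
  have hnab : ∀ a ∈ (𝔞 : FractionalIdeal (𝓞 F)⁰ F), ∀ b ∈ (𝔞 : FractionalIdeal (𝓞 F)⁰ F),
      a * b * n ∈ (1 : Submodule (𝓞 F) F) := by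
    intro a ha b hb
    apply H.mem_one_of_algebraMap_mem hS
    have e : algebraMap F B (a * b * n) = (a • j ω) * (algebraMap F B (b * t) - b • j ω) := by
      have h2 : j ω * j ω = t • j ω - n • (1 : B) := by
        rw [H.mul_self_eq, htr, hnm, Algebra.smul_def, Algebra.smul_def n, mul_one]
      rw [mul_sub, smul_mul_smul_comm, h2, Algebra.algebraMap_eq_smul_one, Algebra.algebraMap_eq_smul_one,
        smul_mul_smul_comm, mul_one]
      module
    rw [e]
    obtain ⟨o, ho⟩ := Submodule.mem_one.1 (hta b hb)
    rw [← ho]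
    exact S.mul_mem (h a ha) (S.sub_mem (S.algebraMap_mem o) (h b hb))
  let T : Subalgebra (𝓞 F) (QuadExt D) :=
    { carrier := {z | ∃ a : 𝓞 F, ∃ b ∈ (𝔞 : FractionalIdeal (𝓞 F)⁰ F),
        z = algebraMap (𝓞 F) (QuadExt D) a + algebraMap F (QuadExt D) b * ω}
      add_mem' := by
        rintro _ _ ⟨a, b, hb, rfl⟩ ⟨c, d, hd, rfl⟩
        refine ⟨a + c, b + d, Submodule.add_mem (𝔞 : FractionalIdeal (𝓞 F)⁰ F).coeToSubmodule hb hd, ?_⟩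
        rw [map_add, map_add]; ring
      mul_mem' := by
        rintro _ _ ⟨a, b, hb, rfl⟩ ⟨c, d, hd, rfl⟩
        obtain ⟨p, hp⟩ := Submodule.mem_one.1 (hnab b hb d hd)
        obtain ⟨q, hq⟩ := Submodule.mem_one.1 (hta b hb)
        refine ⟨a * c - p, algebraMap (𝓞 F) F a * d + algebraMap (𝓞 F) F c * b + algebraMap (𝓞 F) F q * d, ?_, ?_⟩
        · have hs : ∀ (o : 𝓞 F), ∀ x ∈ (𝔞 : FractionalIdeal (𝓞 F)⁰ F),
              algebraMap (𝓞 F) F o * x ∈ (𝔞 : FractionalIdeal (𝓞 F)⁰ F) := fun o x hx => by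
            rw [← Algebra.smul_def]
            exact Submodule.smul_mem (𝔞 : FractionalIdeal (𝓞 F)⁰ F).coeToSubmodule o hx
          exact Submodule.add_mem (𝔞 : FractionalIdeal (𝓞 F)⁰ F).coeToSubmodule (Submodule.add_mem (𝔞 : FractionalIdeal (𝓞 F)⁰ F).coeToSubmodule (hs a d hd) (hs c b hb)) (hs q d hd)
        · have e1 : ∀ o : 𝓞 F, algebraMap (𝓞 F) (QuadExt D) o = algebraMap F _ (algebraMap (𝓞 F) F o) :=
            fun o => IsScalarTower.algebraMap_apply _ _ _ _
          rw [map_sub, e1 p, hp, map_add, map_add, map_mul, map_mul, map_mul, hq, map_mul]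
          simp only [e1, map_mul]
          linear_combination (algebraMap F (QuadExt D) b * algebraMap F (QuadExt D) d) * hsq
      algebraMap_mem' := fun o => ⟨o, 0, FractionalIdeal.zero_mem _, by simp⟩ }
  have hTS : ∀ z ∈ T, j z ∈ S := by
    rintro _ ⟨a, b, hb, rfl⟩
    rw [map_add, map_mul, AlgHom.commutes, IsScalarTower.algebraMap_apply (𝓞 F) F (QuadExt D), AlgHom.commutes,
      ← IsScalarTower.algebraMap_apply (𝓞 F) F B, ← Algebra.smul_def]
    exact S.add_mem (S.algebraMap_mem a) (h b hb)
  refine ⟨T, ⟨⟨?_, ?_⟩, ω, hω, rfl⟩, hTS⟩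
  · have : IsNoetherian (𝓞 F) (Subalgebra.toSubmodule S) := isNoetherian_of_fg_of_noetherian _ hS.1
    let f : Subalgebra.toSubmodule T →ₗ[𝓞 F] Subalgebra.toSubmodule S :=
      { toFun := fun z => ⟨j z, hTS z z.2⟩
        map_add' := fun z w => Subtype.ext (map_add j (z : QuadExt D) w)
        map_smul' := fun c z => Subtype.ext (by
          change j (c • (z : QuadExt D)) = c • j z
          have e1 : c • (z : QuadExt D) = algebraMap F _ (algebraMap (𝓞 F) F c) * z :=
            (Algebra.smul_def c (z : QuadExt D)).trans
              (by rw [IsScalarTower.algebraMap_apply (𝓞 F) F (QuadExt D)])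
          rw [e1, Algebra.smul_def, map_mul, AlgHom.commutes,
            ← IsScalarTower.algebraMap_apply (𝓞 F) F B]) }
    have hf : Function.Injective f := fun z w h => Subtype.ext (hinj (congrArg Subtype.val h))
    have := isNoetherian_of_injective f hf
    exact (Module.Finite.iff_fg).1 inferInstance
  · rw [eq_top_iff]
    rintro z -
    obtain ⟨s, r, rfl⟩ := exists_eq_add_smul H hD j hω z
    obtain ⟨a, ha, ha0⟩ : ∃ a ∈ (𝔞 : FractionalIdeal (𝓞 F)⁰ F), a ≠ 0 := by
      by_contra! h
      exact 𝔞.ne_zero (FractionalIdeal.eq_zero_iff.2 h)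
    have h1 : (1 : QuadExt D) ∈ T := T.one_mem
    have h2 : algebraMap F (QuadExt D) a * ω ∈ T := ⟨0, a, ha, by rw [map_zero, zero_add]⟩
    have e : algebraMap F (QuadExt D) s + r • ω = s • (1 : QuadExt D) + (r * a⁻¹) • (algebraMap F (QuadExt D) a * ω) := by
      rw [← Algebra.smul_def a ω, smul_smul, inv_mul_cancel_right₀ ha0, Algebra.algebraMap_eq_smul_one]
    rw [e]
    exact Submodule.add_mem _ (Submodule.smul_mem _ _ (Submodule.subset_span h1))
      (Submodule.smul_mem _ _ (Submodule.subset_span h2))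

include hD H in
/-- `x` is a special point if and only if `𝔞 ω ⊆ R_x / 𝓞_F`. -/
theorem mem_specialPoints_iff {R : Subalgebra (𝓞 F) B} (hR : IsOrder F R) (𝔞 : (FractionalIdeal (𝓞 F)⁰ F)ˣ)
    {ω : QuadExt D} (hω : fieldDisc ω = -D) {x : (BHat F B)ˣ} :
    x ∈ specialPoints R 𝔞 j ↔ (Submodule.Quotient.mk (j ω) : TraceQuot F B) ∈
      colonLattice (𝔞 : FractionalIdeal (𝓞 F)⁰ F) (quotLattice (orderAtAlg R x)) := by
  have := H.finite
  have hS := isOrder_orderAtAlg hR x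
  constructor
  · rintro ⟨T, ⟨-, ω', hω', hT⟩, hTx⟩ a ha
    obtain ⟨s, t, h⟩ := exists_eq_add_smul H hD j hω' ω
    have h1 : algebraMap F (QuadExt D) a * ω' ∈ T := by
      rw [← SetLike.mem_coe, hT]
      exact ⟨0, a, ha, by rw [map_zero, zero_add]⟩
    have h2 := hTx _ h1
    have h3 : quatDisc F (j ω) = t ^ 2 * -D := by
      rw [h, map_add, AlgHom.commutes, map_smul, H.quatDisc_add_smul, quatDisc_map H hD j hω']
    rw [quatDisc_map H hD j hω] at h3
    have hD0 := ne_zero_of_totallyPositive hD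
    -- Equal discriminants leave only the ambiguity `ω ≡ ± ω'` modulo `F`, and a lattice is stable
    -- under the sign. This is also why the order does not depend on the choice of generator.
    have ht : t ^ 2 = 1 := mul_right_cancel₀ (neg_ne_zero.2 hD0) (by rw [← h3, one_mul])
    rw [map_mul, AlgHom.commutes, ← Algebra.smul_def] at h2
    have h4 : (Submodule.Quotient.mk (j ω) : TraceQuot F B) = t • Submodule.Quotient.mk (j ω') := by
      rw [← Submodule.Quotient.mk_smul, Submodule.Quotient.eq]
      refine Submodule.mem_one.2 ⟨s, ?_⟩
      conv_rhs => rw [h, map_add, AlgHom.commutes, map_smul]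
      abel
    rw [h4, smul_comm, ← Submodule.Quotient.mk_smul]
    have h5 : (Submodule.Quotient.mk (a • j ω') : TraceQuot F B) ∈ quotLattice (orderAtAlg R x) := ⟨_, h2, rfl⟩
    rcases mul_self_eq_one_iff.1 ((pow_two t).symm.trans ht) with rfl | rfl
    · rwa [one_smul]
    · rw [neg_one_smul]; exact Submodule.neg_mem _ h5
  · intro h
    obtain ⟨b, hb, hb'⟩ := exists_lift_colonLattice 𝔞 h
    obtain ⟨s, hs⟩ := Submodule.mem_one.1 ((Submodule.Quotient.eq _).1 hb)
    refine exists_isQuadOrder H hD j hS 𝔞 (fieldDisc_algebraMap_add H hD j hω s) fun a ha => ?_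
    rw [map_add, AlgHom.commutes, hs, sub_add_cancel]
    exact hb' a ha

end SpecialPoints

/-! ## Special points with a given vector -/

section VectorFibers

set_option linter.unusedSectionVars false

variable {F : Type*} [Field F] [NumberField F] {B : Type*} [Ring B] [Algebra F B]
  {R : Subalgebra (𝓞 F) B}

/-- `Γ_{x,y} = (Bˣ ∩ x⁻¹ R̂ˣ y) / (𝓞 F)ˣ`. -/
def transporter (R : Subalgebra (𝓞 F) B) (x y : (BHat F B)ˣ) : Set (Bˣ ⧸ intUnits F B) :=
  {g | ∃ γ : Bˣ, (γ : Bˣ ⧸ intUnits F B) = g ∧ ∃ u ∈ orderHatUnits R, globalUnits F B γ = x⁻¹ * u * y}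

lemma mem_orderAtUnits_iff {x : (BHat F B)ˣ} {γ : Bˣ} :
    γ ∈ orderAtUnits R x ↔ x * globalUnits F B γ * x⁻¹ ∈ orderHatUnits R := by
  rw [mem_orderAtUnits, mem_orderHatUnits, mem_orderAt, mem_orderAt, mul_inv_rev, mul_inv_rev, inv_inv,
    ← mul_assoc]
  rfl

lemma transport_mul_int {x y : (BHat F B)ˣ} {γ ε : Bˣ} (hε : ε ∈ intUnits F B)
    (h : x * globalUnits F B γ * y⁻¹ ∈ orderHatUnits R) :
    x * globalUnits F B (γ * ε) * y⁻¹ ∈ orderHatUnits R := by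
  have h1 := mem_orderAtUnits_iff.1 (intUnits_le_orderAtUnits (R := R) y hε)
  have := mul_mem h h1
  rw [map_mul]
  simpa only [mul_assoc, inv_mul_cancel_left] using this

lemma mk_mem_transporter {x y : (BHat F B)ˣ} {γ : Bˣ} :
    (γ : Bˣ ⧸ intUnits F B) ∈ transporter R x y ↔ x * globalUnits F B γ * y⁻¹ ∈ orderHatUnits R := by
  constructor
  · rintro ⟨γ', h, u, hu, e⟩
    have h1 : x * globalUnits F B γ' * y⁻¹ ∈ orderHatUnits R := by
      rw [e]; simpa [mul_assoc] using hu
    have h2 := transport_mul_int (QuotientGroup.eq.1 h) h1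
    rwa [mul_inv_cancel_left] at h2
  · intro h
    exact ⟨γ, rfl, _, h, by group⟩

lemma out_mem_transporter {x y : (BHat F B)ˣ} {g : Bˣ ⧸ intUnits F B} :
    g ∈ transporter R x y ↔ x * globalUnits F B g.out * y⁻¹ ∈ orderHatUnits R := by
  rw [← mk_mem_transporter, QuotientGroup.out_eq']

/-- The hypothesis says `y = u⁻¹ x γ` with `u ∈ R̂ˣ`, whence `R_y = γ⁻¹ R_x γ`. -/
lemma mem_orderAt_conj {x y : (BHat F B)ˣ} {γ : Bˣ} (h : x * globalUnits F B γ * y⁻¹ ∈ orderHatUnits R)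
    (b : B) : ((γ⁻¹ : Bˣ) : B) * b * γ ∈ orderAt R y ↔ b ∈ orderAt R x := by
  set u := x * globalUnits F B γ * y⁻¹ with hu
  have hy : y = u⁻¹ * x * globalUnits F B γ := by rw [hu]; group
  have hy1 : (y : BHat F B) = ((u⁻¹ : (BHat F B)ˣ) : BHat F B) * (x : BHat F B) * 1 ⊗ₜ[F] (γ : B) := by
    conv_lhs => rw [hy]
    rfl
  have hy2 : ((y⁻¹ : (BHat F B)ˣ) : BHat F B) = 1 ⊗ₜ[F] ((γ⁻¹ : Bˣ) : B) * ((x⁻¹ : (BHat F B)ˣ) : BHat F B) * (u : BHat F B) := by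
    conv_lhs => rw [hy, mul_inv_rev, mul_inv_rev, inv_inv, ← mul_assoc]
    rfl
  have key : (y : BHat F B) * (1 ⊗ₜ[F] (((γ⁻¹ : Bˣ) : B) * b * γ)) * ((y⁻¹ : (BHat F B)ˣ) : BHat F B) =
      ((u⁻¹ : (BHat F B)ˣ) : BHat F B) * ((x : BHat F B) * 1 ⊗ₜ[F] b * ((x⁻¹ : (BHat F B)ˣ) : BHat F B)) * (u : BHat F B) := by
    have e : (1 : FinAdele F) ⊗ₜ[F] (γ : B) * (1 : FinAdele F) ⊗ₜ[F] (((γ⁻¹ : Bˣ) : B) * b * γ) *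
        (1 : FinAdele F) ⊗ₜ[F] ((γ⁻¹ : Bˣ) : B) = 1 ⊗ₜ[F] b := by
      rw [← one_tmul_mul, ← one_tmul_mul]
      congr 1
      rw [mul_assoc, mul_assoc, mul_assoc, Units.mul_inv, mul_one, Units.mul_inv_cancel_left]
    rw [hy1, hy2, ← e]
    simp only [mul_assoc]
  obtain ⟨hu1, hu2⟩ := mem_orderHatUnits.1 h
  rw [mem_orderAt, mem_orderAt, key]
  constructor
  · intro h1
    have := (orderHat R).mul_mem ((orderHat R).mul_mem hu1 h1) hu2
    simpa only [mul_assoc, Units.mul_inv_cancel_left, Units.mul_inv, mul_one] using this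
  · intro h1
    exact (orderHat R).mul_mem ((orderHat R).mul_mem hu2 h1) hu1

lemma mk_conj_mem_colonLattice {x y : (BHat F B)ˣ} {γ : Bˣ} (h : x * globalUnits F B γ * y⁻¹ ∈ orderHatUnits R)
    (𝔞 : FractionalIdeal (𝓞 F)⁰ F) (b : B) :
    (Submodule.Quotient.mk (((γ⁻¹ : Bˣ) : B) * b * γ) : TraceQuot F B) ∈
        colonLattice 𝔞 (quotLattice (orderAtAlg R y)) ↔
      (Submodule.Quotient.mk b : TraceQuot F B) ∈ colonLattice 𝔞 (quotLattice (orderAtAlg R x)) := by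
  rw [mem_colonLattice, mem_colonLattice]
  refine forall₂_congr fun a _ => ?_
  rw [← Submodule.Quotient.mk_smul, ← Submodule.Quotient.mk_smul, mk_mem_quotLattice, mk_mem_quotLattice]
  refine exists_congr fun s => ?_
  rw [mem_orderAtAlg, mem_orderAtAlg, ← mem_orderAt_conj h]
  have : a • (((γ⁻¹ : Bˣ) : B) * b * γ) + algebraMap F B s =
      ((γ⁻¹ : Bˣ) : B) * (a • b + algebraMap F B s) * γ := by
    rw [mul_add, add_mul, mul_smul_comm, smul_mul_assoc, ← Algebra.commutes s, mul_assoc (algebraMap F B s),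
      Units.inv_mul, mul_one]
  rw [this]

variable [NumberField.IsTotallyReal F] [IsDomain B] (H : DefiniteQuat F B) {D : F}
  (hD : ∀ τ : F →+* ℝ, 0 < τ D) (j : QuadExt D →ₐ[F] B) {ω : QuadExt D} (hω : fieldDisc ω = -D)
  (hR : IsOrder F R) (𝔞 : (FractionalIdeal (𝓞 F)⁰ F)ˣ)

/-- The class of `γ⁻¹ ω γ` in `B / F`. -/
def conjVec (j : QuadExt D →ₐ[F] B) (ω : QuadExt D) (γ : Bˣ) : TraceQuot F B :=
  Submodule.Quotient.mk (((γ⁻¹ : Bˣ) : B) * j ω * γ)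

/-- The vectors of `𝔞⁻¹ L_y` of length `ξ`. -/
def vectorsAt (R : Subalgebra (𝓞 F) B) (ξ : F) (y : (BHat F B)ˣ) : Set (TraceQuot F B) :=
  {v | v ∈ colonLattice (𝔞 : FractionalIdeal (𝓞 F)⁰ F) (quotLattice (orderAtAlg R y)) ∧
    H.quadCoord.form v v = ξ}

/-- The embedding `Kˣ → Bˣ`. -/
abbrev unitsMap (j : QuadExt D →ₐ[F] B) : (QuadExt D)ˣ →* Bˣ := Units.map (j : QuadExt D →* B)

include hR in
lemma finite_vectorsAt (ξ : F) (y : (BHat F B)ˣ) : (vectorsAt H 𝔞 R ξ y).Finite := by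
  have := H.finite
  exact H.quadCoord.finite_form_eq ((isOrder_orderAtAlg hR y).isLattice_quotLattice.colon 𝔞.ne_zero) ξ

lemma conjVec_mul_units (κ : (QuadExt D)ˣ) (γ : Bˣ) :
    conjVec j ω (unitsMap j κ * γ) = conjVec j ω γ := by
  rw [conjVec, conjVec, mul_inv_rev, Units.val_mul, Units.val_mul, ← map_inv]
  congr 1
  have : j ((κ⁻¹ : (QuadExt D)ˣ) : QuadExt D) * j ω * j (κ : QuadExt D) = j ω := by
    rw [← map_mul, ← map_mul, mul_comm ((κ⁻¹ : (QuadExt D)ˣ) : QuadExt D), mul_assoc, Units.inv_mul, mul_one]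
  change ((γ⁻¹ : Bˣ) : B) * j ((κ⁻¹ : (QuadExt D)ˣ) : QuadExt D) * j ω * (j (κ : QuadExt D) * γ) = _
  conv_rhs => rw [← this]
  simp only [mul_assoc]

lemma conjVec_mul_int {ε : Bˣ} (hε : ε ∈ intUnits F B) (γ : Bˣ) :
    conjVec j ω (γ * ε) = conjVec j ω γ := by
  rw [conjVec, conjVec, mul_inv_rev, Units.val_mul, Units.val_mul]
  congr 1
  have h1 := intUnits_comm (inv_mem hε)
  rw [h1, mul_assoc, mul_assoc, h1]
  simp only [mul_assoc, Units.mul_inv, mul_one]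

lemma conjVec_out (γ : Bˣ) : conjVec j ω (γ : Bˣ ⧸ intUnits F B).out = conjVec j ω γ := by
  obtain ⟨ε, hε⟩ := QuotientGroup.mk_out_eq_mul (intUnits F B) γ
  rw [hε, conjVec_mul_int j ε.2]

include hD hω hR in
lemma conjVec_mem_vectorsAt {x y : (BHat F B)ˣ} {γ : Bˣ} (hx : x ∈ specialPoints R 𝔞 j)
    (h : x * globalUnits F B γ * y⁻¹ ∈ orderHatUnits R) : conjVec j ω γ ∈ vectorsAt H 𝔞 R D y := by
  refine ⟨(mk_conj_mem_colonLattice h _ _).2 ((mem_specialPoints_iff H hD j hR 𝔞 hω).1 hx), ?_⟩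
  rw [conjVec, H.quadCoord_form_mk, discForm_self, H.quatDisc_conj, quatDisc_map H hD j hω, neg_neg]

include hD hω in
lemma mem_specialPoints_of_conjVec {x y : (BHat F B)ˣ} {γ : Bˣ} (hR : IsOrder F R)
    (h : x * globalUnits F B γ * y⁻¹ ∈ orderHatUnits R) (hv : conjVec j ω γ ∈ vectorsAt H 𝔞 R D y) :
    x ∈ specialPoints R 𝔞 j :=
  (mem_specialPoints_iff H hD j hR 𝔞 hω).2 ((mk_conj_mem_colonLattice h _ _).1 hv.1)

-- A lift of `v` is shifted by a scalar until its trace is that of `ω`; trace and discriminant then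
-- agree, and such elements are conjugate.
include hD hω in
lemma exists_conjVec_eq [Algebra.IsCentral F B] {y : (BHat F B)ˣ} {v : TraceQuot F B}
    (hv : v ∈ vectorsAt H 𝔞 R D y) : ∃ γ : Bˣ, conjVec j ω γ = v := by
  obtain ⟨b, rfl⟩ := Submodule.Quotient.mk_surjective _ v
  have h1 : quatDisc F b = -D := by
    have := hv.2
    rw [H.quadCoord_form_mk, discForm_self] at this
    rw [← this, neg_neg]
  set s := (redTrace F (j ω) - redTrace F b) / 2
  have ht : redTrace F (j ω) = redTrace F (algebraMap F B s + (1 : F) • b) := by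
    rw [one_smul, redTrace_add, H.redTrace_algebraMap]; ring
  have hd : quatDisc F (j ω) = quatDisc F (algebraMap F B s + (1 : F) • b) := by
    rw [H.quatDisc_add_smul, quatDisc_map H hD j hω, h1]; ring
  obtain ⟨γ, hγ⟩ := H.exists_conj_eq (algebraMap_ne_of_fieldDisc hD j hω) ht hd
  refine ⟨γ, ?_⟩
  rw [conjVec, hγ, one_smul, Submodule.Quotient.eq]
  exact Submodule.mem_one.2 ⟨s, by abel⟩

-- An equality in `B / F` between conjugates of `ω` holds in `B` itself because their traces agree.
-- So `γ γ'⁻¹` centralizes `ω` and lies in `K`, as does its inverse.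
include hD hω H in
lemma exists_units_of_conjVec_eq {γ γ' : Bˣ} (h : conjVec j ω γ = conjVec j ω γ') :
    ∃ κ : (QuadExt D)ˣ, γ = unitsMap j κ * γ' := by
  have hω' := algebraMap_ne_of_fieldDisc hD j hω
  obtain ⟨s, hs⟩ := Submodule.mem_one.1 ((Submodule.Quotient.eq _).1 h)
  have h2 : redTrace F (algebraMap F B s) = 0 := by
    rw [hs, sub_eq_add_neg, redTrace_add, ← neg_one_smul F, redTrace_smul, H.redTrace_conj, H.redTrace_conj]
    ring
  rw [H.redTrace_algebraMap] at h2
  have h3 : s = 0 := by simpa using h2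
  rw [h3, map_zero] at hs
  have h4 := sub_eq_zero.1 hs.symm
  have hcomm : ∀ γ γ' : Bˣ, ((γ⁻¹ : Bˣ) : B) * j ω * γ = ((γ'⁻¹ : Bˣ) : B) * j ω * γ' →
      ∃ z : QuadExt D, j z = ((γ * γ'⁻¹ : Bˣ) : B) := by
    intro γ γ' h
    obtain ⟨s, t, hst⟩ := H.exists_eq_of_commute hω' (b := ((γ * γ'⁻¹ : Bˣ) : B)) (by
      have := congrArg (fun b => (γ : B) * b * ((γ'⁻¹ : Bˣ) : B)) h
      simp only [mul_assoc, Units.mul_inv_cancel_left, Units.mul_inv, mul_one] at this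
      rw [Units.val_mul, mul_assoc, this])
    exact ⟨algebraMap F _ s + t • ω, by rw [hst, map_add, AlgHom.commutes, map_smul]⟩
  obtain ⟨z, hz⟩ := hcomm γ γ' h4
  obtain ⟨z', hz'⟩ := hcomm γ' γ h4.symm
  have hzz : z * z' = 1 := by
    apply quadExt_injective hD j
    rw [map_mul, hz, hz', map_one, ← Units.val_mul, ← Units.val_one]
    congr 1; group
  refine ⟨⟨z, z', hzz, by rw [mul_comm, hzz]⟩, ?_⟩
  rw [← mul_inv_eq_iff_eq_mul]
  exact Units.ext hz.symm

/-! ### Classes of special points -/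

lemma specialClass_out_eq {x : (BHat F B)ˣ} :
    ∃ u ∈ orderHatUnits R, ∃ κ : (QuadExt D)ˣ,
      (DoubleCoset.mk (orderHatUnits R) (fieldUnits j) x).out = u * x * globalUnits F B (unitsMap j κ) := by
  obtain ⟨u, k, hu, hk, h⟩ := DoubleCoset.mk_out_eq_mul (orderHatUnits R) (fieldUnits j) x
  obtain ⟨κ, rfl⟩ := hk
  exact ⟨u, hu, κ, h⟩

-- Being special is a property of the class. This is needed because the sums are evaluated at the
-- chosen representatives `c.out`.
include hD hω hR H in
lemma out_mem_specialPoints {c : DoubleCoset.Quotient (orderHatUnits R : Set (BHat F B)ˣ) (fieldUnits j)}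
    (hc : c ∈ DoubleCoset.mk (orderHatUnits R) (fieldUnits j) '' specialPoints R 𝔞 j) :
    c.out ∈ specialPoints R 𝔞 j := by
  obtain ⟨x, hx, rfl⟩ := hc
  obtain ⟨u, hu, κ, h⟩ := specialClass_out_eq (R := R) j (x := x)
  rw [h]
  set x' := u * x * globalUnits F B (unitsMap j κ) with hx'
  have h1 : x * globalUnits F B (unitsMap j κ) * x'⁻¹ ∈ orderHatUnits R := by
    have : x * globalUnits F B (unitsMap j κ) * x'⁻¹ = u⁻¹ := by rw [hx']; group
    rw [this]; exact inv_mem hu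
  have h2 := (mk_conj_mem_colonLattice h1 (𝔞 : FractionalIdeal (𝓞 F)⁰ F) (j ω)).2
    ((mem_specialPoints_iff H hD j hR 𝔞 hω).1 hx)
  have h3 : conjVec j ω (unitsMap j κ) = Submodule.Quotient.mk (j ω) := by
    rw [← mul_one (unitsMap j κ), conjVec_mul_units, conjVec]
    simp
  rw [mem_specialPoints_iff H hD j hR 𝔞 hω, ← h3]
  exact h2

include hD in
lemma mem_intUnits_iff_map (κ : (QuadExt D)ˣ) :
    unitsMap j κ ∈ intUnits F B ↔ κ ∈ intUnits F (QuadExt D) := by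
  have key : ∀ o : 𝓞 F, j (algebraMap (𝓞 F) (QuadExt D) o) = algebraMap (𝓞 F) B o := fun o => by
    rw [IsScalarTower.algebraMap_apply (𝓞 F) F (QuadExt D), AlgHom.commutes,
      ← IsScalarTower.algebraMap_apply (𝓞 F) F B]
  constructor
  · rintro ⟨o, ho⟩
    refine ⟨o, Units.ext (quadExt_injective hD j ?_)⟩
    exact (key o).trans (congrArg Units.val ho)
  · rintro ⟨o, rfl⟩
    exact ⟨o, Units.ext (key o).symm⟩

include hD H hR in
lemma unitIndex_ne_zero [Algebra.IsCentral F B] (x : (BHat F B)ˣ) : unitIndex R j x ≠ 0 := by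
  have h1 := relIndex_orderAtUnits_ne_zero H hR x
  have h2 : intUnits F (QuadExt D) = (intUnits F B).comap (unitsMap j) := by
    ext κ; exact (mem_intUnits_iff_map hD j κ).symm
  rw [unitIndex, h2, Subgroup.relIndex_comap]
  intro h3
  exact h1 (Subgroup.relIndex_eq_zero_of_le_right (Subgroup.map_comap_le _ _) h3)

include hD hω hR H in
/-- For each vector there is one class of special points, with `[𝓞_xˣ : (𝓞 F)ˣ]` transporters. -/
theorem exists_class_of_vector [Algebra.IsCentral F B] {y : (BHat F B)ˣ} {v : TraceQuot F B}
    (hv : v ∈ vectorsAt H 𝔞 R D y) :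
    ∃ c₀ ∈ DoubleCoset.mk (orderHatUnits R) (fieldUnits j) '' specialPoints R 𝔞 j,
      (∀ c, ∀ g ∈ transporter R c.out y, conjVec j ω g.out = v → c = c₀) ∧
      Nat.card {g | g ∈ transporter R c₀.out y ∧ conjVec j ω g.out = v} = unitIndex R j c₀.out := by
  obtain ⟨γ₀, hγ₀⟩ := exists_conjVec_eq H hD j hω 𝔞 hv
  -- With this choice `γ₀` itself transports `x₀` to `y`, with `u = 1`.
  set x₀ := y * (globalUnits F B γ₀)⁻¹ with hx₀
  have h0 : x₀ * globalUnits F B γ₀ * y⁻¹ ∈ orderHatUnits R := by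
    have : x₀ * globalUnits F B γ₀ * y⁻¹ = 1 := by rw [hx₀]; group
    rw [this]; exact one_mem _
  have hspec : x₀ ∈ specialPoints R 𝔞 j := mem_specialPoints_of_conjVec H hD j hω 𝔞 hR h0 (hγ₀ ▸ hv)
  refine ⟨DoubleCoset.mk _ _ x₀, ⟨x₀, hspec, rfl⟩, ?_, ?_⟩
  · intro c g hg hgv
    obtain ⟨κ, hκ⟩ := exists_units_of_conjVec_eq H hD j hω (hgv.trans hγ₀.symm)
    rw [out_mem_transporter, hκ] at hg
    conv_lhs => rw [← Quotient.out_eq c]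
    refine (DoubleCoset.eq _ _ _ _).2 ⟨_, inv_mem hg, globalUnits F B (unitsMap j κ), ⟨κ, rfl⟩, ?_⟩
    rw [hx₀, map_mul]; group
  · obtain ⟨u, hu, κ₀, hout⟩ := specialClass_out_eq (R := R) j (x := x₀)
    set x := (DoubleCoset.mk (orderHatUnits R) (fieldUnits j) x₀).out with hx
    clear_value x
    -- The chosen representative differs from `x₀` by `κ₀ ∈ Kˣ`; the correction gives a transporter
    -- from it to `y` with the same vector.
    let γ₁ := (unitsMap j κ₀)⁻¹ * γ₀
    have hγ₁v : conjVec j ω γ₁ = v := by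
      rw [← hγ₀]
      simp only [γ₁]
      rw [← map_inv, conjVec_mul_units]
    have hγ₁ : x * globalUnits F B γ₁ * y⁻¹ ∈ orderHatUnits R := by
      have : x * globalUnits F B γ₁ * y⁻¹ = u := by
        rw [hout, hx₀, map_mul, map_inv]; group
      rw [this]; exact hu
    let A : Subgroup (QuadExt D)ˣ := (orderAtUnits R x).comap (unitsMap j)
    have hmem : ∀ κ : (QuadExt D)ˣ, κ ∈ A ↔ x * globalUnits F B (unitsMap j κ * γ₁) * y⁻¹ ∈ orderHatUnits R := by
      intro κ
      rw [Subgroup.mem_comap, mem_orderAtUnits_iff]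
      have : x * globalUnits F B (unitsMap j κ * γ₁) * y⁻¹ =
          x * globalUnits F B (unitsMap j κ) * x⁻¹ * (x * globalUnits F B γ₁ * y⁻¹) := by
        rw [map_mul]; group
      rw [this]
      exact (Subgroup.mul_mem_cancel_right _ hγ₁).symm
    -- Every transporter with vector `v` is `κ γ₁` with `κ ∈ Kˣ`, and `κ γ₁` is a transporter
    -- exactly when `κ ∈ 𝓞_xˣ`. Integral units being central, the fibers of `f` are the cosets of
    -- `(𝓞 F)ˣ`.
    let f : A → {g : Bˣ ⧸ intUnits F B | g ∈ transporter R x y ∧ conjVec j ω g.out = v} := fun κ =>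
      ⟨((unitsMap j κ * γ₁ : Bˣ) : Bˣ ⧸ intUnits F B), mk_mem_transporter.2 ((hmem κ).1 κ.2), by
        rw [conjVec_out, conjVec_mul_units, hγ₁v]⟩
    have hf : ∀ κ κ' : A, f κ = f κ' ↔ κ⁻¹ * κ' ∈ (intUnits F (QuadExt D)).subgroupOf A := by
      intro κ κ'
      rw [Subtype.mk.injEq, QuotientGroup.eq, Subgroup.mem_subgroupOf]
      have hsym : ∀ ε δ : Bˣ, ε ∈ intUnits F B → δ⁻¹ * ε * δ = ε := fun ε δ hε => by
        ext
        rw [Units.val_mul, Units.val_mul, ← intUnits_comm hε, mul_assoc, Units.inv_mul, mul_one]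
      have e : (unitsMap j κ * γ₁)⁻¹ * (unitsMap j κ' * γ₁) = γ₁⁻¹ * unitsMap j ((κ : (QuadExt D)ˣ)⁻¹ * κ') * γ₁ := by
        rw [map_mul, map_inv]; group
      rw [e]
      change _ ↔ (κ : (QuadExt D)ˣ)⁻¹ * κ' ∈ _
      rw [← mem_intUnits_iff_map hD j]
      constructor
      · intro h
        have := hsym _ γ₁⁻¹ h
        have e2 : γ₁⁻¹⁻¹ * (γ₁⁻¹ * unitsMap j ((κ : (QuadExt D)ˣ)⁻¹ * κ') * γ₁) * γ₁⁻¹ =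
          unitsMap j ((κ : (QuadExt D)ˣ)⁻¹ * κ') := by group
        rw [e2] at this
        rw [this]; exact h
      · intro h
        rw [hsym _ _ h]; exact h
    rw [unitIndex, Subgroup.relIndex, Subgroup.index]
    refine (Nat.card_eq_of_bijective (Quotient.lift f fun κ κ' h => ?_) ⟨?_, ?_⟩).symm
    · exact (hf κ κ').2 (QuotientGroup.leftRel_apply.1 h)
    · intro q q' h
      induction q using QuotientGroup.induction_on with | H κ =>
      induction q' using QuotientGroup.induction_on with | H κ' =>
      exact QuotientGroup.eq.2 ((hf κ κ').1 h)
    · rintro ⟨g, hg, hgv⟩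
      obtain ⟨κ, hκ⟩ := exists_units_of_conjVec_eq H hD j hω (hgv.trans hγ₁v.symm)
      have h1 := out_mem_transporter.1 hg
      rw [hκ] at h1
      refine ⟨QuotientGroup.mk ⟨κ, (hmem κ).2 h1⟩, Subtype.ext ?_⟩
      change ((unitsMap j κ * γ₁ : Bˣ) : Bˣ ⧸ intUnits F B) = g
      rw [← hκ, QuotientGroup.out_eq']

end VectorFibers

/-! ### Sums over special points as sums over lattice vectors -/

section SpecialSums

set_option linter.unusedSectionVars false

variable {F : Type*} [Field F] [NumberField F] {B : Type*} [Ring B] [Algebra F B]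
  {R : Subalgebra (𝓞 F) B} [NumberField.IsTotallyReal F] [IsDomain B] (H : DefiniteQuat F B) {D : F}
  (hD : ∀ τ : F →+* ℝ, 0 < τ D) (j : QuadExt D →ₐ[F] B) {ω : QuadExt D} (hω : fieldDisc ω = -D)
  (hR : IsOrder F R) (𝔞 : (FractionalIdeal (𝓞 F)⁰ F)ˣ) [Algebra.IsCentral F B]

/-- `X_{D,𝔞}`, the classes of special points. -/
abbrev specialClasses (R : Subalgebra (𝓞 F) B) (𝔞 : (FractionalIdeal (𝓞 F)⁰ F)ˣ) (j : QuadExt D →ₐ[F] B) :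
    Set (DoubleCoset.Quotient (orderHatUnits R : Set (BHat F B)ˣ) (fieldUnits j)) :=
  DoubleCoset.mk (orderHatUnits R) (fieldUnits j) '' specialPoints R 𝔞 j

include hD hω hR H in
lemma finite_fiber {y : (BHat F B)ˣ} {v : TraceQuot F B} (hv : v ∈ vectorsAt H 𝔞 R D y)
    (c : DoubleCoset.Quotient (orderHatUnits R : Set (BHat F B)ˣ) (fieldUnits j)) :
    {g | g ∈ transporter R c.out y ∧ conjVec j ω g.out = v}.Finite := by
  obtain ⟨c₀, -, h1, h2⟩ := exists_class_of_vector H hD j hω hR 𝔞 hv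
  by_cases hc : c = c₀
  · subst hc
    have h3 : Nat.card {g | g ∈ transporter R c.out y ∧ conjVec j ω g.out = v} ≠ 0 := by
      rw [h2]; exact unitIndex_ne_zero H hD j hR _
    exact Set.finite_coe_iff.1 (Nat.finite_of_card_ne_zero h3)
  · refine Set.finite_empty.subset fun g hg => hc (h1 c g hg.1 hg.2)

include hD hω hR H in
lemma finite_transporter (y : (BHat F B)ˣ)
    {c : DoubleCoset.Quotient (orderHatUnits R : Set (BHat F B)ˣ) (fieldUnits j)}
    (hc : c ∈ specialClasses R 𝔞 j) : (transporter R c.out y).Finite := by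
  refine ((finite_vectorsAt H hR 𝔞 D y).biUnion (t := fun v =>
    {g | g ∈ transporter R c.out y ∧ conjVec j ω g.out = v}) fun v hv =>
      finite_fiber H hD j hω hR 𝔞 hv c).subset fun g hg => ?_
  exact Set.mem_biUnion (conjVec_mem_vectorsAt H hD j hω hR 𝔞
    (out_mem_specialPoints H hD j hω hR 𝔞 hc) (out_mem_transporter.1 hg)) ⟨hg, rfl⟩

-- To a special class is attached its image in `cl(R)` together with a vector of length `D` obtained
-- by transport to the chosen representative. A vector determines its special class, so this map
-- into a finite set is injective.
include hD hω hR H in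
theorem finite_specialClasses : (specialClasses R 𝔞 j).Finite := by
  have := H.finite
  have hcl : Finite (ClassSet R) := finite_classSet H hR fun b hb => H.isUnit_of_ne_zero hb
  have key : ∀ c ∈ specialClasses R 𝔞 j, ∃ y : ClassSet R, ∃ v ∈ vectorsAt H 𝔞 R D y.out,
      ∃ g ∈ transporter R c.out y.out, conjVec j ω g.out = v := by
    intro c hc
    let y := DoubleCoset.mk (orderHatUnits R) (globalUnits F B).range c.out
    obtain ⟨u, k, hu, hk, h⟩ := DoubleCoset.mk_out_eq_mul (orderHatUnits R) (globalUnits F B).range c.out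
    obtain ⟨γ, rfl⟩ := hk
    have h1 : c.out * globalUnits F B γ * (Quotient.out y)⁻¹ ∈ orderHatUnits R := by
      have : c.out * globalUnits F B γ * (Quotient.out y)⁻¹ = u⁻¹ := by
        simp only [y]
        rw [h]; group
      rw [this]; exact inv_mem hu
    have h2 : (γ : Bˣ ⧸ intUnits F B) ∈ transporter R c.out y.out := mk_mem_transporter.2 h1
    exact ⟨y, _, conjVec_mem_vectorsAt H hD j hω hR 𝔞 (out_mem_specialPoints H hD j hω hR 𝔞 hc)
      (out_mem_transporter.1 h2), _, h2, rfl⟩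
  choose! y v hv g hg hgv using key
  let T : Set (ClassSet R × TraceQuot F B) := ⋃ y : ClassSet R, (fun v => (y, v)) '' vectorsAt H 𝔞 R D y.out
  have hT : T.Finite := Set.finite_iUnion fun y => (finite_vectorsAt H hR 𝔞 D _).image _
  refine Set.Finite.of_finite_image (f := fun c => (y c, v c)) (hT.subset ?_) ?_
  · rintro _ ⟨c, hc, rfl⟩
    exact Set.mem_iUnion.2 ⟨y c, v c, hv c hc, rfl⟩
  · intro c hc c' hc' h
    obtain ⟨h1, h2⟩ := Prod.mk.inj h
    obtain ⟨c₀, -, h3, -⟩ := exists_class_of_vector H hD j hω hR 𝔞 (hv c hc)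
    rw [h3 c (g c) (hg c hc) (hgv c hc)]
    refine (h3 c' (g c') ?_ ((hgv c' hc').trans h2.symm)).symm
    have := hg c' hc'
    rwa [← h1] at this

include hD hω hR in
/-- The sum over special points and transporters as a sum over lattice vectors of length `D`. -/
theorem sum_specialClasses (Ψ : TraceQuot F B → ℂ) (y : (BHat F B)ˣ) :
    ∑ᶠ c ∈ specialClasses R 𝔞 j, (unitIndex R j c.out : ℂ)⁻¹ *
      ∑ᶠ g ∈ transporter R c.out y, Ψ (conjVec j ω g.out) = ∑ᶠ v ∈ vectorsAt H 𝔞 R D y, Ψ v := by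
  classical
  have hX := finite_specialClasses H hD j hω hR 𝔞
  have hV := finite_vectorsAt H hR 𝔞 D y
  have hΓ : ∀ c ∈ hX.toFinset, (transporter R c.out y).Finite := fun c hc =>
    finite_transporter H hD j hω hR 𝔞 y (hX.mem_toFinset.1 hc)
  rw [finsum_mem_eq_finite_toFinset_sum _ hX, finsum_mem_eq_finite_toFinset_sum _ hV]
  have h1 : ∀ c ∈ hX.toFinset, (unitIndex R j c.out : ℂ)⁻¹ * ∑ᶠ g ∈ transporter R c.out y, Ψ (conjVec j ω g.out) =
      ∑ v ∈ hV.toFinset, Ψ v * ((unitIndex R j c.out : ℂ)⁻¹ *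
        (Nat.card {g | g ∈ transporter R c.out y ∧ conjVec j ω g.out = v} : ℂ)) := by
    intro c hc
    rw [finsum_mem_eq_finite_toFinset_sum _ (hΓ c hc),
      ← Finset.sum_fiberwise_of_maps_to (t := hV.toFinset) (g := fun g => conjVec j ω g.out), Finset.mul_sum]
    · refine Finset.sum_congr rfl fun v hv => ?_
      have h2 : Nat.card {g | g ∈ transporter R c.out y ∧ conjVec j ω g.out = v} =
          ((hΓ c hc).toFinset.filter fun g => conjVec j ω g.out = v).card := by
        rw [Nat.card_coe_set_eq, ← Set.ncard_coe_finset]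
        congr 1
        ext g
        simp
      rw [h2, Finset.sum_congr rfl (g := fun _ => Ψ v) fun g hg => by rw [(Finset.mem_filter.1 hg).2],
        Finset.sum_const, nsmul_eq_mul]
      ring
    · intro g hg
      rw [Set.Finite.mem_toFinset] at hg ⊢
      exact conjVec_mem_vectorsAt H hD j hω hR 𝔞 (out_mem_specialPoints H hD j hω hR 𝔞 (hX.mem_toFinset.1 hc))
        (out_mem_transporter.1 hg)
  rw [Finset.sum_congr rfl h1, Finset.sum_comm]
  refine Finset.sum_congr rfl fun v hv => ?_
  rw [← Finset.mul_sum]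
  -- After reversing the order of summation, only the class `c₀` of `v` contributes. It does so once
  -- for each of its `[𝓞_xˣ : (𝓞 F)ˣ]` transporters, which cancels the weight.
  obtain ⟨c₀, hc₀, h2, h3⟩ := exists_class_of_vector H hD j hω hR 𝔞 (hV.mem_toFinset.1 hv)
  rw [Finset.sum_eq_single_of_mem c₀ (hX.mem_toFinset.2 hc₀), h3,
    inv_mul_cancel₀ (by exact_mod_cast unitIndex_ne_zero H hD j hR _), mul_one]
  intro c _ hne
  have h4 : IsEmpty {g | g ∈ transporter R c.out y ∧ conjVec j ω g.out = v} :=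
    ⟨fun g => hne (h2 c g g.2.1 g.2.2)⟩
  rw [Nat.card_of_isEmpty, Nat.cast_zero, mul_zero]

open Polynomial in
include H in
/-- If `F(√-D)` does not embed in `B`, there are no vectors of length `D`. -/
theorem vectorsAt_eq_empty (hempty : IsEmpty (QuadExt D →ₐ[F] B)) (y : (BHat F B)ˣ) :
    vectorsAt H 𝔞 R D y = ∅ := by
  rw [Set.eq_empty_iff_forall_notMem]
  rintro v ⟨-, hv⟩
  obtain ⟨b, rfl⟩ := Submodule.Quotient.mk_surjective _ v
  rw [H.quadCoord_form_mk, discForm_self, neg_eq_iff_eq_neg] at hv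
  -- The square of `2 b - tr(b)` is `disc(b) = -D`, so a vector of length `D` would furnish an
  -- embedding of `F(√-D)`.
  set c := (2 : F) • b - algebraMap F B (redTrace F b) with hc
  have h1 : c * c = algebraMap F B (-D) := by
    have h2 := H.mul_self_eq b
    rw [← hv, quatDisc, hc]
    have h3 : ((2 : F) • b - algebraMap F B (redTrace F b)) * ((2 : F) • b - algebraMap F B (redTrace F b)) =
        (4 : F) • (b * b) - (4 : F) • (algebraMap F B (redTrace F b) * b) + algebraMap F B (redTrace F b ^ 2) := by
      rw [map_pow, pow_two, sub_mul, mul_sub, mul_sub, smul_mul_smul_comm, mul_smul_comm, smul_mul_assoc,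
        ← Algebra.commutes (redTrace F b) b]
      module
    rw [h3, h2, smul_sub, map_sub, map_mul, map_ofNat, Algebra.smul_def (4 : F) (algebraMap F B (redNorm F b)), map_ofNat]
    abel
  have h4 : aeval c (X ^ 2 + C D : F[X]) = 0 := by
    rw [map_add, map_pow, aeval_X, aeval_C, pow_two, h1, map_neg, neg_add_cancel]
  let f : QuadExt D →ₐ[F] B := Ideal.Quotient.liftₐ (Ideal.span {(X ^ 2 + C D : F[X])}) (aeval c) fun p hp => by
    obtain ⟨q, rfl⟩ := Ideal.mem_span_singleton'.1 hp
    rw [map_mul, h4, mul_zero]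
  exact hempty.elim f

end SpecialSums

/-! ## The invariant inner product -/

section InnerProduct

set_option linter.unusedSectionVars false

variable {F : Type*} [Field F]

lemma polyInner_smul_right (c : ℂ) (P Q : WeightPoly F) :
    polyInner P (c • Q) = (starRingEnd ℂ) c * polyInner P Q := by
  rw [← polyInner_conj, polyInner_smul, map_mul, polyInner_conj]

lemma polyInner_zero_left (Q : WeightPoly F) : polyInner 0 Q = 0 := by simp [polyInner]

lemma polyInner_zero_right (P : WeightPoly F) : polyInner P 0 = 0 := by simp [polyInner]

lemma polyInner_sum {κ : Type*} (s : Finset κ) (P : κ → WeightPoly F) (Q : WeightPoly F) :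
    polyInner (∑ i ∈ s, P i) Q = ∑ i ∈ s, polyInner (P i) Q := by
  classical
  induction s using Finset.induction_on with
  | empty => exact polyInner_zero_left Q
  | insert i s hi ih => rw [Finset.sum_insert hi, Finset.sum_insert hi, polyInner_add, ih]

lemma polyInner_sum_right {κ : Type*} (s : Finset κ) (P : WeightPoly F) (Q : κ → WeightPoly F) :
    polyInner P (∑ i ∈ s, Q i) = ∑ i ∈ s, polyInner P (Q i) := by
  rw [← polyInner_conj, polyInner_sum, map_sum]
  exact Finset.sum_congr rfl fun i _ => polyInner_conj _ _

lemma polyInner_monomial (m : ((F →+* ℝ) × Fin 3) →₀ ℕ) (a : ℂ) (Q : WeightPoly F) :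
    polyInner (MvPolynomial.monomial m a) Q =
      (m.prod fun _ n => (n.factorial : ℂ)) * a * (starRingEnd ℂ) (Q.coeff m) := by
  classical
  rw [polyInner_eq {m} _ _ MvPolynomial.support_monomial_subset, Finset.sum_singleton,
    MvPolynomial.coeff_monomial, if_pos rfl]

lemma coeff_pderiv_eq {σ : Type*} (p : σ) (Q : MvPolynomial σ ℂ) (m : σ →₀ ℕ) :
    (MvPolynomial.pderiv p Q).coeff m = ((m p : ℂ) + 1) * Q.coeff (m + Finsupp.single p 1) := by
  classical
  induction Q using MvPolynomial.induction_on' with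
  | add P P' h h' => rw [map_add, MvPolynomial.coeff_add, MvPolynomial.coeff_add, h, h', mul_add]
  | monomial s a =>
    rw [MvPolynomial.pderiv_monomial, MvPolynomial.coeff_monomial, MvPolynomial.coeff_monomial]
    by_cases h : s = m + Finsupp.single p 1
    · subst h
      rw [if_pos (add_tsub_cancel_right _ _), if_pos rfl, Finsupp.add_apply, Finsupp.single_eq_same]
      push_cast; ring
    · rw [if_neg h, mul_zero]
      split_ifs with h'
      · have h0 : s p = 0 := by
          by_contra h0
          refine h ?_
          rw [← h', tsub_add_cancel_of_le]
          exact Finsupp.single_le_iff.2 (Nat.one_le_iff_ne_zero.2 h0)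
        rw [h0, Nat.cast_zero, mul_zero]
      · rfl

lemma factorial_prod_add_single {σ : Type*} (p : σ) (m : σ →₀ ℕ) :
    ((m + Finsupp.single p 1).prod fun _ n => (n.factorial : ℂ)) =
      ((m p : ℂ) + 1) * (m.prod fun _ n => (n.factorial : ℂ)) := by
  classical
  have hsub : m.support ⊆ insert p m.support := Finset.subset_insert _ _
  have hsub' : (m + Finsupp.single p 1).support ⊆ insert p m.support := by
    refine Finsupp.support_add.trans (Finset.union_subset hsub ?_)
    exact Finsupp.support_single_subset.trans (by simp)
  rw [Finsupp.prod_of_support_subset _ hsub' _ (by simp), Finsupp.prod_of_support_subset _ hsub _ (by simp),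
    ← Finset.mul_prod_erase _ _ (Finset.mem_insert_self p m.support),
    ← Finset.mul_prod_erase _ (fun x => ((m x).factorial : ℂ)) (Finset.mem_insert_self p m.support), ← mul_assoc]
  congr 1
  · rw [Finsupp.add_apply, Finsupp.single_eq_same, Nat.factorial_succ]; push_cast; ring
  · refine Finset.prod_congr rfl fun x hx => ?_
    rw [Finsupp.add_apply, Finsupp.single_eq_of_ne (Finset.ne_of_mem_erase hx), add_zero]

/-- Multiplication by a variable is adjoint to the derivative. -/
lemma polyInner_mul_X (P Q : WeightPoly F) (p : (F →+* ℝ) × Fin 3) :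
    polyInner (P * MvPolynomial.X p) Q = polyInner P (MvPolynomial.pderiv p Q) := by
  classical
  induction P using MvPolynomial.induction_on' with
  | add P P' h h' => rw [add_mul, polyInner_add, polyInner_add, h, h']
  | monomial m a =>
    rw [MvPolynomial.X, MvPolynomial.monomial_mul, mul_one, polyInner_monomial, polyInner_monomial]
    rw [coeff_pderiv_eq, factorial_prod_add_single, map_mul, map_add, map_one, Complex.conj_natCast]
    ring

variable [NumberField F]

/-- The substitution with matrix `A`. -/
def linSubst (A : (F →+* ℝ) × Fin 3 → (F →+* ℝ) × Fin 3 → ℝ) : WeightPoly F →ₐ[ℂ] WeightPoly F :=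
  MvPolynomial.aeval fun p => ∑ q, MvPolynomial.C ((A p q : ℝ) : ℂ) * MvPolynomial.X q

lemma linSubst_X (A : (F →+* ℝ) × Fin 3 → (F →+* ℝ) × Fin 3 → ℝ) (p : (F →+* ℝ) × Fin 3) :
    linSubst A (MvPolynomial.X p) = ∑ q, MvPolynomial.C ((A p q : ℝ) : ℂ) * MvPolynomial.X q := by
  rw [linSubst, MvPolynomial.aeval_X]

lemma linSubst_C (A : (F →+* ℝ) × Fin 3 → (F →+* ℝ) × Fin 3 → ℝ) (a : ℂ) :
    linSubst (F := F) A (MvPolynomial.C a) = MvPolynomial.C a := by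
  rw [linSubst, MvPolynomial.aeval_C]; rfl

lemma pderiv_linSubst (A : (F →+* ℝ) × Fin 3 → (F →+* ℝ) × Fin 3 → ℝ) (p : (F →+* ℝ) × Fin 3)
    (Q : WeightPoly F) :
    MvPolynomial.pderiv p (linSubst A Q) = ∑ q, ((A q p : ℝ) : ℂ) • linSubst A (MvPolynomial.pderiv q Q) := by
  classical
  induction Q using MvPolynomial.induction_on with
  | C a => simp
  | add P Q hP hQ => simp only [map_add, hP, hQ, smul_add, Finset.sum_add_distrib]
  | mul_X P r hP =>
    have h1 : MvPolynomial.pderiv p (linSubst A (MvPolynomial.X r)) = MvPolynomial.C ((A r p : ℝ) : ℂ) := by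
      rw [linSubst_X, map_sum, Finset.sum_eq_single p]
      · rw [MvPolynomial.pderiv_C_mul, MvPolynomial.pderiv_X_self, mul_one]
      · intro q _ hq
        rw [MvPolynomial.pderiv_C_mul, MvPolynomial.pderiv_X_of_ne hq, mul_zero]
      · intro h; exact absurd (Finset.mem_univ _) h
    rw [map_mul, MvPolynomial.pderiv_mul, hP, h1, Finset.sum_mul]
    have h2 : ∀ q, ((A q p : ℝ) : ℂ) • linSubst A (MvPolynomial.pderiv q (P * MvPolynomial.X r)) =
        ((A q p : ℝ) : ℂ) • linSubst A (MvPolynomial.pderiv q P) * linSubst A (MvPolynomial.X r) +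
          if q = r then ((A q p : ℝ) : ℂ) • linSubst A P else 0 := by
      intro q
      rw [MvPolynomial.pderiv_mul, map_add, map_mul, map_mul, smul_add, smul_mul_assoc]
      congr 1
      split_ifs with h
      · subst h; rw [MvPolynomial.pderiv_X_self, map_one, mul_one]
      · rw [MvPolynomial.pderiv_X_of_ne (Ne.symm h), map_zero, mul_zero, smul_zero]
    rw [Finset.sum_congr rfl fun q _ => h2 q, Finset.sum_add_distrib, Finset.sum_ite_eq' Finset.univ r,
      if_pos (Finset.mem_univ r), MvPolynomial.smul_eq_C_mul, mul_comm (linSubst A P)]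

lemma coeff_zero_linSubst (A : (F →+* ℝ) × Fin 3 → (F →+* ℝ) × Fin 3 → ℝ) (Q : WeightPoly F) :
    (linSubst A Q).coeff 0 = Q.coeff 0 := by
  have h : ∀ P : WeightPoly F, P.coeff 0 = MvPolynomial.constantCoeff P := fun P => rfl
  rw [h, h]
  induction Q using MvPolynomial.induction_on with
  | C a => rw [linSubst_C]
  | add P Q hP hQ => rw [map_add, map_add, map_add, hP, hQ]
  | mul_X P r hP => rw [map_mul, map_mul, map_mul, linSubst_X]; simp

/-- Induction on the first argument: multiplication by a variable is adjoint to the derivative, and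
the chain rule for a linear substitution brings in the transposed matrix. No orthogonality is
required. -/
theorem polyInner_linSubst (A : (F →+* ℝ) × Fin 3 → (F →+* ℝ) × Fin 3 → ℝ) (P Q : WeightPoly F) :
    polyInner P (linSubst A Q) = polyInner (linSubst (fun p q => A q p) P) Q := by
  induction P using MvPolynomial.induction_on generalizing Q with
  | C a =>
    rw [linSubst_C, MvPolynomial.C_apply, polyInner_monomial, polyInner_monomial, coeff_zero_linSubst]
  | add P P' h h' => rw [polyInner_add, map_add, polyInner_add, h, h']
  | mul_X P r hP =>
    rw [polyInner_mul_X, pderiv_linSubst, polyInner_sum_right, map_mul, linSubst_X, Finset.mul_sum, polyInner_sum]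
    refine Finset.sum_congr rfl fun q _ => ?_
    rw [polyInner_smul_right, hP, Complex.conj_ofReal, ← polyInner_mul_X, ← polyInner_smul, MvPolynomial.smul_eq_C_mul]
    congr 1; ring

end InnerProduct

/-! ### Conjugation as an orthogonal substitution -/

section Action

set_option linter.unusedSectionVars false

lemma imCoord_eq_re (q : Quaternion ℝ) (i : Fin 3) : imCoord q i = -(q * imUnit i).re := by
  rw [Quaternion.re_mul]
  fin_cases i <;> simp [imCoord, imUnit]

/-- Coordinates are real parts of products with the imaginary units, and real parts are cyclic. With
`h = g⁻¹` it says that conjugation by `g⁻¹` has the transposed matrix, which is the source of the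
invariance of the inner product. -/
lemma imCoord_conj_symm (g h : Quaternion ℝ) (i l : Fin 3) :
    imCoord (g * imUnit l * h) i = imCoord (h * imUnit i * g) l := by
  rw [imCoord_eq_re, imCoord_eq_re, mul_assoc, quaternion_re_mul_comm]
  simp only [mul_assoc]

lemma quaternion_eq_sum (q : Quaternion ℝ) :
    q = (q.re : Quaternion ℝ) + ∑ l, (imCoord q l : Quaternion ℝ) * imUnit l := by
  rw [Fin.sum_univ_three]
  ext <;> simp only [Quaternion.re_add, Quaternion.imI_add, Quaternion.imJ_add, Quaternion.imK_add,
    Quaternion.re_mul, Quaternion.imI_mul, Quaternion.imJ_mul, Quaternion.imK_mul] <;> simp [imCoord, imUnit]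

variable {F : Type*} [Field F] [NumberField F] {B : Type*} [Ring B] (ι : (F →+* ℝ) → B →+* Quaternion ℝ)

open Classical in
/-- The matrix of the conjugation by `γ`. -/
def conjMatrix (γ : Bˣ) (p q : (F →+* ℝ) × Fin 3) : ℝ :=
  if p.1 = q.1 then imCoord (ι p.1 γ * imUnit q.2 * ι p.1 (γ⁻¹ : Bˣ)) p.2 else 0

lemma polyAct_eq_linSubst (γ : Bˣ) : polyAct ι γ = linSubst (conjMatrix ι γ) := by
  classical
  rw [polyAct, linSubst]
  congr 1
  funext p
  rw [Fintype.sum_prod_type, Finset.sum_eq_single p.1]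
  · simp [conjMatrix]
  · intro τ _ hτ
    simp [conjMatrix, hτ.symm]
  · intro h; exact absurd (Finset.mem_univ _) h

theorem polyInner_polyAct (γ : Bˣ) (P Q : WeightPoly F) :
    polyInner P (polyAct ι γ Q) = polyInner (polyAct ι γ⁻¹ P) Q := by
  rw [polyAct_eq_linSubst, polyAct_eq_linSubst, polyInner_linSubst]
  congr 3
  funext p q
  rw [conjMatrix, conjMatrix]
  by_cases h : p.1 = q.1
  · rw [if_pos h, if_pos h.symm, h, imCoord_conj_symm, inv_inv]
  · rw [if_neg h, if_neg (Ne.symm h)]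

lemma evalAt_polyAct (γ : Bˣ) (P : WeightPoly F) (b : B) :
    evalAt ι (polyAct ι γ P) b = evalAt ι P ((γ : B) * b * ((γ⁻¹ : Bˣ) : B)) := by
  have key : ∀ p : (F →+* ℝ) × Fin 3, imCoord (ι p.1 ((γ : B) * b * ((γ⁻¹ : Bˣ) : B))) p.2 =
      ∑ l, imCoord (ι p.1 γ * imUnit l * ι p.1 (γ⁻¹ : Bˣ)) p.2 * imCoord (ι p.1 b) l := by
    intro p
    have h1 : ι p.1 γ * ι p.1 (γ⁻¹ : Bˣ) = 1 := by rw [← map_mul, Units.mul_inv, map_one]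
    rw [map_mul, map_mul]
    conv_lhs => rw [quaternion_eq_sum (ι p.1 b)]
    generalize ι p.1 γ = g at *
    generalize ι p.1 (γ⁻¹ : Bˣ) = h at *
    have h2 : g * (((ι p.1 b).re : Quaternion ℝ) + ∑ l, (imCoord (ι p.1 b) l : Quaternion ℝ) * imUnit l) * h =
        ((ι p.1 b).re : Quaternion ℝ) + ∑ l, (imCoord (ι p.1 b) l : Quaternion ℝ) * (g * imUnit l * h) := by
      rw [mul_add, add_mul, ← Quaternion.coe_commutes, mul_assoc, h1, mul_one, Finset.mul_sum, Finset.sum_mul]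
      congr 1
      refine Finset.sum_congr rfl fun l _ => ?_
      rw [← mul_assoc, ← Quaternion.coe_commutes, mul_assoc, mul_assoc, mul_assoc]
    rw [h2, DefiniteQuat.imCoord_add, DefiniteQuat.imCoord_coe, zero_add, Fin.sum_univ_three, DefiniteQuat.imCoord_add, DefiniteQuat.imCoord_add,
      DefiniteQuat.imCoord_coe_mul, DefiniteQuat.imCoord_coe_mul, DefiniteQuat.imCoord_coe_mul, Fin.sum_univ_three]
    ring
  rw [evalAt, polyAct, evalAt, ← MvPolynomial.coe_aeval_eq_eval, ← MvPolynomial.coe_aeval_eq_eval]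
  change (MvPolynomial.aeval _) ((MvPolynomial.aeval _) P) = (MvPolynomial.aeval _) P
  rw [← AlgHom.comp_apply, MvPolynomial.comp_aeval]
  congr 2
  funext p
  rw [key, map_sum, Finset.mul_sum, Complex.ofReal_sum]
  refine Finset.sum_congr rfl fun l _ => ?_
  rw [map_mul, MvPolynomial.aeval_C, MvPolynomial.aeval_X]
  change ((_ : ℝ) : ℂ) * _ = _
  push_cast
  ring

end Action

/-! ## The height pairing with special cycles -/

section HeightPairing

set_option linter.unusedSectionVars false

variable {F : Type*} [Field F] [NumberField F] {B : Type*} [Ring B] [Algebra F B]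
  {R : Subalgebra (𝓞 F) B} [NumberField.IsTotallyReal F] [IsDomain B] (H : DefiniteQuat F B) {D : F}
  (hD : ∀ τ : F →+* ℝ, 0 < τ D) (j : QuadExt D →ₐ[F] B) {ω : QuadExt D} (hω : fieldDisc ω = -D)
  (hR : IsOrder F R) (𝔞 : (FractionalIdeal (𝓞 F)⁰ F)ˣ) [Algebra.IsCentral F B]
  {k : (F →+* ℝ) → ℕ} {φ : (BHat F B)ˣ → WeightPoly F} (hφ : φ ∈ quatForms H.ι R k)

/-- The value of a polynomial function at a vector of `B / F`. -/
def evalVec (P : WeightPoly F) (v : TraceQuot F B) : ℂ :=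
  MvPolynomial.eval (toCVec (H.quadCoord.vec v)) P

lemma evalVec_mk (P : WeightPoly F) (b : B) :
    evalVec H P (Submodule.Quotient.mk b) = evalAt H.ι P b := rfl

/-- Since `φ(y) · γ` is itself the value `φ(y γ)`, membership comes for free, without a proof that
the action preserves `V_𝐤`. -/
lemma polyAct_mem (hφ : φ ∈ quatForms H.ι R k) (y : (BHat F B)ˣ) (γ : Bˣ) :
    polyAct H.ι γ (φ y) ∈ weightSpace F k := by
  have h := hφ.2 y 1 (one_mem _) γ
  rw [← h]
  exact hφ.1 _

-- Invariance moves the action to `φ(y) · γ⁻¹`, an element of `V_𝐤`, and pairing with `P_D`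
-- evaluates it at `ω`, that is, evaluates `φ(y)` at `γ⁻¹ω γ`.
include hφ in
lemma polyInner_polyAct_polyAt (y : (BHat F B)ˣ) (γ : Bˣ) :
    polyInner (φ y) (polyAct H.ι γ (polyAt H.ι k (j ω))) = evalVec H (φ y) (conjVec j ω γ) := by
  have hspec := (exists_polyAt H.ι k (j ω)).choose_spec.1.2
  rw [polyInner_polyAct]
  refine (hspec _ (polyAct_mem H hφ y γ⁻¹)).symm.trans ?_
  rw [evalAt_polyAct, conjVec, evalVec_mk, inv_inv]

include hD hω hR hφ in
lemma polyInner_etaForm (y : (BHat F B)ˣ) :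
    polyInner (φ y) (etaForm H.ι R k 𝔞 j ω y) = ∑ᶠ v ∈ vectorsAt H 𝔞 R D y, evalVec H (φ y) v := by
  have hX := finite_specialClasses H hD j hω hR 𝔞
  rw [← sum_specialClasses H hD j hω hR 𝔞 (evalVec H (φ y)) y, etaForm,
    finsum_mem_eq_finite_toFinset_sum _ hX, finsum_mem_eq_finite_toFinset_sum _ hX, Finset.sum_apply,
    polyInner_sum_right]
  refine Finset.sum_congr rfl fun c hc => ?_
  have hΓ := finite_transporter H hD j hω hR 𝔞 y (hX.mem_toFinset.1 hc)
  rw [Pi.smul_apply, polyInner_smul_right, map_inv₀, Complex.conj_natCast]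
  congr 1
  have h1 : minSupp H.ι R c.out (polyAt H.ι k (j ω)) y =
      ∑ᶠ g ∈ transporter R c.out y, polyAct H.ι g.out (polyAt H.ι k (j ω)) := rfl
  rw [h1, finsum_mem_eq_finite_toFinset_sum _ hΓ, finsum_mem_eq_finite_toFinset_sum _ hΓ, polyInner_sum_right]
  exact Finset.sum_congr rfl fun g _ => polyInner_polyAct_polyAt H j hφ y g.out

/-- The weighted sum over the class set of the values at the vectors of length `ξ`. -/
def vectorSum (R : Subalgebra (𝓞 F) B) (φ : (BHat F B)ˣ → WeightPoly F) (ξ : F) : ℂ :=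
  ∑ᶠ c : ClassSet R, (stabCard R c.out : ℂ)⁻¹ * ∑ᶠ v ∈ vectorsAt H 𝔞 R ξ c.out, evalVec H (φ c.out) v

include hD hω hR hφ in
theorem heightPairing_etaForm :
    heightPairing R φ (etaForm H.ι R k 𝔞 j ω) = vectorSum H 𝔞 R φ D :=
  finsum_congr fun c => by rw [polyInner_etaForm H hD j hω hR 𝔞 hφ]

include H in
theorem heightPairing_zero_eq (hempty : IsEmpty (QuadExt D →ₐ[F] B)) :
    heightPairing R φ 0 = vectorSum H 𝔞 R φ D :=
  finsum_congr fun c => by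
    rw [vectorsAt_eq_empty H 𝔞 hempty, finsum_mem_empty, Pi.zero_apply, polyInner_zero_right]

end HeightPairing

/-! ## Theta series at the cusps -/

section Level

set_option linter.unusedSectionVars false

variable {F : Type*} [Field F] [NumberField F] [NumberField.IsTotallyReal F]
  {V : Type*} [AddCommGroup V] [Module F V]
  [Module (𝓞 F) V] [IsScalarTower (𝓞 F) F V] {n : ℕ} (X : QuadCoord F V n)

/-- The dual of a lattice is contained in a multiple of the lattice. -/
theorem QuadCoord.exists_nat_smul_dual {L : Submodule (𝓞 F) V} (hL : IsLattice L) :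
    ∃ N : ℕ, N ≠ 0 ∧ ∀ u ∈ X.dual L, (N : F) • u ∈ L := by
  obtain ⟨r, e, e', hdual, -⟩ := X.exists_dual_basis hL
  choose m hm h using fun i => hL.exists_nat_smul_mem (e' i)
  refine ⟨∏ i, m i, Finset.prod_ne_zero_iff.2 fun i _ => hm i, fun u hu => ?_⟩
  choose c hc using fun i => mem_integralTrace.1 (hu (e i) (e i).2)
  set w : V := ∑ i, (((c i : ℤ) : ℚ) : F) • e' i with hw
  have h1 : ∀ i, Algebra.trace ℚ F (X.form (u - w) (e i)) = 0 := by
    intro i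
    rw [map_sub, LinearMap.sub_apply, map_sub, ← hc, X.form_comm w, hw, X.trace_form_sum_smul]
    simp only [hdual, mul_ite, mul_one, mul_zero, Finset.sum_ite_eq, Finset.mem_univ, if_true, sub_self]
  have h2 : ∀ l ∈ L, Algebra.trace ℚ F (X.form (u - w) l) = 0 := by
    intro l hl
    have h3 : l = ∑ i, (((e.repr ⟨l, hl⟩ i : ℤ) : ℚ) : F) • (e i : V) := by
      have h4 := congrArg Subtype.val (e.sum_repr ⟨l, hl⟩)
      simp only [AddSubmonoidClass.coe_finsetSum] at h4
      refine h4.symm.trans (Finset.sum_congr rfl fun i _ => ?_)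
      rw [Submodule.coe_smul_of_tower, Rat.cast_intCast, Int.cast_smul_eq_zsmul]
    rw [h3, X.trace_form_sum_smul]
    exact Finset.sum_eq_zero fun i _ => by rw [h1, mul_zero]
  -- The vector `w` has the same pairings with `L` as `u`. A multiple of `u - w` lies in `L`, so `u
  -- - w` is orthogonal to itself and vanishes by positivity.
  have h5 : u = w := by
    by_contra hne
    have hne' : u - w ≠ 0 := sub_ne_zero.2 hne
    obtain ⟨p, hp, hpL⟩ := hL.exists_nat_smul_mem (u - w)
    have h6 := h2 _ hpL
    have h7 := X.trace_form_self_pos hne'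
    rw [map_smul, smul_eq_mul, ← nsmul_eq_mul, map_nsmul, nsmul_eq_mul] at h6
    have : (p : ℚ) ≠ 0 := by exact_mod_cast hp
    rcases mul_eq_zero.1 h6 with h8 | h8
    · exact this h8
    · exact h7.ne' h8
  rw [h5, hw, Finset.smul_sum]
  refine L.sum_mem fun i _ => ?_
  rw [smul_comm, Rat.cast_intCast, Int.cast_smul_eq_zsmul]
  refine L.toAddSubgroup.zsmul_mem ?_ _
  rw [← Finset.prod_erase_mul _ _ (Finset.mem_univ i), Nat.cast_mul, mul_smul]
  exact natCast_smul_mem L _ (h i)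

/-- `C` is a level for the lattice `L`. -/
def IsLevel (L : Submodule (𝓞 F) V) (C : ℕ) : Prop := ∀ u ∈ X.dual L, (C : F) • u ∈ L

lemma IsLevel.mul_left {X : QuadCoord F V n} {L : Submodule (𝓞 F) V} {C : ℕ} (h : IsLevel X L C) (m : ℕ) :
    IsLevel X L (m * C) := fun u hu => by
  rw [Nat.cast_mul, mul_smul]; exact natCast_smul_mem L m (h u hu)

end Level

/-! ### Matrices carrying a cusp and their levels -/

section CuspMatrices

set_option linter.unusedSectionVars false

variable {F : Type*} [Field F] [NumberField F] {𝔞 : (FractionalIdeal (𝓞 F)⁰ F)ˣ}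
  {β : Matrix.SpecialLinearGroup (Fin 2) F}

lemma natIdeal_ne_bot {C : ℕ} (hC : C ≠ 0) : Ideal.span {(C : 𝓞 F)} ≠ ⊥ := by
  rw [Ne, Ideal.span_singleton_eq_bot]
  exact_mod_cast hC

lemma halfDifferent_ne_zero : halfDifferent F ≠ 0 := by
  refine mul_ne_zero (FractionalIdeal.spanSingleton_ne_zero_iff.2 (inv_ne_zero two_ne_zero)) ?_
  rw [FractionalIdeal.coeIdeal_ne_zero]
  exact differentIdeal_ne_bot

/-- `x ∈ 2 𝔡⁻¹` if and only if `x / 2 ∈ 𝔡⁻¹`. -/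
lemma half_mem_of_mem_inv_halfDifferent {x : F} (hx : x ∈ (halfDifferent F)⁻¹) :
    x / 2 ∈ ((differentIdeal ℤ (𝓞 F) : Ideal (𝓞 F)) : FractionalIdeal (𝓞 F)⁰ F)⁻¹ := by
  rw [halfDifferent, mul_inv, FractionalIdeal.spanSingleton_inv, inv_inv, FractionalIdeal.mem_singleton_mul] at hx
  obtain ⟨y, hy, rfl⟩ := hx
  rwa [mul_div_cancel_left₀ _ (two_ne_zero)]

lemma cuspMatrices_b {𝔠 : Ideal (𝓞 F)} (hβ : β ∈ cuspMatrices 𝔠 𝔞) :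
    ∀ x ∈ (𝔞 : FractionalIdeal (𝓞 F)⁰ F)⁻¹, β.1 0 1 * x / 2 ∈
      ((differentIdeal ℤ (𝓞 F) : Ideal (𝓞 F)) : FractionalIdeal (𝓞 F)⁰ F)⁻¹ := by
  intro x hx
  apply half_mem_of_mem_inv_halfDifferent
  have h := FractionalIdeal.mul_mem_mul hβ.2.1 hx
  rwa [mul_assoc, mul_inv_cancel₀ 𝔞.ne_zero, mul_one] at h

/-- The lower left entries of the matrices of level `4 C`. -/
lemma cuspMatrices_c {C : ℕ} (hβ : β ∈ cuspMatrices (Ideal.span {(C : 𝓞 F)}) 𝔞) :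
    ∀ x ∈ (𝔞 : FractionalIdeal (𝓞 F)⁰ F), ∃ δ : 𝓞 F, δ ∈ differentIdeal ℤ (𝓞 F) ∧
      x * β.1 1 0 = 2 * C * δ := by
  intro x hx
  have h := FractionalIdeal.mul_mem_mul hβ.2.2.1 hx
  rw [mul_assoc, inv_mul_cancel₀ 𝔞.ne_zero, mul_one, FractionalIdeal.coeIdeal_span_singleton, halfDifferent,
    ← mul_assoc, FractionalIdeal.spanSingleton_mul_spanSingleton, FractionalIdeal.spanSingleton_mul_spanSingleton,
    FractionalIdeal.mem_singleton_mul] at h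
  obtain ⟨y, hy, h⟩ := h
  obtain ⟨δ, hδ, rfl⟩ := (FractionalIdeal.mem_coeIdeal _).1 hy
  refine ⟨δ, hδ, ?_⟩
  rw [mul_comm x, h, map_natCast]
  ring

/-- By the determinant `1 - a d = -b c`, and the ideals prescribed for `b` and `c` multiply to `4 C
𝓞_F`. This is the source of the element `t ≡ 1` in the evaluation of ternary Gauss sums. -/
lemma cuspMatrices_bc {C : ℕ} (hβ : β ∈ cuspMatrices (Ideal.span {(C : 𝓞 F)}) 𝔞) :
    ∃ s : 𝓞 F, 1 - β.1 0 0 * β.1 1 1 = 4 * C * s := by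
  have hdet := det_entries β
  have h := FractionalIdeal.mul_mem_mul hβ.2.1 hβ.2.2.1
  have e : (halfDifferent F)⁻¹ * (𝔞 : FractionalIdeal (𝓞 F)⁰ F) * (FractionalIdeal.spanSingleton (𝓞 F)⁰ (4 : F) *
      ((Ideal.span {(C : 𝓞 F)} : Ideal (𝓞 F)) : FractionalIdeal (𝓞 F)⁰ F) *
      halfDifferent F * (𝔞 : FractionalIdeal (𝓞 F)⁰ F)⁻¹) = FractionalIdeal.spanSingleton (𝓞 F)⁰ (4 * (C : F)) := by
    have h1 := mul_inv_cancel₀ 𝔞.ne_zero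
    have h2 := mul_inv_cancel₀ (halfDifferent_ne_zero (F := F))
    rw [FractionalIdeal.coeIdeal_span_singleton, map_natCast, FractionalIdeal.spanSingleton_mul_spanSingleton]
    calc _ = (halfDifferent F * (halfDifferent F)⁻¹) * ((𝔞 : FractionalIdeal (𝓞 F)⁰ F) * (𝔞 : FractionalIdeal (𝓞 F)⁰ F)⁻¹) *
          FractionalIdeal.spanSingleton (𝓞 F)⁰ (4 * (C : F)) := by ring
      _ = _ := by rw [h1, h2, one_mul, one_mul]
  rw [e] at h
  obtain ⟨s, hs⟩ := (FractionalIdeal.mem_spanSingleton _).1 h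
  refine ⟨-s, ?_⟩
  have : 1 - β.1 0 0 * β.1 1 1 = -(β.1 0 1 * β.1 1 0) := by
    linear_combination -hdet
  rw [this, ← hs, Algebra.smul_def]
  simp only [map_neg]
  ring

lemma not_dvd_one_two : ¬ (∃ s : 𝓞 F, (1 : F) = 2 * s) := by
  rintro ⟨s, hs⟩
  have h1 : (s : F) = algebraMap ℚ F (1 / 2) := by
    rw [map_div₀, map_one, map_ofNat, eq_div_iff two_ne_zero, mul_comm, hs]
  have h2 : IsIntegral ℤ (algebraMap ℚ F (1 / 2)) := h1 ▸ s.isIntegral_coe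
  have h3 : IsIntegral ℤ (1 / 2 : ℚ) :=
    (isIntegral_algHom_iff (IsScalarTower.toAlgHom ℤ ℚ F) (algebraMap ℚ F).injective).1 h2
  obtain ⟨m, hm⟩ := IsIntegrallyClosed.isIntegral_iff.1 h3
  have h4 : (2 * m : ℤ) = 1 := by
    have : (2 : ℚ) * (m : ℤ) = 1 := by
      have h5 : ((m : ℤ) : ℚ) = 1 / 2 := by simpa using hm
      rw [h5]; norm_num
    exact_mod_cast this
  omega

/-- If `d = 0`, then `1` would be divisible by `4 C` in `𝓞_F`. Division by `d` is thus allowed for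
every matrix at such a level. -/
lemma cuspMatrices_d_ne_zero {C : ℕ} (hβ : β ∈ cuspMatrices (Ideal.span {(C : 𝓞 F)}) 𝔞) : β.1 1 1 ≠ 0 := by
  intro hd
  obtain ⟨s, hs⟩ := cuspMatrices_bc hβ
  rw [hd, mul_zero, sub_zero] at hs
  refine not_dvd_one_two (F := F) ⟨2 * C * s, ?_⟩
  simp only [map_mul, map_natCast, map_ofNat]
  rw [hs]; ring

variable [NumberField.IsTotallyReal F] {V : Type*} [AddCommGroup V] [Module F V]
  [Module (𝓞 F) V] [IsScalarTower (𝓞 F) F V] {n : ℕ} (X : QuadCoord F V n)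

/-- The transformation of theta series under the matrices carrying the cusp `𝔞`. -/
theorem QuadCoord.hasSum_theta_cusp {L : Submodule (𝓞 F) V} (hL : IsLattice L)
    (hint : ∀ u ∈ L, ∀ v ∈ L, X.form u v ∈ (1 : FractionalIdeal (𝓞 F)⁰ F)) {C : ℕ} (hC : IsLevel X L C)
    (hβ : β ∈ cuspMatrices (Ideal.span {(C : 𝓞 F)}) 𝔞)
    {k : (F →+* ℝ) → ℕ} {P : MvPolynomial ((F →+* ℝ) × Fin n) ℂ} (hP : IsMultiHarmonic k P)
    (w : (F →+* ℝ) → UpperHalfPlane) :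
    HasSum (fun y : colonLattice (𝔞 : FractionalIdeal (𝓞 F)⁰ F) L => X.term (fun τ => (moebius β w τ : ℂ)) P y)
      (X.gaussSum 𝔞 (β.1 0 1) (β.1 1 1) L *
        (halfRoot (fun τ => (w τ : ℂ)) / halfRoot (innerPoint β w)) ^ n * autFactor k β w *
        ∑' l : L, X.term (fun τ => (w τ : ℂ)) P l) := by
  refine X.hasSum_theta_moebius 𝔞.ne_zero hL hint hβ.1
    (fun x hx => mem_integralTrace_of_mem_inv_different (cuspMatrices_b hβ x hx)) hβ.2.2.2
    (cuspMatrices_d_ne_zero hβ) (fun u hu a ha => ?_) (fun u hu => ?_) hP w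
  · obtain ⟨δ, -, h⟩ := cuspMatrices_c hβ a ha
    rw [smul_smul, h]
    have : (2 * (C : F) * (δ : F)) • u = ((2 * δ : 𝓞 F) : F) • (C : F) • u := by
      rw [smul_smul]; congr 1; simp only [map_mul, map_ofNat]; ring
    rw [this]
    exact int_smul_mem L _ (hC u hu)
  · obtain ⟨δ, -, h⟩ := cuspMatrices_c hβ _ hβ.1
    -- The factor `2` in the level absorbs the `1/2`: `a c / 2 = C δ`, and `δ C u` lies in `L`,
    -- against which the dual vector `u` pairs integrally.
    have e : β.1 0 0 * β.1 1 0 / 2 * X.form u u = X.form u ((δ : F) • (C : F) • u) := by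
      rw [map_smul, map_smul, smul_eq_mul, smul_eq_mul, h]; ring
    rw [e]
    exact hu _ (int_smul_mem L δ (hC u hu))

end CuspMatrices

/-! ## Common levels -/

section CommonLevel

set_option linter.unusedSectionVars false

/-- A finite family of properties of natural numbers which are stable under multiples and satisfied by
nonzero numbers has a common nonzero solution. -/
lemma exists_common_multiple {I : Type*} [Finite I] {p : I → ℕ → Prop}
    (hmul : ∀ i m c, p i c → p i (m * c)) (h : ∀ i, ∃ c, c ≠ 0 ∧ p i c) : ∃ c, c ≠ 0 ∧ ∀ i, p i c := by
  classical
  have := Fintype.ofFinite I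
  choose c hc hp using h
  refine ⟨∏ i, c i, Finset.prod_ne_zero_iff.2 fun i _ => hc i, fun i => ?_⟩
  rw [← Finset.prod_erase_mul _ _ (Finset.mem_univ i)]
  exact hmul _ _ _ (hp i)

variable {F : Type*} [Field F] [NumberField F] [NumberField.IsTotallyReal F]
  {V : Type*} [AddCommGroup V] [Module F V]
  [Module (𝓞 F) V] [IsScalarTower (𝓞 F) F V] {n : ℕ} (X : QuadCoord F V n)

/-- `C` is a level for `L`, and `C` carries the basis `e` into `L` and `L` into the lattice spanned
by `e`. -/
def IsBasisLevel {I : Type*} (e : Module.Basis I F V) (L : Submodule (𝓞 F) V) (C : ℕ) : Prop :=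
  IsLevel X L C ∧ (∀ i, (C : F) • e i ∈ L) ∧ ∀ v ∈ L, ∀ i, (C : F) * e.repr v i ∈ (1 : Submodule (𝓞 F) F)

lemma IsBasisLevel.mul_left {X : QuadCoord F V n} {I : Type*} {e : Module.Basis I F V}
    {L : Submodule (𝓞 F) V} {C : ℕ} (h : IsBasisLevel X e L C) (m : ℕ) : IsBasisLevel X e L (m * C) := by
  refine ⟨h.1.mul_left m, fun i => ?_, fun v hv i => ?_⟩
  · rw [Nat.cast_mul, mul_smul]; exact natCast_smul_mem L m (h.2.1 i)
  · rw [Nat.cast_mul, mul_assoc]; exact natCast_smul_mem (1 : Submodule (𝓞 F) F) m (h.2.2 v hv i)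

lemma exists_isBasisLevel {I : Type*} [Finite I] (e : Module.Basis I F V) {L : Submodule (𝓞 F) V}
    (hL : IsLattice L) : ∃ C, C ≠ 0 ∧ IsBasisLevel X e L C := by
  obtain ⟨N, hN, hd⟩ := X.exists_nat_smul_dual hL
  obtain ⟨N₁, hN₁, h₁⟩ := exists_common_multiple (p := fun i c => ((c : ℕ) : F) • e i ∈ L)
    (fun i m c h => by rw [Nat.cast_mul, mul_smul]; exact natCast_smul_mem L m h)
    fun i => hL.exists_nat_smul_mem (e i)
  obtain ⟨N₂, hN₂, h₂⟩ := exists_common_multiple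
    (p := fun i c => ∀ v ∈ L, ((c : ℕ) : F) * e.repr v i ∈ (1 : Submodule (𝓞 F) F))
    (fun i m c h v hv => by
      rw [Nat.cast_mul, mul_assoc]; exact natCast_smul_mem (1 : Submodule (𝓞 F) F) m (h v hv))
    fun i => by
      obtain ⟨m, hm, h⟩ := isLattice_one.exists_nat_smul_le (F := F) (hL.1.map ((e.coord i).restrictScalars (𝓞 F)))
      exact ⟨m, hm, fun v hv => h _ ⟨v, hv, rfl⟩⟩
  refine ⟨N * N₁ * N₂, mul_ne_zero (mul_ne_zero hN hN₁) hN₂, fun u hu => ?_, fun i => ?_, fun v hv i => ?_⟩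
  · rw [mul_assoc, mul_comm, Nat.cast_mul, mul_smul]; exact natCast_smul_mem L _ (hd u hu)
  · rw [mul_right_comm, Nat.cast_mul, mul_smul]; exact natCast_smul_mem L _ (h₁ i)
  · rw [Nat.cast_mul, mul_assoc]; exact natCast_smul_mem (1 : Submodule (𝓞 F) F) _ (h₂ i v hv)

lemma exists_nat_dvd {α : 𝓞 F} (hα : α ≠ 0) : ∃ m : ℕ, m ≠ 0 ∧ α ∣ (m : 𝓞 F) := by
  obtain ⟨m, hm, x, hx⟩ := exists_nat_mul_integral ((α : F)⁻¹)
  refine ⟨m, hm, x, NumberField.RingOfIntegers.coe_injective ?_⟩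
  have : (α : F) ≠ 0 := by simpa using hα
  simp only [map_mul, map_natCast, hx]
  field_simp

end CommonLevel

/-! ## The factor of weight `1/2` -/

section HalfFactor

set_option linter.unusedSectionVars false

variable {F : Type*} [Field F] [NumberField F] [NumberField.IsTotallyReal F]
  {𝔞 : (FractionalIdeal (𝓞 F)⁰ F)ˣ} {β : Matrix.SpecialLinearGroup (Fin 2) F}

lemma continuous_halfRoot {A T : Type*} [TopologicalSpace A] [Fintype T] {f : A → T → ℂ}
    (hf : ∀ τ, Continuous fun a => f a τ) (him : ∀ a τ, 0 < (f a τ).im) : Continuous fun a => halfRoot (f a) := by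
  refine continuous_finsetProd _ fun τ _ => ?_
  refine Continuous.cpow (continuous_const.mul (hf τ)) continuous_const fun a => ?_
  rw [Complex.mem_slitPlane_iff]
  left
  simpa using him a τ

lemma continuous_innerPoint (β : Matrix.SpecialLinearGroup (Fin 2) F) (τ : F →+* ℝ) :
    Continuous fun w => innerPoint β w τ := by
  have h : Continuous fun w : (F →+* ℝ) → UpperHalfPlane => ((w τ : UpperHalfPlane) : ℂ) :=
    UpperHalfPlane.continuous_coe.comp (continuous_apply τ)
  refine Continuous.inv₀ ((h.inv₀ fun w => (w τ).ne_zero).add continuous_const) fun w h0 => ?_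
  have h1 := innerPoint_im_pos β w τ
  have h2 : innerPoint β w τ = 0 := by rw [innerPoint, h0, inv_zero]
  rw [h2] at h1
  exact lt_irrefl _ h1

variable (𝔞 β) in
/-- The quotient of `θ_𝔞(β w)` and `θ(w)`. -/
def halfFactor (w : (F →+* ℝ) → UpperHalfPlane) : ℂ :=
  ((Real.sqrt (idealNorm 𝔞))⁻¹ : ℝ) * ((selfCoord F).gaussSum 𝔞 (β.1 0 1) (β.1 1 1) 1 *
    (halfRoot (fun τ => (w τ : ℂ)) / halfRoot (innerPoint β w)))

lemma continuous_halfFactor : Continuous (halfFactor 𝔞 β) := by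
  refine continuous_const.mul (continuous_const.mul (Continuous.div ?_ ?_ fun w =>
    halfRoot_ne_zero (innerPoint_im_pos β w)))
  · exact continuous_halfRoot (fun τ => UpperHalfPlane.continuous_coe.comp (continuous_apply τ))
      fun w τ => (w τ).im_pos
  · exact continuous_halfRoot (continuous_innerPoint β) (innerPoint_im_pos β)

lemma expHalf_sq (ξ : F) (z : (F →+* ℝ) → UpperHalfPlane) :
    expHalf (ξ ^ 2) z = (selfCoord F).term (fun τ => (z τ : ℂ)) 1 ξ := by
  rw [QuadCoord.term, polyGauss, (selfCoord F).gaussC_vec (fun τ => (z τ : ℂ)), map_one, one_mul, expHalf,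
    selfCoord_form, Finset.mul_sum, Finset.mul_sum]
  congr 1
  exact Finset.sum_congr rfl fun τ _ => by rw [pow_two]; ring

lemma isMultiHarmonic_one : IsMultiHarmonic (fun _ : F →+* ℝ => 0) (1 : MvPolynomial ((F →+* ℝ) × Fin 1) ℂ) := by
  refine ⟨fun m hm τ => ?_, fun τ => by simp⟩
  have : m = 0 := Finset.mem_singleton.1 (MvPolynomial.support_monomial_subset hm)
  simp [this]

/-- The transformation formula in dimension one with the constant polynomial. It is used in the same
form as for `B / F`, so the square roots of the two cases match without any discussion of branches.
-/
lemma isHalfFactor_halfFactor {C : ℕ} (hC : IsLevel (selfCoord F) 1 C)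
    (hβ : β ∈ cuspMatrices (Ideal.span {(C : 𝓞 F)}) 𝔞) : IsHalfFactor 𝔞 β (halfFactor 𝔞 β) := by
  refine ⟨continuous_halfFactor, fun w => ?_⟩
  have h := ((selfCoord F).hasSum_theta_cusp isLattice_one (fun u hu v hv => ?_) hC hβ isMultiHarmonic_one w).tsum_eq
  · have e1 : basicTheta 1 w = ∑' l : (1 : Submodule (𝓞 F) F), (selfCoord F).term (fun τ => (w τ : ℂ)) 1 l := by
      have hn : idealNorm (1 : (FractionalIdeal (𝓞 F)⁰ F)ˣ) = 1 := by simp [idealNorm]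
      rw [basicTheta, hn, Real.sqrt_one, inv_one, Complex.ofReal_one, one_mul]
      simp only [expHalf_sq]
      have hs : ∀ x : F, x ∈ (((1 : (FractionalIdeal (𝓞 F)⁰ F)ˣ)⁻¹ : (FractionalIdeal (𝓞 F)⁰ F)ˣ) :
          FractionalIdeal (𝓞 F)⁰ F) ↔ x ∈ (1 : Submodule (𝓞 F) F) := fun x => by
        rw [inv_one, Units.val_one, FractionalIdeal.mem_one_iff, Submodule.mem_one]
      exact (Equiv.subtypeEquivRight hs).tsum_eq
        (fun l : (1 : Submodule (𝓞 F) F) => (selfCoord F).term (fun τ => (w τ : ℂ)) 1 (l : F))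
    have e2 : basicTheta 𝔞 (moebius β w) = ((Real.sqrt (idealNorm 𝔞))⁻¹ : ℝ) *
        ∑' y : colonLattice (𝔞 : FractionalIdeal (𝓞 F)⁰ F) (1 : Submodule (𝓞 F) F),
          (selfCoord F).term (fun τ => (moebius β w τ : ℂ)) 1 y := by
      rw [basicTheta]
      simp only [expHalf_sq]
      congr 1
      refine (Equiv.subtypeEquivRight fun x => ?_).tsum_eq
        (fun l : colonLattice (𝔞 : FractionalIdeal (𝓞 F)⁰ F) (1 : Submodule (𝓞 F) F) =>
          (selfCoord F).term (fun τ => (moebius β w τ : ℂ)) 1 (l : F))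
      rw [mem_colonLattice_top 𝔞.ne_zero, Units.val_inv_eq_inv_val]
    rw [e1, e2, h, halfFactor, autFactor]
    simp only [pow_zero, pow_one, Finset.prod_const_one, mul_one]
    ring
  · obtain ⟨a, rfl⟩ := Submodule.mem_one.1 hu
    obtain ⟨b, rfl⟩ := Submodule.mem_one.1 hv
    exact (FractionalIdeal.mem_one_iff _).2 ⟨a * b, by rw [map_mul]; rfl⟩

end HalfFactor

/-! ## The Fourier expansion of the theta lift -/

section Expansion

set_option linter.unusedSectionVars false

variable {F : Type*} [Field F] [NumberField F] [NumberField.IsTotallyReal F]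
  {B : Type*} [Ring B] [Algebra F B] [IsDomain B] (H : DefiniteQuat F B) {R : Subalgebra (𝓞 F) B}
  {𝔞 : (FractionalIdeal (𝓞 F)⁰ F)ˣ} {β : Matrix.SpecialLinearGroup (Fin 2) F}

lemma term_eq_evalVec (P : WeightPoly F) (v : TraceQuot F B) {ξ : F} (hv : H.quadCoord.form v v = ξ)
    (z : (F →+* ℝ) → UpperHalfPlane) :
    H.quadCoord.term (fun τ => (z τ : ℂ)) P v = evalVec H P v * expHalf ξ z := by
  rw [QuadCoord.term, polyGauss, H.quadCoord.gaussC_vec (fun τ => (z τ : ℂ)), hv, evalVec, expHalf]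
  congr 2
  rw [Finset.mul_sum, Finset.mul_sum]
  exact Finset.sum_congr rfl fun τ _ => by ring

lemma thetaAt_eq_tsum (y : (BHat F B)ˣ) (P : WeightPoly F) (z : (F →+* ℝ) → UpperHalfPlane) :
    thetaAt H.ι R y P z =
      ∑' l : quotLattice (orderAtAlg R y), H.quadCoord.term (fun τ => (z τ : ℂ)) P l := by
  rw [thetaAt]
  refine tsum_congr fun l => ?_
  rw [H.evalAt_mul_expHalf]
  congr 1
  exact Quotient.out_eq' _

/-- A level at which all the lattices `L_x` and the lattice `𝓞_F` have good transformation behaviour. -/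
structure IsGoodLevel (e : Module.Basis (Fin 3) F (TraceQuot F B)) (α β : 𝓞 F) (R : Subalgebra (𝓞 F) B)
    (C : ℕ) : Prop where
  self : IsLevel (selfCoord F) 1 C
  left_dvd : α ∣ (C : 𝓞 F)
  right_dvd : β ∣ (C : 𝓞 F)
  lattice : ∀ c : ClassSet R, IsBasisLevel H.quadCoord e (quotLattice (orderAtAlg R c.out)) C

lemma exists_isGoodLevel (hR : IsOrder F R) (e : Module.Basis (Fin 3) F (TraceQuot F B)) {α β : 𝓞 F}
    (hα : α ≠ 0) (hβ : β ≠ 0) : ∃ C, C ≠ 0 ∧ IsGoodLevel H e α β R C := by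
  have := H.finite
  have := finite_classSet H hR fun b hb => H.isUnit_of_ne_zero hb
  obtain ⟨N, hN, h⟩ := (selfCoord F).exists_nat_smul_dual isLattice_one
  obtain ⟨a, ha, ha'⟩ := exists_nat_dvd hα
  obtain ⟨b, hb, hb'⟩ := exists_nat_dvd hβ
  obtain ⟨M, hM, hM'⟩ := exists_common_multiple
    (p := fun (c : ClassSet R) C => IsBasisLevel H.quadCoord e (quotLattice (orderAtAlg R c.out)) C)
    (fun _ m _ h => h.mul_left m)
    fun c => exists_isBasisLevel H.quadCoord e (isOrder_orderAtAlg hR c.out).isLattice_quotLattice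
  refine ⟨a * b * N * M, by positivity, ?_, ?_, ?_, fun c => (hM' c).mul_left _⟩
  · rw [mul_right_comm]
    exact IsLevel.mul_left h _
  · rw [mul_assoc, mul_assoc, Nat.cast_mul]; exact ha'.mul_right _
  · rw [mul_assoc, mul_comm a, mul_assoc, Nat.cast_mul]; exact hb'.mul_right _

/-- The Fourier expansion of the theta series of one class. -/
lemma hasSum_class (hR : IsOrder F R) {e : Module.Basis (Fin 3) F (TraceQuot F B)} {α γ : 𝓞 F}
    (horth : ∀ i j, i ≠ j → H.quadCoord.form (e i) (e j) = 0)
    (h0 : H.quadCoord.form (e 0) (e 0) = -(α : F)) (h1 : H.quadCoord.form (e 1) (e 1) = -(γ : F))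
    (h2 : H.quadCoord.form (e 2) (e 2) = (α : F) * γ) {C : ℕ} (hC : IsGoodLevel H e α γ R C)
    (hβ : β ∈ cuspMatrices (Ideal.span {(C : 𝓞 F)}) 𝔞) {k : (F →+* ℝ) → ℕ} {P : WeightPoly F}
    (hP : P ∈ weightSpace F k) (c : ClassSet R) (w : (F →+* ℝ) → UpperHalfPlane) :
    HasSum (fun ξ : F => (∑ᶠ v ∈ vectorsAt H 𝔞 R ξ c.out, evalVec H P v) * expHalf ξ (moebius β w))
      (((selfCoord F).gaussSum 𝔞 (β.1 0 1) (β.1 1 1) 1 *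
        (halfRoot (fun τ => (w τ : ℂ)) / halfRoot (innerPoint β w))) ^ 3 * autFactor k β w *
          thetaAt H.ι R c.out P w) := by
  have := H.finite
  have hS := isOrder_orderAtAlg hR c.out
  have hint : ∀ u ∈ quotLattice (orderAtAlg R c.out), ∀ v ∈ quotLattice (orderAtAlg R c.out),
      H.quadCoord.form u v ∈ (1 : FractionalIdeal (𝓞 F)⁰ F) := fun u hu v hv =>
    (FractionalIdeal.mem_one_iff _).2 (Submodule.mem_one.1 (H.form_mem_one hS hu hv))
  obtain ⟨hlev, hb1, hb2⟩ := hC.lattice c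
  obtain ⟨s, hs⟩ := cuspMatrices_bc hβ
  have hcube : H.quadCoord.gaussSum 𝔞 (β.1 0 1) (β.1 1 1) (quotLattice (orderAtAlg R c.out)) =
      (selfCoord F).gaussSum 𝔞 (β.1 0 1) (β.1 1 1) 1 ^ 3 := by
    -- Here `t = 1 - a d = 4 C s`. Divisibility by `C` supplies all the denominators to be cleared
    -- as well as the factors `α` and `γ`, and the `4` supplies the factor `2`.
    have ht : ((4 * s * (C : 𝓞 F) : 𝓞 F) : F) = ((4 * s : 𝓞 F) : F) * (C : F) := by
      simp only [map_mul, map_natCast]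
    refine H.quadCoord.gaussSum_eq_cube 𝔞.ne_zero hint hβ.1
      (fun x hx => mem_integralTrace_of_mem_inv_different (cuspMatrices_b hβ x hx)) hβ.2.2.2
      (cuspMatrices_d_ne_zero hβ) e horth (t := 4 * s * (C : 𝓞 F)) h0 h1 h2 ?_ (fun i => ?_)
      (fun v hv i => ?_) ?_ (hC.left_dvd.mul_left _) (hC.right_dvd.mul_left _)
    · rw [hs]
      simp only [map_mul, map_natCast, map_ofNat]
      ring
    · rw [ht, mul_smul]
      exact int_smul_mem _ _ (hb1 i)
    · rw [ht, mul_assoc]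
      exact int_smul_mem (1 : Submodule (𝓞 F) F) _ (hb2 v hv i)
    · exact ⟨2 * s * C, by ring⟩
  have h := H.quadCoord.hasSum_theta_cusp hS.isLattice_quotLattice hint hlev hβ (k := k) (P := P) hP w
  rw [hcube, ← mul_pow, ← thetaAt_eq_tsum] at h
  -- The sum over `𝔞⁻¹L` is grouped by the length of the vector; each fiber is finite and `e_F` is
  -- constant on it.
  refine Eq.mp (congrArg (fun f : F → ℂ => HasSum f _) (funext fun ξ => ?_))
    (h.tsum_fiberwise fun y => H.quadCoord.form y.1 y.1)
  symm
  let E : vectorsAt H 𝔞 R ξ c.out ≃ (fun y : colonLattice (𝔞 : FractionalIdeal (𝓞 F)⁰ F)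
      (quotLattice (orderAtAlg R c.out)) => H.quadCoord.form y.1 y.1) ⁻¹' {ξ} :=
    { toFun := fun v => ⟨⟨v.1, v.2.1⟩, v.2.2⟩
      invFun := fun v => ⟨v.1.1, v.1.2, v.2⟩
      left_inv := fun _ => rfl
      right_inv := fun _ => rfl }
  have : Finite (vectorsAt H 𝔞 R ξ c.out) := finite_vectorsAt H hR 𝔞 ξ c.out
  rw [← E.tsum_eq, ← finsum_set_coe_eq_finsum_mem, ← tsum_eq_finsum (L := SummationFilter.unconditional _) (Set.toFinite _), ← tsum_mul_right]
  exact tsum_congr fun v => (term_eq_evalVec H P v.1 v.2.2 _).symm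

/-- The theta lift has a Fourier expansion at every cusp. -/
theorem hasFourierExpansionAt_thetaLift (hR : IsOrder F R) {k : (F →+* ℝ) → ℕ}
    {φ : (BHat F B)ˣ → WeightPoly F} (hφ : φ ∈ quatForms H.ι R k) (𝔞 : (FractionalIdeal (𝓞 F)⁰ F)ˣ) :
    HasFourierExpansionAt k 𝔞 (thetaLift H.ι R φ) fun ξ => (idealNorm 𝔞 : ℂ)⁻¹ * vectorSum H 𝔞 R φ ξ := by
  obtain ⟨e, α, γ, hα, hγ, horth, h0, h1, h2⟩ := H.exists_orthogonal_basis
  obtain ⟨C, hC0, hC⟩ := exists_isGoodLevel H hR e hα hγ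
  have := H.finite
  have := finite_classSet H hR fun b hb => H.isUnit_of_ne_zero hb
  have := Fintype.ofFinite (ClassSet R)
  refine ⟨Ideal.span {(C : 𝓞 F)}, natIdeal_ne_bot hC0, fun β hβ =>
    ⟨halfFactor 𝔞 β, isHalfFactor_halfFactor hC.self hβ, fun w => ?_⟩⟩
  have h := hasSum_sum fun c (_ : c ∈ (Finset.univ : Finset (ClassSet R))) =>
    (hasSum_class H hR horth h0 h1 h2 hC hβ (hφ.1 c.out) c w).mul_left ((stabCard R c.out : ℂ)⁻¹)
  have h' := h.mul_left (((Real.sqrt (idealNorm 𝔞))⁻¹ : ℝ) * (idealNorm 𝔞 : ℂ)⁻¹)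
  have hN : 0 ≤ idealNorm 𝔞 := by
    rw [idealNorm]; exact_mod_cast FractionalIdeal.absNorm_nonneg _
  -- The cube of `h` carries `N(𝔞)^{-3/2}`. One factor `N(𝔞)^{-1/2}` belongs to the normalization of
  -- the expansion, and the remaining two are the `N(𝔞)⁻¹` of the coefficient.
  have hsq : (idealNorm 𝔞 : ℂ)⁻¹ = (((Real.sqrt (idealNorm 𝔞))⁻¹ : ℝ) : ℂ) ^ 2 := by
    rw [← Complex.ofReal_pow, inv_pow, Real.sq_sqrt hN, Complex.ofReal_inv]
  refine (congrArg₂ (fun (f : F → ℂ) a => HasSum f a) (funext fun ξ => ?_) ?_).mpr h'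
  · change _ * ((idealNorm 𝔞 : ℂ)⁻¹ * vectorSum H 𝔞 R φ ξ) * _ = _
    rw [vectorSum, finsum_eq_sum_of_fintype, mul_assoc, mul_assoc, mul_assoc, Finset.sum_mul]
    simp only [mul_assoc]
  · rw [thetaLift, finsum_eq_sum_of_fintype, halfFactor, Finset.mul_sum, Finset.mul_sum]
    refine Finset.sum_congr rfl fun c _ => ?_
    rw [hsq]
    ring

end Expansion

/-! ### Fourier coefficients as height pairings -/

theorem mainTheorem4 {F : Type*} [Field F] [NumberField F] [NumberField.IsTotallyReal F]
    {B : Type*} [Ring B] [Algebra F B] [Algebra.IsCentral F B] [IsSimpleRing B]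
    (hB : Module.finrank F B = 4)
    (ι : (F →+* ℝ) → B →+* Quaternion ℝ)
    (hι : ∀ (τ : F →+* ℝ) (a : F), ι τ (algebraMap F B a) = ((τ a : ℝ) : Quaternion ℝ))
    (R : Subalgebra (𝓞 F) B) (hR : IsOrder F R)
    (k : (F →+* ℝ) → ℕ)
    (φ : (BHat F B)ˣ → WeightPoly F) (hφ : φ ∈ quatForms ι R k)
    (D : F) (hD : ∀ τ : F →+* ℝ, 0 < τ D)
    (𝔞 : (FractionalIdeal (𝓞 F)⁰ F)ˣ) :
    (∀ (j : QuadExt D →ₐ[F] B) (ω : QuadExt D), fieldDisc ω = -D →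
      IsFourierCoeffAt k 𝔞 (thetaLift ι R φ) D
        ((idealNorm 𝔞 : ℂ)⁻¹ * heightPairing R φ (etaForm ι R k 𝔞 j ω))) ∧
    (IsEmpty (QuadExt D →ₐ[F] B) →
      IsFourierCoeffAt k 𝔞 (thetaLift ι R φ) D
        ((idealNorm 𝔞 : ℂ)⁻¹ * heightPairing R φ 0)) := by
  obtain ⟨τ, -⟩ := exists_realEmb F
  -- As `B` is simple, it embeds into the Hamilton quaternions at any real place and therefore has
  -- no zero divisors.
  have : IsDomain B := isDomain_of_injective (ι τ).injective
  obtain ⟨H, rfl⟩ := exists_definiteQuat hB ι (fun τ => (ι τ).injective) hι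
  -- The coefficients obtained here involve neither an embedding of `K` nor `ω`, so one and the same
  -- expansion serves every choice of them.
  have h := hasFourierExpansionAt_thetaLift H hR hφ 𝔞
  refine ⟨fun j ω hω => ⟨_, h, ?_⟩, fun hempty => ⟨_, h, ?_⟩⟩
  · rw [heightPairing_etaForm H hD j hω hR 𝔞 hφ]
  · rw [heightPairing_zero_eq H 𝔞 hempty]

end
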